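/- Let $G$ be a compact Lie group with Lie algebra $\mathfrak g$, let $\langle\cdot,\cdot\rangle$ be an $\mathrm{Ad}$-invariant inner product on $\mathfrak g$, and let $U=[0,1]$. Let $\mathcal A=C^1(U,\mathfrak g)\otimes\mathbb R^4$ be the Banach space of quadruples $\mathcal T=(T_0,T_1,T_2,T_3)$ of $C^1$ maps $U\to\mathfrak g$, with the indefinite metric $$g(X,Y)=\int_0^1\big(\langle X_0,Y_0\rangle+\langle X_1,Y_1\rangle-\langle X_2,Y_2\rangle-\langle X_3,Y_3\rangle\big)\,dt$$ and the endomorphisms $$I X=(X_1,-X_0,-X_3,X_2),\qquad S X=(X_2,X_3,X_0,X_1),\qquad T X=(X_3,-X_2,-X_1,X_0).$$ Let $\mu^{-1}(0)\subset\mathcal A$ be the set of solutions of the Nahm–Schmid equations $$\dot T_1+[T_0,T_1]=-[T_2,T_3],\qquad \dot T_2+[T_0,T_2]=[T_3,T_1],\qquad \dot T_3+[T_0,T_3]=[T_1,T_2].$$ The group $\mathcal G_{00}=\{u\in C^2(U,G): u(0)=1=u(1)\}$ acts on $\mu^{-1}(0)$ by $u.\mathcal T=(uT_0u^{-1}-\dot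 uu^{-1},uT_1u^{-1},uT_2u^{-1},uT_3u^{-1})$, and $\mathrm{Lie}(\mathcal G_{00})=\{\xi\in C^2(U,\mathfrak g):\xi(0)=0=\xi(1)\}$. The tangent space at $\mathcal T$ of the $\mathcal G_{00}$-orbit consists of the vectors $(-\dot\xi+[\xi,T_0],[\xi,T_1],[\xi,T_2],[\xi,T_3])$ with $\xi\in\mathrm{Lie}(\mathcal G_{00})$. Let $\mathcal D\subset\mu^{-1}(0)$ be the set of those $\mathcal T$ at which the restriction of $g$ to this tangent space is degenerate. Put $\mathcal M=\mu^{-1}(0)/\mathcal G_{00}$ and $\mathcal M^0=(\mu^{-1}(0)\setminus\mathcal D)/\mathcal G_{00}\subset\mathcal M$. **Theorem.** 1. For every $\mathcal T\in\mu^{-1}(0)$ the bounded operator $$\Delta_{\mathcal T}:\mathrm{Lie}(\mathcal G_{00})\to C^0(U,\mathfrak g),\qquad \Delta_{\mathcal T}\xi=\ddot\xi+[\dot T_0,\xi]+2[T_0,\dot\xi]+[T_0,[T_0,\xi]]+[T_1,[T_1,\xi]]-[T_2,[T_2,\xi]]-[T_3,[T_3,\xi]]$$ is Fredholm of index zero,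 and it is an isomorphism if and only if $\mathcal T\notin\mathcal D$. 2. $\mu^{-1}(0)$ is a smooth Banach submanifold of $\mathcal A$, and $\mathcal M$, with the quotient topology, is a smooth (Hausdorff, second countable) manifold of dimension $4\dim\mathfrak g$ such that the projection $\pi:\mu^{-1}(0)\to\mathcal M$ is a smooth submersion. The subset $\mathcal M^0$ is open in $\mathcal M$ and carries a smooth hypersymplectic structure: a smooth pseudo-Riemannian metric $g$ of signature $(2\dim\mathfrak g,2\dim\mathfrak g)$ and smooth $g$-skew-adjoint endomorphisms $I,S,T$ of the tangent bundle, parallel for the Levi-Civita connection of $g$, with $I^2=-1$, $S^2=T^2=1$, $IS=T=-SI$. 3. For every $\mathcal T\in\mu^{-1}(0)\setminus\mathcal D$ let $H_{\mathcal T}$ be the space of solutions $X\in C^1(U,\mathfrak g)\otimes\mathbb R^4$ of $$\begin{aligned}\dot X_1+[T_0,X_1]+[X_0,T_1]+[T_2,X_3]+[X_2,T_3]&=0,\\ \dot X_2+[T_0,X_2]+[X_0,T_2]-[T_3,X_1]-[X_3,T_1]&=0,\\ \dot X_3+[T_0,X_3]+[X_0,T_3]-[T_1,X_2]-[X_1,T_2]&=0,\\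 \dot X_0+[T_0,X_0]+[T_1,X_1]-[T_2,X_2]-[T_3,X_3]&=0.\end{aligned}$$ Then $H_{\mathcal T}$ is contained in the tangent space of $\mu^{-1}(0)$ at $\mathcal T$, is invariant under $I,S,T$, and $d\pi_{\mathcal T}$ restricts to a linear isomorphism $H_{\mathcal T}\to \mathrm T_{\pi(\mathcal T)}\mathcal M^0$ under which the metric and the endomorphisms $I,S,T$ of $\mathcal M^0$ correspond to the metric $g$ and the endomorphisms $I,S,T$ of $\mathcal A$ given above. -/

import Mathlib

open Set Manifold TopologicalSpace
open scoped ContDiff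

namespace NahmSchmid

noncomputable section

/-! ### Function spaces on `U = [0,1]` -/

section FunctionSpaces

variable (E : Type*) [NormedAddCommGroup E] [NormedSpace ℝ E]

/-- `f' : [0,1] → E` is the derivative of `f : [0,1] → E` (one-sided at the end points). -/
def IsDeriv {E : Type*} [NormedAddCommGroup E] [NormedSpace ℝ E]
    (f f' : C(unitInterval, E)) : Prop :=
  ∀ t : unitInterval, HasDerivWithinAt (fun s : ℝ => f (projIcc 0 1 zero_le_one s)) (f' t)
    (Icc (0 : ℝ) 1) (t : ℝ)

variable {E} in
theorem IsDeriv.add {f f' g g' : C(unitInterval, E)} (hf : IsDeriv f f') (hg : IsDeriv g g') :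
    IsDeriv (f + g) (f' + g') := fun t => (hf t).add (hg t)

variable {E} in
theorem IsDeriv.smul {f f' : C(unitInterval, E)} (c : ℝ) (hf : IsDeriv f f') :
    IsDeriv (c • f) (c • f') := fun t => (hf t).const_smul c

variable {E} in
theorem IsDeriv.zero : IsDeriv (0 : C(unitInterval, E)) 0 :=
  fun t => by simpa using hasDerivWithinAt_const (t : ℝ) (Icc (0 : ℝ) 1) (0 : E)

/-- The Banach space `C¹([0,1], E)`: a `C¹` function is stored as the pair `(f, f')` of continuous
functions; the induced norm `max ‖f‖ ‖f'‖` is equivalent to the `C¹`-norm `‖f‖ + ‖f'‖`. -/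
def C1 : Submodule ℝ (C(unitInterval, E) × C(unitInterval, E)) where
  carrier := {p | IsDeriv p.1 p.2}
  add_mem' hf hg := hf.add hg
  zero_mem' := IsDeriv.zero
  smul_mem' c _ hf := hf.smul c

/-- The Banach space `{ξ ∈ C²([0,1], E) | ξ(0) = 0 = ξ(1)}`; the function `ξ` is stored as the
triple `(ξ, ξ', ξ'')`. For `E = 𝔤` this is the Lie algebra of the gauge group `𝒢₀₀`. -/
def LieG00 : Submodule ℝ (C(unitInterval, E) × C(unitInterval, E) × C(unitInterval, E)) where
  carrier := {p | IsDeriv p.1 p.2.1 ∧ IsDeriv p.2.1 p.2.2 ∧ p.1 0 = 0 ∧ p.1 1 = 0}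
  add_mem' := by
    rintro a b ⟨h1, h2, h3, h4⟩ ⟨k1, k2, k3, k4⟩
    exact ⟨h1.add k1, h2.add k2, by simp [h3, k3], by simp [h4, k4]⟩
  zero_mem' := ⟨IsDeriv.zero, IsDeriv.zero, rfl, rfl⟩
  smul_mem' := by
    rintro c a ⟨h1, h2, h3, h4⟩
    exact ⟨h1.smul c, h2.smul c, by simp [h3], by simp [h4]⟩

variable {E}

/-- The underlying continuous function of a `C¹` function. -/
def fn (f : C1 E) : C(unitInterval, E) := f.1.1

/-- The derivative of a `C¹` function. -/
def der (f : C1 E) : C(unitInterval, E) := f.1.2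

variable (E) in
/-- The space `𝒜` of quadruples `(T₀, T₁, T₂, T₃)` of `C¹` functions on `[0,1]`; it is also the
tangent space of `𝒜` at each of its points. -/
abbrev Quad : Type _ := Fin 4 → C1 E

instance : NormedSpace ℝ (Quad E) := inferInstance

/-- The complex structure `I(X₀,X₁,X₂,X₃) = (X₁,-X₀,-X₃,X₂)` on quadruples. -/
def opI (X : Quad E) : Quad E := ![X 1, -X 0, -X 3, X 2]

/-- The product structure `S(X₀,X₁,X₂,X₃) = (X₂,X₃,X₀,X₁)` on quadruples. -/
def opS (X : Quad E) : Quad E := ![X 2, X 3, X 0, X 1]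

/-- The product structure `T(X₀,X₁,X₂,X₃) = (X₃,-X₂,-X₁,X₀)` on quadruples. -/
def opT (X : Quad E) : Quad E := ![X 3, -X 2, -X 1, X 0]

/-- The indefinite `L²` metric `g(X,Y) = ∫₀¹ (⟨X₀,Y₀⟩ + ⟨X₁,Y₁⟩ - ⟨X₂,Y₂⟩ - ⟨X₃,Y₃⟩) dt`. -/
def metricL2 (B : LinearMap.BilinForm ℝ E) (X Y : Quad E) : ℝ :=
  ∫ t : unitInterval, (B (fn (X 0) t) (fn (Y 0) t) + B (fn (X 1) t) (fn (Y 1) t)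
    - B (fn (X 2) t) (fn (Y 2) t) - B (fn (X 3) t) (fn (Y 3) t))

/-- The pointwise bracket `t ↦ [f(t), h(t)]` of continuous functions, as a bounded operator in `h`;
`br` is a continuous bilinear map on `E`. -/
def brC (br : E →L[ℝ] E →L[ℝ] E) (f : C(unitInterval, E)) :
    C(unitInterval, E) →L[ℝ] C(unitInterval, E) :=
  LinearMap.mkContinuous
    { toFun := fun h => ⟨fun t => br (f t) (h t), by fun_prop⟩
      map_add' := fun h k => by ext t; simp
      map_smul' := fun c h => by ext t; simp }
    (‖br‖ * ‖f‖) (fun h => by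
      refine (ContinuousMap.norm_le _ (by positivity)).2 fun t => ?_
      refine (br.le_opNorm₂ (f t) (h t)).trans ?_
      gcongr
      · exact f.norm_coe_le_norm t
      · exact h.norm_coe_le_norm t)

theorem IsDeriv.bracket (br : E →L[ℝ] E →L[ℝ] E) {f f' h h' : C(unitInterval, E)}
    (hf : IsDeriv f f') (hh : IsDeriv h h') :
    IsDeriv (brC br f h) (brC br f h' + brC br f' h) := fun t => by
  have := br.hasDerivWithinAt_of_bilinear (hf t) (hh t)
  simpa [brC, projIcc_of_mem zero_le_one t.2] using this

/-- The operator `Δ_𝒯 ξ = ξ'' + [T₀', ξ] + 2 [T₀, ξ'] + [T₀,[T₀,ξ]] + [T₁,[T₁,ξ]]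
- [T₂,[T₂,ξ]] - [T₃,[T₃,ξ]]` from `Lie(𝒢₀₀)` to `C⁰([0,1], 𝔤)`. -/
def Delta (br : E →L[ℝ] E →L[ℝ] E) (T : Quad E) : LieG00 E →L[ℝ] C(unitInterval, E) :=
  (ContinuousLinearMap.snd ℝ _ _ ∘L ContinuousLinearMap.snd ℝ _ _
    + brC br (der (T 0)) ∘L ContinuousLinearMap.fst ℝ _ _
    + (2 : ℝ) • (brC br (fn (T 0)) ∘L ContinuousLinearMap.fst ℝ _ _ ∘L
        ContinuousLinearMap.snd ℝ _ _)
    + (brC br (fn (T 0)) ∘L brC br (fn (T 0)) + brC br (fn (T 1)) ∘L brC br (fn (T 1))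
        - brC br (fn (T 2)) ∘L brC br (fn (T 2)) - brC br (fn (T 3)) ∘L brC br (fn (T 3))) ∘L
        ContinuousLinearMap.fst ℝ _ _) ∘L (LieG00 E).subtypeL

/-- The fundamental vector field at `𝒯` of the infinitesimal gauge transformation `ξ`:
`(-ξ' + [ξ,T₀], [ξ,T₁], [ξ,T₂], [ξ,T₃])`. -/
def fundField (br : E →L[ℝ] E →L[ℝ] E) (T : Quad E) (ξ : LieG00 E) : Quad E := fun i =>
  if i = 0 then
    ⟨(-ξ.1.2.1 + brC br ξ.1.1 (fn (T 0)),
      -ξ.1.2.2 + (brC br ξ.1.1 (der (T 0)) + brC br ξ.1.2.1 (fn (T 0)))), by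
      have h := (ξ.2.2.1.smul (-1)).add (ξ.2.1.bracket br (T 0).2)
      simpa [C1, fn, der] using h⟩
  else
    ⟨(brC br ξ.1.1 (fn (T i)), brC br ξ.1.1 (der (T i)) + brC br ξ.1.2.1 (fn (T i))),
      ξ.2.1.bracket br (T i).2⟩

/-- The tangent space at `𝒯` of the `𝒢₀₀`-orbit through `𝒯`. -/
def orbitTangent (br : E →L[ℝ] E →L[ℝ] E) (T : Quad E) : Set (Quad E) :=
  range (fundField br T)

/-- The Nahm--Schmid equations. -/
def IsSolution (br : E →L[ℝ] E →L[ℝ] E) (T : Quad E) : Prop :=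
  der (T 1) + brC br (fn (T 0)) (fn (T 1)) = -brC br (fn (T 2)) (fn (T 3)) ∧
  der (T 2) + brC br (fn (T 0)) (fn (T 2)) = brC br (fn (T 3)) (fn (T 1)) ∧
  der (T 3) + brC br (fn (T 0)) (fn (T 3)) = brC br (fn (T 1)) (fn (T 2))

/-- The left-hand sides of the linearised Nahm--Schmid equations at `𝒯` (`i = 1, 2, 3`) and of the
gauge-fixing equation (`i = 0`). -/
def linEq (br : E →L[ℝ] E →L[ℝ] E) (T X : Quad E) : Fin 4 → C(unitInterval, E) :=
  ![der (X 0) + brC br (fn (T 0)) (fn (X 0)) + brC br (fn (T 1)) (fn (X 1))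
      - brC br (fn (T 2)) (fn (X 2)) - brC br (fn (T 3)) (fn (X 3)),
    der (X 1) + brC br (fn (T 0)) (fn (X 1)) + brC br (fn (X 0)) (fn (T 1))
      + brC br (fn (T 2)) (fn (X 3)) + brC br (fn (X 2)) (fn (T 3)),
    der (X 2) + brC br (fn (T 0)) (fn (X 2)) + brC br (fn (X 0)) (fn (T 2))
      - brC br (fn (T 3)) (fn (X 1)) - brC br (fn (X 3)) (fn (T 1)),
    der (X 3) + brC br (fn (T 0)) (fn (X 3)) + brC br (fn (X 0)) (fn (T 3))
      - brC br (fn (T 1)) (fn (X 2)) - brC br (fn (X 1)) (fn (T 2))]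

theorem linEq_add (br : E →L[ℝ] E →L[ℝ] E) (T X Y : Quad E) :
    linEq br T (X + Y) = linEq br T X + linEq br T Y := by
  ext i t
  fin_cases i <;> simp [linEq, fn, der, brC] <;> abel

theorem linEq_smul (br : E →L[ℝ] E →L[ℝ] E) (T X : Quad E) (c : ℝ) :
    linEq br T (c • X) = c • linEq br T X := by
  ext i t
  fin_cases i <;> simp [linEq, fn, der, brC, smul_sub]

/-- The space of solutions `X` of the linearised Nahm--Schmid equations at `𝒯` together with
`X₀' + [T₀,X₀] + [T₁,X₁] - [T₂,X₂] - [T₃,X₃] = 0`. -/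
def horizontal (br : E →L[ℝ] E →L[ℝ] E) (T : Quad E) : Submodule ℝ (Quad E) where
  carrier := {X | linEq br T X = 0}
  add_mem' {X Y} hX hY := by
    simp only [mem_ofPred_eq] at *
    rw [linEq_add, hX, hY, add_zero]
  zero_mem' := by
    have := linEq_smul br T 0 0
    simpa using this
  smul_mem' c X hX := by
    simp only [mem_ofPred_eq] at *
    rw [linEq_smul, hX, smul_zero]

end FunctionSpaces

/-! ### The Lie group, the gauge group and the moduli space

`G` is a Lie group modelled on `E`. Its Lie algebra `𝔤 = T₁G` is `GroupLieAlgebra 𝓘(ℝ, E) G`,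
which is by definition the vector space `E`; we use `E`, with its norm, for `𝔤`. -/

section Moduli

variable (E : Type*) [NormedAddCommGroup E] [NormedSpace ℝ E]
  (G : Type*) [TopologicalSpace G] [ChartedSpace E G] [Group G] [LieGroup 𝓘(ℝ, E) ∞ G]

theorem lieGroup_minSmoothness : LieGroup 𝓘(ℝ, E) (minSmoothness ℝ 3) G := by
  rw [minSmoothness_of_isRCLikeNormedField]
  infer_instance

variable [FiniteDimensional ℝ E]

/-- The Lie bracket of `𝔤 = T₁G`, as a continuous bilinear map. -/
def lieBracket : E →L[ℝ] E →L[ℝ] E :=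
  haveI := lieGroup_minSmoothness E G
  haveI : CompleteSpace E := FiniteDimensional.complete ℝ E
  let L : GroupLieAlgebra 𝓘(ℝ, E) G →ₗ[ℝ] GroupLieAlgebra 𝓘(ℝ, E) G →ₗ[ℝ]
      GroupLieAlgebra 𝓘(ℝ, E) G :=
    LinearMap.mk₂ ℝ (fun x y => ⁅x, y⁆) add_lie smul_lie lie_add lie_smul
  LinearMap.toContinuousBilinearMap (𝕜 := ℝ) (E := E) (F := E) (G := E) L

theorem lieBracket_apply (x y : GroupLieAlgebra 𝓘(ℝ, E) G) : lieBracket E G x y = ⁅x, y⁆ := rfl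

variable {G}

/-- The adjoint action `Ad(u) : 𝔤 → 𝔤`, the derivative at `1` of `x ↦ u x u⁻¹`. -/
def Ad (u : G) (v : E) : E :=
  mfderiv 𝓘(ℝ, E) 𝓘(ℝ, E) (fun x : G => u * x * u⁻¹) 1 (v : TangentSpace 𝓘(ℝ, E) (1 : G))

/-- `u̇(t) u(t)⁻¹ ∈ 𝔤` for a curve `u : [0,1] → G`: the derivative at `s = t` of
`s ↦ u(s) u(t)⁻¹`. Only the values of `u` on `[0,1]` matter. -/
def rightLogDeriv (u : ℝ → G) (t : ℝ) : E :=
  mfderivWithin 𝓘(ℝ, ℝ) 𝓘(ℝ, E) (fun s : ℝ => u s * (u t)⁻¹) (Icc 0 1) t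
    (1 : TangentSpace 𝓘(ℝ, ℝ) t)

/-- The elements of `𝒢₀₀`: gauge transformations `u : [0,1] → G` of class `C²` with
`u(0) = 1 = u(1)`. Only the values of `u` on `[0,1]` matter. -/
structure IsGauge00 (u : ℝ → G) : Prop where
  contMDiffOn : ContMDiffOn 𝓘(ℝ, ℝ) 𝓘(ℝ, E) 2 u (Icc 0 1)
  zero : u 0 = 1
  one : u 1 = 1

variable {E}

/-- `T' = u.T = (Ad(u) T₀ - u̇ u⁻¹, Ad(u) T₁, Ad(u) T₂, Ad(u) T₃)`. -/
def IsGaugeTransform (u : ℝ → G) (T T' : Quad E) : Prop :=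
  ∀ t : unitInterval,
    fn (T' 0) t = Ad E (u t) (fn (T 0) t) - rightLogDeriv E u t ∧
    fn (T' 1) t = Ad E (u t) (fn (T 1) t) ∧
    fn (T' 2) t = Ad E (u t) (fn (T 2) t) ∧
    fn (T' 3) t = Ad E (u t) (fn (T 3) t)

variable (E G)

/-- `μ⁻¹(0)`: the set of solutions of the Nahm--Schmid equations with values in `𝔤`. -/
def solutions : Set (Quad E) := {T | IsSolution (lieBracket E G) T}

/-- Two solutions are related if they lie in the same `𝒢₀₀`-orbit. -/
def gaugeRel (T T' : solutions E G) : Prop :=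
  ∃ u : ℝ → G, IsGauge00 E u ∧ IsGaugeTransform u T.1 T'.1

/-- The moduli space `ℳ = μ⁻¹(0) / 𝒢₀₀` of solutions, with the quotient topology. The relation
`gaugeRel` is the orbit relation of the group `𝒢₀₀`, hence already an equivalence relation. -/
abbrev Moduli : Type _ := Quot (gaugeRel E G)

/-- The projection `μ⁻¹(0) → ℳ`. -/
def proj (T : solutions E G) : Moduli E G := Quot.mk _ T

/-- The degeneracy locus `𝒟`: the solutions `𝒯` such that the restriction of the `L²` metric to
the tangent space at `𝒯` of the `𝒢₀₀`-orbit through `𝒯` is degenerate. -/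
def degeneracyLocus (B : LinearMap.BilinForm ℝ E) : Set (Quad E) :=
  {T | T ∈ solutions E G ∧ ∃ X ∈ orbitTangent (lieBracket E G) T, X ≠ 0 ∧
    ∀ Y ∈ orbitTangent (lieBracket E G) T, metricL2 B X Y = 0}

/-- `ℳ⁰ = (μ⁻¹(0) ∖ 𝒟) / 𝒢₀₀` as a subset of `ℳ`. -/
def moduliZero (B : LinearMap.BilinForm ℝ E) : Set (Moduli E G) :=
  proj E G '' {T | T.1 ∉ degeneracyLocus E G B}

end Moduli

/-! ### Hypersymplectic manifolds -/

section Hypersymplectic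

open Bundle

variable {F : Type*} [NormedAddCommGroup F] [NormedSpace ℝ F] [FiniteDimensional ℝ F]
  {H : Type*} [TopologicalSpace H] (J : ModelWithCorners ℝ F H)
  (M : Type*) [TopologicalSpace M] [ChartedSpace H M] [IsManifold J ∞ M]

variable {M} in
/-- `∇` is the Levi-Civita connection of the (pseudo-Riemannian) metric `g`: it is torsion-free and
`v(g(Y, Z)) = g(∇_v Y, Z) + g(Y, ∇_v Z)`. Here `∇_v Y` at `x` is written `cov Y x v`. -/
structure IsLeviCivita
    (g : ∀ x : M, TangentSpace J x →L[ℝ] TangentSpace J x →L[ℝ] ℝ)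
    (cov : CovariantDerivative J F (TangentSpace J : M → Type _)) : Prop where
  torsion_free : ∀ (X Y : ∀ x : M, TangentSpace J x) (x : M),
    MDifferentiableAt J (J.prod 𝓘(ℝ, F)) (fun y => TotalSpace.mk' F y (X y)) x →
    MDifferentiableAt J (J.prod 𝓘(ℝ, F)) (fun y => TotalSpace.mk' F y (Y y)) x →
    cov Y x (X x) - cov X x (Y x) = VectorField.mlieBracket J X Y x
  metric : ∀ (Y Z : ∀ x : M, TangentSpace J x) (x : M) (v : TangentSpace J x),
    MDifferentiableAt J (J.prod 𝓘(ℝ, F)) (fun y => TotalSpace.mk' F y (Y y)) x →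
    MDifferentiableAt J (J.prod 𝓘(ℝ, F)) (fun y => TotalSpace.mk' F y (Z y)) x →
    mvfderiv J (fun y => g y (Y y) (Z y)) x v = g x (cov Y x v) (Z x) + g x (Y x) (cov Z x v)

variable {M J} in
/-- The endomorphism field `A` is parallel: `∇_v (A Y) = A (∇_v Y)`. -/
def IsParallel (cov : CovariantDerivative J F (TangentSpace J : M → Type _))
    (A : ∀ x : M, TangentSpace J x →L[ℝ] TangentSpace J x) : Prop :=
  ∀ (Y : ∀ x : M, TangentSpace J x) (x : M) (v : TangentSpace J x),
    MDifferentiableAt J (J.prod 𝓘(ℝ, F)) (fun y => TotalSpace.mk' F y (Y y)) x →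
    cov (fun y => A y (Y y)) x v = A x (cov Y x v)

/-- A smooth hypersymplectic structure `(g, I, S, T)` on a manifold `M` of dimension `4k`. -/
structure HypersymplecticStructure (k : ℕ) where
  dim_eq : Module.finrank ℝ F = 4 * k
  /-- The pseudo-Riemannian metric. -/
  g : ∀ x : M, TangentSpace J x →L[ℝ] TangentSpace J x →L[ℝ] ℝ
  g_smooth : ContMDiff J (J.prod 𝓘(ℝ, F →L[ℝ] F →L[ℝ] ℝ)) ∞
    (fun x => TotalSpace.mk' (F →L[ℝ] F →L[ℝ] ℝ)
      (E := fun y : M => TangentSpace J y →L[ℝ] TangentSpace J y →L[ℝ] ℝ) x (g x))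
  g_symm : ∀ x v w, g x v w = g x w v
  /-- The metric has signature `(2k, 2k)` (in particular it is non-degenerate). -/
  g_signature : ∀ x, ∃ P N : Submodule ℝ (TangentSpace J x), IsCompl P N ∧
    Module.finrank ℝ P = 2 * k ∧ Module.finrank ℝ N = 2 * k ∧
    (∀ v ∈ P, v ≠ 0 → 0 < g x v v) ∧ (∀ v ∈ N, v ≠ 0 → g x v v < 0)
  /-- The endomorphism `I`. -/
  I : ∀ x : M, TangentSpace J x →L[ℝ] TangentSpace J x
  /-- The endomorphism `S`. -/
  S : ∀ x : M, TangentSpace J x →L[ℝ] TangentSpace J x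
  /-- The endomorphism `T`. -/
  T : ∀ x : M, TangentSpace J x →L[ℝ] TangentSpace J x
  I_smooth : ContMDiff J (J.prod 𝓘(ℝ, F →L[ℝ] F)) ∞
    (fun x => TotalSpace.mk' (F →L[ℝ] F)
      (E := fun y : M => TangentSpace J y →L[ℝ] TangentSpace J y) x (I x))
  S_smooth : ContMDiff J (J.prod 𝓘(ℝ, F →L[ℝ] F)) ∞
    (fun x => TotalSpace.mk' (F →L[ℝ] F)
      (E := fun y : M => TangentSpace J y →L[ℝ] TangentSpace J y) x (S x))
  T_smooth : ContMDiff J (J.prod 𝓘(ℝ, F →L[ℝ] F)) ∞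
    (fun x => TotalSpace.mk' (F →L[ℝ] F)
      (E := fun y : M => TangentSpace J y →L[ℝ] TangentSpace J y) x (T x))
  I_sq : ∀ x v, I x (I x v) = -v
  S_sq : ∀ x v, S x (S x v) = v
  T_sq : ∀ x v, T x (T x v) = v
  I_S : ∀ x v, I x (S x v) = T x v
  S_I : ∀ x v, S x (I x v) = -T x v
  I_skew : ∀ x v w, g x (I x v) w = -g x v (I x w)
  S_skew : ∀ x v w, g x (S x v) w = -g x v (S x w)
  T_skew : ∀ x v w, g x (T x v) w = -g x v (T x w)
  parallel : ∃ cov : CovariantDerivative J F (TangentSpace J : M → Type _),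
    IsLeviCivita J g cov ∧ IsParallel cov I ∧ IsParallel cov S ∧ IsParallel cov T

end Hypersymplectic

end

end NahmSchmid

open NahmSchmid

universe u v

/-!
The moduli space is described by two invariants of a solution `T`: the holonomy of the connection
`T₀`, that is, the value at `1` of the solution of `v' v⁻¹ = -T₀`, `v(0) = 1`, and the initial
values `T₁(0), T₂(0), T₃(0)`.

*Solutions.* `T₀` and the initial values determine a solution, by uniqueness for ordinary
differential equations, and they are arbitrary: the equations imply that `⟨T₁,T₁⟩ + ⟨T₂,T₂⟩` and
`⟨T₁,T₁⟩ + ⟨T₃,T₃⟩` are constant, which gives the a priori bound for global existence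
(`exists_nsMap_eq`). So the set of solutions is the graph of a smooth map on the Banach space of
data `(T₀, T₁(0), T₂(0), T₃(0))`; it has one global chart (`solHomeo`), and a shear of the space of
quadruples shows that it is a submanifold (`isSmoothEmbedding_val`).

*Quotient.* A gauge transformation `u` takes the parallel transport `v` to `u v`. So two solutions
are equivalent under the transformations which are `1` at both ends exactly if they have the same
holonomy and the same initial values (`gaugeRel_iff`), and the moduli space is an open subset of
`G × 𝔤³` (`isOpenEmbedding_invts`), which provides its charts. The holonomy is a smooth submersion,
since in the coordinate `κ`, inverse to the chart of `G` at `1`, the transport of `T₀ + δ` differs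
from that of `T₀` by the solution of an equation which the implicit function theorem solves
(`exists_hol_chart`, `exists_straightening`, `isSubmersion_proj`).

*The operator `Δ`.* On the functions with `ξ(0) = 0`, the map `ξ ↦ (ξ'(0), Δ ξ)` is invertible, by the
theory of linear initial value problems (`deltaIvp_bijective`). So the end condition `ξ(1) = 0`
amounts to a square system of linear equations for `ξ'(0)` (`isFredholm_Delta`, `index_Delta`,
`isInvertible_Delta_iff`). Integration by parts identifies `g(V(ξ), V(η))`, for the fundamental
vector fields `V`, with `-∫ ⟨Δ ξ, η⟩`, so the kernel of `Δ` measures the degeneracy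
(`degenerate_iff`).

*Hypersymplectic structure.* The transport of `T₀` takes a solution to one with `T₀ = 0`, determined
by the initial values `a ∈ 𝔤³`. Horizontal vectors are the solutions of a linear equation
`X' + q(T, X) = 0`, so each is determined by `X(0) ∈ 𝔤⁴`. This gives a frame of the moduli space,
indexed by `𝔤⁴`: its entries are `(-∫ X₀, (X₁(0), X₂(0), X₃(0)))`, left invariant in the
`G`-direction (`frm`, `frmQ`). It is invertible exactly off the degeneracy locus. The metric in this
frame depends on `a` only and the endomorphisms are constant. The
Levi-Civita connection comes from the flat connection of the affine space of quadruples: the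
derivative of a horizontal family along the horizontal lift of a tangent vector is
projected orthogonally to the horizontal vectors (`hGam`). It is metric since infinitesimal gauge
transformations preserve the metric (`fderiv_hg_eq`), torsion-free by the structure equation of `G`
(`torsion_hGam`, `fderiv_frmQ_sub`), and commutes with the endomorphisms since `q(T, ·)` does
(`hGam_comm`). The non-degeneracy of the metric on horizontal vectors, off the degeneracy locus, is
`horC_nondegenerate`; its signature is neutral since `S` is an anti-isometry
(`exists_neutral_splitting`). The passage from such a frame to a hypersymplectic structure is
`HyperFrame.toStructure`.
-/

set_option linter.unusedSectionVars false

namespace NahmSchmid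

noncomputable section

/-! ### Calculus of continuous functions on the unit interval -/

section Interval

open MeasureTheory intervalIntegral

variable {V : Type*} [NormedAddCommGroup V] [NormedSpace ℝ V]

theorem IsDeriv.neg {f f' : C(unitInterval, V)} (hf : IsDeriv f f') : IsDeriv (-f) (-f') := by
  simpa using hf.smul (-1)

theorem IsDeriv.sub {f f' g g' : C(unitInterval, V)} (hf : IsDeriv f f') (hg : IsDeriv g g') :
    IsDeriv (f - g) (f' - g') := fun t => (hf t).sub (hg t)

theorem isDeriv_const (v : V) : IsDeriv (ContinuousMap.const unitInterval v) 0 :=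
  fun t => by simpa using hasDerivWithinAt_const (t : ℝ) (Icc (0 : ℝ) 1) v

theorem IsDeriv.clm {W : Type*} [NormedAddCommGroup W] [NormedSpace ℝ W] (L : V →L[ℝ] W)
    {f f' : C(unitInterval, V)} (hf : IsDeriv f f') :
    IsDeriv (L.compLeftContinuous ℝ unitInterval f) (L.compLeftContinuous ℝ unitInterval f') :=
  fun t => L.hasFDerivAt.comp_hasDerivWithinAt (t : ℝ) (hf t)

theorem continuous_extend (f : C(unitInterval, V)) :
    Continuous fun s : ℝ => f (projIcc 0 1 zero_le_one s) :=
  f.continuous.comp continuous_projIcc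

/-- The antiderivative `t ↦ ∫₀ᵗ f` as a bounded operator. -/
def prim : C(unitInterval, V) →L[ℝ] C(unitInterval, V) :=
  LinearMap.mkContinuous
    { toFun := fun f => ⟨fun t => ∫ s in (0 : ℝ)..t, f (projIcc 0 1 zero_le_one s), by
        have := intervalIntegral.continuous_primitive
          (fun a b => (continuous_extend f).intervalIntegrable (μ := volume) a b) 0
        exact this.comp continuous_subtype_val⟩
      map_add' := fun f g => by
        ext t
        exact intervalIntegral.integral_add ((continuous_extend f).intervalIntegrable _ _)
          ((continuous_extend g).intervalIntegrable _ _)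
      map_smul' := fun c f => by
        ext t
        exact intervalIntegral.integral_smul c _ }
    1 (fun f => by
      refine (ContinuousMap.norm_le _ (by positivity)).2 fun t => ?_
      have h := intervalIntegral.norm_integral_le_of_norm_le_const (a := (0 : ℝ)) (b := t)
        (f := fun s => f (projIcc 0 1 zero_le_one s)) (C := ‖f‖) (fun s _ => f.norm_coe_le_norm _)
      refine h.trans ?_
      rw [sub_zero, abs_of_nonneg t.2.1, one_mul]
      exact mul_le_of_le_one_right (norm_nonneg _) t.2.2)

theorem prim_apply (f : C(unitInterval, V)) (t : unitInterval) :
    prim f t = ∫ s in (0 : ℝ)..t, f (projIcc 0 1 zero_le_one s) := rfl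

@[simp] theorem prim_zero (f : C(unitInterval, V)) : prim f 0 = 0 := by
  simp [prim_apply]

theorem norm_prim_le (f : C(unitInterval, V)) : ‖prim f‖ ≤ ‖f‖ := by
  simpa using (prim (V := V)).le_of_opNorm_le (LinearMap.mkContinuous_norm_le _ zero_le_one _) f

variable [CompleteSpace V]

theorem isDeriv_prim (f : C(unitInterval, V)) : IsDeriv (prim f) f := fun t => by
  have h : HasDerivAt (fun s : ℝ => ∫ x in (0 : ℝ)..s, f (projIcc 0 1 zero_le_one x))
      (f (projIcc 0 1 zero_le_one t)) t :=
    intervalIntegral.integral_hasDerivAt_right ((continuous_extend f).intervalIntegrable _ _)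
      ((continuous_extend f).stronglyMeasurableAtFilter _ _) (continuous_extend f).continuousAt
  rw [projIcc_val] at h
  refine h.hasDerivWithinAt.congr_of_mem (fun s hs => ?_) t.2
  rw [prim_apply, projIcc_of_mem zero_le_one hs]

theorem IsDeriv.eq_add_prim {f f' : C(unitInterval, V)} (h : IsDeriv f f') (t : unitInterval) :
    f t = f 0 + prim f' t := by
  have := intervalIntegral.integral_eq_sub_of_hasDerivAt_of_le (a := (0 : ℝ)) (b := t)
    (f := fun s => f (projIcc 0 1 zero_le_one s)) (f' := fun s => f' (projIcc 0 1 zero_le_one s))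
    t.2.1 (continuous_extend f).continuousOn (fun s hs => by
      have hs1 : s ∈ Icc (0 : ℝ) 1 := ⟨hs.1.le, hs.2.le.trans t.2.2⟩
      have := h ⟨s, hs1⟩
      rw [projIcc_of_mem zero_le_one hs1]
      exact this.hasDerivAt (Icc_mem_nhds hs.1 (hs.2.trans_le t.2.2)))
    ((continuous_extend f').intervalIntegrable _ _)
  rw [prim_apply, this, projIcc_val, projIcc_left]
  simp [show (⟨0, left_mem_Icc.2 zero_le_one⟩ : unitInterval) = 0 from rfl]

theorem IsDeriv.unique {f f' f'' : C(unitInterval, V)} (h : IsDeriv f f') (h' : IsDeriv f f'') :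
    f' = f'' := by
  ext t
  exact (uniqueDiffOn_Icc zero_lt_one (t : ℝ) t.2).eq_deriv _ (h t) (h' t)

theorem IsDeriv.const_of_zero {f : C(unitInterval, V)} (h : IsDeriv f 0) (t : unitInterval) :
    f t = f 0 := by
  simpa using h.eq_add_prim t

/-- The fundamental theorem of calculus for the measure of the subtype `[0,1]`. -/
theorem IsDeriv.integral_eq {f f' : C(unitInterval, V)} (h : IsDeriv f f') :
    ∫ t : unitInterval, f' t = f 1 - f 0 := by
  have h1 := h.eq_add_prim 1
  rw [h1, add_sub_cancel_left, prim_apply]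
  rw [show ((1 : unitInterval) : ℝ) = 1 from rfl, intervalIntegral.integral_of_le zero_le_one,
    ← integral_Icc_eq_integral_Ioc, ← integral_subtype_comap measurableSet_Icc]
  refine integral_congr_ae (Filter.Eventually.of_forall fun t => ?_)
  simp

theorem integral_eq_prim_one (f : C(unitInterval, V)) : ∫ t : unitInterval, f t = prim f 1 := by
  simpa using (isDeriv_prim f).integral_eq

theorem continuous_integrable (f : C(unitInterval, V)) :
    Integrable (fun t : unitInterval => f t) :=
  f.continuous.integrable_of_hasCompactSupport (HasCompactSupport.of_compactSpace _)

end Interval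

/-! ### The Banach space of `C¹` functions -/

section C1

variable {V : Type*} [NormedAddCommGroup V] [NormedSpace ℝ V]

/-- The inclusion of `C¹` functions into continuous functions. -/
def fnL : C1 V →L[ℝ] C(unitInterval, V) :=
  ContinuousLinearMap.fst ℝ _ _ ∘L (C1 V).subtypeL

/-- Differentiation of `C¹` functions. -/
def derL : C1 V →L[ℝ] C(unitInterval, V) :=
  ContinuousLinearMap.snd ℝ _ _ ∘L (C1 V).subtypeL

@[simp] theorem fn_sub (f g : C1 V) : fn (f - g) = fn f - fn g := rfl
@[simp] theorem fn_zero : fn (0 : C1 V) = 0 := rfl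
@[simp] theorem der_sub (f g : C1 V) : der (f - g) = der f - der g := rfl
@[simp] theorem der_zero : der (0 : C1 V) = 0 := rfl

theorem isDeriv_fn (f : C1 V) : IsDeriv (fn f) (der f) := f.2

variable [CompleteSpace V]

theorem C1.ext_fn {f g : C1 V} (h : fn f = fn g) : f = g := by
  refine Subtype.ext (Prod.ext h ?_)
  have hf := isDeriv_fn f
  rw [h] at hf
  exact hf.unique (isDeriv_fn g)

/-- The `C¹` function with a given value at `0` and a given derivative. -/
def C1.ofDer (v : V) (f : C(unitInterval, V)) : C1 V :=
  ⟨(ContinuousMap.const _ v + prim f, f), by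
    have h := (isDeriv_const v).add (isDeriv_prim f)
    rw [zero_add] at h
    exact h⟩

@[simp] theorem C1.fn_ofDer (v : V) (f : C(unitInterval, V)) :
    fn (C1.ofDer v f) = ContinuousMap.const _ v + prim f := rfl
@[simp] theorem C1.der_ofDer (v : V) (f : C(unitInterval, V)) : der (C1.ofDer v f) = f := rfl

/-- A Grönwall estimate for `C¹` functions. -/
theorem IsDeriv.norm_le_exp {f f' : C(unitInterval, V)} (h : IsDeriv f f') {K δ ε : ℝ}
    (hK : 1 ≤ K) (h0 : ‖f 0‖ ≤ δ) (hε : 0 ≤ ε) (hf : ∀ t, ‖f' t‖ ≤ K * ‖f t‖ + ε)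
    (t : unitInterval) : ‖f t‖ ≤ (δ + ε) * Real.exp K := by
  have hδ : 0 ≤ δ := (norm_nonneg _).trans h0
  have := norm_le_gronwallBound_of_norm_deriv_right_le (a := (0 : ℝ)) (b := 1) (K := K) (δ := δ)
    (ε := ε) (f := fun s => f (projIcc 0 1 zero_le_one s))
    (f' := fun s => f' (projIcc 0 1 zero_le_one s))
    (continuous_extend f).continuousOn (fun s hs => by
      have hs1 : s ∈ Icc (0 : ℝ) 1 := ⟨hs.1, hs.2.le⟩
      have := h ⟨s, hs1⟩
      rw [projIcc_of_mem zero_le_one hs1]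
      refine this.mono_of_mem_nhdsWithin ?_
      exact Icc_mem_nhdsGE_of_mem hs)
    (by rw [projIcc_left]; exact h0) (fun s _ => hf _) t t.2
  rw [projIcc_val, sub_zero] at this
  refine this.trans ?_
  rw [gronwallBound_of_K_ne_0 (by positivity)]
  have h1 : Real.exp (K * t) ≤ Real.exp K :=
    Real.exp_le_exp.2 (mul_le_of_le_one_right (by positivity) t.2.2)
  have h2 : 1 ≤ Real.exp (K * t) := Real.one_le_exp (mul_nonneg (by positivity) t.2.1)
  have h3 : ε / K ≤ ε := div_le_self hε hK
  have h4 : ε / K * (Real.exp (K * t) - 1) ≤ ε * Real.exp K := by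
    apply mul_le_mul h3 (by linarith) (by linarith) hε
  nlinarith

end C1

/-! ### Linear differential equations -/

section LinearODE

open intervalIntegral

variable {V : Type*} [NormedAddCommGroup V] [NormedSpace ℝ V] [CompleteSpace V]

/-- Pointwise application of a continuous family of operators to a continuous function. -/
def applyC {W : Type*} [NormedAddCommGroup W] [NormedSpace ℝ W]
    (A : C(unitInterval, V →L[ℝ] W)) (f : C(unitInterval, V)) : C(unitInterval, W) :=
  ⟨fun t => A t (f t), by fun_prop⟩

/-- Weighting with `e^{-lt}` gives the norm of the integration a factor `1/l`. -/
theorem norm_prim_exp_le {l : ℝ} (hl : 0 < l) (h : C(unitInterval, V)) (t : unitInterval) :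
    ‖∫ s in (0 : ℝ)..t, Real.exp (l * s) • h (projIcc 0 1 zero_le_one s)‖ ≤
      Real.exp (l * t) * (‖h‖ / l) := by
  have h1 : ∀ s : ℝ, HasDerivAt (fun s => Real.exp (l * s) * (‖h‖ / l))
      (Real.exp (l * s) * ‖h‖) s := fun s => by
    have := (((hasDerivAt_id s).const_mul l).exp).mul_const (‖h‖ / l)
    convert! this using 1
    simp only [id]
    field_simp
  have h2 : ∫ s in (0 : ℝ)..t, Real.exp (l * s) * ‖h‖ =
      Real.exp (l * t) * (‖h‖ / l) - Real.exp (l * 0) * (‖h‖ / l) :=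
    intervalIntegral.integral_eq_sub_of_hasDerivAt (fun s _ => h1 s)
      ((by fun_prop : Continuous fun s : ℝ => Real.exp (l * s) * ‖h‖).intervalIntegrable _ _)
  have h3 := intervalIntegral.norm_integral_le_of_norm_le (a := (0 : ℝ)) (b := t) t.2.1
    (f := fun s => Real.exp (l * s) • h (projIcc 0 1 zero_le_one s))
    (g := fun s => Real.exp (l * s) * ‖h‖) (μ := MeasureTheory.volume)
    (Filter.Eventually.of_forall fun s _ => by
      rw [norm_smul, Real.norm_of_nonneg (Real.exp_pos _).le]
      exact mul_le_mul_of_nonneg_left (h.norm_coe_le_norm _) (Real.exp_pos _).le)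
    ((by fun_prop : Continuous fun s : ℝ => Real.exp (l * s) * ‖h‖).intervalIntegrable _ _)
  rw [h2] at h3
  have : 0 ≤ Real.exp (l * 0) * (‖h‖ / l) := by positivity
  linarith

/-- Existence for linear initial value problems on `[0,1]`: after multiplication with `e^{-lt}` for
large `l` the integral equation becomes a contraction. -/
theorem exists_linearODE (A : C(unitInterval, V →L[ℝ] V)) (v : V) (f : C(unitInterval, V)) :
    ∃ X : C1 V, fn X 0 = v ∧ der X = applyC A (fn X) + f := by
  -- the unknown is `Y = e^{-lt} X`; this `l` makes `S` contract by the factor `1/2`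
  set l : ℝ := 2 * (‖A‖ + 1) with hl
  have hlpos : 0 < l := by positivity
  let E1 : C(unitInterval, ℝ) := ⟨fun t => Real.exp (l * t), by fun_prop⟩
  let E2 : C(unitInterval, ℝ) := ⟨fun t => Real.exp (-(l * t)), by fun_prop⟩
  let S : C(unitInterval, V) → C(unitInterval, V) := fun Y =>
    E2 • (ContinuousMap.const _ v + prim (E1 • applyC A Y + f))
  have hS : ContractingWith (1 / 2) S := by
    refine ⟨by rw [div_lt_one] <;> norm_num, LipschitzWith.of_dist_le_mul fun Y Z => ?_⟩
    rw [ContinuousMap.dist_le (by positivity)]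
    intro t
    have e1 : S Y t - S Z t = E2 t • ∫ s in (0 : ℝ)..t, Real.exp (l * s) •
        (applyC A (Y - Z)) (projIcc 0 1 zero_le_one s) := by
      have e2 : prim (E1 • applyC A Y + f) - prim (E1 • applyC A Z + f) =
          prim (E1 • applyC A (Y - Z)) := by
        rw [← map_sub]
        congr 1
        ext t
        simp [applyC, smul_sub]
      have e3 : prim (E1 • applyC A (Y - Z)) t = ∫ s in (0 : ℝ)..t, Real.exp (l * s) •
          (applyC A (Y - Z)) (projIcc 0 1 zero_le_one s) := by
        rw [prim_apply]
        refine intervalIntegral.integral_congr fun s hs => ?_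
        rw [uIcc_of_le t.2.1] at hs
        have : ((projIcc 0 1 zero_le_one s : unitInterval) : ℝ) = s := by
          rw [projIcc_of_mem zero_le_one ⟨hs.1, hs.2.trans t.2.2⟩]
        simp [E1, this]
      rw [← e3, ← e2]
      simp [S, smul_sub, smul_add]
    rw [dist_eq_norm, e1, norm_smul]
    have h1 := norm_prim_exp_le hlpos (applyC A (Y - Z)) t
    have h2 : ‖applyC A (Y - Z)‖ ≤ ‖A‖ * ‖Y - Z‖ := by
      refine (ContinuousMap.norm_le _ (by positivity)).2 fun t => ?_
      refine ((A t).le_opNorm _).trans ?_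
      gcongr
      · exact A.norm_coe_le_norm t
      · exact (Y - Z).norm_coe_le_norm t
    have h3 : ‖E2 t‖ * Real.exp (l * t) = 1 := by
      change ‖Real.exp (-(l * t))‖ * _ = _
      rw [Real.norm_of_nonneg (Real.exp_pos _).le, ← Real.exp_add]
      simp
    calc _ ≤ ‖E2 t‖ * (Real.exp (l * t) * (‖applyC A (Y - Z)‖ / l)) := by gcongr
      _ = ‖applyC A (Y - Z)‖ / l := by rw [← mul_assoc, h3, one_mul]
      _ ≤ ‖A‖ * ‖Y - Z‖ / l := by gcongr
      _ ≤ (((1 / 2 : NNReal)) : ℝ) * dist Y Z := by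
          rw [dist_eq_norm, div_le_iff₀ hlpos, hl]
          push_cast
          nlinarith [norm_nonneg A, norm_nonneg (Y - Z)]
  obtain ⟨Y, hY, -⟩ := hS.exists_fixedPoint 0 (edist_ne_top _ _)
  have key : E1 • Y = ContinuousMap.const _ v + prim (E1 • applyC A Y + f) := by
    conv_lhs => rw [← hY.eq]
    ext t
    have : E1 t * E2 t = 1 := by
      change Real.exp _ * Real.exp _ = 1
      rw [← Real.exp_add]; simp
    simp [S, smul_smul, this]
  refine ⟨C1.ofDer v (E1 • applyC A Y + f), by simp, ?_⟩
  rw [C1.der_ofDer, C1.fn_ofDer, ← key]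
  ext t
  simp [applyC]

/-- Uniqueness for linear initial value problems, by the Grönwall estimate for the difference. -/
theorem linearODE_unique (A : C(unitInterval, V →L[ℝ] V)) {X Y : C1 V} (f : C(unitInterval, V))
    (h0 : fn X 0 = fn Y 0) (hX : der X = applyC A (fn X) + f) (hY : der Y = applyC A (fn Y) + f) :
    X = Y := by
  rw [← sub_eq_zero]
  refine C1.ext_fn ?_
  have h := (isDeriv_fn (X - Y)).norm_le_exp (K := ‖A‖ + 1) (δ := 0) (ε := 0) (by simp [norm_nonneg A])
    (by simp [h0]) le_rfl (fun t => by
      have : der (X - Y) t = A t (fn (X - Y) t) := by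
        simp [hX, hY, applyC]
      rw [this, add_zero]
      refine ((A t).le_opNorm _).trans ?_
      gcongr
      exact (A.norm_coe_le_norm t).trans (le_add_of_nonneg_right zero_le_one))
  ext t
  simpa using h t

end LinearODE

/-! ### Composition operators on spaces of continuous functions -/

section Nemytskii

universe w

variable {V W : Type w} [NormedAddCommGroup V] [NormedSpace ℝ V]
  [NormedAddCommGroup W] [NormedSpace ℝ W]

/-- Pointwise application of operators, as a bounded operator. -/
def applyCL : C(unitInterval, V →L[ℝ] W) →L[ℝ] C(unitInterval, V) →L[ℝ] C(unitInterval, W) :=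
  LinearMap.mkContinuous₂
    (LinearMap.mk₂ ℝ
      (applyC : C(unitInterval, V →L[ℝ] W) → C(unitInterval, V) → C(unitInterval, W))
      (fun A B f => by ext t; simp [applyC]) (fun c A f => by ext t; simp [applyC])
      (fun A f g => by ext t; simp [applyC]) (fun c A f => by ext t; simp [applyC]))
    1 (fun A f => by
      refine (ContinuousMap.norm_le _ (by positivity)).2 fun t => ?_
      rw [one_mul]
      refine ((A t).le_opNorm _).trans ?_
      gcongr
      · exact A.norm_coe_le_norm t
      · exact f.norm_coe_le_norm t)

@[simp] theorem applyCL_apply (A : C(unitInterval, V →L[ℝ] W)) (f : C(unitInterval, V))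
    (t : unitInterval) : applyCL A f t = A t (f t) := rfl

/-- The derivative of composition with `f` at `x` is the pointwise application of `f'(x(t))`. By the
mean value inequality the pointwise remainder is bounded by the variation of `f'` near `x`, which is
uniformly small since composition with `f'` is continuous. -/
theorem hasFDerivAt_comp_left {f : C(V, W)} {f' : C(V, V →L[ℝ] W)}
    (hf : ∀ x, HasFDerivAt f (f' x) x) (x : C(unitInterval, V)) :
    HasFDerivAt (fun y : C(unitInterval, V) => f.comp y) (applyCL (f'.comp x)) x := by
  rw [hasFDerivAt_iff_isLittleO_nhds_zero, Asymptotics.isLittleO_iff]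
  intro c hc
  have hcont : ContinuousAt (fun y : C(unitInterval, V) => (f'.comp y : C(unitInterval, V →L[ℝ] W))) x :=
    (ContinuousMap.continuous_postcomp f').continuousAt
  obtain ⟨δ, hδ, hball⟩ := Metric.continuousAt_iff (α := C(unitInterval, V))
    (β := C(unitInterval, V →L[ℝ] W)).1 hcont c hc
  filter_upwards [Metric.ball_mem_nhds (0 : C(unitInterval, V)) hδ] with h hh
  rw [mem_ball_zero_iff] at hh
  refine (ContinuousMap.norm_le _ (by positivity)).2 fun t => ?_
  have hseg : ∀ z ∈ segment ℝ (x t) (x t + h t), ‖f' z - f' (x t)‖ ≤ c := by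
    intro z hz
    rw [segment_eq_image'] at hz
    obtain ⟨s, hs, rfl⟩ := hz
    have h1 : dist (x + s • h) x < δ := by
      rw [dist_eq_norm, add_sub_cancel_left, norm_smul, Real.norm_of_nonneg hs.1]
      exact (mul_le_of_le_one_left (norm_nonneg _) hs.2).trans_lt hh
    have h2 := (ContinuousMap.dist_apply_le_dist t).trans_lt (hball h1)
    rw [dist_eq_norm] at h2
    simpa using h2.le
  have := (convex_segment (x t) (x t + h t)).norm_image_sub_le_of_norm_hasFDerivWithin_le'
    (f := f) (fun z _ => (hf z).hasFDerivWithinAt) hseg (left_mem_segment _ _ _)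
    (right_mem_segment _ _ _)
  rw [add_sub_cancel_left] at this
  refine this.trans ?_
  gcongr
  exact h.norm_coe_le_norm t

/-- By induction on `n`, since the derivative of composition with `f` is given by composition with
`f'`, hence has one order of differentiability less. -/
theorem contDiff_comp_left_nat (n : ℕ) : ∀ {W : Type w} [NormedAddCommGroup W] [NormedSpace ℝ W]
    (f : C(V, W)), ContDiff ℝ n f → ContDiff ℝ n (fun y : C(unitInterval, V) => f.comp y) := by
  induction n with
  | zero =>
    intro W _ _ f _
    exact contDiff_zero.2 (ContinuousMap.continuous_postcomp f)
  | succ n ih =>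
    intro W _ _ f hf
    have hf0 : ContDiff ℝ ((n : ℕ∞ω) + 1) f := by exact_mod_cast hf
    have h1 := contDiff_succ_iff_fderiv.1 hf0
    have hc : Continuous (fderiv ℝ f) := h1.2.2.continuous
    have := ih ⟨fderiv ℝ f, hc⟩ h1.2.2
    rw [show ((n + 1 : ℕ) : ℕ∞ω) = (n : ℕ∞ω) + 1 by push_cast; rfl]
    rw [contDiff_succ_iff_hasFDerivAt]
    have hA : ContDiff ℝ n (fun A : C(unitInterval, V →L[ℝ] W) => applyCL (V := V) (W := W) A) :=
      ContinuousLinearMap.contDiff _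
    exact ⟨fun x => applyCL ((⟨fderiv ℝ f, hc⟩ : C(V, V →L[ℝ] W)).comp x), hA.comp this,
      fun x => hasFDerivAt_comp_left (f' := ⟨fderiv ℝ f, hc⟩)
        (fun y => (h1.1 y).hasFDerivAt) x⟩

/-- Composition with a smooth map is a smooth operator between spaces of continuous functions. -/
theorem contDiff_comp_left (f : C(V, W)) (hf : ContDiff ℝ ∞ f) :
    ContDiff ℝ ∞ (fun y : C(unitInterval, V) => f.comp y) :=
  contDiff_infty.2 fun n => contDiff_comp_left_nat n f (contDiff_infty.1 hf n)

end Nemytskii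

/-! ### The Lie group in the chart at the identity -/

section LieGroupChart

variable {E : Type*} [NormedAddCommGroup E] [NormedSpace ℝ E] [FiniteDimensional ℝ E]
  {G : Type*} [TopologicalSpace G] [ChartedSpace E G] [Group G] [LieGroup 𝓘(ℝ, E) ∞ G]

variable (E G) in
/-- The chart of the Lie group at the identity. -/
def phi : OpenPartialHomeomorph G E := chartAt E (1 : G)

local notation "φ" => phi E G
local notation "κ" => (OpenPartialHomeomorph.symm (phi E G))
local notation "e₀" => phi E G 1

theorem isTopologicalGroup (E : Type*) [NormedAddCommGroup E] [NormedSpace ℝ E] (G : Type*)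
    [TopologicalSpace G] [ChartedSpace E G] [Group G] [LieGroup 𝓘(ℝ, E) ∞ G] :
    IsTopologicalGroup G :=
  topologicalGroup_of_lieGroup 𝓘(ℝ, E) ∞

theorem one_mem_phi : (1 : G) ∈ (phi E G).source := mem_chart_source E 1

theorem e0_mem : e₀ ∈ (phi E G).target := (phi E G).map_source one_mem_phi

@[simp] theorem kap_e0 : κ e₀ = 1 := (phi E G).left_inv one_mem_phi

theorem contMDiffAt_phi {g : G} (hg : g ∈ (phi E G).source) : ContMDiffAt 𝓘(ℝ, E) 𝓘(ℝ, E) ∞ φ g :=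
  (contMDiffOn_chart (x := (1 : G))).contMDiffAt ((phi E G).open_source.mem_nhds hg)

theorem contMDiffAt_kap {y : E} (hy : y ∈ (phi E G).target) : ContMDiffAt 𝓘(ℝ, E) 𝓘(ℝ, E) ∞ κ y :=
  (contMDiffOn_chart_symm (x := (1 : G))).contMDiffAt ((phi E G).open_target.mem_nhds hy)

variable {X : Type*} [NormedAddCommGroup X] [NormedSpace ℝ X]

theorem contDiffAt_phi_comp {f : X → G} {x : X} (hf : ContMDiffAt 𝓘(ℝ, X) 𝓘(ℝ, E) ∞ f x)
    (hx : f x ∈ (phi E G).source) : ContDiffAt ℝ ∞ (fun y => φ (f y)) x :=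
  ((contMDiffAt_phi hx).comp x hf).contDiffAt

theorem contMDiffAt_kap_comp {f : X → E} {x : X} (hf : ContDiffAt ℝ ∞ f x)
    (hx : f x ∈ (phi E G).target) : ContMDiffAt 𝓘(ℝ, X) 𝓘(ℝ, E) ∞ (fun y => κ (f y)) x :=
  (contMDiffAt_kap hx).comp x hf.contMDiffAt

theorem eventually_mem_source {Y : Type*} [TopologicalSpace Y] {f : Y → G} {l : Filter Y} {y : Y}
    (hf : Filter.Tendsto f l (nhds (f y))) (hy : f y ∈ (phi E G).source) : ∀ᶠ z in l, f z ∈ (phi E G).source :=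
  hf ((phi E G).open_source.mem_nhds hy)

variable (E G) in
/-- The group multiplication in the chart at the identity. -/
def lmul (p : E × E) : E := φ (κ p.1 * κ p.2)

theorem contDiffAt_lmul {p : E × E} (h1 : p.1 ∈ (phi E G).target) (h2 : p.2 ∈ (phi E G).target)
    (h : κ p.1 * κ p.2 ∈ (phi E G).source) : ContDiffAt ℝ ∞ (lmul E G) p :=
  contDiffAt_phi_comp ((contMDiffAt_kap_comp contDiffAt_fst h1).mul
    (contMDiffAt_kap_comp contDiffAt_snd h2)) h

variable (E G) in
/-- The derivative at the identity of right translation by the point with coordinates `y`: the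
value at `y` of the right invariant vector fields in the chart at the identity. -/
def rtr (y : E) : E →L[ℝ] E := fderiv ℝ (fun x => lmul E G (x, y)) e₀

variable (E G) in
/-- The derivative at the identity of left translation by the point with coordinates `y`: the
value at `y` of the left invariant vector fields in the chart at the identity. -/
def ltr (y : E) : E →L[ℝ] E := fderiv ℝ (fun x => lmul E G (y, x)) e₀

variable (E G) in
/-- The inverse of `rtr y`. -/
def rinv (y : E) : E →L[ℝ] E := fderiv ℝ (fun z => φ (κ z * (κ y)⁻¹)) y

theorem contDiffAt_rtr {y : E} (hy : y ∈ (phi E G).target) : ContDiffAt ℝ ∞ (rtr E G) y := by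
  have h : ContDiffAt ℝ ∞ (Function.uncurry fun y x => lmul E G (x, y)) (y, e₀) := by
    have : (Function.uncurry fun y x => lmul E G (x, y)) = lmul E G ∘ Prod.swap := rfl
    rw [this]
    refine ContDiffAt.comp _ (contDiffAt_lmul e0_mem hy ?_) (contDiff_snd.prodMk contDiff_fst).contDiffAt
    simpa using (phi E G).map_target hy
  exact h.fderiv (contDiffAt_const (c := e₀)) (by simp)

theorem contDiffAt_ltr {y : E} (hy : y ∈ (phi E G).target) : ContDiffAt ℝ ∞ (ltr E G) y := by
  have h : ContDiffAt ℝ ∞ (Function.uncurry fun y x => lmul E G (y, x)) (y, e₀) := by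
    refine contDiffAt_lmul hy e0_mem ?_
    simpa using (phi E G).map_target hy
  exact h.fderiv (contDiffAt_const (c := e₀)) (by simp)

theorem contDiffAt_rinv {y : E} (hy : y ∈ (phi E G).target) : ContDiffAt ℝ ∞ (rinv E G) y := by
  have h : ContDiffAt ℝ ∞ (Function.uncurry fun y z => φ (κ z * (κ y)⁻¹)) (y, y) := by
    refine contDiffAt_phi_comp ((contMDiffAt_kap_comp contDiffAt_snd hy).mul
      (contMDiffAt_kap_comp contDiffAt_fst hy).inv) ?_
    simpa using one_mem_phi (E := E) (G := G)
  exact h.fderiv contDiffAt_id (by simp)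

theorem hasFDerivAt_rtr {y : E} (hy : y ∈ (phi E G).target) :
    HasFDerivAt (fun x => φ (κ x * κ y)) (rtr E G y) e₀ := by
  have : ContDiffAt ℝ ∞ (fun x => lmul E G (x, y)) e₀ :=
    ContDiffAt.comp (g := lmul E G) e₀
      (contDiffAt_lmul (p := (e₀, y)) e0_mem hy (by simpa using (phi E G).map_target hy))
      (contDiffAt_id.prodMk contDiffAt_const)
  exact (this.differentiableAt (by simp)).hasFDerivAt

theorem hasFDerivAt_ltr {y : E} (hy : y ∈ (phi E G).target) :
    HasFDerivAt (fun x => φ (κ y * κ x)) (ltr E G y) e₀ := by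
  have : ContDiffAt ℝ ∞ (fun x => lmul E G (y, x)) e₀ :=
    ContDiffAt.comp (g := lmul E G) e₀
      (contDiffAt_lmul (p := (y, e₀)) hy e0_mem (by simpa using (phi E G).map_target hy))
      (contDiffAt_const.prodMk contDiffAt_id)
  exact (this.differentiableAt (by simp)).hasFDerivAt

theorem hasFDerivAt_rinv {y : E} (hy : y ∈ (phi E G).target) :
    HasFDerivAt (fun z => φ (κ z * (κ y)⁻¹)) (rinv E G y) y := by
  have : ContDiffAt ℝ ∞ (fun z => φ (κ z * (κ y)⁻¹)) y := by
    refine contDiffAt_phi_comp ((contMDiffAt_kap_comp contDiffAt_id hy).mul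
      contMDiffAt_const) ?_
    simpa using one_mem_phi (E := E) (G := G)
  exact (this.differentiableAt (by simp)).hasFDerivAt

theorem continuousAt_kap {y : E} (hy : y ∈ (phi E G).target) : ContinuousAt κ y :=
  (phi E G).continuousAt_symm hy

theorem eventually_phi_kap {y : E} (hy : y ∈ (phi E G).target) : ∀ᶠ z in nhds y, φ (κ z) = z := by
  filter_upwards [(phi E G).open_target.mem_nhds hy] with z hz using (phi E G).right_inv hz

theorem rtr_rinv {y : E} (hy : y ∈ (phi E G).target) (v : E) : rtr E G y (rinv E G y v) = v := by
  have h1 := hasFDerivAt_rinv hy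
  have h0 : φ (κ y * (κ y)⁻¹) = e₀ := by simp
  have h2 := hasFDerivAt_rtr hy
  rw [← h0] at h2
  have h3 := h2.comp y h1
  have h4 : (fun x => φ (κ x * κ y)) ∘ (fun z => φ (κ z * (κ y)⁻¹)) =ᶠ[nhds y] id := by
    have := isTopologicalGroup E G
    have hc : ContinuousAt (fun z => κ z * (κ y)⁻¹) y :=
      (continuousAt_kap hy).mul continuousAt_const
    filter_upwards [eventually_phi_kap hy, eventually_mem_source (E := E) (f := fun z => κ z * (κ y)⁻¹)
      hc (by simpa using one_mem_phi (E := E) (G := G))] with z hz hz2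
    simp [(phi E G).left_inv hz2, hz]
  have h5 := (hasFDerivAt_id (𝕜 := ℝ) y).congr_of_eventuallyEq h4
  have h6 : (rtr E G y).comp (rinv E G y) = ContinuousLinearMap.id ℝ E := h3.unique h5
  simpa using DFunLike.congr_fun h6 v

theorem rinv_rtr {y : E} (hy : y ∈ (phi E G).target) (v : E) : rinv E G y (rtr E G y v) = v := by
  have h1 := hasFDerivAt_rtr hy
  have h0 : φ (κ e₀ * κ y) = y := by simpa using (phi E G).right_inv hy
  have h2 := hasFDerivAt_rinv hy
  have h2' : HasFDerivAt (fun z => φ (κ z * (κ y)⁻¹)) (rinv E G y) (φ (κ e₀ * κ y)) := by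
    rwa [h0]
  have h3 := h2'.comp e₀ h1
  have h4 : (fun z => φ (κ z * (κ y)⁻¹)) ∘ (fun x => φ (κ x * κ y)) =ᶠ[nhds e₀] id := by
    have := isTopologicalGroup E G
    have hc : ContinuousAt (fun z => κ z * κ y) e₀ :=
      (continuousAt_kap e0_mem).mul continuousAt_const
    filter_upwards [eventually_phi_kap e0_mem, eventually_mem_source (E := E) (f := fun z => κ z * κ y)
      hc (by simpa using (phi E G).map_target hy)] with z hz hz2
    simp [(phi E G).left_inv hz2, hz]
  have h5 := (hasFDerivAt_id (𝕜 := ℝ) e₀).congr_of_eventuallyEq h4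
  have h6 : (rinv E G y).comp (rtr E G y) = ContinuousLinearMap.id ℝ E := h3.unique h5
  simpa using DFunLike.congr_fun h6 v

theorem rtr_e0 : rtr E G e₀ = ContinuousLinearMap.id ℝ E := by
  refine (hasFDerivAt_rtr e0_mem).unique ((hasFDerivAt_id e₀).congr_of_eventuallyEq ?_)
  filter_upwards [eventually_phi_kap e0_mem] with z hz
  simp [hz]

theorem ltr_e0 : ltr E G e₀ = ContinuousLinearMap.id ℝ E := by
  refine (hasFDerivAt_ltr e0_mem).unique ((hasFDerivAt_id e₀).congr_of_eventuallyEq ?_)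
  filter_upwards [eventually_phi_kap e0_mem] with z hz
  simp [hz]

/-- The derivative of the group multiplication at the identity is the addition. -/
theorem hasFDerivAt_lmul : HasFDerivAt (lmul E G)
    (ContinuousLinearMap.fst ℝ E E + ContinuousLinearMap.snd ℝ E E) (e₀, e₀) := by
  have h := ((contDiffAt_lmul (p := (e₀, e₀)) (G := G) e0_mem e0_mem
    (by simpa using one_mem_phi (E := E) (G := G))).differentiableAt (by simp)).hasFDerivAt
  have h1 := h.comp e₀ (f := fun x => (x, e₀))
    ((hasFDerivAt_id e₀).prodMk (hasFDerivAt_const e₀ e₀))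
  have h2 := h.comp e₀ (f := fun x => (e₀, x))
    ((hasFDerivAt_const e₀ e₀).prodMk (hasFDerivAt_id e₀))
  have h3 := h1.unique (hasFDerivAt_rtr (E := E) (G := G) (y := e₀) e0_mem)
  have h4 := h2.unique (hasFDerivAt_ltr (E := E) (G := G) (y := e₀) e0_mem)
  rw [rtr_e0] at h3
  rw [ltr_e0] at h4
  convert! h using 1
  ext a
  · simpa using (DFunLike.congr_fun h3 a).symm
  · simpa using (DFunLike.congr_fun h4 a).symm

/-- The derivative of the inversion at the identity is `-1`. -/
theorem hasFDerivAt_linv :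
    HasFDerivAt (fun x => φ (κ x)⁻¹) (-ContinuousLinearMap.id ℝ E) e₀ := by
  have hd : ContDiffAt ℝ ∞ (fun x => φ (κ x)⁻¹) e₀ :=
    contDiffAt_phi_comp (contMDiffAt_kap_comp contDiffAt_id e0_mem).inv
      (by simpa using one_mem_phi (E := E) (G := G))
  have h := (hd.differentiableAt (by simp)).hasFDerivAt
  have h1 := (hasFDerivAt_id e₀).prodMk h
  have h0 : (id e₀, φ (κ e₀)⁻¹) = (e₀, e₀) := by simp
  have h2 := hasFDerivAt_lmul (E := E) (G := G)
  rw [← h0] at h2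
  have h3 := h2.comp e₀ h1
  have h4 : lmul E G ∘ (fun x => (id x, φ (κ x)⁻¹)) =ᶠ[nhds e₀] fun _ => e₀ := by
    have := isTopologicalGroup E G
    have hc : ContinuousAt (fun z => (κ z)⁻¹) e₀ := (continuousAt_kap e0_mem).inv
    filter_upwards [eventually_mem_source (E := E) (f := fun z => (κ z)⁻¹)
      hc (by simpa using one_mem_phi (E := E) (G := G))] with z hz2
    simp [lmul, (phi E G).left_inv hz2]
  have h5 := h3.unique ((hasFDerivAt_const e₀ e₀).congr_of_eventuallyEq h4)
  convert! h using 1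
  ext v
  have h6 := congrArg (fun L : E →L[ℝ] E => L v) h5
  simp at h6
  simpa using (eq_neg_of_add_eq_zero_right h6).symm

end LieGroupChart

/-! ### Lie brackets of vector fields in a chart -/

section MLieBracket

variable {F : Type*} [NormedAddCommGroup F] [NormedSpace ℝ F]
  {N : Type*} [TopologicalSpace N] [ChartedSpace F N] [IsManifold 𝓘(ℝ, F) ∞ N]

theorem mfderiv_extChartAt_self (x : N) :
    (mfderiv 𝓘(ℝ, F) 𝓘(ℝ, F) (extChartAt 𝓘(ℝ, F) x) x : F →L[ℝ] F) =
      ContinuousLinearMap.id ℝ F := by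
  have : IsManifold 𝓘(ℝ, F) 1 N := IsManifold.of_le (n := ∞) (by simp)
  ext v
  have h := mfderiv_chartAt_eq_tangentCoordChange (I := 𝓘(ℝ, F)) (mem_chart_source F x)
  refine (DFunLike.congr_fun h v).trans ?_
  exact tangentCoordChange_self (I := 𝓘(ℝ, F)) (mem_extChartAt_source x)

theorem mpullback_extChartAt_symm (V : ∀ x : N, TangentSpace 𝓘(ℝ, F) x) (x : N) {p : F}
    (hp : p ∈ (extChartAt 𝓘(ℝ, F) x).target) :
    VectorField.mpullbackWithin 𝓘(ℝ, F) 𝓘(ℝ, F) (extChartAt 𝓘(ℝ, F) x).symm V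
      (range 𝓘(ℝ, F)) p =
      mfderiv 𝓘(ℝ, F) 𝓘(ℝ, F) (extChartAt 𝓘(ℝ, F) x) ((extChartAt 𝓘(ℝ, F) x).symm p)
        (V ((extChartAt 𝓘(ℝ, F) x).symm p)) := by
  have : IsManifold 𝓘(ℝ, F) 1 N := IsManifold.of_le (n := ∞) (by simp)
  rw [VectorField.mpullbackWithin_apply]
  have h1 := mfderivWithin_extChartAt_symm_comp_mfderiv_extChartAt (I := 𝓘(ℝ, F)) hp
  have h2 := mfderiv_extChartAt_comp_mfderivWithin_extChartAt_symm (I := 𝓘(ℝ, F)) hp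
  rw [ContinuousLinearMap.inverse_eq h1 h2]
  rfl

/-- The Lie bracket of vector fields can be computed from their representatives in the preferred
chart at the given point. -/
theorem mlieBracket_eq_of_chart {V W : ∀ x : N, TangentSpace 𝓘(ℝ, F) x} {x : N} {v w : F → F}
    (hV : ∀ᶠ p in nhds (extChartAt 𝓘(ℝ, F) x x),
      mfderiv 𝓘(ℝ, F) 𝓘(ℝ, F) (extChartAt 𝓘(ℝ, F) x) ((extChartAt 𝓘(ℝ, F) x).symm p)
        (V ((extChartAt 𝓘(ℝ, F) x).symm p)) = v p)
    (hW : ∀ᶠ p in nhds (extChartAt 𝓘(ℝ, F) x x),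
      mfderiv 𝓘(ℝ, F) 𝓘(ℝ, F) (extChartAt 𝓘(ℝ, F) x) ((extChartAt 𝓘(ℝ, F) x).symm p)
        (W ((extChartAt 𝓘(ℝ, F) x).symm p)) = w p) :
    VectorField.mlieBracket 𝓘(ℝ, F) V W x =
      fderiv ℝ w (extChartAt 𝓘(ℝ, F) x x) (v (extChartAt 𝓘(ℝ, F) x x)) -
        fderiv ℝ v (extChartAt 𝓘(ℝ, F) x x) (w (extChartAt 𝓘(ℝ, F) x x)) := by
  rw [← VectorField.mlieBracketWithin_univ, VectorField.mlieBracketWithin_apply]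
  have h0 : ((extChartAt 𝓘(ℝ, F) x).symm ⁻¹' univ ∩ range 𝓘(ℝ, F)) = (univ : Set F) := by simp
  rw [h0]
  have hT := extChartAt_target_mem_nhds (I := 𝓘(ℝ, F)) x
  have e1 : VectorField.mpullbackWithin 𝓘(ℝ, F) 𝓘(ℝ, F) (extChartAt 𝓘(ℝ, F) x).symm V
      (range 𝓘(ℝ, F)) =ᶠ[nhds (extChartAt 𝓘(ℝ, F) x x)] v := by
    filter_upwards [hT, hV] with p hp h
    rw [mpullback_extChartAt_symm V x hp, h]
  have e2 : VectorField.mpullbackWithin 𝓘(ℝ, F) 𝓘(ℝ, F) (extChartAt 𝓘(ℝ, F) x).symm W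
      (range 𝓘(ℝ, F)) =ᶠ[nhds (extChartAt 𝓘(ℝ, F) x x)] w := by
    filter_upwards [hT, hW] with p hp h
    rw [mpullback_extChartAt_symm W x hp, h]
  have e3 := e1.lieBracket_vectorField_eq (𝕜 := ℝ) e2
  have e4 : ((mfderiv 𝓘(ℝ, F) 𝓘(ℝ, F) (extChartAt 𝓘(ℝ, F) x) x).inverse : F →L[ℝ] F) =
      ContinuousLinearMap.id ℝ F := by
    have := mfderiv_extChartAt_self (F := F) x
    exact (congrArg ContinuousLinearMap.inverse this).trans ContinuousLinearMap.inverse_id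
  have e5 := fun V W : F → F => congrFun (VectorField.lieBracketWithin_univ (𝕜 := ℝ) (V := V) (W := W))
    (extChartAt 𝓘(ℝ, F) x x)
  exact ((DFunLike.congr_fun e4 _).trans (e5 _ _)).trans e3

end MLieBracket

section LieGroupChart

variable {E : Type*} [NormedAddCommGroup E] [NormedSpace ℝ E] [FiniteDimensional ℝ E]
  {G : Type*} [TopologicalSpace G] [ChartedSpace E G] [Group G] [LieGroup 𝓘(ℝ, E) ∞ G]

local notation "φ" => phi E G
local notation "κ" => (OpenPartialHomeomorph.symm (phi E G))
local notation "e₀" => phi E G 1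

/-! ### The adjoint action -/

theorem mfderiv_one_eq {X : Type*} [NormedAddCommGroup X] [NormedSpace ℝ X] {f : G → X}
    (hf : MDifferentiableAt 𝓘(ℝ, E) 𝓘(ℝ, X) f 1) (v : E) :
    mfderiv 𝓘(ℝ, E) 𝓘(ℝ, X) f 1 v = fderiv ℝ (fun z => f (κ z)) e₀ v := by
  rw [hf.mfderiv]
  simp only [writtenInExtChartAt, extChartAt_model_space_eq_id, ModelWithCorners.range_eq_univ,
    fderivWithin_univ]
  rfl

variable (E) in
/-- The adjoint action as a bounded operator. -/
def AdL (g : G) : E →L[ℝ] E := fderiv ℝ (fun z => φ (g * κ z * g⁻¹)) e₀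

theorem contDiffAt_conj (g : G) : ContDiffAt ℝ ∞ (fun z => φ (g * κ z * g⁻¹)) e₀ := by
  refine contDiffAt_phi_comp ((contMDiffAt_const.mul
    (contMDiffAt_kap_comp contDiffAt_id e0_mem)).mul contMDiffAt_const) ?_
  simpa using one_mem_phi (E := E) (G := G)

theorem hasFDerivAt_AdL (g : G) : HasFDerivAt (fun z => φ (g * κ z * g⁻¹)) (AdL E g) e₀ :=
  ((contDiffAt_conj g).differentiableAt (by simp)).hasFDerivAt

theorem Ad_eq_AdL (g : G) (v : E) : Ad E g v = AdL E g v := by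
  have hd : MDifferentiableAt 𝓘(ℝ, E) 𝓘(ℝ, E) (fun x : G => g * x * g⁻¹) 1 :=
    (((contMDiffAt_const.mul contMDiffAt_id).mul contMDiffAt_const :
      ContMDiffAt 𝓘(ℝ, E) 𝓘(ℝ, E) ∞ (fun x : G => g * x * g⁻¹) 1)).mdifferentiableAt (by simp)
  unfold Ad
  rw [hd.mfderiv]
  simp only [writtenInExtChartAt, ModelWithCorners.range_eq_univ, fderivWithin_univ, AdL]
  have h1 : g * 1 * g⁻¹ = 1 := by simp
  have : (extChartAt 𝓘(ℝ, E) (g * 1 * g⁻¹) ∘ (fun x : G => g * x * g⁻¹) ∘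
      (extChartAt 𝓘(ℝ, E) (1 : G)).symm) = fun z => φ (g * κ z * g⁻¹) := by
    rw [h1]; rfl
  rw [this]
  rfl

theorem conj_eventually (g : G) : ∀ᶠ z in nhds e₀, g * κ z * g⁻¹ ∈ (phi E G).source := by
  have := isTopologicalGroup E G
  have hc : ContinuousAt (fun z => g * κ z * g⁻¹) e₀ :=
    (continuousAt_const.mul (continuousAt_kap e0_mem)).mul continuousAt_const
  exact eventually_mem_source (E := E) (f := fun z => g * κ z * g⁻¹) hc
    (by simpa using one_mem_phi (E := E) (G := G))

theorem AdL_mul (g h : G) : AdL E (g * h) = (AdL E g).comp (AdL E h) := by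
  have h1 := hasFDerivAt_AdL (E := E) h
  have h2 : HasFDerivAt (fun z => φ (g * κ z * g⁻¹)) (AdL E g) (φ (h * κ e₀ * h⁻¹)) := by
    simpa using hasFDerivAt_AdL (E := E) g
  have h3 := h2.comp e₀ h1
  refine (hasFDerivAt_AdL (g * h)).unique (h3.congr_of_eventuallyEq ?_)
  filter_upwards [conj_eventually h] with z hz
  simp only [Function.comp, (phi E G).left_inv hz]
  congr 1
  group

theorem AdL_one : AdL E (1 : G) = ContinuousLinearMap.id ℝ E := by
  refine (hasFDerivAt_AdL (1 : G)).unique ((hasFDerivAt_id (𝕜 := ℝ) e₀).congr_of_eventuallyEq ?_)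
  filter_upwards [eventually_phi_kap e0_mem] with z hz
  simp [hz]

theorem AdL_inv_apply (g : G) (v : E) : AdL E g⁻¹ (AdL E g v) = v := by
  rw [← ContinuousLinearMap.comp_apply, ← AdL_mul]; simp [AdL_one]

theorem AdL_apply_inv (g : G) (v : E) : AdL E g (AdL E g⁻¹ v) = v := by
  rw [← ContinuousLinearMap.comp_apply, ← AdL_mul]; simp [AdL_one]

/-- Left translation is conjugation followed by right translation. -/
theorem ltr_eq {y : E} (hy : y ∈ (phi E G).target) :
    ltr E G y = (rtr E G y).comp (AdL E (κ y)) := by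
  have h1 := hasFDerivAt_AdL (E := E) (κ y)
  have h2 : HasFDerivAt (fun x => φ (κ x * κ y)) (rtr E G y) (φ (κ y * κ e₀ * (κ y)⁻¹)) := by
    simpa using hasFDerivAt_rtr hy
  have h3 := h2.comp e₀ h1
  refine (hasFDerivAt_ltr hy).unique (h3.congr_of_eventuallyEq ?_)
  filter_upwards [conj_eventually (κ y)] with z hz
  simp [(phi E G).left_inv hz]

theorem AdL_kap {y : E} (hy : y ∈ (phi E G).target) :
    AdL E (κ y) = (rinv E G y).comp (ltr E G y) := by
  rw [ltr_eq hy]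
  ext v
  simp [rinv_rtr hy]

theorem contDiffAt_AdL_kap {y : E} (hy : y ∈ (phi E G).target) :
    ContDiffAt ℝ ∞ (fun y => AdL E (κ y)) y := by
  refine ((contDiffAt_rinv hy).clm_comp (contDiffAt_ltr hy)).congr_of_eventuallyEq ?_
  filter_upwards [(phi E G).open_target.mem_nhds hy] with z hz using AdL_kap hz

/-- Near `1` the adjoint action is smooth in the chart; it is continuous elsewhere since it is a
homomorphism. -/
theorem continuous_AdL : Continuous (fun g : G => AdL E g) := by
  have := isTopologicalGroup E G
  have h1 : ContinuousAt (fun g : G => AdL E g) 1 := by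
    have h2 : ContinuousAt (fun g : G => AdL E (κ (φ g))) 1 :=
      ContinuousAt.comp (g := fun y => AdL E (κ y)) (f := φ)
        (contDiffAt_AdL_kap e0_mem).continuousAt ((phi E G).continuousAt one_mem_phi)
    refine h2.congr ?_
    filter_upwards [(phi E G).open_source.mem_nhds one_mem_phi] with g hg
    rw [(phi E G).left_inv hg]
  rw [continuous_iff_continuousAt]
  intro g
  have h3 : ContinuousAt (fun x : G => (AdL E (x * g⁻¹)).comp (AdL E g)) g := by
    have h4 : ContinuousAt (fun x : G => AdL E (x * g⁻¹)) g := by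
      refine ContinuousAt.comp (g := fun g : G => AdL E g) ?_
        (continuousAt_id.mul continuousAt_const)
      simpa using h1
    exact h4.clm_comp continuousAt_const
  refine h3.congr (Filter.Eventually.of_forall fun x => ?_)
  simp [← AdL_mul]

/-- The mixed second derivatives of the multiplication at the identity are symmetric. -/
theorem fderiv_rtr_eq (v x : E) : fderiv ℝ (rtr E G) e₀ v x = fderiv ℝ (ltr E G) e₀ x v := by
  have hL : ContDiffAt ℝ ∞ (lmul E G) (e₀, e₀) := contDiffAt_lmul e0_mem e0_mem
    (by simpa using one_mem_phi (E := E) (G := G))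
  have hsymm : IsSymmSndFDerivAt ℝ (lmul E G) (e₀, e₀) := hL.isSymmSndFDerivAt (by
    rw [minSmoothness_of_isRCLikeNormedField]; exact WithTop.coe_le_coe.2 le_top)
  have hD : DifferentiableAt ℝ (fderiv ℝ (lmul E G)) (e₀, e₀) :=
    (hL.fderiv_right (m := 1) (by norm_cast)).differentiableAt (by simp)
  have hev : ∀ᶠ p in nhds (e₀, e₀), DifferentiableAt ℝ (lmul E G) p := by
    have : ContDiffAt ℝ 1 (lmul E G) (e₀, e₀) := hL.of_le (by simp)
    filter_upwards [this.eventually (by simp)] with p hp using hp.differentiableAt (by simp)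
  -- `rtr` and `ltr` are the two partial derivatives of the multiplication, so both sides are mixed
  -- second derivatives
  have h1 : HasFDerivAt (rtr E G) ((ContinuousLinearMap.compL ℝ E (E × E) E).flip
      (ContinuousLinearMap.inl ℝ E E) ∘L (fderiv ℝ (fderiv ℝ (lmul E G)) (e₀, e₀)) ∘L
      ContinuousLinearMap.inr ℝ E E) e₀ := by
    have h2 : HasFDerivAt (fun y : E => (e₀, y)) (ContinuousLinearMap.inr ℝ E E) e₀ := by
      simpa using! (hasFDerivAt_const e₀ e₀).prodMk (hasFDerivAt_id (𝕜 := ℝ) e₀)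
    have h3 := hD.hasFDerivAt.comp e₀ (f := fun y : E => (e₀, y)) h2
    have h4 := ((ContinuousLinearMap.compL ℝ E (E × E) E).flip
      (ContinuousLinearMap.inl ℝ E E)).hasFDerivAt.comp e₀ h3
    refine h4.congr_of_eventuallyEq ?_
    filter_upwards [h2.continuousAt.eventually hev] with y hy
    have h5 : HasFDerivAt (fun x : E => (x, y)) (ContinuousLinearMap.inl ℝ E E) e₀ := by
      simpa using! (hasFDerivAt_id (𝕜 := ℝ) e₀).prodMk (hasFDerivAt_const y e₀)
    exact (hy.hasFDerivAt.comp e₀ (f := fun x : E => (x, y)) h5).fderiv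
  have h1' : HasFDerivAt (ltr E G) ((ContinuousLinearMap.compL ℝ E (E × E) E).flip
      (ContinuousLinearMap.inr ℝ E E) ∘L (fderiv ℝ (fderiv ℝ (lmul E G)) (e₀, e₀)) ∘L
      ContinuousLinearMap.inl ℝ E E) e₀ := by
    have h2 : HasFDerivAt (fun y : E => (y, e₀)) (ContinuousLinearMap.inl ℝ E E) e₀ := by
      simpa using! (hasFDerivAt_id (𝕜 := ℝ) e₀).prodMk (hasFDerivAt_const e₀ e₀)
    have h3 := hD.hasFDerivAt.comp e₀ (f := fun y : E => (y, e₀)) h2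
    have h4 := ((ContinuousLinearMap.compL ℝ E (E × E) E).flip
      (ContinuousLinearMap.inr ℝ E E)).hasFDerivAt.comp e₀ h3
    refine h4.congr_of_eventuallyEq ?_
    filter_upwards [h2.continuousAt.eventually hev] with y hy
    have h5 : HasFDerivAt (fun x : E => (y, x)) (ContinuousLinearMap.inr ℝ E E) e₀ := by
      simpa using! (hasFDerivAt_const y e₀).prodMk (hasFDerivAt_id (𝕜 := ℝ) e₀)
    exact (hy.hasFDerivAt.comp e₀ (f := fun x : E => (y, x)) h5).fderiv
  rw [h1.fderiv, h1'.fderiv]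
  simp [hsymm.eq (0, v) (x, 0)]

/-- The Lie bracket of `𝔤` in the chart at the identity. -/
theorem lieBracket_eq (x y : E) :
    lieBracket E G x y = fderiv ℝ (ltr E G) e₀ x y - fderiv ℝ (ltr E G) e₀ y x := by
  -- in the chart, the left invariant vector fields are `p ↦ ltr p x`
  have key : ∀ x : E, ∀ᶠ p in nhds (extChartAt 𝓘(ℝ, E) (1 : G) 1),
      mfderiv 𝓘(ℝ, E) 𝓘(ℝ, E) (extChartAt 𝓘(ℝ, E) (1 : G)) ((extChartAt 𝓘(ℝ, E) (1 : G)).symm p)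
        (mulInvariantVectorField (I := 𝓘(ℝ, E)) (G := G) x ((extChartAt 𝓘(ℝ, E) (1 : G)).symm p)) =
        ltr E G p x := by
    intro x
    filter_upwards [(phi E G).open_target.mem_nhds e0_mem] with p hp
    have hs : κ p * 1 ∈ (phi E G).source := by simpa using (phi E G).map_target hp
    have hL : MDifferentiableAt 𝓘(ℝ, E) 𝓘(ℝ, E) (fun b : G => κ p * b) 1 :=
      (contMDiff_mul_left (I := 𝓘(ℝ, E)) (n := ∞)).contMDiffAt.mdifferentiableAt (by simp)
    have hφ : MDifferentiableAt 𝓘(ℝ, E) 𝓘(ℝ, E) φ (κ p * 1) :=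
      (contMDiffAt_phi hs).mdifferentiableAt (by simp)
    have h1 := mfderiv_comp (1 : G) hφ hL
    have h2 := mfderiv_one_eq (hφ.comp (1 : G) hL) x
    rw [h1] at h2
    have h3 : fderiv ℝ (fun z => (φ ∘ fun b : G => κ p * b) (κ z)) e₀ x = ltr E G p x := rfl
    rw [h3] at h2
    rw [← h2]
    have h4 : κ p * 1 = κ p := mul_one _
    simp only [mulInvariantVectorField]
    change mfderiv 𝓘(ℝ, E) 𝓘(ℝ, E) φ (κ p) _ = mfderiv 𝓘(ℝ, E) 𝓘(ℝ, E) φ (κ p * 1) _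
    congr 1
    rw [h4]
  have h := mlieBracket_eq_of_chart (key x) (key y)
  have e : extChartAt 𝓘(ℝ, E) (1 : G) 1 = e₀ := rfl
  rw [e] at h
  have hd : DifferentiableAt ℝ (ltr E G) e₀ := (contDiffAt_ltr e0_mem).differentiableAt (by simp)
  have hf : ∀ z : E, fderiv ℝ (fun p => ltr E G p z) e₀ =
      (fderiv ℝ (ltr E G) e₀).flip z := fun z => by
    have := (hd.hasFDerivAt.clm_apply (hasFDerivAt_const z e₀)).fderiv
    rw [this]; simp
  rw [hf, hf, ltr_e0] at h
  exact h

/-- The derivative of the adjoint action at the identity is the adjoint representation. -/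
theorem hasFDerivAt_AdL_kap :
    HasFDerivAt (fun y => AdL E (κ y)) (lieBracket E G) e₀ := by
  have h := ((contDiffAt_AdL_kap (E := E) (G := G) e0_mem).differentiableAt (by simp)).hasFDerivAt
  have hr := ((contDiffAt_rtr (E := E) (G := G) e0_mem).differentiableAt (by simp)).hasFDerivAt
  -- differentiate `ltr = rtr ∘ Ad` at the identity
  have h1 := hr.clm_comp h
  have h2 : HasFDerivAt (ltr E G) _ e₀ := h1.congr_of_eventuallyEq (by
    filter_upwards [(phi E G).open_target.mem_nhds e0_mem] with y hy using ltr_eq hy)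
  convert! h using 1
  ext v x
  have h3 := DFunLike.congr_fun (DFunLike.congr_fun h2.fderiv v) x
  simp [AdL_one, rtr_e0, fderiv_rtr_eq] at h3
  rw [lieBracket_eq, h3]
  abel

end LieGroupChart

section LogDeriv

variable {E : Type*} [NormedAddCommGroup E] [NormedSpace ℝ E] [FiniteDimensional ℝ E]
  {G : Type*} [TopologicalSpace G] [ChartedSpace E G] [Group G] [LieGroup 𝓘(ℝ, E) ∞ G]

local notation "φ" => phi E G
local notation "κ" => (OpenPartialHomeomorph.symm (phi E G))
local notation "e₀" => phi E G 1
local notation "U₁" => Icc (0 : ℝ) 1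

/-! ### Logarithmic derivatives of curves in the Lie group -/

/-- The curve `u : [0,1] → G` has the right logarithmic derivative `u̇(t) u(t)⁻¹ = ξ`, read in the
chart of `G` at the identity. -/
def HasLog (u : ℝ → G) (t : ℝ) (ξ : E) : Prop :=
  ContinuousWithinAt u U₁ t ∧ HasDerivWithinAt (fun s => φ (u s * (u t)⁻¹)) ξ U₁ t

theorem HasLog.tendsto {u : ℝ → G} {t : ℝ} {ξ : E} (h : HasLog u t ξ) :
    Filter.Tendsto (fun s => u s * (u t)⁻¹) (nhdsWithin t U₁) (nhds 1) := by
  have := isTopologicalGroup E G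
  simpa using h.1.tendsto.mul_const (u t)⁻¹

theorem HasLog.mem_source {u : ℝ → G} {t : ℝ} {ξ : E} (h : HasLog u t ξ) :
    ∀ᶠ s in nhdsWithin t U₁, u s * (u t)⁻¹ ∈ (phi E G).source :=
  h.tendsto ((phi E G).open_source.mem_nhds one_mem_phi)

theorem hasLog_const (g : G) (t : ℝ) : HasLog (fun _ => g) t (0 : E) :=
  ⟨continuousWithinAt_const, hasDerivWithinAt_const _ _ _⟩

/-- The product rule `(uv)'(uv)⁻¹ = u'u⁻¹ + Ad(u)(v'v⁻¹)`. -/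
theorem HasLog.mul {u v : ℝ → G} {t : ℝ} {ξ η : E} (ht : t ∈ U₁) (hu : HasLog u t ξ)
    (hv : HasLog v t η) : HasLog (fun s => u s * v s) t (ξ + AdL E (u t) η) := by
  have := isTopologicalGroup E G
  refine ⟨hu.1.mul hv.1, ?_⟩
  have h1 : HasFDerivAt (fun z => φ (u t * κ z * (u t)⁻¹)) (AdL E (u t))
      (φ (v t * (v t)⁻¹)) := by
    simpa using hasFDerivAt_AdL (E := E) (u t)
  have h2 := h1.comp_hasDerivWithinAt (s := U₁) t hv.2
  have h3 := hu.2.prodMk h2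
  have h4 : HasFDerivAt (lmul E G) (ContinuousLinearMap.fst ℝ E E + ContinuousLinearMap.snd ℝ E E)
      (φ (u t * (u t)⁻¹), ((fun z => φ (u t * κ z * (u t)⁻¹)) ∘ fun s => φ (v s * (v t)⁻¹)) t) := by
    simpa using hasFDerivAt_lmul (E := E) (G := G)
  -- `u(s)v(s)(u(t)v(t))⁻¹` is the product of `u(s)u(t)⁻¹` and the conjugate of `v(s)v(t)⁻¹`, and
  -- the multiplication has the derivative `+` at the identity
  have h5 := h4.comp_hasDerivWithinAt (s := U₁) t h3
  have hw : ∀ᶠ s in nhdsWithin t U₁, u t * (v s * (v t)⁻¹) * (u t)⁻¹ ∈ (phi E G).source := by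
    have h6 : Filter.Tendsto (fun s => u t * (v s * (v t)⁻¹) * (u t)⁻¹) (nhdsWithin t U₁)
        (nhds 1) := by
      simpa using (hv.tendsto.const_mul (u t)).mul_const (u t)⁻¹
    exact h6 ((phi E G).open_source.mem_nhds one_mem_phi)
  refine HasDerivWithinAt.congr_of_eventuallyEq_of_mem (by simpa using h5) ?_ ht
  filter_upwards [hu.mem_source, hv.mem_source, hw] with s h7 h8 h9
  simp only [Function.comp, lmul, (phi E G).left_inv h7, (phi E G).left_inv h8,
    (phi E G).left_inv h9]
  congr 1
  group

/-- The rule `(u⁻¹)'u = -Ad(u⁻¹)(u'u⁻¹)`. -/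
theorem HasLog.inv {u : ℝ → G} {t : ℝ} {ξ : E} (ht : t ∈ U₁) (hu : HasLog u t ξ) :
    HasLog (fun s => (u s)⁻¹) t (-AdL E (u t)⁻¹ ξ) := by
  have := isTopologicalGroup E G
  refine ⟨hu.1.inv, ?_⟩
  have h1 : HasFDerivAt (fun x => φ (κ x)⁻¹) (-ContinuousLinearMap.id ℝ E)
      (φ (u t * (u t)⁻¹)) := by
    simpa using hasFDerivAt_linv (E := E) (G := G)
  have h2 := h1.comp_hasDerivWithinAt (s := U₁) t hu.2
  have h3 : HasFDerivAt (fun z => φ ((u t)⁻¹ * κ z * ((u t)⁻¹)⁻¹)) (AdL E (u t)⁻¹)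
      (((fun x => φ (κ x)⁻¹) ∘ fun s => φ (u s * (u t)⁻¹)) t) := by
    simpa using hasFDerivAt_AdL (E := E) (u t)⁻¹
  have h5 := h3.comp_hasDerivWithinAt (s := U₁) t h2
  have hw : ∀ᶠ s in nhdsWithin t U₁, (u s * (u t)⁻¹)⁻¹ ∈ (phi E G).source := by
    have h6 : Filter.Tendsto (fun s => (u s * (u t)⁻¹)⁻¹) (nhdsWithin t U₁) (nhds 1) := by
      simpa only [inv_one] using hu.tendsto.inv
    exact h6 ((phi E G).open_source.mem_nhds one_mem_phi)
  refine HasDerivWithinAt.congr_of_eventuallyEq_of_mem (by simpa using h5) ?_ ht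
  filter_upwards [hu.mem_source, hw] with s h7 h9
  simp only [Function.comp, (phi E G).left_inv h7, (phi E G).left_inv h9]
  congr 1
  group

/-- Logarithmic derivatives in a translated chart. -/
theorem HasLog.chart {u : ℝ → G} {t : ℝ} {ξ : E} (ht : t ∈ U₁) (hu : HasLog u t ξ) {g : G}
    (hg : u t * g⁻¹ ∈ (phi E G).source) :
    HasDerivWithinAt (fun s => φ (u s * g⁻¹)) (rtr E G (φ (u t * g⁻¹)) ξ) U₁ t := by
  have h1 : HasFDerivAt (fun x => φ (κ x * κ (φ (u t * g⁻¹)))) (rtr E G (φ (u t * g⁻¹)))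
      (φ (u t * (u t)⁻¹)) := by
    simpa using hasFDerivAt_rtr ((phi E G).map_source hg)
  have h2 := h1.comp_hasDerivWithinAt (s := U₁) t hu.2
  refine h2.congr_of_eventuallyEq_of_mem ?_ ht
  filter_upwards [hu.mem_source] with s hs
  simp only [Function.comp, (phi E G).left_inv hs, (phi E G).left_inv hg]
  congr 1
  group

/-- The converse of `HasLog.chart`: the logarithmic derivative can be computed in any translated
chart. -/
theorem HasLog.of_chart {u : ℝ → G} {t : ℝ} {ξ : E} (ht : t ∈ U₁)
    (hc : ContinuousWithinAt u U₁ t) {g : G} (hg : u t * g⁻¹ ∈ (phi E G).source)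
    (hd : HasDerivWithinAt (fun s => φ (u s * g⁻¹)) (rtr E G (φ (u t * g⁻¹)) ξ) U₁ t) :
    HasLog u t ξ := by
  have := isTopologicalGroup E G
  refine ⟨hc, ?_⟩
  have h1 := (hasFDerivAt_rinv ((phi E G).map_source hg)).comp_hasDerivWithinAt (s := U₁) t hd
  rw [rinv_rtr ((phi E G).map_source hg)] at h1
  refine h1.congr_of_eventuallyEq_of_mem ?_ ht
  have h2 : Filter.Tendsto (fun s => u s * g⁻¹) (nhdsWithin t U₁) (nhds (u t * g⁻¹)) :=
    hc.tendsto.mul_const g⁻¹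
  filter_upwards [h2 ((phi E G).open_source.mem_nhds hg)] with s hs
  simp only [Function.comp, (phi E G).left_inv (show u s * g⁻¹ ∈ (phi E G).source from hs),
    (phi E G).left_inv hg]
  congr 1
  group

/-- The adjoint action along a curve solves `Ad(u)' = ad(u'u⁻¹) Ad(u)`. -/
theorem HasLog.hasDerivWithinAt_AdL {u : ℝ → G} {t : ℝ} {ξ : E} (ht : t ∈ U₁)
    (hu : HasLog u t ξ) :
    HasDerivWithinAt (fun s => AdL E (u s)) ((lieBracket E G ξ).comp (AdL E (u t))) U₁ t := by
  have h1 : HasFDerivAt (fun y => AdL E (κ y)) (lieBracket E G) (φ (u t * (u t)⁻¹)) := by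
    simpa using hasFDerivAt_AdL_kap (E := E) (G := G)
  have h2 := h1.comp_hasDerivWithinAt (s := U₁) t hu.2
  have h3 := h2.clm_comp (hasDerivWithinAt_const t U₁ (AdL E (u t)))
  refine HasDerivWithinAt.congr_of_eventuallyEq_of_mem (by simpa using h3) ?_ ht
  filter_upwards [hu.mem_source] with s hs
  simp only [(phi E G).left_inv hs, ← AdL_mul]
  congr 1
  group

/-- A curve with vanishing logarithmic derivative is constant. -/
theorem const_of_hasLog_zero {u : ℝ → G} (hu : ∀ t ∈ U₁, HasLog u t (0 : E)) :
    ∀ t ∈ U₁, u t = u 0 := by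
  have := isTopologicalGroup E G
  -- the coordinates in a translated chart are locally constant, and `[0,1]` is connected
  have hloc : IsLocallyConstant (fun t : unitInterval => u t) := by
    rw [IsLocallyConstant.iff_eventually_eq]
    intro t
    have h1 := (hu t t.2).mem_source
    obtain ⟨ε, hε, hb⟩ := Metric.mem_nhdsWithin_iff.1 h1
    filter_upwards [Metric.ball_mem_nhds t hε] with s hs
    have hcv : Convex ℝ (Metric.ball (t : ℝ) ε ∩ U₁) := (convex_ball _ _).inter (convex_Icc _ _)
    have hder : ∀ r ∈ Metric.ball (t : ℝ) ε ∩ U₁,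
        HasDerivWithinAt (fun s => φ (u s * (u t)⁻¹)) 0 (Metric.ball (t : ℝ) ε ∩ U₁) r := by
      intro r hr
      have := (hu r hr.2).chart hr.2 (g := u t) (hb hr)
      rw [map_zero] at this
      exact this.mono inter_subset_right
    have hs' : (s : ℝ) ∈ Metric.ball (t : ℝ) ε ∩ U₁ := ⟨hs, s.2⟩
    have ht' : (t : ℝ) ∈ Metric.ball (t : ℝ) ε ∩ U₁ := ⟨Metric.mem_ball_self hε, t.2⟩
    have h2 := hcv.norm_image_sub_le_of_norm_hasDerivWithin_le (C := 0) hder (by simp) ht' hs'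
    have h3 : φ (u s * (u t)⁻¹) = φ (u t * (u t)⁻¹) := by
      simpa [sub_eq_zero] using h2
    have h4 := (phi E G).injOn (hb hs') (hb ht') h3
    exact mul_right_cancel h4
  intro t ht
  exact hloc.apply_eq_of_isPreconnected isPreconnected_univ (x := ⟨t, ht⟩) (y := 0) trivial trivial

/-- A curve is determined by its logarithmic derivative and its initial value. -/
theorem eq_of_hasLog {u v : ℝ → G} {ξ : ℝ → E} (hu : ∀ t ∈ U₁, HasLog u t (ξ t))
    (hv : ∀ t ∈ U₁, HasLog v t (ξ t)) (h0 : u 0 = v 0) : ∀ t ∈ U₁, u t = v t := by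
  intro t ht
  have h := const_of_hasLog_zero (E := E) (u := fun s => (v s)⁻¹ * u s) (fun s hs => by
    simpa using ((hv s hs).inv hs).mul hs (hu s hs)) t ht
  simp only [h0, inv_mul_cancel] at h
  exact (inv_mul_eq_one.1 h).symm

/-! ### Comparison with manifold derivatives -/

/-- In the definition of `rightLogDeriv` the manifold derivative of `s ↦ u(s)u(t)⁻¹` at `t` uses the
chart at `u(t)u(t)⁻¹ = 1`. -/
theorem written_eq (u : ℝ → G) (t : ℝ) :
    writtenInExtChartAt 𝓘(ℝ, ℝ) 𝓘(ℝ, E) t (fun s => u s * (u t)⁻¹) =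
      fun s => φ (u s * (u t)⁻¹) := by
  have h1 : u t * (u t)⁻¹ = 1 := mul_inv_cancel _
  change extChartAt 𝓘(ℝ, E) (u t * (u t)⁻¹) ∘ _ = _
  rw [h1]
  rfl

theorem HasLog.rightLogDeriv_eq {u : ℝ → G} {t : ℝ} {ξ : E} (ht : t ∈ U₁) (hu : HasLog u t ξ) :
    rightLogDeriv E u t = ξ := by
  have := isTopologicalGroup E G
  have hd : MDifferentiableWithinAt 𝓘(ℝ, ℝ) 𝓘(ℝ, E) (fun s => u s * (u t)⁻¹) U₁ t := by
    refine ⟨hu.1.mul continuousWithinAt_const, ?_⟩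
    rw [DifferentiableWithinAtProp]
    simp only [mul_inv_cancel]
    simpa using! hu.2.differentiableWithinAt
  unfold rightLogDeriv
  rw [hd.mfderivWithin, written_eq]
  have h := hu.2.derivWithin (uniqueDiffOn_Icc zero_lt_one t ht)
  rw [← fderivWithin_derivWithin] at h
  simpa using! h

/-- Curves of class `C²` have logarithmic derivatives. -/
theorem hasLog_of_contMDiffOn {u : ℝ → G} (hu : ContMDiffOn 𝓘(ℝ, ℝ) 𝓘(ℝ, E) 2 u U₁) {t : ℝ}
    (ht : t ∈ U₁) : HasLog u t (rightLogDeriv E u t) := by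
  have := isTopologicalGroup E G
  suffices h : ∃ ξ : E, HasLog u t ξ by
    obtain ⟨ξ, hξ⟩ := h
    rwa [hξ.rightLogDeriv_eq ht]
  refine ⟨derivWithin (fun s => φ (u s * (u t)⁻¹)) U₁ t, (hu t ht).continuousWithinAt, ?_⟩
  have h1 : ContMDiffWithinAt 𝓘(ℝ, ℝ) 𝓘(ℝ, E) 2 (fun s => u s * (u t)⁻¹) U₁ t := by
    have : LieGroup 𝓘(ℝ, E) 2 G := LieGroup.of_le (n := ∞) (WithTop.coe_le_coe.2 le_top)
    exact (hu t ht).mul contMDiffWithinAt_const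
  have h2 := ((h1.mdifferentiableWithinAt (by simp))).2
  have h3 : DifferentiableWithinAt ℝ (fun s => φ (u s * (u t)⁻¹)) U₁ t := by
    rw [DifferentiableWithinAtProp] at h2
    simp only [mul_inv_cancel] at h2
    simpa using! h2
  exact h3.hasDerivWithinAt

/-- A curve with a logarithmic derivative of class `C¹` is of class `C²`. -/
theorem contMDiffOn_of_hasLog {u : ℝ → G} {ξ : C1 E}
    (hu : ∀ t : unitInterval, HasLog u t (fn ξ t)) : ContMDiffOn 𝓘(ℝ, ℝ) 𝓘(ℝ, E) 2 u U₁ := by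
  have := isTopologicalGroup E G
  intro t ht
  obtain ⟨ε, hε, hb⟩ := Metric.mem_nhdsWithin_iff.1 (hu ⟨t, ht⟩).mem_source
  set s := U₁ ∩ Metric.ball t ε with hs
  have hts : t ∈ s := ⟨ht, Metric.mem_ball_self hε⟩
  have hU : UniqueDiffOn ℝ s := (uniqueDiffOn_Icc zero_lt_one).inter Metric.isOpen_ball
  set y : ℝ → E := fun r => φ (u r * (u t)⁻¹) with hy
  set x : ℝ → E := fun r => fn ξ (projIcc 0 1 zero_le_one r) with hx
  have hx1 : ContDiffOn ℝ 1 x s := by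
    rw [show (1 : ℕ∞ω) = 0 + 1 by simp, contDiffOn_succ_iff_derivWithin hU]
    have hd : ∀ r ∈ s, HasDerivWithinAt x (der ξ (projIcc 0 1 zero_le_one r)) s r := fun r hr => by
      have := (isDeriv_fn ξ ⟨r, hr.1⟩).mono (inter_subset_left (t := Metric.ball t ε))
      rwa [projIcc_of_mem zero_le_one hr.1]
    refine ⟨fun r hr => (hd r hr).differentiableWithinAt, by simp, contDiffOn_zero.2 ?_⟩
    have hc : Continuous fun r : ℝ => der ξ (projIcc 0 1 zero_le_one r) :=
      (der ξ).continuous.comp continuous_projIcc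
    exact hc.continuousOn.congr fun r hr => (hd r hr).derivWithin (hU r hr)
  have hm : ∀ r ∈ s, u r * (u t)⁻¹ ∈ (phi E G).source := fun r hr => hb ⟨hr.2, hr.1⟩
  have hyd : ∀ r ∈ s, HasDerivWithinAt y (rtr E G (y r) (x r)) s r := fun r hr => by
    have := ((hu ⟨r, hr.1⟩).chart hr.1 (g := u t) (hm r hr)).mono
      (inter_subset_left (t := Metric.ball t ε))
    simpa [hx, projIcc_of_mem zero_le_one hr.1] using this
  -- the coordinates satisfy `y' = rtr(y) x`, so every order of differentiability of `y` up to that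
  -- of `x` gives one more
  have step : ∀ n : ℕ, n ≤ 1 → ContDiffOn ℝ n y s → ContDiffOn ℝ (n + 1) y s := by
    intro n hn hyn
    rw [contDiffOn_succ_iff_derivWithin hU]
    refine ⟨fun r hr => (hyd r hr).differentiableWithinAt, by simp, ?_⟩
    have : ContDiffOn ℝ n (fun r => rtr E G (y r) (x r)) s := by
      refine ContDiffOn.clm_apply (fun r hr => ?_) (hx1.of_le (by exact_mod_cast hn))
      exact ((contDiffAt_rtr ((phi E G).map_source (hm r hr))).of_le
        (WithTop.coe_le_coe.2 le_top)).comp_contDiffWithinAt r (hyn r hr)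
    exact this.congr fun r hr => (hyd r hr).derivWithin (hU r hr)
  have h0 : ContDiffOn ℝ (0 : ℕ) y s :=
    contDiffOn_zero.2 fun r hr => (hyd r hr).continuousWithinAt
  have h1 := step 0 (by norm_num) h0
  have h2 : ContDiffOn ℝ 2 y s := by
    have := step 1 le_rfl (by simpa using h1)
    norm_num at this
    exact this
  have h3 : ContDiffWithinAt ℝ 2 y U₁ t := by
    have := h2 t hts
    exact (contDiffWithinAt_inter (Metric.ball_mem_nhds t hε)).1 this
  have h4 : ContMDiffWithinAt 𝓘(ℝ, ℝ) 𝓘(ℝ, E) 2 (fun r => κ (y r) * u t) U₁ t := by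
    have : LieGroup 𝓘(ℝ, E) 2 G := LieGroup.of_le (n := ∞) (WithTop.coe_le_coe.2 le_top)
    refine ContMDiffWithinAt.mul ?_ contMDiffWithinAt_const
    exact ((contMDiffAt_kap ((phi E G).map_source (hm t hts))).of_le
      (WithTop.coe_le_coe.2 le_top)).comp_contMDiffWithinAt t h3.contMDiffWithinAt
  refine h4.congr_of_eventuallyEq_of_mem ?_ ht
  filter_upwards [(hu ⟨t, ht⟩).mem_source] with r hr
  simp [hy, (phi E G).left_inv hr]

end LogDeriv

section LieAlgebra

variable {E : Type*} [NormedAddCommGroup E] [NormedSpace ℝ E] [FiniteDimensional ℝ E]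
  {G : Type*} [TopologicalSpace G] [ChartedSpace E G] [Group G] [LieGroup 𝓘(ℝ, E) ∞ G]

local notation "φ" => phi E G
local notation "κ" => (OpenPartialHomeomorph.symm (phi E G))
local notation "e₀" => phi E G 1
local notation "U₁" => Icc (0 : ℝ) 1

/-! ### Invariance of the bracket and of the inner product -/

/-- The algebraic properties of the bracket and of the inner product used below. -/
structure IsMetricLie (br : E →L[ℝ] E →L[ℝ] E) (B : LinearMap.BilinForm ℝ E) : Prop where
  skew : ∀ x y, br x y = -br y x
  jacobi : ∀ x y z, br x (br y z) = br (br x y) z + br y (br x z)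
  symm : ∀ x y, B x y = B y x
  pos : ∀ x, x ≠ 0 → 0 < B x x
  inv : ∀ x y z, B (br x y) z = -B y (br x z)

theorem lieBracket_skew (x y : E) : lieBracket E G x y = -lieBracket E G y x := by
  rw [lieBracket_eq, lieBracket_eq]; abel

theorem lieBracket_jacobi (x y z : E) : lieBracket E G x (lieBracket E G y z) =
    lieBracket E G (lieBracket E G x y) z + lieBracket E G y (lieBracket E G x z) := by
  have := lieGroup_minSmoothness E G
  have : CompleteSpace E := FiniteDimensional.complete ℝ E
  have h : ∀ a b c : GroupLieAlgebra 𝓘(ℝ, E) G, ⁅a, ⁅b, c⁆⁆ = ⁅⁅a, b⁆, c⁆ + ⁅b, ⁅a, c⁆⁆ :=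
    fun a b c => leibniz_lie a b c
  exact h x y z

/-- Differentiate `Ad(g κ(z) g⁻¹) = Ad(g) Ad(κ(z)) Ad(g)⁻¹` in `z` at the identity. -/
theorem AdL_bracket (g : G) (x y : E) :
    AdL E g (lieBracket E G x y) = lieBracket E G (AdL E g x) (AdL E g y) := by
  have h1 := (hasFDerivAt_AdL_kap (E := E) (G := G))
  have h2 : HasFDerivAt (fun y => AdL E (κ y)) (lieBracket E G) (φ (g * κ e₀ * g⁻¹)) := by
    simpa using h1
  have h3 := h2.comp e₀ (hasFDerivAt_AdL (E := E) g)
  have h4 := ((hasFDerivAt_const (AdL E g) e₀).clm_comp h1).clm_comp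
    (hasFDerivAt_const (AdL E g⁻¹) e₀)
  have h5 := h3.unique (h4.congr_of_eventuallyEq (by
    filter_upwards [conj_eventually g] with z hz
    simp only [Function.comp, (phi E G).left_inv hz, AdL_mul]))
  have h6 := congrArg (fun L : E →L[ℝ] E →L[ℝ] E => L x (AdL E g y)) h5
  simpa [AdL_inv_apply] using h6.symm

/-- The invariance under the bracket is the derivative of the `Ad`-invariance at the identity. -/
theorem isMetricLie_lieBracket {B : LinearMap.BilinForm ℝ E} (hs : ∀ x y, B x y = B y x)
    (hp : ∀ x, x ≠ 0 → 0 < B x x) (hA : ∀ (u : G) (x y : E), B (Ad E u x) (Ad E u y) = B x y) :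
    IsMetricLie (lieBracket E G) B where
  skew := lieBracket_skew
  jacobi := lieBracket_jacobi
  symm := hs
  pos := hp
  inv x y z := by
    let BL : E →L[ℝ] E →L[ℝ] ℝ := LinearMap.toContinuousBilinearMap (𝕜 := ℝ) B
    have h1 := (hasFDerivAt_AdL_kap (E := E) (G := G))
    have h2 := h1.clm_apply (hasFDerivAt_const y e₀)
    have h3 := h1.clm_apply (hasFDerivAt_const z e₀)
    have h4 := BL.hasFDerivAt_of_bilinear h2 h3
    have h5 : (fun w => BL (AdL E (κ w) y) (AdL E (κ w) z)) = fun _ => B y z := by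
      funext w
      have := hA (κ w) y z
      rw [Ad_eq_AdL, Ad_eq_AdL] at this
      exact this
    rw [h5] at h4
    have h6 := congrArg (fun L : E →L[ℝ] ℝ => L x) (h4.unique (hasFDerivAt_const (B y z) e₀))
    simp [AdL_one, BL] at h6
    linarith

variable (E G) in
theorem exists_bound_AdL [CompactSpace G] : ∃ C : ℝ, 1 ≤ C ∧ ∀ g : G, ‖AdL E g‖ ≤ C := by
  obtain ⟨C, hC⟩ := isCompact_univ.exists_bound_of_continuousOn
    (continuous_AdL (E := E) (G := G)).continuousOn
  exact ⟨max C 1, le_max_right _ _, fun g => (hC g trivial).trans (le_max_left _ _)⟩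

/-! ### Integration of curves in the Lie algebra -/

variable (E G) in
/-- A globally smooth map agreeing with `rinv` near the coordinates of the identity. -/
theorem exists_rinv_extension : ∃ (r : ℝ) (ρ : E → E →L[ℝ] E), 0 < r ∧ ContDiff ℝ ∞ ρ ∧
    Metric.ball e₀ r ⊆ (phi E G).target ∧ ∀ y ∈ Metric.ball e₀ r, ρ y = rinv E G y := by
  obtain ⟨R, hR, hb⟩ := Metric.isOpen_iff.1 (phi E G).open_target e₀ e0_mem
  -- multiply with a bump function supported in the domain of the chart
  let f : ContDiffBump e₀ := ⟨R / 4, R / 2, by positivity, by linarith⟩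
  refine ⟨R / 4, fun y => f y • rinv E G y, by positivity, ?_,
    (Metric.ball_subset_ball (by linarith)).trans hb, fun y hy => ?_⟩
  · rw [contDiff_iff_contDiffAt]
    intro y
    by_cases hy : y ∈ (phi E G).target
    · exact f.contDiff.contDiffAt.smul (contDiffAt_rinv hy)
    · have hy2 : y ∈ (Metric.closedBall e₀ (R / 2))ᶜ := fun h =>
        hy (hb (Metric.closedBall_subset_ball (by linarith) h))
      refine (contDiffAt_const (c := (0 : E →L[ℝ] E))).congr_of_eventuallyEq ?_
      filter_upwards [Metric.isClosed_closedBall.isOpen_compl.mem_nhds hy2] with z hz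
      have : f z = 0 := f.zero_of_le_dist (by
        have : R / 2 < dist z e₀ := by simpa using hz
        exact this.le)
      simp [this]
  · have : f y = 1 := f.one_of_mem_closedBall (Metric.ball_subset_closedBall hy)
    simp [this]

theorem contDiff_applyCL : ContDiff ℝ ∞ (fun A : C(unitInterval, E →L[ℝ] E) =>
    (applyCL A : C(unitInterval, E) →L[ℝ] C(unitInterval, E))) := ContinuousLinearMap.contDiff _

variable (E G) in
/-- Curves with small logarithmic derivative `η` have coordinates `e₀ + ∫ Λ(η)` for a smooth
map `Λ`, the local inverse of `ζ ↦ (rinv (e₀ + ∫ ζ)) ζ`. -/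
theorem exists_local_integration : ∃ (ε : ℝ) (Λ : C(unitInterval, E) → C(unitInterval, E)),
    0 < ε ∧ ContDiffAt ℝ ∞ Λ 0 ∧ Λ 0 = 0 ∧
    HasFDerivAt Λ (ContinuousLinearMap.id ℝ _) 0 ∧
    ∀ η, ‖η‖ < ε → (∀ t, e₀ + prim (Λ η) t ∈ (phi E G).target) ∧
      ∀ t : unitInterval, HasLog
        (fun s => κ (e₀ + prim (Λ η) (projIcc 0 1 zero_le_one s))) t (η t) := by
  have hEc : CompleteSpace E := FiniteDimensional.complete ℝ E
  obtain ⟨r, ρ, hr, hρ, hrt, hρr⟩ := exists_rinv_extension E G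
  let Y : C(unitInterval, E) → C(unitInterval, E) := fun ζ => ContinuousMap.const _ e₀ + prim ζ
  have hY : ContDiff ℝ ∞ Y := contDiff_const.add
    (ContinuousLinearMap.contDiff (𝕜 := ℝ) (prim (V := E)))
  let ρc : C(E, E →L[ℝ] E) := ⟨ρ, hρ.continuous⟩
  -- `Γ(ζ)` is the logarithmic derivative of the curve with coordinates `e₀ + ∫ ζ`; it has the
  -- derivative `1` at `0`, so it has a smooth local inverse
  let Γ : C(unitInterval, E) → C(unitInterval, E) := fun ζ => applyCL (ρc.comp (Y ζ)) ζ
  have hAρ : ContDiff ℝ ∞ (fun ζ => (applyCL (ρc.comp (Y ζ)) :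
      C(unitInterval, E) →L[ℝ] C(unitInterval, E))) :=
    contDiff_applyCL.comp ((contDiff_comp_left ρc hρ).comp hY)
  have hΓ : ContDiff ℝ ∞ Γ := hAρ.clm_apply contDiff_id
  have hY0 : Y 0 = ContinuousMap.const _ e₀ := by simp [Y]
  have hρ0 : ρ e₀ = ContinuousLinearMap.id ℝ E := by
    rw [hρr e₀ (Metric.mem_ball_self hr)]
    ext v
    simpa [rtr_e0] using rinv_rtr (E := E) (G := G) e0_mem v
  have hA0 : applyCL (ρc.comp (Y 0)) = ContinuousLinearMap.id ℝ C(unitInterval, E) := by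
    ext ζ t
    simp [hY0, ρc, hρ0]
  have hΓ' : HasFDerivAt Γ (ContinuousLinearMap.id ℝ _) 0 := by
    have h2 := (hAρ.differentiable (by simp) 0).hasFDerivAt.clm_apply (hasFDerivAt_id (𝕜 := ℝ) (0 : C(unitInterval, E)))
    simpa [hA0] using! h2
  let Id := ContinuousLinearEquiv.refl ℝ C(unitInterval, E)
  have hΓ'' : HasFDerivAt Γ (Id : C(unitInterval, E) →L[ℝ] C(unitInterval, E)) 0 := hΓ'
  let e := hΓ.contDiffAt.toOpenPartialHomeomorph Γ hΓ'' (by simp)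
  have he : (e : C(unitInterval, E) → C(unitInterval, E)) = Γ := rfl
  have h0s : (0 : C(unitInterval, E)) ∈ e.source :=
    hΓ.contDiffAt.mem_toOpenPartialHomeomorph_source hΓ'' (by simp)
  have hΓ0 : Γ 0 = 0 := by simp [Γ]
  have h0t : (0 : C(unitInterval, E)) ∈ e.target := by
    have := e.map_source h0s
    rwa [he, hΓ0] at this
  have hs0 : e.symm 0 = 0 := by
    have := e.left_inv h0s
    rwa [he, hΓ0] at this
  have hcs : ContinuousAt e.symm 0 := e.continuousAt_symm h0t
  have hd : HasFDerivAt (e : C(unitInterval, E) → C(unitInterval, E))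
      (Id : C(unitInterval, E) →L[ℝ] C(unitInterval, E)) (e.symm 0) := by
    rw [hs0]; exact hΓ''
  have hnear : ∀ᶠ η in nhds (0 : C(unitInterval, E)), η ∈ e.target ∧ ‖prim (e.symm η)‖ < r := by
    refine Filter.Eventually.and (e.open_target.mem_nhds h0t) ?_
    have : ContinuousAt (fun η => ‖prim (e.symm η)‖) 0 :=
      (prim.continuous.continuousAt.comp hcs).norm
    have h2 : ‖prim (e.symm 0)‖ < r := by rw [hs0]; simpa using hr
    exact this.eventually_lt continuousAt_const h2
  obtain ⟨ε, hε, hball⟩ := Metric.eventually_nhds_iff.1 hnear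
  refine ⟨ε, e.symm, hε, ?_, hs0, e.hasFDerivAt_symm h0t hd, fun η hη => ?_⟩
  · exact e.contDiffAt_symm h0t hd (by rw [hs0]; exact hΓ.contDiffAt)
  · obtain ⟨h1, h2⟩ := hball (y := η) (by simpa using hη)
    have hin : ∀ t, e₀ + prim (e.symm η) t ∈ Metric.ball e₀ r := fun t => by
      rw [mem_ball_iff_norm, add_sub_cancel_left]
      exact ((prim (e.symm η)).norm_coe_le_norm t).trans_lt h2
    refine ⟨fun t => hrt (hin t), fun t => ?_⟩
    have hsol : Γ (e.symm η) = η := e.right_inv h1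
    have hyd : HasDerivWithinAt (fun s => e₀ + prim (e.symm η) (projIcc 0 1 zero_le_one s))
        (e.symm η t) U₁ t := (isDeriv_prim (e.symm η) t).const_add e₀
    have hpr : projIcc 0 1 zero_le_one (t : ℝ) = t := projIcc_of_mem zero_le_one t.2
    have hm := hrt (hin t)
    refine HasLog.of_chart (g := 1) t.2 ?_ ?_ ?_
    · have h5 : ContinuousAt κ (e₀ + prim (e.symm η) (projIcc 0 1 zero_le_one (t : ℝ))) := by
        rw [hpr]; exact continuousAt_kap hm
      exact ContinuousAt.comp_continuousWithinAt (g := κ) h5 hyd.continuousWithinAt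
    · simpa [hpr] using (phi E G).map_target hm
    · have hval : e.symm η t = rtr E G (e₀ + prim (e.symm η) t) (η t) := by
        have h6 : η t = rinv E G (e₀ + prim (e.symm η) t) (e.symm η t) := by
          have := DFunLike.congr_fun hsol t
          rw [← this]
          simp [Γ, Y, ρc, hρr _ (hin t)]
        rw [h6, rtr_rinv hm]
      simp only [inv_one, mul_one, hpr, (phi E G).right_inv hm, ← hval]
      refine hyd.congr_of_eventuallyEq_of_mem (Filter.Eventually.of_forall fun s => ?_) t.2
      exact (phi E G).right_inv (hrt (hin _))

/-- The pointwise adjoint action of the inverse of a curve. -/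
def AdInv (v : ℝ → G) (hv : ContinuousOn v U₁) : C(unitInterval, E →L[ℝ] E) :=
  ⟨fun t => AdL E (v t)⁻¹, by
    have := isTopologicalGroup E G
    exact (continuous_AdL (E := E) (G := G)).comp
      ((hv.comp_continuous continuous_subtype_val fun t => t.2).inv)⟩

theorem norm_AdInv_le {C : ℝ} (hC1 : 1 ≤ C) (hC : ∀ g : G, ‖AdL E g‖ ≤ C) (v : ℝ → G)
    (hv : ContinuousOn v U₁) (δ : C(unitInterval, E)) :
    ‖applyCL (AdInv (E := E) v hv) δ‖ ≤ C * ‖δ‖ := by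
  refine (ContinuousMap.norm_le _ (by positivity)).2 fun t => ?_
  refine ((AdL E (v t)⁻¹).le_opNorm _).trans ?_
  gcongr
  · exact hC _
  · exact δ.norm_coe_le_norm t

theorem continuousOn_of_hasLog {v : ℝ → G} {ξ : unitInterval → E}
    (hv : ∀ t : unitInterval, HasLog v t (ξ t)) : ContinuousOn v U₁ := fun t ht => (hv ⟨t, ht⟩).1

/-- If `v` integrates `-a` and `z` integrates `-Ad(v⁻¹) δ`, then `v z` integrates `-(a + δ)`. -/
theorem hasLog_perturb {v z : ℝ → G} {a δ : C(unitInterval, E)}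
    (hv : ∀ t : unitInterval, HasLog v t (-a t))
    (hz : ∀ t : unitInterval, HasLog z t ((-applyCL (AdInv v (continuousOn_of_hasLog hv)) δ) t))
    (t : unitInterval) : HasLog (fun s => v s * z s) t (-(a + δ) t) := by
  have h := (hv t).mul t.2 (hz t)
  have : (-(a + δ) t) = -a t + AdL E (v t)
      ((-applyCL (AdInv v (continuousOn_of_hasLog hv)) δ) t) := by
    simp [AdInv, AdL_apply_inv]
    abel
  rwa [this]

variable (G) in
/-- Every continuous curve in `𝔤` is the logarithmic derivative of a curve in the compact
group `G`. -/
theorem exists_hasLog [CompactSpace G] (a : C(unitInterval, E)) :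
    ∃ v : ℝ → G, v 0 = 1 ∧ ∀ t : unitInterval, HasLog v t (-a t) := by
  obtain ⟨C, hC1, hC⟩ := exists_bound_AdL E G
  obtain ⟨ε, Λ, hε, -, -, -, hΛ⟩ := exists_local_integration E G
  obtain ⟨n, hn⟩ := exists_nat_gt (C * ‖a‖ / ε)
  have hn0 : (0 : ℝ) < n := lt_of_le_of_lt (by positivity) hn
  -- advance from `0` to `a` in `n` steps of length `a/n`; the step size which
  -- `exists_local_integration` allows is the same in each step since `Ad` is bounded on the compact
  -- group
  suffices h : ∀ k : ℕ, ∃ v : ℝ → G, v 0 = 1 ∧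
      ∀ t : unitInterval, HasLog v t (-(((k : ℝ) / n) • a) t) by
    obtain ⟨v, hv⟩ := h n
    refine ⟨v, ?_⟩
    rwa [div_self hn0.ne', one_smul] at hv
  intro k
  induction k with
  | zero => exact ⟨fun _ => 1, rfl, fun t => by simpa using hasLog_const (E := E) (1 : G) t⟩
  | succ k ih =>
    obtain ⟨v, hv0, hv⟩ := ih
    set δ : C(unitInterval, E) := (1 / (n : ℝ)) • a with hδ
    set η := -applyCL (AdInv v (continuousOn_of_hasLog hv)) δ with hη
    have hsmall : ‖η‖ < ε := by
      rw [hη, norm_neg]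
      refine (norm_AdInv_le hC1 hC _ _ _).trans_lt ?_
      rw [hδ, norm_smul, Real.norm_of_nonneg (by positivity)]
      rw [div_lt_iff₀ hε] at hn
      rw [show C * (1 / (n : ℝ) * ‖a‖) = (C * ‖a‖) / n by ring, div_lt_iff₀ hn0]
      linarith
    refine ⟨fun s => v s * κ (e₀ + prim (Λ η) (projIcc 0 1 zero_le_one s)), ?_, fun t => ?_⟩
    · simp [hv0, prim_zero]
    · have := hasLog_perturb hv (hΛ η hsmall).2 t
      have h2 : ((k + 1 : ℕ) / (n : ℝ)) • a = ((k : ℝ) / n) • a + δ := by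
        rw [hδ, ← add_smul]; push_cast; congr 1; ring
      rwa [h2]

/-- The curve `v` in `G` with `v̇ v⁻¹ = -a` and `v(0) = 1`. -/
def transport (G : Type*) [TopologicalSpace G] [ChartedSpace E G] [Group G]
    [LieGroup 𝓘(ℝ, E) ∞ G] [CompactSpace G] (a : C(unitInterval, E)) : ℝ → G :=
  (exists_hasLog G a).choose

/-- The holonomy `v(1)` of the connection with potential `a`. -/
def hol (G : Type*) [TopologicalSpace G] [ChartedSpace E G] [Group G]
    [LieGroup 𝓘(ℝ, E) ∞ G] [CompactSpace G] (a : C(unitInterval, E)) : G := transport G a 1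

variable [CompactSpace G]

variable (G) in
@[simp] theorem transport_zero (a : C(unitInterval, E)) : transport G a 0 = 1 :=
  (exists_hasLog G a).choose_spec.1

variable (G) in
theorem hasLog_transport (a : C(unitInterval, E)) (t : unitInterval) :
    HasLog (transport G a) t (-a t) := (exists_hasLog G a).choose_spec.2 t

theorem transport_eq {a : C(unitInterval, E)} {v : ℝ → G} (h0 : v 0 = 1)
    (hv : ∀ t : unitInterval, HasLog v t (-a t)) (t : unitInterval) : transport G a t = v t :=
  eq_of_hasLog (ξ := fun t => -a (projIcc 0 1 zero_le_one t))
    (fun t ht => by simpa [projIcc_of_mem zero_le_one ht] using hasLog_transport G a ⟨t, ht⟩)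
    (fun t ht => by simpa [projIcc_of_mem zero_le_one ht] using hv ⟨t, ht⟩) (by simp [h0]) t t.2

theorem hol_eq {a : C(unitInterval, E)} {v : ℝ → G} (h0 : v 0 = 1)
    (hv : ∀ t : unitInterval, HasLog v t (-a t)) : hol G a = v 1 := transport_eq h0 hv 1

variable (G) in
/-- `Ad(v⁻¹)` for the transport `v` of `a`. -/
def AdT (a : C(unitInterval, E)) : C(unitInterval, E →L[ℝ] E) :=
  AdInv (transport G a) (continuousOn_of_hasLog (hasLog_transport G a))

variable (G) in
/-- The holonomy is smooth: near `a` it is `δ ↦ hol(a) κ(P(δ))` for a smooth `P`, with derivative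
`-∫ Ad(v⁻¹) δ` at `0`. -/
theorem exists_hol_chart (a : C(unitInterval, E)) : ∃ P : C(unitInterval, E) → E,
    ContDiffAt ℝ ∞ P 0 ∧ P 0 = e₀ ∧
    HasFDerivAt P (-(ContinuousMap.evalCLM ℝ (1 : unitInterval) ∘L prim ∘L applyCL (AdT G a))) 0 ∧
    ∀ᶠ δ in nhds 0, P δ ∈ (phi E G).target ∧ hol G (a + δ) = hol G a * κ (P δ) := by
  obtain ⟨ε, Λ, hε, hΛs, hΛ0, hΛd, hΛ⟩ := exists_local_integration E G
  let N : C(unitInterval, E) →L[ℝ] C(unitInterval, E) := -applyCL (AdT G a)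
  let Q : C(unitInterval, E) →L[ℝ] E := ContinuousMap.evalCLM ℝ (1 : unitInterval) ∘L prim
  have hN0 : N 0 = 0 := map_zero N
  have hQΛ : HasFDerivAt Λ (ContinuousLinearMap.id ℝ _) (N 0) := by rwa [hN0]
  refine ⟨fun δ => e₀ + Q (Λ (N δ)), ?_, ?_, ?_, ?_⟩
  · refine contDiffAt_const.add (Q.contDiff.contDiffAt.comp 0 ?_)
    exact ContDiffAt.comp (g := Λ) 0 (by rwa [hN0]) N.contDiff.contDiffAt
  · simp [hΛ0]
  · have h := (Q.hasFDerivAt.comp (0 : C(unitInterval, E))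
      (hQΛ.comp (0 : C(unitInterval, E)) N.hasFDerivAt)).const_add e₀
    convert! h using 1
    ext δ
    simp [Q, N]
  · have hsm : ∀ᶠ δ in nhds (0 : C(unitInterval, E)), ‖N δ‖ < ε := by
      have : ContinuousAt (fun δ => ‖N δ‖) 0 := N.continuous.norm.continuousAt
      exact this.eventually_lt continuousAt_const (by simpa using hε)
    filter_upwards [hsm] with δ hδ
    obtain ⟨h1, h2⟩ := hΛ _ hδ
    refine ⟨h1 1, ?_⟩
    have h3 := hasLog_perturb (hasLog_transport G a) h2
    have hp1 : projIcc 0 1 zero_le_one (1 : ℝ) = (1 : unitInterval) := projIcc_right _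
    have h4 := hol_eq (a := a + δ) (by simp [prim_zero]) h3
    rw [h4, hp1]
    rfl

end LieAlgebra

/-! ### Quadruples as functions with values in `𝔤 ⊗ ℝ⁴` -/

section Quadruples

universe w
variable {E : Type w} [NormedAddCommGroup E] [NormedSpace ℝ E]

/-- Pointwise application of a bounded bilinear map. -/
def bilC {V W X : Type*} [NormedAddCommGroup V] [NormedSpace ℝ V] [NormedAddCommGroup W]
    [NormedSpace ℝ W] [NormedAddCommGroup X] [NormedSpace ℝ X] (b : V →L[ℝ] W →L[ℝ] X) :
    C(unitInterval, V) →L[ℝ] C(unitInterval, W) →L[ℝ] C(unitInterval, X) :=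
  LinearMap.mkContinuous₂
    (LinearMap.mk₂ ℝ (fun (f : C(unitInterval, V)) (g : C(unitInterval, W)) =>
        (⟨fun t => b (f t) (g t), by fun_prop⟩ : C(unitInterval, X)))
      (fun A B f => by ext t; simp) (fun c A f => by ext t; simp)
      (fun A f g => by ext t; simp) (fun c A f => by ext t; simp))
    ‖b‖ (fun f g => by
      refine (ContinuousMap.norm_le _ (by positivity)).2 fun t => ?_
      refine (b.le_opNorm₂ (f t) (g t)).trans ?_
      gcongr
      · exact f.norm_coe_le_norm t
      · exact g.norm_coe_le_norm t)

@[simp] theorem bilC_apply {V W X : Type*} [NormedAddCommGroup V] [NormedSpace ℝ V]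
    [NormedAddCommGroup W] [NormedSpace ℝ W] [NormedAddCommGroup X] [NormedSpace ℝ X]
    (b : V →L[ℝ] W →L[ℝ] X) (f : C(unitInterval, V)) (g : C(unitInterval, W))
    (t : unitInterval) : bilC b f g t = b (f t) (g t) := rfl

@[simp] theorem brC_apply (br : E →L[ℝ] E →L[ℝ] E) (f h : C(unitInterval, E)) (t : unitInterval) :
    brC br f h t = br (f t) (h t) := rfl

/-- A quadruple of functions as a function with values in quadruples. -/
def tup : (Fin 4 → C(unitInterval, E)) →L[ℝ] C(unitInterval, Fin 4 → E) :=
  LinearMap.mkContinuous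
    { toFun := fun X => ⟨fun t i => X i t, by fun_prop⟩
      map_add' := fun X Y => by ext t i; simp
      map_smul' := fun c X => by ext t i; simp } 1 (fun X => by
      refine (ContinuousMap.norm_le _ (by positivity)).2 fun t => ?_
      rw [one_mul]
      exact (pi_norm_le_iff_of_nonneg (norm_nonneg X)).2 fun i =>
        ((X i).norm_coe_le_norm t).trans (norm_le_pi_norm X i))

/-- The values of a quadruple. -/
def ev : Quad E →L[ℝ] C(unitInterval, Fin 4 → E) :=
  tup ∘L ContinuousLinearMap.pi fun i => fnL ∘L ContinuousLinearMap.proj i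

/-- The derivatives of a quadruple. -/
def dv : Quad E →L[ℝ] C(unitInterval, Fin 4 → E) :=
  tup ∘L ContinuousLinearMap.pi fun i => derL ∘L ContinuousLinearMap.proj i

@[simp] theorem ev_apply (X : Quad E) (t : unitInterval) (i : Fin 4) : ev X t i = fn (X i) t := rfl
@[simp] theorem dv_apply (X : Quad E) (t : unitInterval) (i : Fin 4) : dv X t i = der (X i) t := rfl

theorem isDeriv_ev (X : Quad E) : IsDeriv (ev X) (dv X) := fun t =>
  hasDerivWithinAt_pi.2 fun i => isDeriv_fn (X i) t

variable [FiniteDimensional ℝ E]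

theorem Quad.ext_ev {X Y : Quad E} (h : ev X = ev Y) : X = Y := by
  have : CompleteSpace E := FiniteDimensional.complete ℝ E
  funext i
  refine C1.ext_fn ?_
  ext t
  exact congrFun (DFunLike.congr_fun h t) i

variable (E) in
/-- Coordinates on the space of `C¹` quadruples: the pairs `(X(0), X')`. -/
abbrev Crd : Type _ := (Fin 4 → E) × C(unitInterval, Fin 4 → E)

/-- The constant functions. -/
def constC (V : Type*) [NormedAddCommGroup V] [NormedSpace ℝ V] : V →L[ℝ] C(unitInterval, V) :=
  LinearMap.mkContinuous
    { toFun := fun v => ContinuousMap.const unitInterval v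
      map_add' := fun _ _ => rfl
      map_smul' := fun _ _ => rfl } 1 (fun v => by
      refine (ContinuousMap.norm_le _ (by positivity)).2 fun t => ?_
      exact (one_mul ‖v‖).ge)

/-- The function with the given initial value and derivative. -/
def val : Crd E →L[ℝ] C(unitInterval, Fin 4 → E) :=
  constC _ ∘L ContinuousLinearMap.fst ℝ _ _ + prim ∘L ContinuousLinearMap.snd ℝ _ _

theorem val_apply (y : Crd E) (t : unitInterval) : val y t = y.1 + prim y.2 t := rfl

@[simp] theorem val_zero (y : Crd E) : val y 0 = y.1 := by simp [val_apply]

theorem isDeriv_val (y : Crd E) : IsDeriv (val y) y.2 := by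
  have : CompleteSpace E := FiniteDimensional.complete ℝ E
  have := (isDeriv_const y.1).add (isDeriv_prim y.2)
  rwa [zero_add] at this

variable (E) in
/-- The coordinates `(X(0), X')` of a quadruple `X`. -/
def crdEquiv : Quad E ≃L[ℝ] Crd E :=
  have : CompleteSpace E := FiniteDimensional.complete ℝ E
  { toFun := fun X => (ev X 0, dv X)
    invFun := fun y i =>
      ⟨((ContinuousLinearMap.proj (R := ℝ) (φ := fun _ : Fin 4 => E) i).compLeftContinuous ℝ _
          (val y),
        (ContinuousLinearMap.proj (R := ℝ) (φ := fun _ : Fin 4 => E) i).compLeftContinuous ℝ _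
          y.2), fun t => hasDerivWithinAt_pi.1 (isDeriv_val y t) i⟩
    map_add' := fun X Y => by simp
    map_smul' := fun c X => by simp
    left_inv := fun X => by
      refine Quad.ext_ev ?_
      ext t i
      have := (isDeriv_ev X).eq_add_prim t
      rw [this]
      rfl
    right_inv := fun y => by
      ext1
      · funext i
        simp [fn]
      · rfl
    continuous_toFun := by
      have h : Continuous fun X : Quad E => ev X := ev.continuous
      exact ((ContinuousEvalConst.continuous_eval_const (0 : unitInterval)).comp h).prodMk
        dv.continuous
    continuous_invFun := by
      refine continuous_pi fun i => ?_
      refine Continuous.subtype_mk ?_ _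
      exact (((ContinuousLinearMap.proj (R := ℝ) (φ := fun _ : Fin 4 => E) i).compLeftContinuous ℝ
          unitInterval).continuous.comp val.continuous).prodMk
        (((ContinuousLinearMap.proj (R := ℝ) (φ := fun _ : Fin 4 => E) i).compLeftContinuous ℝ
          unitInterval).continuous.comp continuous_snd) }

@[simp] theorem val_crd (X : Quad E) : val (crdEquiv E X) = ev X := by
  ext t : 1
  exact ((isDeriv_ev X).eq_add_prim t).symm

@[simp] theorem ev_crd_symm (y : Crd E) : ev ((crdEquiv E).symm y) = val y := by
  rw [← val_crd, ContinuousLinearEquiv.apply_symm_apply]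

@[simp] theorem dv_crd_symm (y : Crd E) : dv ((crdEquiv E).symm y) = y.2 := rfl

theorem val_injective : Function.Injective (val : Crd E → C(unitInterval, Fin 4 → E)) := by
  intro y z h
  have : (crdEquiv E).symm y = (crdEquiv E).symm z := Quad.ext_ev (by simp [h])
  exact (crdEquiv E).symm.injective this

/-! ### Linear initial value problems -/

/-- The linear differential operator `X ↦ (X(0), X' + A X)`. -/
def ivp (A : C(unitInterval, (Fin 4 → E) →L[ℝ] (Fin 4 → E))) : Crd E →L[ℝ] Crd E :=
  ContinuousLinearMap.id ℝ (Crd E) + (ContinuousLinearMap.inr ℝ _ _) ∘L applyCL A ∘L val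

theorem ivp_apply (A : C(unitInterval, (Fin 4 → E) →L[ℝ] (Fin 4 → E))) (X : Crd E) :
    ivp A X = (X.1, X.2 + applyCL A (val X)) := by
  simp [ivp, Prod.ext_iff]

/-- Existence and uniqueness for linear initial value problems. -/
theorem ivp_bijective (A : C(unitInterval, (Fin 4 → E) →L[ℝ] (Fin 4 → E))) :
    Function.Bijective (ivp A) := by
  have : CompleteSpace E := FiniteDimensional.complete ℝ E
  have key : ∀ y : Crd E, ∃ X : C1 (Fin 4 → E), fn X = val y ∧ der X = y.2 := fun y =>
    ⟨⟨(val y, y.2), isDeriv_val y⟩, rfl, rfl⟩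
  constructor
  · intro X Y h
    obtain ⟨X', hX, hX2⟩ := key X
    obtain ⟨Y', hY, hY2⟩ := key Y
    rw [ivp_apply, ivp_apply, Prod.mk.injEq] at h
    refine val_injective ?_
    rw [← hX, ← hY]
    congr 1
    refine linearODE_unique (-A) (X.2 + applyCL A (val X)) ?_ ?_ ?_
    · rw [hX, hY, val_zero, val_zero, h.1]
    · rw [hX, hX2]; ext t i; simp [applyC]
    · rw [hY, hY2, h.2]; ext t i; simp [applyC]
  · rintro ⟨v, f⟩
    obtain ⟨X, h0, hX⟩ := exists_linearODE (-A) v f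
    refine ⟨(v, der X), ?_⟩
    have hv : val (v, der X) = fn X := by
      ext t : 1
      rw [(isDeriv_fn X).eq_add_prim t, h0]
      rfl
    rw [ivp_apply, hv, hX]
    ext1
    · rfl
    · ext t i
      simp [applyC]

theorem isInvertible_ivp (A : C(unitInterval, (Fin 4 → E) →L[ℝ] (Fin 4 → E))) :
    (ivp A).IsInvertible := by
  have : CompleteSpace E := FiniteDimensional.complete ℝ E
  exact ⟨ContinuousLinearEquiv.ofBijective (ivp A)
    (LinearMap.ker_eq_bot.2 (ivp_bijective A).1) (LinearMap.range_eq_top.2 (ivp_bijective A).2),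
    ContinuousLinearEquiv.coe_ofBijective _ _ _⟩

/-- The solution operator of the initial value problem, the inverse of `ivp A`. -/
def ivpInv (A : C(unitInterval, (Fin 4 → E) →L[ℝ] (Fin 4 → E))) : Crd E →L[ℝ] Crd E :=
  (ivp A).inverse

@[simp] theorem ivp_ivpInv (A : C(unitInterval, (Fin 4 → E) →L[ℝ] (Fin 4 → E)))
    (y : Crd E) : ivp A (ivpInv A y) = y :=
  (isInvertible_ivp A).self_apply_inverse y

@[simp] theorem ivpInv_ivp (A : C(unitInterval, (Fin 4 → E) →L[ℝ] (Fin 4 → E))) (X : Crd E) :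
    ivpInv A (ivp A X) = X := (isInvertible_ivp A).inverse_apply_self X

theorem contDiff_ivp : ContDiff ℝ ∞ (fun A : C(unitInterval, (Fin 4 → E) →L[ℝ] (Fin 4 → E)) =>
    ivp A) :=
  contDiff_const.add (contDiff_const.clm_comp (contDiff_applyCL.clm_comp contDiff_const))

theorem contDiff_ivpInv : ContDiff ℝ ∞
    (fun A : C(unitInterval, (Fin 4 → E) →L[ℝ] (Fin 4 → E)) => ivpInv A) := by
  have : CompleteSpace E := FiniteDimensional.complete ℝ E
  rw [contDiff_iff_contDiffAt]
  intro A
  obtain ⟨e, he⟩ := isInvertible_ivp A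
  -- inversion of bounded operators is smooth
  have h := contDiffAt_map_inverse (n := ∞) e
  rw [he] at h
  exact h.comp A contDiff_ivp.contDiffAt

end Quadruples

section NahmSchmidMap

universe w
variable {E : Type w} [NormedAddCommGroup E] [NormedSpace ℝ E] [FiniteDimensional ℝ E]

/-! ### The quadratic terms of the Nahm--Schmid equations -/

/-- The pointwise bilinear map `q` such that the linearised Nahm--Schmid equations together with
the gauge-fixing equation are `X' + q(T, X) = 0`. -/
def qL (br : E →L[ℝ] E →L[ℝ] E) : (Fin 4 → E) →L[ℝ] (Fin 4 → E) →L[ℝ] (Fin 4 → E) :=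
  LinearMap.toContinuousBilinearMap (𝕜 := ℝ) (LinearMap.mk₂ ℝ
    (fun a x : Fin 4 → E =>
      ![br (a 0) (x 0) + br (a 1) (x 1) - br (a 2) (x 2) - br (a 3) (x 3),
        br (a 0) (x 1) + br (x 0) (a 1) + br (a 2) (x 3) + br (x 2) (a 3),
        br (a 0) (x 2) + br (x 0) (a 2) - br (a 3) (x 1) - br (x 3) (a 1),
        br (a 0) (x 3) + br (x 0) (a 3) - br (a 1) (x 2) - br (x 1) (a 2)])
    (fun a b x => by ext i; fin_cases i <;> simp <;> abel)
    (fun c a x => by ext i; fin_cases i <;> simp [smul_sub])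
    (fun a b x => by ext i; fin_cases i <;> simp <;> abel)
    (fun c a x => by ext i; fin_cases i <;> simp [smul_sub]))

theorem qL_apply (br : E →L[ℝ] E →L[ℝ] E) (a x : Fin 4 → E) : qL br a x =
    ![br (a 0) (x 0) + br (a 1) (x 1) - br (a 2) (x 2) - br (a 3) (x 3),
      br (a 0) (x 1) + br (x 0) (a 1) + br (a 2) (x 3) + br (x 2) (a 3),
      br (a 0) (x 2) + br (x 0) (a 2) - br (a 3) (x 1) - br (x 3) (a 1),
      br (a 0) (x 3) + br (x 0) (a 3) - br (a 1) (x 2) - br (x 1) (a 2)] := rfl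

theorem linEq_apply (br : E →L[ℝ] E →L[ℝ] E) (T X : Quad E) (i : Fin 4) (t : unitInterval) :
    linEq br T X i t = (dv X + bilC (qL br) (ev T) (ev X)) t i := by
  fin_cases i <;> simp [linEq, qL_apply, add_assoc, add_sub_assoc]

/-- The projection of quadruples which forgets the entry of index `0`. -/
def killZero : (Fin 4 → E) →L[ℝ] (Fin 4 → E) :=
  ContinuousLinearMap.pi fun i => if i = 0 then 0 else ContinuousLinearMap.proj i

@[simp] theorem killZero_zero (x : Fin 4 → E) : killZero x 0 = 0 := by simp [killZero]

@[simp] theorem killZero_of_ne (x : Fin 4 → E) {i : Fin 4} (hi : i ≠ 0) : killZero x i = x i := by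
  simp [killZero, hi]

/-- The bilinear terms of the linearised Nahm--Schmid equations. -/
def qN (br : E →L[ℝ] E →L[ℝ] E) : (Fin 4 → E) →L[ℝ] (Fin 4 → E) →L[ℝ] (Fin 4 → E) :=
  (ContinuousLinearMap.compL ℝ (Fin 4 → E) (Fin 4 → E) (Fin 4 → E) killZero).comp (qL br)

@[simp] theorem qN_zero (br : E →L[ℝ] E →L[ℝ] E) (a x : Fin 4 → E) : qN br a x 0 = 0 := by
  simp [qN]

@[simp] theorem qN_of_ne (br : E →L[ℝ] E →L[ℝ] E) (a x : Fin 4 → E) {i : Fin 4} (hi : i ≠ 0) :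
    qN br a x i = qL br a x i := by
  simp [qN, hi]

theorem qN_symm {br : E →L[ℝ] E →L[ℝ] E} (h : ∀ x y, br x y = -br y x) (a x : Fin 4 → E) :
    qN br a x = qN br x a := by
  ext i
  by_cases hi : i = 0
  · simp [hi]
  · rw [qN_of_ne _ _ _ hi, qN_of_ne _ _ _ hi]
    fin_cases i <;> simp [qL_apply] at hi ⊢
    · rw [h (a 0), h (x 0) (a 1), h (a 2), h (x 2) (a 3)]
      rw [h (x 1) (a 0), h (a 1) (x 0), h (x 3) (a 2), h (a 3) (x 2)]; abel
    · rw [h (a 0), h (x 0) (a 2), h (a 3), h (x 3) (a 1)]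
      rw [h (x 2) (a 0), h (a 2) (x 0), h (x 1) (a 3), h (a 1) (x 3)]; abel
    · rw [h (a 0), h (x 0) (a 3), h (a 1), h (x 1) (a 2)]
      rw [h (x 3) (a 0), h (a 3) (x 0), h (x 2) (a 1), h (a 2) (x 1)]; abel

/-- The multiplication operators attached to a bilinear map. -/
def mat (b : (Fin 4 → E) →L[ℝ] (Fin 4 → E) →L[ℝ] (Fin 4 → E)) :
    C(unitInterval, Fin 4 → E) →L[ℝ] C(unitInterval, (Fin 4 → E) →L[ℝ] (Fin 4 → E)) :=
  b.compLeftContinuous ℝ unitInterval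

@[simp] theorem applyCL_mat (b : (Fin 4 → E) →L[ℝ] (Fin 4 → E) →L[ℝ] (Fin 4 → E))
    (f g : C(unitInterval, Fin 4 → E)) : applyCL (mat b f) g = bilC b f g := rfl

/-! ### The Nahm--Schmid map -/

/-- The map `T ↦ (T(0), (T₀', T₁' + ½ q₁(T,T), …))`. -/
def nsMap (br : E →L[ℝ] E →L[ℝ] E) (y : Crd E) : Crd E :=
  (y.1, y.2 + (1 / 2 : ℝ) • bilC (qN br) (val y) (val y))

theorem contDiff_bilC (b : (Fin 4 → E) →L[ℝ] (Fin 4 → E) →L[ℝ] (Fin 4 → E)) :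
    ContDiff ℝ ∞ (fun f : C(unitInterval, Fin 4 → E) =>
      (bilC b f : C(unitInterval, Fin 4 → E) →L[ℝ] C(unitInterval, Fin 4 → E))) :=
  ContinuousLinearMap.contDiff _

theorem contDiff_nsMap (br : E →L[ℝ] E →L[ℝ] E) : ContDiff ℝ ∞ (nsMap br) := by
  have hv : ContDiff ℝ ∞ (fun y : Crd E => val y) := ContinuousLinearMap.contDiff _
  have h1 : ContDiff ℝ ∞ (fun y : Crd E => bilC (qN br) (val y)) :=
    (contDiff_bilC (qN br)).comp hv
  have h2 : ContDiff ℝ ∞ (fun y : Crd E => (1 / 2 : ℝ) • bilC (qN br) (val y) (val y)) :=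
    (h1.clm_apply hv).const_smul _
  exact contDiff_fst.prodMk (contDiff_snd.add h2)

/-- The derivative of the Nahm--Schmid map is the operator of a linear initial value problem, since
the quadratic terms come from a symmetric bilinear map. -/
theorem hasFDerivAt_nsMap {br : E →L[ℝ] E →L[ℝ] E} (h : ∀ x y, br x y = -br y x) (y : Crd E) :
    HasFDerivAt (nsMap br) (ivp (mat (qN br) (val y))) y := by
  have h1 := (bilC (qN br)).hasFDerivAt_of_bilinear
    (val (E := E)).hasFDerivAt (val (E := E)).hasFDerivAt (x := y)
  have h2 := (hasFDerivAt_fst (𝕜 := ℝ) (p := y)).prodMk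
    ((hasFDerivAt_snd (𝕜 := ℝ) (p := y)).add (h1.const_smul (1 / 2 : ℝ)))
  convert! h2 using 1
  refine ContinuousLinearMap.ext fun x => ?_
  rw [ivp_apply]
  refine Prod.ext rfl ?_
  have : bilC (qN br) (val x) (val y) = bilC (qN br) (val y) (val x) := by
    ext t : 1
    exact qN_symm h _ _
  simp [this, ← two_smul ℝ, smul_smul]

/-- Since the Nahm--Schmid map is quadratic, its differences are given by its derivative at the
midpoint. -/
theorem nsMap_sub {br : E →L[ℝ] E →L[ℝ] E} (h : ∀ x y, br x y = -br y x) (y z : Crd E) :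
    nsMap br y - nsMap br z = ivp (mat (qN br) (val ((1 / 2 : ℝ) • (y + z)))) (y - z) := by
  rw [ivp_apply]
  refine Prod.ext rfl ?_
  have : bilC (qN br) (val z) (val y) = bilC (qN br) (val y) (val z) := by
    ext t : 1
    exact qN_symm h _ _
  simp only [nsMap, Prod.snd_sub, applyCL_mat, map_smul, map_add, map_sub, this,
    _root_.smul_apply, _root_.add_apply]
  module

/-- A solution is determined by `T₀` and the initial values. -/
theorem nsMap_injective {br : E →L[ℝ] E →L[ℝ] E} (h : ∀ x y, br x y = -br y x) :
    Function.Injective (nsMap br) := by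
  intro y z hyz
  rw [← sub_eq_zero, nsMap_sub h] at hyz
  rw [← sub_eq_zero]
  exact (ivp_bijective _).1 (hyz.trans (map_zero _).symm)

/-- The Nahm--Schmid map has smooth local inverses, by the inverse function theorem. -/
theorem exists_nsMap_local {br : E →L[ℝ] E →L[ℝ] E} (h : ∀ x y, br x y = -br y x) (y : Crd E) :
    ∃ e : OpenPartialHomeomorph (Crd E) (Crd E), (∀ z, e z = nsMap br z) ∧ y ∈ e.source ∧
      ContDiffAt ℝ ∞ e.symm (nsMap br y) := by
  have : CompleteSpace E := FiniteDimensional.complete ℝ E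
  obtain ⟨e', he'⟩ := isInvertible_ivp (mat (qN br) (val y))
  have hd := hasFDerivAt_nsMap h y
  rw [← he'] at hd
  have hc := (contDiff_nsMap br).contDiffAt (x := y)
  let e := hc.toOpenPartialHomeomorph (nsMap br) hd (by simp)
  have hs : y ∈ e.source := hc.mem_toOpenPartialHomeomorph_source hd (by simp)
  have hl : e.symm (nsMap br y) = y := e.left_inv hs
  refine ⟨e, fun z => rfl, hs, ?_⟩
  refine e.contDiffAt_symm (f₀' := e') (e.map_source hs) ?_ ?_
  · rw [hl]; exact hd
  · rw [hl]; exact hc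

theorem isOpen_range_nsMap {br : E →L[ℝ] E →L[ℝ] E} (h : ∀ x y, br x y = -br y x) :
    IsOpen (range (nsMap br)) := by
  rw [isOpen_iff_mem_nhds]
  rintro _ ⟨y, rfl⟩
  obtain ⟨e, he, hs, -⟩ := exists_nsMap_local h y
  have h1 := e.map_source hs
  rw [he] at h1
  filter_upwards [e.open_target.mem_nhds h1] with z hz
  exact ⟨e.symm z, by rw [← he, e.right_inv hz]⟩

/-! ### The model of the space of solutions -/

variable (E) in
/-- The data `((T₀(0), T₀'), (T₁(0), T₂(0), T₃(0)))` which determine a solution of the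
Nahm--Schmid equations. -/
abbrev Data : Type w := (E × C(unitInterval, E)) × (Fin 3 → E)

variable (E) in
/-- A quadruple as its entry of index `0` and the triple of the other entries. -/
def consL : (E × (Fin 3 → E)) ≃L[ℝ] (Fin 4 → E) := Fin.consEquivL ℝ (fun _ : Fin 4 => E)

/-- The right-hand side of the equation `nsMap T = ι(f)` which the solution with data `f`
satisfies. -/
def incl : Data E →L[ℝ] Crd E :=
  (((consL E : (E × (Fin 3 → E)) →L[ℝ] (Fin 4 → E)) ∘L
    ((ContinuousLinearMap.fst ℝ E _ ∘L ContinuousLinearMap.fst ℝ _ _).prod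
      (ContinuousLinearMap.snd ℝ _ _))).prod
  ((((consL E : (E × (Fin 3 → E)) →L[ℝ] (Fin 4 → E)) ∘L
    ContinuousLinearMap.inl ℝ _ _).compLeftContinuous ℝ unitInterval) ∘L
      ContinuousLinearMap.snd ℝ E _ ∘L ContinuousLinearMap.fst ℝ _ _))

/-- The data of a quadruple. -/
def restr : Crd E →L[ℝ] Data E :=
  ((ContinuousLinearMap.proj (R := ℝ) (φ := fun _ : Fin 4 => E) 0 ∘L
      ContinuousLinearMap.fst ℝ _ _).prod
    ((ContinuousLinearMap.proj (R := ℝ) (φ := fun _ : Fin 4 => E) 0).compLeftContinuous ℝ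
      unitInterval ∘L ContinuousLinearMap.snd ℝ _ _)).prod
  (ContinuousLinearMap.snd ℝ _ _ ∘L ((consL E).symm : (Fin 4 → E) →L[ℝ] (E × (Fin 3 → E))) ∘L
    ContinuousLinearMap.fst ℝ _ _)

theorem restr_apply (y : Crd E) : restr y =
    ((y.1 0, ⟨fun t => y.2 t 0, by fun_prop⟩), fun i => y.1 i.succ) := rfl

@[simp] theorem restr_incl (f : Data E) : restr (incl f) = f := rfl

@[simp] theorem restr_nsMap (br : E →L[ℝ] E →L[ℝ] E) (y : Crd E) :
    restr (nsMap br y) = restr y := by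
  rw [restr_apply, restr_apply]
  refine Prod.ext (Prod.ext rfl ?_) rfl
  ext t
  simp [nsMap]

theorem eq_incl_restr_iff (z : Crd E) : z = incl (restr z) ↔ ∀ (i : Fin 3) t, z.2 t i.succ = 0 := by
  constructor
  · intro h i t
    rw [h]; rfl
  · intro h
    refine Prod.ext ?_ ?_
    · funext i
      refine Fin.cases rfl (fun i => rfl) i
    · ext t i
      refine Fin.cases rfl (fun i => h i t) i

/-- The Nahm--Schmid equations say that the entries of index `1, 2, 3` of the second component of
`nsMap T` vanish. -/
theorem isSolution_iff {br : E →L[ℝ] E →L[ℝ] E} (T : Quad E) :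
    IsSolution br T ↔ nsMap br (crdEquiv E T) = incl (restr (crdEquiv E T)) := by
  rw [← restr_nsMap br, eq_incl_restr_iff]
  have e1 : ∀ (t : unitInterval) (i : Fin 4), i ≠ 0 → (nsMap br (crdEquiv E T)).2 t i =
      der (T i) t + (1 / 2 : ℝ) • qL br (ev T t) (ev T t) i := fun t i hi => by
    simp only [nsMap, val_crd, ContinuousMap.add_apply, ContinuousMap.smul_apply, Pi.add_apply,
      Pi.smul_apply, bilC_apply, qN_of_ne _ _ _ hi]
    rfl
  have k1 : ∀ t, (nsMap br (crdEquiv E T)).2 t 1 = der (T 1) t + br (fn (T 0) t) (fn (T 1) t) +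
      br (fn (T 2) t) (fn (T 3) t) := fun t => by
    rw [e1 t 1 (by decide)]; simp [qL_apply]; module
  have k2 : ∀ t, (nsMap br (crdEquiv E T)).2 t 2 = der (T 2) t + br (fn (T 0) t) (fn (T 2) t) -
      br (fn (T 3) t) (fn (T 1) t) := fun t => by
    rw [e1 t 2 (by decide)]; simp [qL_apply]; module
  have k3 : ∀ t, (nsMap br (crdEquiv E T)).2 t 3 = der (T 3) t + br (fn (T 0) t) (fn (T 3) t) -
      br (fn (T 1) t) (fn (T 2) t) := fun t => by
    rw [e1 t 3 (by decide)]; simp [qL_apply]; module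
  constructor
  · rintro ⟨h1, h2, h3⟩ i t
    have a1 := DFunLike.congr_fun h1 t
    have a2 := DFunLike.congr_fun h2 t
    have a3 := DFunLike.congr_fun h3 t
    simp only [ContinuousMap.add_apply, ContinuousMap.neg_apply, brC_apply] at a1 a2 a3
    fin_cases i
    · exact (k1 t).trans (by rw [a1]; abel)
    · exact (k2 t).trans (by rw [a2]; abel)
    · exact (k3 t).trans (by rw [a3]; abel)
  · intro H
    refine ⟨?_, ?_, ?_⟩
    · ext t
      have := (k1 t).symm.trans (H 0 t)
      simpa using eq_neg_of_add_eq_zero_left this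
    · ext t
      have := (k2 t).symm.trans (H 1 t)
      simpa using sub_eq_zero.1 this
    · ext t
      have := (k3 t).symm.trans (H 2 t)
      simpa using sub_eq_zero.1 this

/-! ### Existence of solutions -/

/-- A positive definite form on a finite-dimensional space is bounded below by its minimum on the
unit sphere. -/
theorem exists_bound_form {B : LinearMap.BilinForm ℝ E} (hp : ∀ x, x ≠ 0 → 0 < B x x) :
    ∃ c : ℝ, 0 < c ∧ ∀ x, ‖x‖ ^ 2 ≤ c * B x x := by
  let BL : E →L[ℝ] E →L[ℝ] ℝ := LinearMap.toContinuousBilinearMap (𝕜 := ℝ) B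
  have hBL : ∀ x, BL x x = B x x := fun x => rfl
  have hc : Continuous fun x => BL x x := by fun_prop
  have : ProperSpace E := FiniteDimensional.proper ℝ E
  rcases (Metric.sphere (0 : E) 1).eq_empty_or_nonempty with he | hne
  · refine ⟨1, one_pos, fun x => ?_⟩
    by_cases hx : x = 0
    · simp [hx]
    · exfalso
      have : ‖x‖⁻¹ • x ∈ Metric.sphere (0 : E) 1 := by
        simp [norm_smul, hx]
      rw [he] at this
      exact this
  · obtain ⟨x0, h0, hmin⟩ := (isCompact_sphere (0 : E) 1).exists_isMinOn hne hc.continuousOn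
    have hx0 : x0 ≠ 0 := by
      rintro rfl
      simp at h0
    have hm := hp x0 hx0
    refine ⟨(B x0 x0)⁻¹, inv_pos.2 hm, fun x => ?_⟩
    by_cases hx : x = 0
    · simp [hx]
    · have hs : ‖x‖⁻¹ • x ∈ Metric.sphere (0 : E) 1 := by
        simp [norm_smul, hx]
      have h1 : B x0 x0 ≤ B (‖x‖⁻¹ • x) (‖x‖⁻¹ • x) := hmin hs
      have hn : 0 < ‖x‖ := norm_pos_iff.2 hx
      simp only [map_smul, LinearMap.smul_apply, smul_eq_mul] at h1
      rw [← div_eq_inv_mul, le_div_iff₀ hm]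
      rw [← div_eq_inv_mul, ← div_eq_inv_mul, div_div, le_div_iff₀ (by positivity)] at h1
      linarith [sq (‖x‖)]

/-- A function `B(X,X) + B(Y,Y)` with vanishing derivative is constant. -/
theorem conserved_bound {br : E →L[ℝ] E →L[ℝ] E} {B : LinearMap.BilinForm ℝ E}
    (hL : IsMetricLie br B) {X X' Y Y' : C(unitInterval, E)} (hX : IsDeriv X X')
    (hY : IsDeriv Y Y') (h : ∀ t, B (X' t) (X t) + B (Y' t) (Y t) = 0) (t : unitInterval) :
    B (X t) (X t) + B (Y t) (Y t) = B (X 0) (X 0) + B (Y 0) (Y 0) := by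
  let BL : E →L[ℝ] E →L[ℝ] ℝ := LinearMap.toContinuousBilinearMap (𝕜 := ℝ) B
  have hBL : ∀ x y, BL x y = B x y := fun x y => rfl
  let f : C(unitInterval, ℝ) := ⟨fun t => BL (X t) (X t) + BL (Y t) (Y t), by fun_prop⟩
  have hf : IsDeriv f 0 := fun t => by
    have h1 := (BL.hasDerivWithinAt_of_bilinear (hX t) (hX t)).add
      (BL.hasDerivWithinAt_of_bilinear (hY t) (hY t))
    have h2 := h t
    refine h1.congr_deriv ?_
    simp only [projIcc_of_mem zero_le_one t.2, hBL]
    rw [hL.symm (X t) (X' t), hL.symm (Y t) (Y' t)]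
    simp only [Subtype.coe_eta, ContinuousMap.coe_zero, Pi.zero_apply]
    linarith
  exact hf.const_of_zero t

/-- The a priori estimate for the solutions of the Nahm--Schmid equations: the quantities
`B(T₁,T₁) + B(T₂,T₂)` and `B(T₁,T₁) + B(T₃,T₃)` are conserved. -/
theorem exists_apriori {br : E →L[ℝ] E →L[ℝ] E} {B : LinearMap.BilinForm ℝ E}
    (hL : IsMetricLie br B) : ∃ C : ℝ, 0 ≤ C ∧ ∀ (y : Crd E) (f : Data E), nsMap br y = incl f →
      ‖val y‖ ≤ C * ‖f‖ := by
  have : CompleteSpace E := FiniteDimensional.complete ℝ E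
  obtain ⟨c, hc, hcB⟩ := exists_bound_form hL.pos
  let BL : E →L[ℝ] E →L[ℝ] ℝ := LinearMap.toContinuousBilinearMap (𝕜 := ℝ) B
  have hnn : ∀ x, 0 ≤ B x x := fun x => by
    by_cases hx : x = 0
    · simp [hx]
    · exact (hL.pos x hx).le
  set b := ‖BL‖ with hb
  refine ⟨2 + Real.sqrt (c * (2 * b)), by positivity, fun y f hy => ?_⟩
  set T := (crdEquiv E).symm y with hT
  have hyT : crdEquiv E T = y := by simp [hT]
  have hf : restr y = f := by rw [← restr_nsMap br, hy, restr_incl]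
  have hsol : IsSolution br T := by
    rw [isSolution_iff, hyT, hf, hy]
  have hval : val y = ev T := by rw [← hyT, val_crd]
  have hi0 : ∀ i : Fin 3, fn (T i.succ) 0 = f.2 i := fun i => by
    have : (val y) 0 i.succ = f.2 i := by
      rw [val_zero, ← hf]; rfl
    rw [← this, hval]; rfl
  have hB0 : ∀ i : Fin 3, B (f.2 i) (f.2 i) ≤ b * ‖f‖ ^ 2 := fun i => by
    have h1 : BL (f.2 i) (f.2 i) ≤ ‖BL‖ * ‖f.2 i‖ * ‖f.2 i‖ :=
      (le_abs_self _).trans (BL.le_opNorm₂ _ _)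
    have h2 : ‖f.2 i‖ ≤ ‖f‖ := (norm_le_pi_norm _ i).trans (norm_snd_le f)
    refine h1.trans ?_
    rw [mul_assoc, ← sq]
    gcongr
  have e1 := fun t => DFunLike.congr_fun hsol.1 t
  have e2 := fun t => DFunLike.congr_fun hsol.2.1 t
  have e3 := fun t => DFunLike.congr_fun hsol.2.2 t
  simp only [ContinuousMap.add_apply, ContinuousMap.neg_apply, brC_apply,
    ← eq_sub_iff_add_eq] at e1 e2 e3
  have hz : ∀ x z : E, B (br x z) z = 0 := fun x z => by
    have h1 := hL.inv x z z
    rw [hL.symm z] at h1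
    linarith
  -- by invariance, `B([T₀,Tᵢ],Tᵢ) = 0` and the two cubic terms cancel
  have h12 := conserved_bound hL (isDeriv_fn (T 1)) (isDeriv_fn (T 2)) (fun t => by
    rw [e1 t, e2 t]
    have h1 := hL.inv (fn (T 3) t) (fn (T 1) t) (fn (T 2) t)
    have h2 := hL.symm (fn (T 1) t) (br (fn (T 3) t) (fn (T 2) t))
    have h3 := hL.skew (fn (T 2) t) (fn (T 3) t)
    simp only [map_sub, map_neg, LinearMap.sub_apply, LinearMap.neg_apply, hz, h3]
    linarith)
  have h13 := conserved_bound hL (isDeriv_fn (T 1)) (isDeriv_fn (T 3)) (fun t => by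
    rw [e1 t, e3 t]
    have h1 := hL.inv (fn (T 2) t) (fn (T 1) t) (fn (T 3) t)
    have h2 := hL.symm (fn (T 1) t) (br (fn (T 2) t) (fn (T 3) t))
    have h3 := hL.skew (fn (T 1) t) (fn (T 2) t)
    simp only [map_sub, map_neg, LinearMap.sub_apply, LinearMap.neg_apply, hz, h3]
    linarith)
  have hfin : ∀ z : E, B z z ≤ 2 * b * ‖f‖ ^ 2 → ‖z‖ ≤ Real.sqrt (c * (2 * b)) * ‖f‖ := by
    intro z hz
    have h1 : ‖z‖ ^ 2 ≤ (c * (2 * b)) * ‖f‖ ^ 2 := by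
      refine (hcB z).trans ?_
      rw [mul_assoc]
      gcongr
    refine abs_le_of_sq_le_sq' ?_ (by positivity) |>.2
    rw [mul_pow, Real.sq_sqrt (by positivity)]
    exact h1
  have q0 := hB0 0
  have q1 := hB0 1
  have q2 := hB0 2
  rw [← hi0] at q0 q1 q2
  change B (fn (T 1) 0) (fn (T 1) 0) ≤ _ at q0
  change B (fn (T 2) 0) (fn (T 2) 0) ≤ _ at q1
  change B (fn (T 3) 0) (fn (T 3) 0) ≤ _ at q2
  have hbig : Real.sqrt (c * (2 * b)) * ‖f‖ ≤ (2 + Real.sqrt (c * (2 * b))) * ‖f‖ := by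
    gcongr; linarith
  rw [hval]
  refine (ContinuousMap.norm_le _ (by positivity)).2 fun t => ?_
  refine (pi_norm_le_iff_of_nonneg (by positivity)).2 fun i => ?_
  have p1 := h12 t
  have p2 := h13 t
  -- the entry of index `0` is part of the data, the others are bounded by the conserved quantities
  fin_cases i
  · have h0 : fn (T 0) t = f.1.1 + prim f.1.2 t := by
      have h1 := (isDeriv_fn (T 0)).eq_add_prim t
      have h2 : fn (T 0) 0 = f.1.1 := by
        have h3 : (val y) 0 0 = f.1.1 := by rw [val_zero, ← hf]; rfl
        rw [← h3, hval]; rfl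
      have h3 : der (T 0) = f.1.2 := by rw [← hf]; rfl
      rw [h1, h2, h3]
    change ‖fn (T 0) t‖ ≤ _
    rw [h0]
    have h1 : ‖f.1.1‖ ≤ ‖f‖ := (norm_fst_le f.1).trans (norm_fst_le f)
    have h2 : ‖prim f.1.2 t‖ ≤ ‖f‖ := ((prim f.1.2).norm_coe_le_norm t).trans
      ((norm_prim_le _).trans ((norm_snd_le f.1).trans (norm_fst_le f)))
    have h3 : 0 ≤ Real.sqrt (c * (2 * b)) * ‖f‖ := by positivity
    refine (norm_add_le _ _).trans ?_
    linarith
  · exact (hfin (fn (T 1) t) (by linarith [hnn (fn (T 2) t)])).trans hbig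
  · exact (hfin (fn (T 2) t) (by linarith [hnn (fn (T 1) t)])).trans hbig
  · exact (hfin (fn (T 3) t) (by linarith [hnn (fn (T 1) t)])).trans hbig

/-- The Grönwall estimate bounds the inverses of the linearised equations uniformly on bounded sets of
`T`. -/
theorem exists_ivp_bound (br : E →L[ℝ] E →L[ℝ] E) (R : ℝ) : ∃ K : ℝ, 0 < K ∧
    ∀ (z : C(unitInterval, Fin 4 → E)) (x : Crd E), ‖z‖ ≤ R →
      ‖x‖ ≤ K * ‖ivp (mat (qN br) z) x‖ := by
  have : CompleteSpace E := FiniteDimensional.complete ℝ E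
  set k := max 1 (‖qN br‖ * R) with hk
  have hk1 : 1 ≤ k := le_max_left _ _
  refine ⟨1 + k * (2 * Real.exp k), by positivity, fun z x hz => ?_⟩
  set n := ‖ivp (mat (qN br) z) x‖ with hn
  have hn0 : 0 ≤ n := norm_nonneg _
  have h1 : ‖x.1‖ ≤ n := by
    have := norm_fst_le (ivp (mat (qN br) z) x)
    rwa [← hn, ivp_apply] at this
  have h2 : ‖x.2 + bilC (qN br) z (val x)‖ ≤ n := by
    have := norm_snd_le (ivp (mat (qN br) z) x)
    rwa [← hn, ivp_apply] at this
  have hq : ∀ t, ‖qN br (z t) (val x t)‖ ≤ k * ‖val x t‖ := fun t => by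
    refine ((qN br).le_opNorm₂ _ _).trans ?_
    gcongr
    refine le_trans ?_ (le_max_right _ _)
    gcongr
    exact (z.norm_coe_le_norm t).trans hz
  have hx2 : ∀ t, ‖x.2 t‖ ≤ k * ‖val x t‖ + n := fun t => by
    have h3 : x.2 t = (x.2 + bilC (qN br) z (val x)) t - qN br (z t) (val x t) := by simp
    rw [h3]
    refine (norm_sub_le _ _).trans ?_
    have := ((x.2 + bilC (qN br) z (val x)).norm_coe_le_norm t).trans h2
    linarith [hq t]
  have hv : ∀ t, ‖val x t‖ ≤ (n + n) * Real.exp k :=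
    (isDeriv_val x).norm_le_exp hk1 (by simpa using h1) hn0 hx2
  have hfin : n ≤ (1 + k * (2 * Real.exp k)) * n := by
    have : 0 ≤ k * (2 * Real.exp k) * n := by positivity
    linarith
  refine (norm_prod_le_iff).2 ⟨h1.trans hfin, ?_⟩
  refine (ContinuousMap.norm_le _ (by positivity)).2 fun t => ?_
  refine (hx2 t).trans ?_
  have := mul_le_mul_of_nonneg_left (hv t) (zero_le_one.trans hk1)
  linarith

/-- Every choice of `T₀`, `T₁(0)`, `T₂(0)`, `T₃(0)` extends to a solution of the Nahm--Schmid
equations on the whole interval. -/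
theorem exists_nsMap_eq {br : E →L[ℝ] E →L[ℝ] E} {B : LinearMap.BilinForm ℝ E}
    (hL : IsMetricLie br B) (f : Data E) : ∃ y, nsMap br y = incl f := by
  have : CompleteSpace E := FiniteDimensional.complete ℝ E
  obtain ⟨C, hC0, hC⟩ := exists_apriori hL
  -- the continuity method along the segment from `0` to `f`: the set `S` of the parameters for
  -- which a solution exists is open by the inverse function theorem
  let p : unitInterval → Crd E := fun s => incl ((s : ℝ) • f)
  have hp : Continuous p := incl.continuous.comp (continuous_subtype_val.smul continuous_const)
  let S : Set unitInterval := p ⁻¹' (range (nsMap br))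
  have hSo : IsOpen S := (isOpen_range_nsMap hL.skew).preimage hp
  have hSc : IsClosed S := by
    -- it is closed: the a priori bound and `exists_ivp_bound` at the midpoints show that the
    -- solutions for a convergent sequence of parameters form a Cauchy sequence
    refine IsSeqClosed.isClosed fun s s0 hs hlim => ?_
    choose y hy using hs
    have hyv : ∀ n, ‖val (y n)‖ ≤ C * ‖f‖ := fun n => by
      refine (hC _ _ (hy n)).trans ?_
      rw [norm_smul, Real.norm_of_nonneg (s n).2.1]
      gcongr
      exact mul_le_of_le_one_left (norm_nonneg _) (s n).2.2
    obtain ⟨K, hK, hKb⟩ := exists_ivp_bound br (C * ‖f‖)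
    have hd : ∀ n m, ‖y n - y m‖ ≤ K * ‖p (s n) - p (s m)‖ := fun n m => by
      rw [← hy n, ← hy m, nsMap_sub hL.skew]
      refine hKb _ _ ?_
      rw [map_smul, map_add, norm_smul, Real.norm_of_nonneg (by norm_num)]
      have := norm_add_le (val (y n)) (val (y m))
      linarith [hyv n, hyv m]
    have hpc : CauchySeq (fun n => p (s n)) := ((hp.tendsto s0).comp hlim).cauchySeq
    have hyc : CauchySeq y := by
      rw [Metric.cauchySeq_iff] at hpc ⊢
      intro ε hε
      obtain ⟨N, hN⟩ := hpc (ε / K) (by positivity)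
      refine ⟨N, fun m hm n hn => ?_⟩
      have h1 := hN m hm n hn
      rw [dist_eq_norm, lt_div_iff₀ hK] at h1
      rw [dist_eq_norm]
      refine (hd m n).trans_lt ?_
      linarith
    obtain ⟨y0, hy0⟩ := cauchySeq_tendsto_of_complete hyc
    refine ⟨y0, tendsto_nhds_unique (((contDiff_nsMap br).continuous.tendsto y0).comp hy0) ?_⟩
    have := (hp.tendsto s0).comp hlim
    refine this.congr fun n => (hy n).symm
  have h0 : (0 : unitInterval) ∈ S := ⟨0, by simp [p, nsMap]⟩
  have hS : S = univ := IsClopen.eq_univ ⟨hSc, hSo⟩ ⟨0, h0⟩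
  have h1 : (1 : unitInterval) ∈ S := by rw [hS]; trivial
  obtain ⟨y, hy⟩ := h1
  exact ⟨y, by simpa [p] using hy⟩

end NahmSchmidMap

section DeltaOperator

universe w
variable {E : Type w} [NormedAddCommGroup E] [NormedSpace ℝ E] [FiniteDimensional ℝ E]

/-! ### The operator `Δ` is Fredholm of index zero -/

variable (E) in
/-- The triple `(ξ, ξ', ξ'')` with `ξ(0) = 0`, and with given `ξ'(0)` and `ξ''`. -/
def toTriple : (E × C(unitInterval, E)) →L[ℝ]
    C(unitInterval, E) × C(unitInterval, E) × C(unitInterval, E) :=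
  let p : (E × C(unitInterval, E)) →L[ℝ] C(unitInterval, E) :=
    constC E ∘L ContinuousLinearMap.fst ℝ _ _ + prim ∘L ContinuousLinearMap.snd ℝ _ _
  (prim ∘L p).prod (p.prod (ContinuousLinearMap.snd ℝ _ _))

theorem toTriple_apply (x : E × C(unitInterval, E)) : toTriple E x =
    (prim (constC E x.1 + prim x.2), constC E x.1 + prim x.2, x.2) := rfl

theorem toTriple_isDeriv (x : E × C(unitInterval, E)) :
    IsDeriv (toTriple E x).1 (toTriple E x).2.1 ∧ IsDeriv (toTriple E x).2.1 (toTriple E x).2.2 := by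
  have : CompleteSpace E := FiniteDimensional.complete ℝ E
  refine ⟨isDeriv_prim _, ?_⟩
  have := (isDeriv_const x.1).add (isDeriv_prim x.2)
  rwa [zero_add] at this

theorem eq_toTriple {a a' a'' : C(unitInterval, E)} (h : IsDeriv a a') (h' : IsDeriv a' a'')
    (h0 : a 0 = 0) : (a, a', a'') = toTriple E (a' 0, a'') := by
  have : CompleteSpace E := FiniteDimensional.complete ℝ E
  have e1 : a' = constC E (a' 0) + prim a'' := by
    ext t
    exact h'.eq_add_prim t
  have e2 : a = prim a' := by
    ext t
    rw [h.eq_add_prim t, h0, zero_add]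
  rw [toTriple_apply, ← e1, ← e2]

/-- The operator `Δ` without boundary conditions. -/
def bigDelta (br : E →L[ℝ] E →L[ℝ] E) (T : Quad E) :
    C(unitInterval, E) × C(unitInterval, E) × C(unitInterval, E) →L[ℝ] C(unitInterval, E) :=
  ContinuousLinearMap.snd ℝ _ _ ∘L ContinuousLinearMap.snd ℝ _ _
    + brC br (der (T 0)) ∘L ContinuousLinearMap.fst ℝ _ _
    + (2 : ℝ) • (brC br (fn (T 0)) ∘L ContinuousLinearMap.fst ℝ _ _ ∘L
        ContinuousLinearMap.snd ℝ _ _)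
    + (brC br (fn (T 0)) ∘L brC br (fn (T 0)) + brC br (fn (T 1)) ∘L brC br (fn (T 1))
        - brC br (fn (T 2)) ∘L brC br (fn (T 2)) - brC br (fn (T 3)) ∘L brC br (fn (T 3))) ∘L
        ContinuousLinearMap.fst ℝ _ _

theorem Delta_eq (br : E →L[ℝ] E →L[ℝ] E) (T : Quad E) (ξ : LieG00 E) :
    Delta br T ξ = bigDelta br T ξ.1 := rfl

theorem bigDelta_apply (br : E →L[ℝ] E →L[ℝ] E) (T : Quad E)
    (x : C(unitInterval, E) × C(unitInterval, E) × C(unitInterval, E)) (t : unitInterval) :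
    bigDelta br T x t = x.2.2 t + br (der (T 0) t) (x.1 t) + (2 : ℝ) • br (fn (T 0) t) (x.2.1 t) +
      (br (fn (T 0) t) (br (fn (T 0) t) (x.1 t)) + br (fn (T 1) t) (br (fn (T 1) t) (x.1 t)) -
      br (fn (T 2) t) (br (fn (T 2) t) (x.1 t)) - br (fn (T 3) t) (br (fn (T 3) t) (x.1 t))) := rfl

/-- The operator `ξ ↦ (ξ'(0), Δ ξ)`, with `ξ` determined by `ξ(0) = 0`, `ξ'(0)` and `ξ''`. -/
def deltaIvp (br : E →L[ℝ] E →L[ℝ] E) (T : Quad E) :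
    (E × C(unitInterval, E)) →L[ℝ] (E × C(unitInterval, E)) :=
  (ContinuousLinearMap.fst ℝ _ _).prod (bigDelta br T ∘L toTriple E)

/-- The equation `Δ ξ = f` with `ξ(0) = 0` and given `ξ'(0)` is an initial value problem for `(ξ,
ξ')`. -/
theorem deltaIvp_bijective (br : E →L[ℝ] E →L[ℝ] E) (T : Quad E) :
    Function.Bijective (deltaIvp br T) := by
  have : CompleteSpace E := FiniteDimensional.complete ℝ E
  -- the first order system for the pair `(ξ, ξ')`
  let low : C(unitInterval, E →L[ℝ] E) :=
    ⟨fun t => -(br (der (T 0) t) + ((br (fn (T 0) t)).comp (br (fn (T 0) t)) +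
      (br (fn (T 1) t)).comp (br (fn (T 1) t)) - (br (fn (T 2) t)).comp (br (fn (T 2) t)) -
      (br (fn (T 3) t)).comp (br (fn (T 3) t)))), by fun_prop⟩
  let A : C(unitInterval, (E × E) →L[ℝ] (E × E)) :=
    ⟨fun t => (ContinuousLinearMap.inl ℝ E E).comp (ContinuousLinearMap.snd ℝ E E) +
      (ContinuousLinearMap.inr ℝ E E).comp ((low t).comp (ContinuousLinearMap.fst ℝ E E) -
        (2 : ℝ) • (br (fn (T 0) t)).comp (ContinuousLinearMap.snd ℝ E E)), by fun_prop⟩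
  have hA : ∀ t p, A t p = (p.2, -(br (der (T 0) t) p.1 + (br (fn (T 0) t) (br (fn (T 0) t) p.1) +
      br (fn (T 1) t) (br (fn (T 1) t) p.1) - br (fn (T 2) t) (br (fn (T 2) t) p.1) -
      br (fn (T 3) t) (br (fn (T 3) t) p.1))) - (2 : ℝ) • br (fn (T 0) t) p.2) := fun t p => by
    simp [A, low]
  let pr1 := (ContinuousLinearMap.fst ℝ E E).compLeftContinuous ℝ unitInterval
  let pr2 := (ContinuousLinearMap.snd ℝ E E).compLeftContinuous ℝ unitInterval
  have hsplit : ∀ (f : C(unitInterval, E)) (a a' a'' : C(unitInterval, E)), IsDeriv a a' →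
      IsDeriv a' a'' → bigDelta br T (a, a', a'') = f → ∃ X : C1 (E × E),
        fn X = a.prodMk a' ∧ der X = applyC A (fn X) + (ContinuousMap.const _ 0).prodMk f := by
    intro f a a' a'' h1 h2 hf
    refine ⟨⟨(a.prodMk a', a'.prodMk a''), fun t => (h1 t).prodMk (h2 t)⟩, rfl, ?_⟩
    ext t : 1
    have h3 := DFunLike.congr_fun hf t
    rw [bigDelta_apply] at h3
    change (a' t, a'' t) = A t (a t, a' t) + (0, f t)
    rw [hA, ← h3, Prod.mk_add_mk]
    refine Prod.ext (by simp) ?_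
    simp only
    abel
  constructor
  · rw [injective_iff_map_eq_zero]
    intro x hx
    have hx1 : x.1 = 0 := congrArg Prod.fst hx
    have hx2 : bigDelta br T (toTriple E x) = 0 := congrArg Prod.snd hx
    obtain ⟨h1, h2⟩ := toTriple_isDeriv x
    obtain ⟨X, hX, hX'⟩ := hsplit 0 _ _ _ h1 h2 hx2
    obtain ⟨Y, hY, hY'⟩ := hsplit 0 0 0 0 IsDeriv.zero IsDeriv.zero (map_zero _)
    have h3 := linearODE_unique A _ (by
      rw [hX, hY]
      simp [toTriple_apply, hx1]) hX' hY'
    have h4 : (toTriple E x).2.1 = 0 := by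
      have h5 := congrArg (fun Z => pr2 (fn Z)) h3
      simp only [hX, hY] at h5
      exact h5
    rw [h4] at h2
    have h5 : (toTriple E x).2.2 = 0 := h2.unique IsDeriv.zero
    exact Prod.ext hx1 h5
  · rintro ⟨v, f⟩
    obtain ⟨X, h0, hX⟩ := exists_linearODE A ((0 : E), v) ((ContinuousMap.const _ 0).prodMk f)
    have hd := isDeriv_fn X
    set a := pr1 (fn X) with ha
    set a' := pr2 (fn X) with ha'
    set a'' := pr2 (der X) with ha''
    have hXv : ∀ t, fn X t = (a t, a' t) := fun t => rfl
    have hX2 : ∀ t, der X t = A t (a t, a' t) + (0, f t) := fun t => DFunLike.congr_fun hX t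
    have h1 : IsDeriv a a' := by
      have h2 := hd.clm (ContinuousLinearMap.fst ℝ E E)
      convert! h2 using 1
      ext t
      have := congrArg Prod.fst (hX2 t)
      rw [hA] at this
      simpa using this.symm
    have h2 : IsDeriv a' a'' := hd.clm (ContinuousLinearMap.snd ℝ E E)
    have h3 := eq_toTriple h1 h2 (congrArg Prod.fst h0)
    have hv : a' 0 = v := congrArg Prod.snd h0
    refine ⟨(a' 0, a''), Prod.ext hv ?_⟩
    change bigDelta br T (toTriple E (a' 0, a'')) = f
    rw [← h3]
    ext t
    have h4 : a'' t = _ := congrArg Prod.snd (hX2 t)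
    rw [bigDelta_apply]
    simp only
    rw [h4, hA]
    simp only [Prod.mk_add_mk]
    abel

/-- The solution operator of the initial value problem for `Δ`. -/
def deltaInv (br : E →L[ℝ] E →L[ℝ] E) (T : Quad E) :
    (E × C(unitInterval, E)) →L[ℝ] (E × C(unitInterval, E)) := (deltaIvp br T).inverse

theorem isInvertible_deltaIvp (br : E →L[ℝ] E →L[ℝ] E) (T : Quad E) :
    (deltaIvp br T).IsInvertible := by
  have : CompleteSpace E := FiniteDimensional.complete ℝ E
  exact ⟨ContinuousLinearEquiv.ofBijective (deltaIvp br T)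
    (LinearMap.ker_eq_bot.2 (deltaIvp_bijective br T).1)
    (LinearMap.range_eq_top.2 (deltaIvp_bijective br T).2),
    ContinuousLinearEquiv.coe_ofBijective _ _ _⟩

theorem deltaIvp_deltaInv (br : E →L[ℝ] E →L[ℝ] E) (T : Quad E) (y : E × C(unitInterval, E)) :
    deltaIvp br T (deltaInv br T y) = y := (isInvertible_deltaIvp br T).self_apply_inverse y

theorem deltaInv_deltaIvp (br : E →L[ℝ] E →L[ℝ] E) (T : Quad E) (x : E × C(unitInterval, E)) :
    deltaInv br T (deltaIvp br T x) = x := (isInvertible_deltaIvp br T).inverse_apply_self x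

variable (E) in
/-- The value `ξ(1)`. -/
def endVal : (E × C(unitInterval, E)) →L[ℝ] E :=
  ContinuousMap.evalCLM ℝ (1 : unitInterval) ∘L ContinuousLinearMap.fst ℝ _ _ ∘L toTriple E

theorem prim_const_one (v : E) : prim (constC E v) 1 = v := by
  have : CompleteSpace E := FiniteDimensional.complete ℝ E
  rw [← integral_eq_prim_one]
  change ∫ _ : unitInterval, v = v
  simp

@[simp] theorem endVal_const (v : E) : endVal E (v, 0) = v := by
  change (toTriple E (v, 0)).1 1 = v
  simp [toTriple_apply, prim_const_one]

/-- The element of `LieG00` with a given second derivative, obtained by subtracting a linear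
function. -/
def corr : (E × C(unitInterval, E)) →L[ℝ] LieG00 E :=
  (toTriple E ∘L (ContinuousLinearMap.id ℝ _ - ContinuousLinearMap.inl ℝ _ _ ∘L endVal E)).codRestrict
    (LieG00 E) (fun x => by
      obtain ⟨h1, h2⟩ := toTriple_isDeriv (x - (endVal E x, 0))
      refine ⟨h1, h2, ?_, ?_⟩
      · exact prim_zero _
      · change endVal E (x - (endVal E x, 0)) = 0
        rw [map_sub, endVal_const, sub_self])

theorem coe_corr (x : E × C(unitInterval, E)) :
    (corr x : LieG00 E).1 = toTriple E (x - (endVal E x, 0)) := rfl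

/-- The coordinates `(ξ'(0), ξ'')` of an element of `LieG00`. -/
def lieCrd : LieG00 E →ₗ[ℝ] E × C(unitInterval, E) where
  toFun ξ := (ξ.1.2.1 0, ξ.1.2.2)
  map_add' _ _ := rfl
  map_smul' _ _ := rfl

theorem toTriple_lieCrd (ξ : LieG00 E) : toTriple E (lieCrd ξ) = ξ.1 :=
  (eq_toTriple ξ.2.1 ξ.2.2.1 ξ.2.2.2.1).symm

theorem endVal_lieCrd (ξ : LieG00 E) : endVal E (lieCrd ξ) = 0 := by
  change (toTriple E (lieCrd ξ)).1 1 = 0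
  rw [toTriple_lieCrd]
  exact ξ.2.2.2.2

theorem corr_lieCrd (ξ : LieG00 E) : corr (lieCrd ξ) = ξ := by
  refine Subtype.ext ?_
  have h2 : (((0 : E), (0 : C(unitInterval, E))) : E × C(unitInterval, E)) = 0 := rfl
  rw [coe_corr, endVal_lieCrd, h2, sub_zero, toTriple_lieCrd]

theorem deltaIvp_lieCrd (br : E →L[ℝ] E →L[ℝ] E) (T : Quad E) (ξ : LieG00 E) :
    deltaIvp br T (lieCrd ξ) = (ξ.1.2.1 0, Delta br T ξ) := by
  refine Prod.ext rfl ?_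
  change bigDelta br T (toTriple E (lieCrd ξ)) = _
  rw [toTriple_lieCrd]
  rfl

theorem exists_lieCrd {x : E × C(unitInterval, E)} (hx : endVal E x = 0) :
    ∃ ξ : LieG00 E, lieCrd ξ = x := by
  refine ⟨corr x, ?_⟩
  change ((toTriple E (x - (endVal E x, 0))).2.1 0, (toTriple E (x - (endVal E x, 0))).2.2) = x
  have h2 : (((0 : E), (0 : C(unitInterval, E))) : E × C(unitInterval, E)) = 0 := rfl
  rw [hx, h2, sub_zero, toTriple_apply]
  refine Prod.ext ?_ rfl
  change x.1 + prim x.2 0 = x.1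
  simp

/-- A parametrix of `Δ` is given by the solutions of `Δ ξ = f` with `ξ(0) = 0` and `ξ'(0) = 0`,
corrected by a linear function so as to vanish at `1`. It is an exact inverse on the `ξ` with `ξ'(0)
= 0`, and on the `f` for which no correction is needed; both have finite codimension. -/
theorem isFredholm_Delta (br : E →L[ℝ] E →L[ℝ] E) (T : Quad E) : (Delta br T).IsFredholm := by
  let N : C(unitInterval, E) →L[ℝ] E × C(unitInterval, E) :=
    deltaInv br T ∘L ContinuousLinearMap.inr ℝ _ _
  refine ContinuousLinearMap.IsFredholm.of_isQuasiInverse (v := corr ∘L N) ⟨?_, ?_⟩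
  · let A : LieG00 E →ₗ[ℝ] E := LinearMap.fst ℝ _ _ ∘ₗ lieCrd
    refine LinearMap.FiniteRangeSetoid.equiv_of_eqOn_coFG (A := LinearMap.ker A) ?_ ?_
    · exact LinearMap.ker_coFG_iff_hasFiniteRange.2 LinearMap.HasFiniteRange.of_isNoetherian_rng
    · intro ξ hξ
      have h0 : ξ.1.2.1 0 = 0 := hξ
      change corr (deltaInv br T (0, Delta br T ξ)) = ξ
      have h1 := deltaIvp_lieCrd br T ξ
      rw [h0] at h1
      rw [← h1, deltaInv_deltaIvp, corr_lieCrd]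
  · let A : C(unitInterval, E) →ₗ[ℝ] E := (endVal E ∘L N : C(unitInterval, E) →L[ℝ] E)
    refine LinearMap.FiniteRangeSetoid.equiv_of_eqOn_coFG (A := LinearMap.ker A) ?_ ?_
    · exact LinearMap.ker_coFG_iff_hasFiniteRange.2 LinearMap.HasFiniteRange.of_isNoetherian_rng
    · intro f hf
      have h0 : endVal E (deltaInv br T (0, f)) = 0 := hf
      change Delta br T (corr (deltaInv br T (0, f))) = f
      rw [Delta_eq, coe_corr, h0]
      have h1 := congrArg Prod.snd (deltaIvp_deltaInv br T (0, f))
      have h2 : (((0 : E), (0 : C(unitInterval, E))) : E × C(unitInterval, E)) = 0 := rfl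
      rw [h2, sub_zero]
      exact h1

/-- The endomorphism `v ↦ ξ(1)` of `𝔤`, where `Δ ξ = 0`, `ξ(0) = 0` and `ξ'(0) = v`. -/
def shoot (br : E →L[ℝ] E →L[ℝ] E) (T : Quad E) : E →ₗ[ℝ] E :=
  (endVal E ∘L deltaInv br T ∘L ContinuousLinearMap.inl ℝ _ _ : E →L[ℝ] E)

theorem shoot_apply (br : E →L[ℝ] E →L[ℝ] E) (T : Quad E) (v : E) :
    shoot br T v = endVal E (deltaInv br T (v, 0)) := rfl

/-- The kernel and the cokernel of `Δ` are those of the endomorphism `shoot` of `𝔤`. -/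
theorem index_Delta (br : E →L[ℝ] E →L[ℝ] E) (T : Quad E) :
    Module.finrank ℝ (Delta br T).ker =
      Module.finrank ℝ (C(unitInterval, E) ⧸ (Delta br T).range) := by
  -- the kernel is the kernel of `shoot`
  let k : (Delta br T).ker →ₗ[ℝ] LinearMap.ker (shoot br T) :=
    { toFun := fun ξ => ⟨ξ.1.1.2.1 0, by
        have h1 := deltaIvp_lieCrd br T ξ.1
        have h2 : Delta br T ξ.1 = 0 := ξ.2
        rw [h2] at h1
        rw [LinearMap.mem_ker, shoot_apply, ← h1, deltaInv_deltaIvp, endVal_lieCrd]⟩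
      map_add' := fun _ _ => rfl
      map_smul' := fun _ _ => rfl }
  have hk : Function.Bijective k := by
    constructor
    · rw [injective_iff_map_eq_zero]
      intro ξ hξ
      have h0 : ξ.1.1.2.1 0 = 0 := congrArg Subtype.val hξ
      have h1 := deltaIvp_lieCrd br T ξ.1
      have h2 : Delta br T ξ.1 = 0 := ξ.2
      rw [h2, h0] at h1
      have h3 : lieCrd ξ.1 = 0 := (deltaIvp_bijective br T).1 (h1.trans (map_zero _).symm)
      refine Subtype.ext ?_
      rw [← corr_lieCrd ξ.1, h3, map_zero]
      rfl
    · rintro ⟨v, hv⟩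
      obtain ⟨ξ, hξ⟩ := exists_lieCrd (x := deltaInv br T (v, 0)) hv
      have h1 := deltaIvp_lieCrd br T ξ
      rw [hξ, deltaIvp_deltaInv, Prod.mk.injEq] at h1
      exact ⟨⟨ξ, h1.2.symm⟩, Subtype.ext h1.1.symm⟩
  -- the cokernel is the cokernel of `shoot`
  let c : C(unitInterval, E) →ₗ[ℝ] E ⧸ LinearMap.range (shoot br T) :=
    (LinearMap.range (shoot br T)).mkQ ∘ₗ
      (endVal E ∘L deltaInv br T ∘L ContinuousLinearMap.inr ℝ _ _ : C(unitInterval, E) →L[ℝ] E)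
  have hc : ∀ f, c f = (LinearMap.range (shoot br T)).mkQ (endVal E (deltaInv br T (0, f))) :=
    fun f => rfl
  have hdec : ∀ v f, deltaInv br T (v, f) = deltaInv br T (v, 0) + deltaInv br T (0, f) := by
    intro v f
    rw [← map_add]; simp
  have hcs : Function.Surjective c := by
    intro q
    obtain ⟨w, rfl⟩ := (LinearMap.range (shoot br T)).mkQ_surjective q
    -- `f = Δ(t ↦ t w)`, where `t ↦ t w` has the value `w` at `1`
    set f := (deltaIvp br T (w, 0)).2 with hf
    have h1 : deltaInv br T (w, f) = (w, 0) := deltaInv_deltaIvp br T (w, 0)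
    refine ⟨f, ?_⟩
    rw [hc, ← sub_eq_zero, ← map_sub, Submodule.mkQ_apply, Submodule.Quotient.mk_eq_zero]
    refine ⟨-w, ?_⟩
    have h2 := congrArg (endVal E) h1
    rw [hdec, map_add, endVal_const] at h2
    rw [map_neg, shoot_apply]
    nth_rw 2 [← h2]
    abel
  have hck : LinearMap.ker c = (Delta br T).range := by
    ext f
    rw [LinearMap.mem_ker, hc, Submodule.mkQ_apply, Submodule.Quotient.mk_eq_zero]
    constructor
    · rintro ⟨v, hv⟩
      rw [shoot_apply] at hv
      obtain ⟨ξ, hξ⟩ := exists_lieCrd (x := deltaInv br T (-v, f)) (by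
        rw [hdec, map_add, ← hv, ← map_add, ← map_add, Prod.mk_add_mk, neg_add_cancel, add_zero]
        change endVal E (deltaInv br T 0) = 0
        simp)
      have h1 := deltaIvp_lieCrd br T ξ
      rw [hξ, deltaIvp_deltaInv, Prod.mk.injEq] at h1
      exact ⟨ξ, h1.2.symm⟩
    · rintro ⟨ξ, rfl⟩
      have h1 := deltaIvp_lieCrd br T ξ
      have h2 := congrArg (fun y => endVal E (deltaInv br T y)) h1
      simp only [deltaInv_deltaIvp, endVal_lieCrd] at h2
      rw [hdec, map_add] at h2
      refine ⟨-(ξ.1.2.1 0), ?_⟩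
      rw [map_neg, shoot_apply]
      exact (eq_neg_of_add_eq_zero_right h2.symm).symm
  rw [(LinearEquiv.ofBijective k hk).finrank_eq, ← hck,
    (c.quotKerEquivOfSurjective hcs).finrank_eq]
  have h1 := (shoot br T).finrank_range_add_finrank_ker
  have h2 := (LinearMap.range (shoot br T)).finrank_quotient_add_finrank
  omega

/-- An injective Fredholm operator of index zero is invertible. -/
theorem isInvertible_Delta_iff (br : E →L[ℝ] E →L[ℝ] E) (T : Quad E) :
    (Delta br T).IsInvertible ↔ ∀ ξ, Delta br T ξ = 0 → ξ = 0 := by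
  have : CompleteSpace E := FiniteDimensional.complete ℝ E
  constructor
  · rintro ⟨e, he⟩ ξ hξ
    rw [← he] at hξ
    exact e.injective (hξ.trans (map_zero e).symm)
  · intro h
    have hfin := (isFredholm_Delta br T).finite_coker
    have hk : (Delta br T).ker = ⊥ := LinearMap.ker_eq_bot'.2 h
    have h1 := index_Delta br T
    rw [hk, finrank_bot] at h1
    have hr : (Delta br T).range = ⊤ := by
      have : Module.Finite ℝ (C(unitInterval, E) ⧸ (Delta br T).range) := hfin
      exact Submodule.Quotient.subsingleton_iff.1 (Module.finrank_zero_iff.1 h1.symm)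
    have hq : Topology.IsQuotientMap (Delta br T) :=
      Topology.isQuotientMap_iff_isStrictMap_surjective.2
        ⟨(isFredholm_Delta br T).isStrictMap, LinearMap.range_eq_top.1 hr⟩
    have hi : Function.Injective (Delta br T) := LinearMap.ker_eq_bot.1 hk
    let e := LinearEquiv.ofBijective (Delta br T : LieG00 E →ₗ[ℝ] C(unitInterval, E))
      ⟨hi, LinearMap.range_eq_top.1 hr⟩
    refine ⟨⟨e, (Delta br T).continuous, hq.continuous_iff.2 ?_⟩, rfl⟩
    exact continuous_id.congr fun ξ => (e.symm_apply_apply ξ).symm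

end DeltaOperator

section Metric

universe w
variable {E : Type w} [NormedAddCommGroup E] [NormedSpace ℝ E] [FiniteDimensional ℝ E]

/-! ### The para-quaternionic operators and the indefinite metric -/

variable (E) in
/-- The operator `I` on `𝔤 ⊗ ℝ⁴`. -/
def qI : (Fin 4 → E) →L[ℝ] (Fin 4 → E) :=
  LinearMap.toContinuousLinearMap (𝕜 := ℝ)
    { toFun := fun x => ![x 1, -x 0, -x 3, x 2]
      map_add' := fun x y => by ext i; fin_cases i <;> simp <;> abel
      map_smul' := fun c x => by ext i; fin_cases i <;> simp }

variable (E) in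
/-- The operator `S` on `𝔤 ⊗ ℝ⁴`. -/
def qS : (Fin 4 → E) →L[ℝ] (Fin 4 → E) :=
  LinearMap.toContinuousLinearMap (𝕜 := ℝ)
    { toFun := fun x => ![x 2, x 3, x 0, x 1]
      map_add' := fun x y => by ext i; fin_cases i <;> simp
      map_smul' := fun c x => by ext i; fin_cases i <;> simp }

variable (E) in
/-- The operator `T` on `𝔤 ⊗ ℝ⁴`. -/
def qT : (Fin 4 → E) →L[ℝ] (Fin 4 → E) :=
  LinearMap.toContinuousLinearMap (𝕜 := ℝ)
    { toFun := fun x => ![x 3, -x 2, -x 1, x 0]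
      map_add' := fun x y => by ext i; fin_cases i <;> simp <;> abel
      map_smul' := fun c x => by ext i; fin_cases i <;> simp }

theorem qI_apply (x : Fin 4 → E) : qI E x = ![x 1, -x 0, -x 3, x 2] := rfl
theorem qS_apply (x : Fin 4 → E) : qS E x = ![x 2, x 3, x 0, x 1] := rfl
theorem qT_apply (x : Fin 4 → E) : qT E x = ![x 3, -x 2, -x 1, x 0] := rfl

theorem qI_qI (x : Fin 4 → E) : qI E (qI E x) = -x := by
  ext i; fin_cases i <;> simp [qI_apply]
theorem qS_qS (x : Fin 4 → E) : qS E (qS E x) = x := by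
  ext i; fin_cases i <;> simp [qS_apply]
theorem qT_qT (x : Fin 4 → E) : qT E (qT E x) = x := by
  ext i; fin_cases i <;> simp [qT_apply]
theorem qI_qS (x : Fin 4 → E) : qI E (qS E x) = qT E x := by
  ext i; fin_cases i <;> simp [qI_apply, qS_apply, qT_apply]
theorem qS_qI (x : Fin 4 → E) : qS E (qI E x) = -qT E x := by
  ext i; fin_cases i <;> simp [qI_apply, qS_apply, qT_apply]

/-- The operators `I`, `S`, `T` commute with `q(a, ·)`: this is what makes the solutions of the
linearised and gauge-fixed equations a module over the para-quaternions. -/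
theorem qL_qI {br : E →L[ℝ] E →L[ℝ] E} (h : ∀ x y, br x y = -br y x) (a x : Fin 4 → E) :
    qL br a (qI E x) = qI E (qL br a x) := by
  ext i
  fin_cases i <;> simp [qL_apply, qI_apply, h (x 0), h (x 1), h (x 2), h (x 3)] <;> abel

theorem qL_qS {br : E →L[ℝ] E →L[ℝ] E} (h : ∀ x y, br x y = -br y x) (a x : Fin 4 → E) :
    qL br a (qS E x) = qS E (qL br a x) := by
  ext i
  fin_cases i <;> simp [qL_apply, qS_apply, h (x 0), h (x 1), h (x 2), h (x 3)] <;> abel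

theorem qL_qT {br : E →L[ℝ] E →L[ℝ] E} (h : ∀ x y, br x y = -br y x) (a x : Fin 4 → E) :
    qL br a (qT E x) = qT E (qL br a x) := by
  rw [← qI_qS, ← qI_qS, qL_qI h, qL_qS h]

/-- The inner product of signature `(2n, 2n)` on `𝔤 ⊗ ℝ⁴`. -/
def g4 (B : LinearMap.BilinForm ℝ E) : (Fin 4 → E) →L[ℝ] (Fin 4 → E) →L[ℝ] ℝ :=
  LinearMap.toContinuousBilinearMap (𝕜 := ℝ) (LinearMap.mk₂ ℝ
    (fun x y : Fin 4 → E => B (x 0) (y 0) + B (x 1) (y 1) - B (x 2) (y 2) - B (x 3) (y 3))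
    (fun a b x => by simp; ring) (fun c a x => by simp; ring)
    (fun a b x => by simp; ring) (fun c a x => by simp; ring))

theorem g4_apply (B : LinearMap.BilinForm ℝ E) (x y : Fin 4 → E) :
    g4 B x y = B (x 0) (y 0) + B (x 1) (y 1) - B (x 2) (y 2) - B (x 3) (y 3) := rfl

theorem g4_symm {B : LinearMap.BilinForm ℝ E} (h : ∀ x y, B x y = B y x) (x y : Fin 4 → E) :
    g4 B x y = g4 B y x := by
  simp only [g4_apply, h (x _)]

theorem g4_qI {B : LinearMap.BilinForm ℝ E} (x y : Fin 4 → E) :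
    g4 B (qI E x) y = -g4 B x (qI E y) := by
  simp [g4_apply, qI_apply]; ring

theorem g4_qS {B : LinearMap.BilinForm ℝ E} (x y : Fin 4 → E) :
    g4 B (qS E x) y = -g4 B x (qS E y) := by
  simp [g4_apply, qS_apply]; ring

theorem g4_qT {B : LinearMap.BilinForm ℝ E} (x y : Fin 4 → E) :
    g4 B (qT E x) y = -g4 B x (qT E y) := by
  simp [g4_apply, qT_apply]; ring

/-- The indefinite `L²` metric on functions with values in `𝔤 ⊗ ℝ⁴`. -/
def gC (B : LinearMap.BilinForm ℝ E) : C(unitInterval, Fin 4 → E) →L[ℝ]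
    C(unitInterval, Fin 4 → E) →L[ℝ] ℝ :=
  (ContinuousLinearMap.compL ℝ C(unitInterval, Fin 4 → E) C(unitInterval, ℝ) ℝ
    (ContinuousMap.evalCLM ℝ (1 : unitInterval) ∘L prim)).comp (bilC (g4 B))

theorem gC_apply (B : LinearMap.BilinForm ℝ E) (f h : C(unitInterval, Fin 4 → E)) :
    gC B f h = prim (bilC (g4 B) f h) 1 := rfl

theorem gC_eq_integral (B : LinearMap.BilinForm ℝ E) (f h : C(unitInterval, Fin 4 → E)) :
    gC B f h = ∫ t : unitInterval, g4 B (f t) (h t) := by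
  rw [gC_apply, ← integral_eq_prim_one]
  rfl

theorem metricL2_eq (B : LinearMap.BilinForm ℝ E) (X Y : Quad E) :
    metricL2 B X Y = gC B (ev X) (ev Y) := by
  rw [gC_eq_integral]
  rfl

theorem gC_symm {B : LinearMap.BilinForm ℝ E} (h : ∀ x y, B x y = B y x)
    (x y : C(unitInterval, Fin 4 → E)) : gC B x y = gC B y x := by
  simp only [gC_eq_integral, g4_symm h (x _)]

/-- Pointwise application of an operator. -/
def pw (L : (Fin 4 → E) →L[ℝ] (Fin 4 → E)) :
    C(unitInterval, Fin 4 → E) →L[ℝ] C(unitInterval, Fin 4 → E) :=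
  L.compLeftContinuous ℝ unitInterval

@[simp] theorem pw_apply (L : (Fin 4 → E) →L[ℝ] (Fin 4 → E)) (f : C(unitInterval, Fin 4 → E))
    (t : unitInterval) : pw L f t = L (f t) := rfl

/-- An operator which is skew for the pointwise inner product is skew for the `L²` metric. -/
theorem gC_skew {B : LinearMap.BilinForm ℝ E} {L : (Fin 4 → E) →L[ℝ] (Fin 4 → E)}
    (h : ∀ x y, g4 B (L x) y = -g4 B x (L y)) (x y : C(unitInterval, Fin 4 → E)) :
    gC B (pw L x) y = -gC B x (pw L y) := by
  simp only [gC_eq_integral, pw_apply, h, MeasureTheory.integral_neg]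

/-! ### Infinitesimal gauge transformations -/

/-- The bracket of an element of `𝔤` with a quadruple. -/
def brT (br : E →L[ℝ] E →L[ℝ] E) : E →L[ℝ] (Fin 4 → E) →L[ℝ] (Fin 4 → E) :=
  LinearMap.toContinuousBilinearMap (𝕜 := ℝ) (LinearMap.mk₂ ℝ
    (fun x v => fun i => br x (v i))
    (fun a b x => by ext; simp) (fun c a x => by ext; simp)
    (fun a b x => by ext; simp) (fun c a x => by ext; simp))

@[simp] theorem brT_apply (br : E →L[ℝ] E →L[ℝ] E) (x : E) (v : Fin 4 → E) (i : Fin 4) :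
    brT br x v i = br x (v i) := rfl

variable (E) in
/-- The quadruple `(x, 0, 0, 0)`. -/
def inj0 : E →L[ℝ] (Fin 4 → E) :=
  (consL E : (E × (Fin 3 → E)) →L[ℝ] (Fin 4 → E)) ∘L ContinuousLinearMap.inl ℝ _ _

@[simp] theorem inj0_zero (x : E) : inj0 E x 0 = x := rfl
@[simp] theorem inj0_one (x : E) : inj0 E x 1 = 0 := rfl
@[simp] theorem inj0_two (x : E) : inj0 E x 2 = 0 := rfl
@[simp] theorem inj0_three (x : E) : inj0 E x 3 = 0 := rfl

/-- `[x, ·]` is a derivation of `q`. -/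
theorem brT_qL {br : E →L[ℝ] E →L[ℝ] E}
    (hj : ∀ x y z, br x (br y z) = br (br x y) z + br y (br x z)) (x : E) (a v : Fin 4 → E) :
    brT br x (qL br a v) = qL br (brT br x a) v + qL br a (brT br x v) := by
  ext i
  fin_cases i <;> simp [qL_apply, hj x] <;> abel

theorem qL_inj0 (br : E →L[ℝ] E →L[ℝ] E) (x : E) (v : Fin 4 → E) :
    qL br (inj0 E x) v = brT br x v := by
  ext i
  fin_cases i <;> simp [qL_apply]

theorem g4_brT {br : E →L[ℝ] E →L[ℝ] E} {B : LinearMap.BilinForm ℝ E} (hL : IsMetricLie br B)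
    (x : E) (u v : Fin 4 → E) : g4 B (brT br x u) v = -g4 B u (brT br x v) := by
  simp only [g4_apply, brT_apply, hL.inv]
  ring

/-- The infinitesimal gauge transformation `[x, z] - (x', 0, 0, 0)`, pointwise. -/
def fundP (br : E →L[ℝ] E →L[ℝ] E) (z : Fin 4 → E) (x x' : E) : Fin 4 → E :=
  brT br x z - inj0 E x'

/-- The adjoint of `(x, x') ↦ [x, z] - (x', 0, 0, 0)` is the pair of the gauge-fixing term `q(z,
v)₀` and `-v₀`. -/
theorem g4_fundP {br : E →L[ℝ] E →L[ℝ] E} {B : LinearMap.BilinForm ℝ E} (hL : IsMetricLie br B)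
    (z v : Fin 4 → E) (x x' : E) :
    g4 B (fundP br z x x') v = B x (qL br z v 0) - B x' (v 0) := by
  have h : ∀ a b, B (br x a) b = B x (br a b) := fun a b => by
    rw [hL.skew x a, map_neg, LinearMap.neg_apply, hL.inv, neg_neg]
  simp [fundP, g4_apply, qL_apply, h]

/-- Infinitesimal gauge transformations solve the linearised Nahm--Schmid equations, and the
gauge-fixing operator takes them to `-Δ`. -/
theorem linearised_fundP {br : E →L[ℝ] E →L[ℝ] E} {B : LinearMap.BilinForm ℝ E}
    (hL : IsMetricLie br B) (z z' : Fin 4 → E) (x x' x'' : E)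
    (hz : ∀ i, i ≠ 0 → z' i = -((1 / 2 : ℝ) • qL br z z i)) :
    (brT br x' z + brT br x z' - inj0 E x'') + qL br z (fundP br z x x') =
      -inj0 E (x'' + br (z' 0) x + (2 : ℝ) • br (z 0) x' +
        (br (z 0) (br (z 0) x) + br (z 1) (br (z 1) x) -
      br (z 2) (br (z 2) x) - br (z 3) (br (z 3) x))) := by
  have hs := hL.skew
  have hd := brT_qL hL.jacobi x z z
  have hsym : ∀ i, i ≠ 0 → ∀ u v, qL br u v i = qL br v u i := fun i hi u v => by
    rw [← qN_of_ne br u v hi, ← qN_of_ne br v u hi, qN_symm hs]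
  ext i
  by_cases hi : i = 0
  · subst hi
    simp [fundP, qL_apply, hs x, hs x']
    module
  · have h1 := congrFun hd i
    rw [Pi.add_apply, hsym i hi (brT br x z) z, ← two_smul ℝ, brT_apply] at h1
    have h2 : qL br z (inj0 E x') i = br x' (z i) := by
      rw [hsym i hi, qL_inj0, brT_apply]
    have h3 : br x (z' i) = -qL br z (brT br x z) i := by
      rw [hz i hi, map_neg, map_smul, h1, smul_smul]
      norm_num
    have h4 : ∀ y : E, inj0 E y i = 0 := fun y => by
      fin_cases i
      · exact absurd rfl hi
      all_goals rfl
    simp only [fundP, map_sub, Pi.add_apply, Pi.sub_apply, Pi.neg_apply, brT_apply, h2, h3, h4]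
    abel

end Metric

section Degeneracy

universe w
variable {E : Type w} [NormedAddCommGroup E] [NormedSpace ℝ E] [FiniteDimensional ℝ E]

/-- The infinitesimal gauge transformation `[ζ, z] - (ζ', 0, 0, 0)`. -/
def fundC (br : E →L[ℝ] E →L[ℝ] E) (z : C(unitInterval, Fin 4 → E)) (ζ ζ' : C(unitInterval, E)) :
    C(unitInterval, Fin 4 → E) :=
  bilC (brT br) ζ z - (inj0 E).compLeftContinuous ℝ unitInterval ζ'

theorem fundC_apply (br : E →L[ℝ] E →L[ℝ] E) (z : C(unitInterval, Fin 4 → E))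
    (ζ ζ' : C(unitInterval, E)) (t : unitInterval) :
    fundC br z ζ ζ' t = fundP br (z t) (ζ t) (ζ' t) := rfl

/-- The derivative of `fundC`. -/
def fundD (br : E →L[ℝ] E →L[ℝ] E) (z z' : C(unitInterval, Fin 4 → E))
    (ζ ζ' ζ'' : C(unitInterval, E)) : C(unitInterval, Fin 4 → E) :=
  bilC (brT br) ζ' z + bilC (brT br) ζ z' - (inj0 E).compLeftContinuous ℝ unitInterval ζ''

theorem isDeriv_bilC {V W X : Type*} [NormedAddCommGroup V] [NormedSpace ℝ V]
    [NormedAddCommGroup W] [NormedSpace ℝ W] [NormedAddCommGroup X] [NormedSpace ℝ X]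
    (b : V →L[ℝ] W →L[ℝ] X) {f f' : C(unitInterval, V)} {g g' : C(unitInterval, W)}
    (hf : IsDeriv f f') (hg : IsDeriv g g') :
    IsDeriv (bilC b f g) (bilC b f' g + bilC b f g') := fun t => by
  have := b.hasDerivWithinAt_of_bilinear (hf t) (hg t)
  simpa [projIcc_of_mem zero_le_one t.2, add_comm] using this

theorem isDeriv_fundC (br : E →L[ℝ] E →L[ℝ] E) {z z' : C(unitInterval, Fin 4 → E)}
    {ζ ζ' ζ'' : C(unitInterval, E)} (hz : IsDeriv z z') (h : IsDeriv ζ ζ') (h' : IsDeriv ζ' ζ'') :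
    IsDeriv (fundC br z ζ ζ') (fundD br z z' ζ ζ' ζ'') :=
  (isDeriv_bilC (brT br) h hz).sub (h'.clm (inj0 E))

/-- Integration by parts: the orthogonal complement of the infinitesimal gauge transformations
vanishing at the end points is described by the gauge-fixing equation. -/
theorem gC_fundC {br : E →L[ℝ] E →L[ℝ] E} {B : LinearMap.BilinForm ℝ E} (hL : IsMetricLie br B)
    (z : C(unitInterval, Fin 4 → E)) {ζ ζ' : C(unitInterval, E)} (h : IsDeriv ζ ζ')
    (h0 : ζ 0 = 0) (h1 : ζ 1 = 0) {x x' : C(unitInterval, Fin 4 → E)} (hx : IsDeriv x x') :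
    gC B (fundC br z ζ ζ') x =
      ∫ t : unitInterval, B (ζ t) ((x' + bilC (qL br) z x) t 0) := by
  have : CompleteSpace E := FiniteDimensional.complete ℝ E
  let BL : E →L[ℝ] E →L[ℝ] ℝ := LinearMap.toContinuousBilinearMap (𝕜 := ℝ) B
  let p0 : (Fin 4 → E) →L[ℝ] E := ContinuousLinearMap.proj (R := ℝ) (φ := fun _ : Fin 4 => E) 0
  have h2 := isDeriv_bilC BL h (hx.clm p0)
  have h3 := h2.integral_eq
  have h4 : (bilC BL ζ (p0.compLeftContinuous ℝ unitInterval x)) 1 -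
      (bilC BL ζ (p0.compLeftContinuous ℝ unitInterval x)) 0 = 0 := by
    simp [h0, h1]
  have h3' := h3.trans h4
  rw [gC_eq_integral, ← sub_eq_zero, ← neg_eq_zero, neg_sub]
  refine (MeasureTheory.integral_sub (continuous_integrable
      (bilC BL ζ (p0.compLeftContinuous ℝ unitInterval (x' + bilC (qL br) z x))))
      (continuous_integrable (bilC (g4 B) (fundC br z ζ ζ') x))).symm.trans ?_
  refine Eq.trans ?_ h3'
  congr 1
  funext t
  change B (ζ t) ((x' + bilC (qL br) z x) t 0) - g4 B (fundC br z ζ ζ' t) (x t) =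
    B (ζ' t) (x t 0) + B (ζ t) (x' t 0)
  rw [fundC_apply, g4_fundP hL]
  simp
  abel

/-- The primitive of `f` is monotone and vanishes at both ends. -/
theorem eq_zero_of_integral {f : C(unitInterval, ℝ)} (hf : ∀ t, 0 ≤ f t)
    (h : ∫ t : unitInterval, f t = 0) : f = 0 := by
  have h1 := isDeriv_prim f
  have hmono : MonotoneOn (fun s => prim f (projIcc 0 1 zero_le_one s)) (Icc (0 : ℝ) 1) := by
    refine monotoneOn_of_deriv_nonneg (convex_Icc 0 1)
      (fun t ht => (h1 ⟨t, ht⟩).continuousWithinAt) ?_ ?_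
    · intro t ht
      rw [interior_Icc] at ht
      exact ((h1 ⟨t, ht.1.le, ht.2.le⟩).hasDerivAt
        (Icc_mem_nhds ht.1 ht.2)).differentiableAt.differentiableWithinAt
    · intro t ht
      rw [interior_Icc] at ht
      rw [((h1 ⟨t, ht.1.le, ht.2.le⟩).hasDerivAt (Icc_mem_nhds ht.1 ht.2)).deriv]
      exact hf _
  rw [integral_eq_prim_one] at h
  have hz : prim f = 0 := by
    ext t
    have a1 := hmono (left_mem_Icc.2 zero_le_one) t.2 t.2.1
    have a2 := hmono t.2 (right_mem_Icc.2 zero_le_one) t.2.2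
    simp only [projIcc_left, projIcc_right, projIcc_of_mem zero_le_one t.2] at a1 a2
    have b1 : prim f ⟨0, left_mem_Icc.2 zero_le_one⟩ = 0 := prim_zero f
    have b2 : prim f ⟨1, right_mem_Icc.2 zero_le_one⟩ = 0 := h
    rw [b1] at a1
    rw [b2] at a2
    exact le_antisymm a2 a1
  rw [hz] at h1
  exact h1.unique IsDeriv.zero

theorem eq_zero_of_integral_form {B : LinearMap.BilinForm ℝ E} (hp : ∀ x, x ≠ 0 → 0 < B x x)
    {f : C(unitInterval, E)} (h : ∫ t : unitInterval, B (f t) (f t) = 0) : f = 0 := by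
  let BL : E →L[ℝ] E →L[ℝ] ℝ := LinearMap.toContinuousBilinearMap (𝕜 := ℝ) B
  have h1 : bilC BL f f = 0 := eq_zero_of_integral (fun t => by
    by_cases ht : f t = 0
    · simp [ht]
    · exact (hp _ ht).le) h
  ext t
  by_contra ht
  have h2 : B (f t) (f t) = 0 := DFunLike.congr_fun h1 t
  exact (hp _ ht).ne' h2

/-! ### The degeneracy locus -/

theorem ev_fundField (br : E →L[ℝ] E →L[ℝ] E) (T : Quad E) (ξ : LieG00 E) :
    ev (fundField br T ξ) = fundC br (ev T) ξ.1.1 ξ.1.2.1 := by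
  ext t i
  rw [fundC_apply]
  fin_cases i
  · change -ξ.1.2.1 t + br (ξ.1.1 t) (fn (T 0) t) = br (ξ.1.1 t) (fn (T 0) t) - ξ.1.2.1 t
    abel
  all_goals
    simp [fundField, fundP, fn]

theorem isDeriv_fundC_lie (br : E →L[ℝ] E →L[ℝ] E) (T : Quad E) (ξ : LieG00 E) :
    IsDeriv (fundC br (ev T) ξ.1.1 ξ.1.2.1)
      (fundD br (ev T) (dv T) ξ.1.1 ξ.1.2.1 ξ.1.2.2) :=
  isDeriv_fundC br (isDeriv_ev T) ξ.2.1 ξ.2.2.1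

/-- The Nahm--Schmid equations in the form `Tᵢ' = -½ q(T, T)ᵢ` for `i = 1, 2, 3`. -/
theorem dv_of_solution {br : E →L[ℝ] E →L[ℝ] E} {T : Quad E} (hT : IsSolution br T)
    (t : unitInterval) (i : Fin 4) (hi : i ≠ 0) :
    dv T t i = -((1 / 2 : ℝ) • qL br (ev T t) (ev T t) i) := by
  rw [isSolution_iff, ← restr_nsMap br, eq_incl_restr_iff] at hT
  obtain ⟨j, rfl⟩ := Fin.exists_succ_eq.2 hi
  have h := hT j t
  rw [nsMap, val_crd] at h
  simp only [ContinuousMap.add_apply, ContinuousMap.smul_apply, Pi.add_apply, Pi.smul_apply,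
    bilC_apply, qN_of_ne _ _ _ hi] at h
  exact eq_neg_of_add_eq_zero_left h

/-- The linearised operator takes an infinitesimal gauge transformation to `-Δ`. -/
theorem fundD_add {br : E →L[ℝ] E →L[ℝ] E} {B : LinearMap.BilinForm ℝ E} (hL : IsMetricLie br B)
    {T : Quad E} (hT : IsSolution br T) (ζ ζ' ζ'' : C(unitInterval, E)) :
    fundD br (ev T) (dv T) ζ ζ' ζ'' + bilC (qL br) (ev T) (fundC br (ev T) ζ ζ') =
      -(inj0 E).compLeftContinuous ℝ unitInterval (bigDelta br T (ζ, ζ', ζ'')) := by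
  ext t : 1
  exact linearised_fundP hL (ev T t) (dv T t) (ζ t) (ζ' t) (ζ'' t)
    (fun i hi => dv_of_solution hT t i hi)

/-- On fundamental vector fields, the metric is the bilinear form of `-Δ`. -/
theorem gC_fundC_fundC {br : E →L[ℝ] E →L[ℝ] E} {B : LinearMap.BilinForm ℝ E}
    (hL : IsMetricLie br B) {T : Quad E} (hT : IsSolution br T) (η ξ : LieG00 E) :
    gC B (fundC br (ev T) η.1.1 η.1.2.1) (fundC br (ev T) ξ.1.1 ξ.1.2.1) =
      -∫ t : unitInterval, B (η.1.1 t) (Delta br T ξ t) := by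
  rw [gC_fundC hL _ η.2.1 η.2.2.2.1 η.2.2.2.2 (isDeriv_fundC_lie br T ξ),
    fundD_add hL hT, ← MeasureTheory.integral_neg]
  congr 1
  funext t
  change B (η.1.1 t) (-(bigDelta br T ξ.1 t)) = _
  rw [map_neg]
  rfl

/-- The gauge group acts locally freely: if the fundamental vector field of `ξ` vanishes, then `ξ' =
[ξ, T₀]` and `ξ(0) = 0`, so that `ξ = 0`. -/
theorem fundField_ne_zero (br : E →L[ℝ] E →L[ℝ] E) (T : Quad E) {ξ : LieG00 E} (hξ : ξ ≠ 0) :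
    fundField br T ξ ≠ 0 := by
  have : CompleteSpace E := FiniteDimensional.complete ℝ E
  intro h
  apply hξ
  have h1 : ∀ t, ξ.1.2.1 t = br (ξ.1.1 t) (fn (T 0) t) := fun t => by
    have h2 := congrArg (fun X => fn (X 0) t) h
    change -ξ.1.2.1 t + br (ξ.1.1 t) (fn (T 0) t) = 0 at h2
    exact (neg_add_eq_zero.1 h2)
  let A : C(unitInterval, E →L[ℝ] E) := ⟨fun t => br.flip (fn (T 0) t), by fun_prop⟩
  let X : C1 E := ⟨(ξ.1.1, ξ.1.2.1), ξ.2.1⟩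
  have hX : X = 0 := linearODE_unique A 0 ξ.2.2.2.1
    (by ext t; exact (h1 t).trans (add_zero _).symm) (by ext t; simp [applyC])
  have h3 : ξ.1.1 = 0 := congrArg (fun Y : C1 E => fn Y) hX
  have h4 : ξ.1.2.1 = 0 := congrArg (fun Y : C1 E => der Y) hX
  have h5 := ξ.2.2.1
  rw [h4] at h5
  exact Subtype.ext (Prod.ext h3 (Prod.ext h4 (h5.unique IsDeriv.zero)))

/-- The restriction of the metric to the tangent space of the gauge orbit is degenerate exactly
if `Δ` has a kernel. -/
theorem degenerate_iff {br : E →L[ℝ] E →L[ℝ] E} {B : LinearMap.BilinForm ℝ E}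
    (hL : IsMetricLie br B) {T : Quad E} (hT : IsSolution br T) :
    (∃ X ∈ orbitTangent br T, X ≠ 0 ∧ ∀ Y ∈ orbitTangent br T, metricL2 B X Y = 0) ↔
      ∃ ξ, Delta br T ξ = 0 ∧ ξ ≠ 0 := by
  have : CompleteSpace E := FiniteDimensional.complete ℝ E
  constructor
  · rintro ⟨_, ⟨ξ, rfl⟩, hX, hY⟩
    refine ⟨ξ, ?_, ?_⟩
    · set f := Delta br T ξ with hf
      -- test with the `η` such that `η'' = f`
      set η : LieG00 E := corr ((0 : E), f) with hη
      have hη'' : η.1.2.2 = f := by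
        change (toTriple E (((0 : E), f) - (endVal E (0, f), 0))).2.2 = f
        simp [toTriple_apply]
      have h1 := hY _ ⟨η, rfl⟩
      rw [metricL2_eq, gC_symm hL.symm, ev_fundField, ev_fundField, gC_fundC_fundC hL hT,
        neg_eq_zero, ← hf] at h1
      let BL : E →L[ℝ] E →L[ℝ] ℝ := LinearMap.toContinuousBilinearMap (𝕜 := ℝ) B
      -- integrate `⟨η, η'⟩'` to get `∫ ⟨η', η'⟩ = -∫ ⟨η, f⟩ = 0`, hence `η' = 0` and `f = η'' = 0`
      have h2 := (isDeriv_bilC BL η.2.1 η.2.2.1).integral_eq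
      have h3 : (bilC BL η.1.1 η.1.2.1) 1 - (bilC BL η.1.1 η.1.2.1) 0 = 0 := by
        have e0 := η.2.2.2.1
        have e1 := η.2.2.2.2
        simp only [bilC_apply, e0, e1, map_zero, _root_.zero_apply, sub_zero]
      rw [h3] at h2
      have h4 : ∫ t : unitInterval, B (η.1.2.1 t) (η.1.2.1 t) = 0 := by
        have h5 : (∫ t : unitInterval, B (η.1.2.1 t) (η.1.2.1 t)) +
            ∫ t : unitInterval, B (η.1.1 t) (f t) = 0 := by
          rw [hη''] at h2
          exact (MeasureTheory.integral_add (continuous_integrable (bilC BL η.1.2.1 η.1.2.1))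
            (continuous_integrable (bilC BL η.1.1 f))).symm.trans h2
        rwa [h1, add_zero] at h5
      have h6 := eq_zero_of_integral_form hL.pos h4
      have h7 := η.2.2.1
      rw [h6, hη''] at h7
      exact h7.unique IsDeriv.zero
    · rintro rfl
      apply hX
      refine Quad.ext_ev ?_
      rw [ev_fundField]
      ext t i
      simp [fundC_apply, fundP]
  · rintro ⟨ξ, hξ, hne⟩
    refine ⟨_, ⟨ξ, rfl⟩, fundField_ne_zero br T hne, ?_⟩
    rintro _ ⟨η, rfl⟩
    rw [metricL2_eq, gC_symm hL.symm, ev_fundField, ev_fundField, gC_fundC_fundC hL hT, hξ]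
    simp

end Degeneracy

section Horizontal

universe w
variable {E : Type w} [NormedAddCommGroup E] [NormedSpace ℝ E] [FiniteDimensional ℝ E]

/-! ### The solution map -/

/-- The solution of the Nahm--Schmid equations with the given data, in the coordinates
`(T(0), T')`. -/
def sol (br : E →L[ℝ] E →L[ℝ] E) (f : Data E) : Crd E := Function.invFun (nsMap br) (incl f)

theorem nsMap_sol {br : E →L[ℝ] E →L[ℝ] E} {B : LinearMap.BilinForm ℝ E} (hL : IsMetricLie br B)
    (f : Data E) : nsMap br (sol br f) = incl f :=
  Function.invFun_eq (exists_nsMap_eq hL f)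

theorem restr_sol {br : E →L[ℝ] E →L[ℝ] E} {B : LinearMap.BilinForm ℝ E} (hL : IsMetricLie br B)
    (f : Data E) : restr (sol br f) = f := by
  rw [← restr_nsMap br, nsMap_sol hL, restr_incl]

theorem sol_restr {br : E →L[ℝ] E →L[ℝ] E} {B : LinearMap.BilinForm ℝ E} (hL : IsMetricLie br B)
    {y : Crd E} (hy : nsMap br y = incl (restr y)) : sol br (restr y) = y :=
  nsMap_injective hL.skew ((nsMap_sol hL _).trans hy.symm)

/-- The solution map is smooth, since the Nahm--Schmid map is injective with smooth local inverses.
-/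
theorem contDiff_sol {br : E →L[ℝ] E →L[ℝ] E} {B : LinearMap.BilinForm ℝ E}
    (hL : IsMetricLie br B) : ContDiff ℝ ∞ (sol br) := by
  rw [contDiff_iff_contDiffAt]
  intro f
  obtain ⟨e, he, hs, hc⟩ := exists_nsMap_local hL.skew (sol br f)
  rw [nsMap_sol hL] at hc
  have hi : ContDiff ℝ ∞ (fun f : Data E => incl f) := ContinuousLinearMap.contDiff _
  have h1 : ContDiffAt ℝ ∞ (fun f' : Data E => e.symm (incl f')) f := hc.comp f hi.contDiffAt
  refine h1.congr_of_eventuallyEq ?_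
  have ht := e.map_source hs
  rw [he, nsMap_sol hL] at ht
  filter_upwards [hi.continuous.continuousAt.preimage_mem_nhds (e.open_target.mem_nhds ht)]
    with f' hf'
  refine nsMap_injective hL.skew ?_
  rw [nsMap_sol hL, ← he, e.right_inv hf']

theorem hasFDerivAt_sol {br : E →L[ℝ] E →L[ℝ] E} {B : LinearMap.BilinForm ℝ E}
    (hL : IsMetricLie br B) (f : Data E) :
    HasFDerivAt (sol br) (ivpInv (mat (qN br) (val (sol br f))) ∘L incl) f := by
  have h1 := ((contDiff_sol hL).differentiable (by simp) f).hasFDerivAt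
  have h2 := (hasFDerivAt_nsMap hL.skew (sol br f)).comp f h1
  have h3 : nsMap br ∘ sol br = fun f => incl f := funext fun f => nsMap_sol hL f
  rw [h3] at h2
  have h4 := h2.unique ((incl (E := E)).hasFDerivAt (x := f))
  rwa [← h4, show ivpInv (mat (qN br) (val (sol br f))) ∘L
    (ivp (mat (qN br) (val (sol br f))) ∘L fderiv ℝ (sol br) f) = fderiv ℝ (sol br) f from
      ContinuousLinearMap.ext fun x => ivpInv_ivp _ _]

/-! ### The linearised equations with the gauge-fixing condition -/

/-- The solution `x` of `x' + q(z, x) = p₂`, `x(0) = p₁`. -/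
def lsol (br : E →L[ℝ] E →L[ℝ] E) (z : C(unitInterval, Fin 4 → E)) :
    Crd E →L[ℝ] C(unitInterval, Fin 4 → E) :=
  val ∘L ivpInv (mat (qL br) z)

theorem lsol_zero (br : E →L[ℝ] E →L[ℝ] E) (z : C(unitInterval, Fin 4 → E)) (p : Crd E) :
    lsol br z p 0 = p.1 := by
  have h := congrArg Prod.fst (ivp_ivpInv (mat (qL br) z) p)
  rw [ivp_apply] at h
  exact (val_zero _).trans h

theorem isDeriv_lsol (br : E →L[ℝ] E →L[ℝ] E) (z : C(unitInterval, Fin 4 → E)) (p : Crd E) :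
    IsDeriv (lsol br z p) (p.2 - bilC (qL br) z (lsol br z p)) := by
  have h := congrArg Prod.snd (ivp_ivpInv (mat (qL br) z) p)
  rw [ivp_apply] at h
  have h1 := isDeriv_val (ivpInv (mat (qL br) z) p)
  rwa [show (ivpInv (mat (qL br) z) p).2 = p.2 - bilC (qL br) z (lsol br z p) from
    eq_sub_of_add_eq h] at h1

theorem eq_lsol (br : E →L[ℝ] E →L[ℝ] E) (z : C(unitInterval, Fin 4 → E))
    {x x' : C(unitInterval, Fin 4 → E)} (hx : IsDeriv x x') :
    lsol br z (x 0, x' + bilC (qL br) z x) = x := by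
  have : CompleteSpace E := FiniteDimensional.complete ℝ E
  have hv : val ((x 0, x') : Crd E) = x := by
    ext t : 1
    exact (hx.eq_add_prim t).symm
  have h := ivpInv_ivp (mat (qL br) z) (x 0, x')
  rw [ivp_apply, applyCL_mat, hv] at h
  exact (congrArg val h).trans hv

theorem contDiff_lsol (br : E →L[ℝ] E →L[ℝ] E) :
    ContDiff ℝ ∞ (fun z : C(unitInterval, Fin 4 → E) => lsol br z) := by
  have hm : ContDiff ℝ ∞ (fun z : C(unitInterval, Fin 4 → E) => mat (qL br) z) :=
    ContinuousLinearMap.contDiff _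
  exact contDiff_const.clm_comp (contDiff_ivpInv.comp hm)

/-- Differentiating `x' + q(z, x) = p₂` in the direction `w` gives `ẋ' + q(z, ẋ) = -q(w, x)` with
`ẋ(0) = 0`. -/
theorem hasFDerivAt_lsol (br : E →L[ℝ] E →L[ℝ] E) (z : C(unitInterval, Fin 4 → E)) (p : Crd E) :
    HasFDerivAt (fun z => lsol br z p)
      (-(lsol br z ∘L ContinuousLinearMap.inr ℝ _ _ ∘L
        (bilC (qL br)).flip (lsol br z p))) z := by
  have hm : ContDiff ℝ ∞ (fun z : C(unitInterval, Fin 4 → E) => mat (qL br) z) :=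
    ContinuousLinearMap.contDiff _
  have h0 : ContDiff ℝ ∞ (fun z : C(unitInterval, Fin 4 → E) => ivpInv (mat (qL br) z) p) :=
    (contDiff_ivpInv.comp hm).clm_apply contDiff_const
  have h1 := (h0.differentiable (by simp) z).hasFDerivAt
  set D := fderiv ℝ (fun z : C(unitInterval, Fin 4 → E) => ivpInv (mat (qL br) z) p) z
  have h2 : HasFDerivAt (fun z => lsol br z p) (val ∘L D) z :=
    (val (E := E)).hasFDerivAt.comp z h1
  have h3 := h1.add (((ContinuousLinearMap.inr ℝ (Fin 4 → E)
    C(unitInterval, Fin 4 → E)).hasFDerivAt).comp z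
      ((bilC (qL br)).hasFDerivAt_of_bilinear (hasFDerivAt_id z) h2))
  have h4 : HasFDerivAt (fun _ : C(unitInterval, Fin 4 → E) => p) _ z :=
    h3.congr_of_eventuallyEq (Filter.Eventually.of_forall fun z' => by
      have := ivp_ivpInv (mat (qL br) z') p
      rw [ivp_apply] at this
      refine this.symm.trans ?_
      refine Prod.ext ?_ ?_
      · simp
      · simp [lsol])
  have h5 := h4.unique (hasFDerivAt_const p z)
  have h6 : val ∘L D = -(lsol br z ∘L ContinuousLinearMap.inr ℝ _ _ ∘L
        (bilC (qL br)).flip (lsol br z p)) := by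
    refine ContinuousLinearMap.ext fun w => ?_
    have h7 := DFunLike.congr_fun h5 w
    have h8 : ivp (mat (qL br) z) (D w) = -(0, bilC (qL br) w (lsol br z p)) := by
      rw [eq_neg_iff_add_eq_zero]
      refine Eq.trans ?_ h7
      rw [ivp_apply]
      refine Prod.ext ?_ ?_
      · simp
      · simp [add_assoc]
    have h9 := ivpInv_ivp (mat (qL br) z) (D w)
    rw [h8, map_neg] at h9
    change val (D w) = _
    rw [← h9, map_neg]
    rfl
  rwa [h6] at h2

/-- A pointwise operator commuting with `q(z, ·)` commutes with the solution operator. -/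
theorem lsol_pw {br : E →L[ℝ] E →L[ℝ] E} {L : (Fin 4 → E) →L[ℝ] (Fin 4 → E)}
    (hLq : ∀ a x, qL br a (L x) = L (qL br a x)) (z : C(unitInterval, Fin 4 → E)) (p : Crd E) :
    lsol br z (L p.1, pw L p.2) = pw L (lsol br z p) := by
  have h := (isDeriv_lsol br z p).clm L
  have h1 := eq_lsol br z h
  have h2 : bilC (qL br) z (pw L (lsol br z p)) = pw L (bilC (qL br) z (lsol br z p)) := by
    ext t : 1
    exact hLq _ _
  have h3 : (pw L (lsol br z p)) 0 = L p.1 := by rw [pw_apply, lsol_zero]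
  change lsol br z ((pw L (lsol br z p)) 0, pw L (p.2 - bilC (qL br) z (lsol br z p)) +
    bilC (qL br) z (pw L (lsol br z p))) = _ at h1
  rwa [h3, h2, map_sub, sub_add_cancel] at h1

/-! ### Solutions in temporal gauge -/

/-- The solution of the Nahm--Schmid equations with `T₀ = 0` and `Tᵢ(0) = aᵢ`. -/
def tq (br : E →L[ℝ] E →L[ℝ] E) (a : Fin 3 → E) : Quad E := (crdEquiv E).symm (sol br (0, a))

/-- The values of the solution of the Nahm--Schmid equations with `T₀ = 0` and `Tᵢ(0) = aᵢ`. -/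
def tz (br : E →L[ℝ] E →L[ℝ] E) (a : Fin 3 → E) : C(unitInterval, Fin 4 → E) :=
  val (sol br (0, a))

theorem ev_tq (br : E →L[ℝ] E →L[ℝ] E) (a : Fin 3 → E) : ev (tq br a) = tz br a :=
  ev_crd_symm _

theorem isSolution_tq {br : E →L[ℝ] E →L[ℝ] E} {B : LinearMap.BilinForm ℝ E}
    (hL : IsMetricLie br B) (a : Fin 3 → E) : IsSolution br (tq br a) := by
  rw [isSolution_iff, tq, ContinuousLinearEquiv.apply_symm_apply, restr_sol hL, nsMap_sol hL]

theorem tz_apply_zero {br : E →L[ℝ] E →L[ℝ] E} {B : LinearMap.BilinForm ℝ E}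
    (hL : IsMetricLie br B) (a : Fin 3 → E) (t : unitInterval) : tz br a t 0 = 0 := by
  have : CompleteSpace E := FiniteDimensional.complete ℝ E
  have h := restr_sol hL (0, a)
  rw [restr_apply] at h
  have h1 : (sol br (0, a)).1 0 = 0 := congrArg (fun p : Data E => p.1.1) h
  have h2 : ∀ t, (sol br (0, a)).2 t 0 = 0 := fun t => congrArg (fun p : Data E => p.1.2 t) h
  have h3 := (isDeriv_val (sol br (0, a))).clm
    (ContinuousLinearMap.proj (R := ℝ) (φ := fun _ : Fin 4 => E) 0)
  have h4 : (ContinuousLinearMap.proj (R := ℝ) (φ := fun _ : Fin 4 => E) 0).compLeftContinuous ℝ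
      unitInterval (sol br (0, a)).2 = 0 := by
    ext t
    exact h2 t
  rw [h4] at h3
  have h5 := h3.const_of_zero t
  refine h5.trans ?_
  refine (congrFun (val_zero (sol br (0, a))) 0).trans h1

theorem contDiff_tz {br : E →L[ℝ] E →L[ℝ] E} {B : LinearMap.BilinForm ℝ E}
    (hL : IsMetricLie br B) : ContDiff ℝ ∞ (tz br) := by
  have hv : ContDiff ℝ ∞ (fun y : Crd E => val y) := ContinuousLinearMap.contDiff _
  exact hv.comp ((contDiff_sol hL).comp (contDiff_const.prodMk contDiff_id))

/-- The derivative of the solution in temporal gauge with respect to its initial values. -/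
def dtz (br : E →L[ℝ] E →L[ℝ] E) (a : Fin 3 → E) :
    (Fin 3 → E) →L[ℝ] C(unitInterval, Fin 4 → E) :=
  val ∘L ivpInv (mat (qN br) (tz br a)) ∘L incl ∘L ContinuousLinearMap.inr ℝ _ _

theorem hasFDerivAt_tz {br : E →L[ℝ] E →L[ℝ] E} {B : LinearMap.BilinForm ℝ E}
    (hL : IsMetricLie br B) (a : Fin 3 → E) : HasFDerivAt (tz br) (dtz br a) a := by
  have h1 := (hasFDerivAt_sol hL (0, a)).comp a
    ((hasFDerivAt_const (0 : E × C(unitInterval, E)) a).prodMk (hasFDerivAt_id a))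
  exact (val (E := E)).hasFDerivAt.comp a h1

/-- A solution of the linearised equations (without gauge-fixing) in temporal gauge is the
variation of a family of solutions. -/
theorem eq_dtz (br : E →L[ℝ] E →L[ℝ] E) (a : Fin 3 → E) {x x' : C(unitInterval, Fin 4 → E)}
    (hx : IsDeriv x x') (h0 : x 0 0 = 0) (h : x' + bilC (qN br) (tz br a) x = 0) :
    x = dtz br a (fun i => x 0 i.succ) := by
  have : CompleteSpace E := FiniteDimensional.complete ℝ E
  have hv : val ((x 0, x') : Crd E) = x := by
    ext t : 1
    exact (hx.eq_add_prim t).symm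
  have h1 := ivpInv_ivp (mat (qN br) (tz br a)) (x 0, x')
  rw [ivp_apply, applyCL_mat, hv] at h1
  have h2 : ((x 0, x' + bilC (qN br) (tz br a) x) : Crd E) =
      incl ((0 : E × C(unitInterval, E)), fun i : Fin 3 => x 0 i.succ) := by
    refine Prod.ext ?_ ?_
    · funext i
      refine Fin.cases ?_ (fun i => rfl) i
      exact h0
    · rw [h]
      ext t i
      refine Fin.cases rfl (fun i => rfl) i
  have h3 := congrArg val h1
  rw [hv] at h3
  refine h3.symm.trans ?_
  change val (ivpInv (mat (qN br) (tz br a)) (x 0, x' + bilC (qN br) (tz br a) x)) = _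
  rw [h2]
  rfl

/-- Every solution of the linearised equations (without gauge-fixing) is the sum of a variation
of solutions in temporal gauge and an infinitesimal gauge transformation. -/
theorem eq_dtz_add_fundC {br : E →L[ℝ] E →L[ℝ] E} {B : LinearMap.BilinForm ℝ E}
    (hL : IsMetricLie br B) (a : Fin 3 → E) {x x' : C(unitInterval, Fin 4 → E)}
    (hx : IsDeriv x x') (h : ∀ t i, i ≠ 0 → (x' + bilC (qL br) (tz br a) x) t i = 0)
    {ζ ζ' ζ'' : C(unitInterval, E)} (hζ : IsDeriv ζ ζ') (hζ' : IsDeriv ζ' ζ'')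
    (h0 : ζ 0 = 0) (hx0 : ∀ t, ζ' t = -x t 0) :
    x = dtz br a (fun i => x 0 i.succ) + fundC br (tz br a) ζ ζ' := by
  have hz : IsDeriv (tz br a) (dv (tq br a)) := by
    have := isDeriv_ev (tq br a)
    rwa [ev_tq] at this
  have hf := isDeriv_fundC br hz hζ hζ'
  have hw := hx.sub hf
  have hL1 := fundD_add hL (isSolution_tq hL a) ζ ζ' ζ''
  rw [ev_tq] at hL1
  -- subtracting the infinitesimal gauge transformation kills the entry of index `0`, so `eq_dtz`
  -- applies to the difference
  have hw0 : ∀ t, (x - fundC br (tz br a) ζ ζ') t 0 = 0 := fun t => by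
    simp [fundC_apply, fundP, tz_apply_zero hL, hx0]
  have hw1 : x' - fundD br (tz br a) (dv (tq br a)) ζ ζ' ζ'' +
      bilC (qN br) (tz br a) (x - fundC br (tz br a) ζ ζ') = 0 := by
    ext t i
    by_cases hi : i = 0
    · subst hi
      have h1 := hw.clm (ContinuousLinearMap.proj (R := ℝ) (φ := fun _ : Fin 4 => E) 0)
      have h2 : (ContinuousLinearMap.proj (R := ℝ) (φ := fun _ : Fin 4 => E) 0).compLeftContinuous ℝ
          unitInterval (x - fundC br (tz br a) ζ ζ') = 0 := by
        ext t
        exact hw0 t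
      rw [h2] at h1
      have h3 := DFunLike.congr_fun (h1.unique IsDeriv.zero) t
      have h4 : (x' - fundD br (tz br a) (dv (tq br a)) ζ ζ' ζ'') t 0 = 0 := h3
      rw [ContinuousMap.add_apply, Pi.add_apply, h4, bilC_apply, qN_zero]
      simp
    · have h1 := h t i hi
      have h2 := congrFun (DFunLike.congr_fun hL1 t) i
      have h4 : ∀ y : E, inj0 E y i = 0 := fun y => by
        fin_cases i
        · exact absurd rfl hi
        all_goals rfl
      have h3 : (-(inj0 E).compLeftContinuous ℝ unitInterval
          (bigDelta br (tq br a) (ζ, ζ', ζ''))) t i = 0 := by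
        change -(inj0 E _ i) = 0
        rw [h4, neg_zero]
      rw [h3] at h2
      simp only [ContinuousMap.add_apply, ContinuousMap.sub_apply, Pi.add_apply, Pi.sub_apply,
        bilC_apply, map_sub, qN_of_ne _ _ _ hi] at h1 h2 ⊢
      simp only [ContinuousMap.coe_zero, Pi.zero_apply]
      rw [show ∀ p q r s : E, p - q + (r - s) = (p + r) - (q + s) from fun p q r s => by abel,
        h1, h2, sub_zero]
  have h5 := eq_dtz br a hw (hw0 0) hw1
  have h6 : (fun i : Fin 3 => (x - fundC br (tz br a) ζ ζ') 0 i.succ) = fun i => x 0 i.succ := by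
    funext i
    have : ∀ y : E, inj0 E y i.succ = 0 := fun y => rfl
    simp [fundC_apply, fundP, h0, this]
  rw [h6] at h5
  exact sub_eq_iff_eq_add.1 h5

end Horizontal

section Frame

universe w
variable {E : Type w} [NormedAddCommGroup E] [NormedSpace ℝ E] [FiniteDimensional ℝ E]

/-! ### The horizontal frame -/

/-- The solution `x` of `x' + q(z, x) = 0` with `x(0) = η`. -/
def horC (br : E →L[ℝ] E →L[ℝ] E) (z : C(unitInterval, Fin 4 → E)) :
    (Fin 4 → E) →L[ℝ] C(unitInterval, Fin 4 → E) :=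
  lsol br z ∘L ContinuousLinearMap.inl ℝ _ _

theorem horC_zero (br : E →L[ℝ] E →L[ℝ] E) (z : C(unitInterval, Fin 4 → E)) (η : Fin 4 → E) :
    horC br z η 0 = η := lsol_zero br z _

theorem isDeriv_horC (br : E →L[ℝ] E →L[ℝ] E) (z : C(unitInterval, Fin 4 → E)) (η : Fin 4 → E) :
    IsDeriv (horC br z η) (-bilC (qL br) z (horC br z η)) := by
  have := isDeriv_lsol br z (η, 0)
  rwa [zero_sub] at this

theorem eq_horC (br : E →L[ℝ] E →L[ℝ] E) (z : C(unitInterval, Fin 4 → E))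
    {x x' : C(unitInterval, Fin 4 → E)} (hx : IsDeriv x x') (h : x' + bilC (qL br) z x = 0) :
    x = horC br z (x 0) := by
  have := eq_lsol br z hx
  rw [h] at this
  exact this.symm

theorem horC_pw {br : E →L[ℝ] E →L[ℝ] E} {L : (Fin 4 → E) →L[ℝ] (Fin 4 → E)}
    (hLq : ∀ a x, qL br a (L x) = L (qL br a x)) (z : C(unitInterval, Fin 4 → E)) (η : Fin 4 → E) :
    horC br z (L η) = pw L (horC br z η) := by
  have := lsol_pw hLq z (η, 0)
  rwa [map_zero] at this

/-- The entry of index `0` of a function with values in quadruples. -/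
def comp0 : C(unitInterval, Fin 4 → E) →L[ℝ] C(unitInterval, E) :=
  (ContinuousLinearMap.proj (R := ℝ) (φ := fun _ : Fin 4 => E) 0).compLeftContinuous ℝ unitInterval

@[simp] theorem comp0_apply (x : C(unitInterval, Fin 4 → E)) (t : unitInterval) :
    comp0 x t = x t 0 := rfl

/-- The integral of the entry of index `0`. -/
def int0 : C(unitInterval, Fin 4 → E) →L[ℝ] E :=
  ContinuousMap.evalCLM ℝ (1 : unitInterval) ∘L prim ∘L comp0

theorem int0_apply (x : C(unitInterval, Fin 4 → E)) : int0 x = prim (comp0 x) 1 := rfl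

variable (E) in
/-- The entries of index `1, 2, 3` of a quadruple. -/
def tl : (Fin 4 → E) →L[ℝ] (Fin 3 → E) :=
  ContinuousLinearMap.pi fun i => ContinuousLinearMap.proj i.succ

@[simp] theorem tl_apply (η : Fin 4 → E) (i : Fin 3) : tl E η i = η i.succ := rfl

/-- The horizontal solutions along the solution in temporal gauge with initial values `a`. -/
def hor (br : E →L[ℝ] E →L[ℝ] E) (a : Fin 3 → E) : (Fin 4 → E) →L[ℝ] C(unitInterval, Fin 4 → E) :=
  horC br (tz br a)

/-- The integral of the entry of index `0` of a horizontal solution. -/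
def hc (br : E →L[ℝ] E →L[ℝ] E) (a : Fin 3 → E) : (Fin 4 → E) →L[ℝ] E := int0 ∘L hor br a

/-- The metric in the horizontal frame. -/
def hg (br : E →L[ℝ] E →L[ℝ] E) (B : LinearMap.BilinForm ℝ E) (a : Fin 3 → E) :
    (Fin 4 → E) →L[ℝ] (Fin 4 → E) →L[ℝ] ℝ :=
  ((ContinuousLinearMap.compL ℝ (Fin 4 → E) C(unitInterval, Fin 4 → E) ℝ).flip (hor br a)) ∘L
    gC B ∘L hor br a

theorem hg_apply (br : E →L[ℝ] E →L[ℝ] E) (B : LinearMap.BilinForm ℝ E) (a : Fin 3 → E)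
    (η θ : Fin 4 → E) : hg br B a η θ = gC B (hor br a η) (hor br a θ) := rfl

variable {br : E →L[ℝ] E →L[ℝ] E} {B : LinearMap.BilinForm ℝ E}

theorem contDiff_hor (hL : IsMetricLie br B) : ContDiff ℝ ∞ (hor br) :=
  ((contDiff_lsol br).comp (contDiff_tz hL)).clm_comp contDiff_const

theorem contDiff_hc (hL : IsMetricLie br B) : ContDiff ℝ ∞ (hc br) :=
  contDiff_const.clm_comp (contDiff_hor hL)

theorem contDiff_hg (hL : IsMetricLie br B) : ContDiff ℝ ∞ (hg br B) := by
  refine contDiff_clm_apply_iff.2 fun η => contDiff_clm_apply_iff.2 fun θ => ?_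
  have h : ∀ η, ContDiff ℝ ∞ (fun a => hor br a η) := fun η =>
    (contDiff_hor hL).clm_apply contDiff_const
  exact (gC B).isBoundedBilinearMap.contDiff.comp₂ (h η) (h θ)

theorem hg_symm (hL : IsMetricLie br B) (a : Fin 3 → E) (η θ : Fin 4 → E) :
    hg br B a η θ = hg br B a θ η := gC_symm hL.symm _ _

theorem hg_skew {L : (Fin 4 → E) →L[ℝ] (Fin 4 → E)}
    (hLq : ∀ a x, qL br a (L x) = L (qL br a x)) (h : ∀ x y, g4 B (L x) y = -g4 B x (L y))
    (a : Fin 3 → E) (η θ : Fin 4 → E) : hg br B a (L η) θ = -hg br B a η (L θ) := by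
  rw [hg_apply, hg_apply, hor, horC_pw hLq, horC_pw hLq, gC_skew h]

/-- The infinitesimal gauge transformation `-∫₀ᵗ x₀` which takes `x` to temporal gauge. -/
def gz (x : C(unitInterval, Fin 4 → E)) : C(unitInterval, E) := -prim (comp0 x)

theorem isDeriv_gz (x : C(unitInterval, Fin 4 → E)) : IsDeriv (gz x) (-comp0 x) := by
  have : CompleteSpace E := FiniteDimensional.complete ℝ E
  exact (isDeriv_prim _).neg

theorem gz_zero (x : C(unitInterval, Fin 4 → E)) : gz x 0 = 0 := by simp [gz]

theorem gz_one (x : C(unitInterval, Fin 4 → E)) : gz x 1 = -int0 x := rfl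

/-- A horizontal vector is the variation of the solution in temporal gauge by its initial values
plus the infinitesimal gauge transformation which restores its entry of index `0`. -/
theorem hor_eq (hL : IsMetricLie br B) (a : Fin 3 → E) (η : Fin 4 → E) :
    hor br a η = dtz br a (tl E η) + fundC br (tz br a) (gz (hor br a η)) (-comp0 (hor br a η)) := by
  have h := isDeriv_horC br (tz br a) η
  have h1 := eq_dtz_add_fundC hL a h (fun t i _ => by
    rw [neg_add_cancel]; rfl) (isDeriv_gz _)
    ((h.clm (ContinuousLinearMap.proj (R := ℝ) (φ := fun _ : Fin 4 => E) 0)).neg) (gz_zero _)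
    (fun t => rfl)
  rw [horC_zero] at h1
  exact h1

/-- Horizontal vectors are orthogonal to the infinitesimal gauge transformations. -/
theorem gC_fundC_hor (hL : IsMetricLie br B) (z : C(unitInterval, Fin 4 → E))
    {ζ ζ' : C(unitInterval, E)} (h : IsDeriv ζ ζ')
    (h0 : ζ 0 = 0) (h1 : ζ 1 = 0) (η : Fin 4 → E) :
    gC B (fundC br z ζ ζ') (horC br z η) = 0 := by
  rw [gC_fundC hL z h h0 h1 (isDeriv_horC br z η), neg_add_cancel]
  simp

/-! ### Nondegeneracy -/

variable (E) in
/-- The reflection `(x₀, x₁, -x₂, -x₃)`. -/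
def qR : (Fin 4 → E) →L[ℝ] (Fin 4 → E) :=
  LinearMap.toContinuousLinearMap (𝕜 := ℝ)
    { toFun := fun x => ![x 0, x 1, -x 2, -x 3]
      map_add' := fun x y => by ext i; fin_cases i <;> simp <;> abel
      map_smul' := fun c x => by ext i; fin_cases i <;> simp }

theorem qR_apply (x : Fin 4 → E) : qR E x = ![x 0, x 1, -x 2, -x 3] := rfl

/-- Composed with the reflection the metric is positive definite. -/
theorem eq_zero_of_gC_qR (hL : IsMetricLie br B) {x : C(unitInterval, Fin 4 → E)}
    (h : gC B x (pw (qR E) x) = 0) : x = 0 := by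
  have hnn : ∀ y, 0 ≤ B y y := fun y => by
    by_cases hy : y = 0
    · simp [hy]
    · exact (hL.pos y hy).le
  have hpt : ∀ v : Fin 4 → E, g4 B v (qR E v) =
      B (v 0) (v 0) + B (v 1) (v 1) + B (v 2) (v 2) + B (v 3) (v 3) := fun v => by
    simp [g4_apply, qR_apply]
  rw [gC_eq_integral] at h
  have h1 : bilC (g4 B) x (pw (qR E) x) = 0 := eq_zero_of_integral (fun t => by
    rw [bilC_apply, pw_apply, hpt]
    have := hnn (x t 0)
    have := hnn (x t 1)
    have := hnn (x t 2)
    have := hnn (x t 3)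
    positivity) h
  ext t i
  have h2 := DFunLike.congr_fun h1 t
  rw [bilC_apply, pw_apply, hpt] at h2
  change _ = (0 : ℝ) at h2
  have h3 : B (x t i) (x t i) = 0 := by
    have := hnn (x t 0)
    have := hnn (x t 1)
    have := hnn (x t 2)
    have := hnn (x t 3)
    fin_cases i <;> simp only [Fin.zero_eta, Fin.mk_one, Fin.reduceFinMk] <;> linarith
  by_contra hne
  exact (hL.pos _ hne).ne' h3

/-- Horizontal vectors are orthogonal to the images of the vertical vectors under `I`, `S`, `T`,
since these operators are skew and preserve horizontal vectors. -/
theorem pair_pw_fundC (hL : IsMetricLie br B) {L : (Fin 4 → E) →L[ℝ] (Fin 4 → E)}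
    (hLq : ∀ a x, qL br a (L x) = L (qL br a x)) (h : ∀ x y, g4 B (L x) y = -g4 B x (L y))
    (T : Quad E) (η : Fin 4 → E) (ξ : LieG00 E) :
    gC B (horC br (ev T) η) (pw L (fundC br (ev T) ξ.1.1 ξ.1.2.1)) = 0 := by
  rw [← neg_eq_zero, ← gC_skew h, ← horC_pw hLq, gC_symm hL.symm,
    gC_fundC_hor hL _ ξ.2.1 ξ.2.2.2.1 ξ.2.2.2.2]

/-- Every quadruple is the sum of the images of elements of `𝔤 ⊗ (1, 0, 0, 0)` under `1, I, S, T`.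
-/
theorem para_decomposition (v : Fin 4 → E) :
    v - ContinuousLinearMap.id ℝ _ (-inj0 E (-v 0)) - qI E (-inj0 E (v 1)) -
      qS E (-inj0 E (-v 2)) - qT E (-inj0 E (-v 3)) = 0 := by
  have h : ∀ x : E, inj0 E x = ![x, 0, 0, 0] := fun x => by
    ext i
    fin_cases i <;> rfl
  ext i
  simp only [h, map_neg, Pi.sub_apply, Pi.neg_apply, qI_apply, qS_apply, qT_apply]
  fin_cases i <;> simp

/-- If `Δ` is onto then the metric is nondegenerate on the horizontal space: the quadruples are
the sum of the horizontal space and of the images under `1, I, S, T` of the vertical space. -/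
theorem horC_nondegenerate (hL : IsMetricLie br B) {T : Quad E} (hT : IsSolution br T)
    (hΔ : Function.Surjective (Delta br T)) (η : Fin 4 → E)
    (h : ∀ θ, gC B (horC br (ev T) η) (horC br (ev T) θ) = 0) : η = 0 := by
  set z := ev T with hz
  set x := horC br z η with hx
  have hx' := isDeriv_horC br z η
  -- the reflection `y` of `x` is made horizontal by subtracting a sum of images of vertical vectors
  -- under `1, I, S, T`; these are orthogonal to `x`, so `0 = g(x, y)`, and `x = 0` by positivity
  set y := pw (qR E) x with hy
  have hy' : IsDeriv y (pw (qR E) (-bilC (qL br) z x)) := hx'.clm (qR E)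
  set f := pw (qR E) (-bilC (qL br) z x) + bilC (qL br) z y with hf
  let pr : Fin 4 → C(unitInterval, Fin 4 → E) →L[ℝ] C(unitInterval, E) := fun i =>
    (ContinuousLinearMap.proj (R := ℝ) (φ := fun _ : Fin 4 => E) i).compLeftContinuous ℝ unitInterval
  -- `y' + q(z, y) = f`, and the vertical vector of `ξ` contributes `-Δ ξ` in the entry `0`; the
  -- signs are those of `para_decomposition`
  obtain ⟨ξ0, h0⟩ := hΔ (-pr 0 f)
  obtain ⟨ξ1, h1⟩ := hΔ (pr 1 f)
  obtain ⟨ξ2, h2⟩ := hΔ (-pr 2 f)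
  obtain ⟨ξ3, h3⟩ := hΔ (-pr 3 f)
  have hs := hL.skew
  have key : ∀ (L : (Fin 4 → E) →L[ℝ] (Fin 4 → E)) (_ : ∀ a x, qL br a (L x) = L (qL br a x))
      (ξ : LieG00 E), ∃ w', IsDeriv (pw L (fundC br z ξ.1.1 ξ.1.2.1)) w' ∧
        ∀ t, (w' + bilC (qL br) z (pw L (fundC br z ξ.1.1 ξ.1.2.1))) t =
          L (-(inj0 E (Delta br T ξ t))) := by
    intro L hLq ξ
    refine ⟨_, (isDeriv_fundC_lie br T ξ).clm L, fun t => ?_⟩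
    have e2 : bilC (qL br) z (pw L (fundC br z ξ.1.1 ξ.1.2.1)) =
        pw L (bilC (qL br) z (fundC br z ξ.1.1 ξ.1.2.1)) := by
      ext t : 1
      exact hLq _ _
    rw [e2]
    refine (L.map_add _ _).symm.trans ?_
    exact congrArg (fun y => L (y t)) (fundD_add hL hT ξ.1.1 ξ.1.2.1 ξ.1.2.2)
  obtain ⟨w0, d0, e0⟩ := key (ContinuousLinearMap.id ℝ _) (fun _ _ => rfl) ξ0
  obtain ⟨w1, d1, e1⟩ := key (qI E) (qL_qI hs) ξ1
  obtain ⟨w2, d2, e2⟩ := key (qS E) (qL_qS hs) ξ2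
  obtain ⟨w3, d3, e3⟩ := key (qT E) (qL_qT hs) ξ3
  have hd := (((hy'.sub d0).sub d1).sub d2).sub d3
  have p0 : ∀ t, Delta br T ξ0 t = -f t 0 := fun t => DFunLike.congr_fun h0 t
  have p1 : ∀ t, Delta br T ξ1 t = f t 1 := fun t => DFunLike.congr_fun h1 t
  have p2 : ∀ t, Delta br T ξ2 t = -f t 2 := fun t => DFunLike.congr_fun h2 t
  have p3 : ∀ t, Delta br T ξ3 t = -f t 3 := fun t => DFunLike.congr_fun h3 t
  have hzero := eq_horC br z hd (by
    simp only [map_sub]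
    rw [show ∀ a b c d e a' b' c' d' e' : C(unitInterval, Fin 4 → E),
      a - b - c - d - e + (a' - b' - c' - d' - e') =
      (a + a') - (b + b') - (c + c') - (d + d') - (e + e') from fun _ _ _ _ _ _ _ _ _ _ => by abel,
      ← hf]
    ext t : 1
    simp only [ContinuousMap.sub_apply, e0 t, e1 t, e2 t, e3 t, p0, p1, p2, p3]
    exact para_decomposition (f t))
  set θ := (y - pw (ContinuousLinearMap.id ℝ _) (fundC br z ξ0.1.1 ξ0.1.2.1)
    - pw (qI E) (fundC br z ξ1.1.1 ξ1.1.2.1) - pw (qS E) (fundC br z ξ2.1.1 ξ2.1.2.1)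
    - pw (qT E) (fundC br z ξ3.1.1 ξ3.1.2.1)) 0
  have h4 := h θ
  rw [← hzero] at h4
  have h5 : gC B x (pw (ContinuousLinearMap.id ℝ _) (fundC br z ξ0.1.1 ξ0.1.2.1)) = 0 := by
    have := gC_fundC_hor hL z ξ0.2.1 ξ0.2.2.2.1 ξ0.2.2.2.2 η
    rw [gC_symm hL.symm] at this
    exact this
  simp only [map_sub] at h4
  rw [h5, pair_pw_fundC hL (qL_qI hs) g4_qI T η ξ1, pair_pw_fundC hL (qL_qS hs) g4_qS T η ξ2,
    pair_pw_fundC hL (qL_qT hs) g4_qT T η ξ3] at h4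
  simp only [sub_zero] at h4
  have h6 := eq_zero_of_gC_qR hL h4
  have h7 : x 0 = η := horC_zero br z η
  rw [← h7, h6]
  rfl

end Frame

/-- A nondegenerate symmetric bilinear form with an anti-isometric involution has neutral
signature. -/
theorem exists_neutral_splitting {V : Type*} [AddCommGroup V] [Module ℝ V] [FiniteDimensional ℝ V]
    (b : LinearMap.BilinForm ℝ V) (hs : ∀ x y, b x y = b y x)
    (hn : ∀ x, (∀ y, b x y = 0) → x = 0) (σ : V →ₗ[ℝ] V) (hσ : ∀ x, σ (σ x) = x)
    (hb : ∀ x, b (σ x) (σ x) = -b x x) {k : ℕ} (hk : Module.finrank ℝ V = 2 * k) :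
    ∃ P N : Submodule ℝ V, IsCompl P N ∧ Module.finrank ℝ P = k ∧ Module.finrank ℝ N = k ∧
      (∀ v ∈ P, v ≠ 0 → 0 < b v v) ∧ (∀ v ∈ N, v ≠ 0 → b v v < 0) := by
  obtain ⟨v, hv⟩ := LinearMap.BilinForm.exists_orthogonal_basis (B := b)
    (LinearMap.IsSymm.mk (fun x y => hs x y))
  have hsum : ∀ x : V, b x x = ∑ i, (v.repr x i) ^ 2 * b (v i) (v i) := fun x => by
    conv_lhs => rw [← v.sum_repr x]
    simp only [map_sum, LinearMap.sum_apply, map_smul, LinearMap.smul_apply, smul_eq_mul]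
    refine Finset.sum_congr rfl fun i _ => ?_
    rw [Finset.sum_eq_single i]
    · ring
    · intro j _ hji
      have : b (v i) (v j) = 0 := hv hji.symm
      simp [this, hs (v j)]
    · simp
  have hne : ∀ i, b (v i) (v i) ≠ 0 := fun i hi => by
    apply v.ne_zero i
    refine hn _ fun y => ?_
    rw [← v.sum_repr y, map_sum]
    refine Finset.sum_eq_zero fun j _ => ?_
    by_cases hij : i = j
    · subst hij
      simp [hi]
    · have : b (v i) (v j) = 0 := hv hij
      simp [this]
  -- split an orthogonal basis according to the sign of the form
  let s : Set (Fin (Module.finrank ℝ V)) := {i | 0 < b (v i) (v i)}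
  let P : Submodule ℝ V := Submodule.span ℝ (v '' s)
  let N : Submodule ℝ V := Submodule.span ℝ (v '' sᶜ)
  have hPN : IsCompl P N :=
    v.linearIndependent.isCompl_span_image v.span_eq isCompl_compl
  have hP : ∀ x ∈ P, x ≠ 0 → 0 < b x x := by
    intro x hx hx0
    have h1 : ∀ i, i ∉ s → v.repr x i = 0 := fun i hi => by
      have := (v.mem_span_image (m := x) (s := s)).1 hx
      by_contra h
      exact hi (this (Finsupp.mem_support_iff.2 h))
    have h2 : ∃ i, v.repr x i ≠ 0 := by
      by_contra! h
      apply hx0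
      rw [← v.sum_repr x]
      simp [h]
    obtain ⟨i, hi⟩ := h2
    rw [hsum]
    refine Finset.sum_pos' (fun j _ => ?_) ⟨i, Finset.mem_univ _, ?_⟩
    · by_cases hj : j ∈ s
      · exact mul_nonneg (sq_nonneg _) (le_of_lt hj)
      · simp [h1 j hj]
    · have his : i ∈ s := by
        by_contra h
        exact hi (h1 i h)
      have : 0 < b (v i) (v i) := his
      positivity
  have hN : ∀ x ∈ N, x ≠ 0 → b x x < 0 := by
    intro x hx hx0
    have h1 : ∀ i, i ∈ s → v.repr x i = 0 := fun i hi => by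
      have := (v.mem_span_image (m := x) (s := sᶜ)).1 hx
      by_contra h
      exact this (Finsupp.mem_support_iff.2 h) hi
    have h2 : ∃ i, v.repr x i ≠ 0 := by
      by_contra! h
      apply hx0
      rw [← v.sum_repr x]
      simp [h]
    obtain ⟨i, hi⟩ := h2
    rw [hsum, ← neg_pos, ← Finset.sum_neg_distrib]
    have hneg : ∀ j, j ∉ s → b (v j) (v j) < 0 := fun j hj => lt_of_le_of_ne (not_lt.1 hj) (hne j)
    refine Finset.sum_pos' (fun j _ => ?_) ⟨i, Finset.mem_univ _, ?_⟩
    · by_cases hj : j ∈ s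
      · simp [h1 j hj]
      · nlinarith [sq_nonneg (v.repr x j), hneg j hj]
    · have his : i ∉ s := fun h => hi (h1 i h)
      have h3 := hneg i his
      have h4 : 0 < (v.repr x i) ^ 2 := by positivity
      nlinarith
  have hinj : Function.Injective σ := fun x y h => by rw [← hσ x, h, hσ]
  -- `P` is positive and `σ P` negative, so they are disjoint and `2 dim P ≤ dim V`; likewise for
  -- `N`
  have hσP : Module.finrank ℝ (P.map σ) = Module.finrank ℝ P :=
    (LinearEquiv.finrank_eq (P.equivMapOfInjective σ hinj)).symm
  have hσN : Module.finrank ℝ (N.map σ) = Module.finrank ℝ N :=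
    (LinearEquiv.finrank_eq (N.equivMapOfInjective σ hinj)).symm
  have hdP : Disjoint P (P.map σ) := by
    rw [Submodule.disjoint_def]
    rintro _ h1 ⟨y, hy, rfl⟩
    by_contra h
    have h2 := hP _ h1 h
    have h3 := hP y hy (by rintro rfl; simp at h)
    rw [hb] at h2
    linarith
  have hdN : Disjoint N (N.map σ) := by
    rw [Submodule.disjoint_def]
    rintro _ h1 ⟨y, hy, rfl⟩
    by_contra h
    have h2 := hN _ h1 h
    have h3 := hN y hy (by rintro rfl; simp at h)
    rw [hb] at h2
    linarith
  have c1 := Submodule.finrank_add_finrank_le_of_disjoint hdP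
  have c2 := Submodule.finrank_add_finrank_le_of_disjoint hdN
  have c3 := Submodule.finrank_add_eq_of_isCompl hPN
  exact ⟨P, N, hPN, by omega, by omega, hP, hN⟩

section Connection

universe w
variable {E : Type w} [NormedAddCommGroup E] [NormedSpace ℝ E] [FiniteDimensional ℝ E]
  {br : E →L[ℝ] E →L[ℝ] E} {B : LinearMap.BilinForm ℝ E}

/-! ### Derivatives of the horizontal frame -/

/-- The covariant variation of the horizontal frame: the solution `x` of
`x' + q(z, x) = -q(h η₁, h η₂)` with `x(0) = 0`. -/
def hZ (br : E →L[ℝ] E →L[ℝ] E) (a : Fin 3 → E) :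
    (Fin 4 → E) →L[ℝ] (Fin 4 → E) →L[ℝ] C(unitInterval, Fin 4 → E) :=
  LinearMap.toContinuousLinearMap (𝕜 := ℝ)
    { toFun := fun η₁ => -(lsol br (tz br a) ∘L ContinuousLinearMap.inr ℝ _ _ ∘L
        bilC (qL br) (hor br a η₁) ∘L hor br a)
      map_add' := fun x y => by
        rw [map_add, map_add, ContinuousLinearMap.add_comp, ContinuousLinearMap.comp_add,
          ContinuousLinearMap.comp_add, neg_add]
      map_smul' := fun c x => by
        rw [map_smul, map_smul, ContinuousLinearMap.smul_comp, ContinuousLinearMap.comp_smul,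
          ContinuousLinearMap.comp_smul, RingHom.id_apply, smul_neg] }

theorem hZ_apply (br : E →L[ℝ] E →L[ℝ] E) (a : Fin 3 → E) (η₁ η₂ : Fin 4 → E) :
    hZ br a η₁ η₂ = -lsol br (tz br a) (0, bilC (qL br) (hor br a η₁) (hor br a η₂)) := rfl

/-- The covariant variation commutes with the pointwise operators which commute with `q`. -/
theorem hZ_pw {L : (Fin 4 → E) →L[ℝ] (Fin 4 → E)}
    (hLq : ∀ a x, qL br a (L x) = L (qL br a x)) (a : Fin 3 → E) (η₁ η₂ : Fin 4 → E) :
    hZ br a η₁ (L η₂) = pw L (hZ br a η₁ η₂) := by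
  have h := lsol_pw hLq (tz br a) (0, bilC (qL br) (hor br a η₁) (hor br a η₂))
  rw [hZ_apply, hZ_apply, map_neg, ← h, map_zero]
  congr 2
  refine Prod.ext rfl ?_
  ext t : 1
  change qL br _ (hor br a (L η₂) t) = L (qL br _ _)
  rw [hor, horC_pw hLq, pw_apply, hLq]

theorem isDeriv_hor (br : E →L[ℝ] E →L[ℝ] E) (a : Fin 3 → E) (η : Fin 4 → E) :
    IsDeriv (hor br a η) (-bilC (qL br) (tz br a) (hor br a η)) := isDeriv_horC br _ η

/-- The rotation of a horizontal solution by the gauge transformation `ζ`, as a solution of an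
inhomogeneous equation. -/
theorem lsol_fundC (hL : IsMetricLie br B) (a : Fin 3 → E) (η : Fin 4 → E)
    {ζ ζ' : C(unitInterval, E)} (hζ : IsDeriv ζ ζ') (h0 : ζ 0 = 0) :
    -lsol br (tz br a) (0, bilC (qL br) (fundC br (tz br a) ζ ζ') (hor br a η)) =
      bilC (brT br) ζ (hor br a η) := by
  have h := isDeriv_bilC (brT br) hζ (isDeriv_hor br a η)
  have h1 := eq_lsol br (tz br a) h
  rw [← h1, ← map_neg]
  congr 1
  refine Prod.ext ?_ ?_
  · simp [h0]
  · ext t : 1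
    have h2 := brT_qL hL.jacobi (ζ t) (tz br a t) (hor br a η t)
    simp only [Prod.snd_neg, ContinuousMap.neg_apply, ContinuousMap.add_apply, bilC_apply,
      fundC_apply, fundP, map_sub, map_neg, _root_.sub_apply, qL_inj0, h2]
    abel

theorem hasFDerivAt_hor (hL : IsMetricLie br B) (a : Fin 3 → E) (η : Fin 4 → E) :
    HasFDerivAt (fun a => hor br a η) ((-(lsol br (tz br a) ∘L ContinuousLinearMap.inr ℝ _ _ ∘L
        (bilC (qL br)).flip (hor br a η))) ∘L dtz br a) a :=
  (hasFDerivAt_lsol br (tz br a) (η, 0)).comp a (hasFDerivAt_tz hL a)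

/-- The derivative of the horizontal frame along the tangent vector with frame coordinates `η₁` is
the covariant variation, up to the rotation by the gauge transformation which takes the horizontal
lift of the tangent vector to temporal gauge. -/
theorem fderiv_hor (hL : IsMetricLie br B) (a : Fin 3 → E) (η₁ η₂ : Fin 4 → E) :
    fderiv ℝ (fun a => hor br a η₂) a (tl E η₁) =
      hZ br a η₁ η₂ - bilC (brT br) (gz (hor br a η₁)) (hor br a η₂) := by
  rw [(hasFDerivAt_hor hL a η₂).fderiv, eq_sub_iff_add_eq,
    ← lsol_fundC hL a η₂ (isDeriv_gz _) (gz_zero _), hZ_apply]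
  conv_rhs => rw [hor_eq hL a η₁]
  change -lsol br (tz br a) (0, bilC (qL br) (dtz br a (tl E η₁)) (hor br a η₂)) + _ = _
  rw [← neg_add, ← map_add, Prod.mk_add_mk, add_zero, ← _root_.add_apply, ← map_add]

theorem differentiableAt_hor (hL : IsMetricLie br B) (a : Fin 3 → E) (η : Fin 4 → E) :
    DifferentiableAt ℝ (fun a => hor br a η) a := (hasFDerivAt_hor hL a η).differentiableAt

theorem gC_brT_skew (hL : IsMetricLie br B) (ζ : C(unitInterval, E))
    (x y : C(unitInterval, Fin 4 → E)) :
    gC B (bilC (brT br) ζ x) y = -gC B x (bilC (brT br) ζ y) := by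
  simp only [gC_eq_integral, bilC_apply, g4_brT hL, MeasureTheory.integral_neg]

/-- The rotations in `fderiv_hor` are skew for the metric, so they do not contribute to its
derivative. -/
theorem fderiv_hg (hL : IsMetricLie br B) (a : Fin 3 → E) (η₁ η₂ η₃ : Fin 4 → E) :
    fderiv ℝ (hg br B) a (tl E η₁) η₂ η₃ =
      gC B (hZ br a η₁ η₂) (hor br a η₃) + gC B (hor br a η₂) (hZ br a η₁ η₃) := by
  have h1 := ((contDiff_hg hL).differentiable (by simp) a).hasFDerivAt
  have h2 := (h1.clm_apply (hasFDerivAt_const η₂ a)).clm_apply (hasFDerivAt_const η₃ a)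
  have h3 := (gC B).hasFDerivAt_of_bilinear (differentiableAt_hor hL a η₂).hasFDerivAt
    (differentiableAt_hor hL a η₃).hasFDerivAt
  have h4 := DFunLike.congr_fun (h2.unique h3) (tl E η₁)
  simp only [fderiv_hor hL, ContinuousLinearMap.precompR_apply, ContinuousLinearMap.precompL_apply,
    _root_.add_apply, ContinuousLinearMap.flip_apply, ContinuousLinearMap.comp_apply,
    map_sub, _root_.sub_apply, gC_brT_skew hL] at h4
  simp only [_root_.zero_apply, map_zero, zero_add, ContinuousLinearMap.compL_apply,
    ContinuousLinearMap.comp_apply, fderiv_hor hL, map_sub] at h4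
  rw [h4]
  ring

/-! ### The Christoffel form -/

/-- The metric in the horizontal frame is nondegenerate. -/
def FrameNondeg (br : E →L[ℝ] E →L[ℝ] E) (B : LinearMap.BilinForm ℝ E) (a : Fin 3 → E) : Prop :=
  ∀ η, (∀ θ, hg br B a η θ = 0) → η = 0

/-- The metric in the horizontal frame, as a linear map to the dual space. -/
def hgDual (br : E →L[ℝ] E →L[ℝ] E) (B : LinearMap.BilinForm ℝ E) (a : Fin 3 → E) :
    (Fin 4 → E) →ₗ[ℝ] Module.Dual ℝ (Fin 4 → E) where
  toFun η := (hg br B a η : (Fin 4 → E) →ₗ[ℝ] ℝ)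
  map_add' x y := by ext; simp
  map_smul' c x := by ext; simp

theorem hgDual_bijective {a : Fin 3 → E} (hn : FrameNondeg br B a) :
    Function.Bijective (hgDual br B a) := by
  have hinj : Function.Injective (hgDual br B a) := by
    rw [injective_iff_map_eq_zero]
    intro η hη
    exact hn η fun θ => DFunLike.congr_fun hη θ
  exact ⟨hinj, (LinearMap.injective_iff_surjective_of_finrank_eq_finrank
    (Subspace.dual_finrank_eq).symm).1 hinj⟩

open Classical in
/-- The connection form of the Levi-Civita connection in the horizontal frame, determined by
`⟨Γ(η₁, η₂), θ⟩ = ⟨Z(η₁, η₂), h θ⟩` where the metric is nondegenerate. -/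
def hGam (br : E →L[ℝ] E →L[ℝ] E) (B : LinearMap.BilinForm ℝ E) (a : Fin 3 → E) :
    (Fin 4 → E) →L[ℝ] (Fin 4 → E) →L[ℝ] (Fin 4 → E) :=
  if hn : FrameNondeg br B a then
    LinearMap.toContinuousBilinearMap (𝕜 := ℝ) ((LinearMap.mk₂ ℝ
      (fun η₁ η₂ => ((gC B (hZ br a η₁ η₂) ∘L hor br a : (Fin 4 → E) →L[ℝ] ℝ) :
        Module.Dual ℝ (Fin 4 → E)))
      (fun x y z => by ext; simp) (fun c x y => by ext; simp) (fun x y z => by ext; simp)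
      (fun c x y => by ext; simp)).compr₂
        (LinearEquiv.ofBijective _ (hgDual_bijective hn)).symm.toLinearMap)
  else 0

theorem hg_hGam {a : Fin 3 → E} (hn : FrameNondeg br B a) (η₁ η₂ θ : Fin 4 → E) :
    hg br B a (hGam br B a η₁ η₂) θ = gC B (hZ br a η₁ η₂) (hor br a θ) := by
  rw [hGam, dif_pos hn]
  have h := LinearEquiv.apply_symm_apply (LinearEquiv.ofBijective _ (hgDual_bijective hn))
    ((gC B (hZ br a η₁ η₂) ∘L hor br a : (Fin 4 → E) →L[ℝ] ℝ) : Module.Dual ℝ (Fin 4 → E))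
  exact DFunLike.congr_fun h θ

theorem eq_of_hg {a : Fin 3 → E} (hn : FrameNondeg br B a) {x y : Fin 4 → E}
    (h : ∀ θ, hg br B a x θ = hg br B a y θ) : x = y :=
  (hgDual_bijective hn).1 (LinearMap.ext h)

/-- The connection form commutes with the operators which commute with `q` and are skew. -/
theorem hGam_comm {L : (Fin 4 → E) →L[ℝ] (Fin 4 → E)}
    (hLq : ∀ a x, qL br a (L x) = L (qL br a x)) (h : ∀ x y, g4 B (L x) y = -g4 B x (L y))
    {a : Fin 3 → E} (hn : FrameNondeg br B a) (η₁ η₂ : Fin 4 → E) :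
    hGam br B a η₁ (L η₂) = L (hGam br B a η₁ η₂) := by
  refine eq_of_hg hn fun θ => ?_
  rw [hg_hGam hn, hg_skew hLq h, hg_hGam hn, hZ_pw hLq, gC_skew h, hor, horC_pw hLq]

/-- The connection is metric. -/
theorem fderiv_hg_eq (hL : IsMetricLie br B) {a : Fin 3 → E} (hn : FrameNondeg br B a)
    (η₁ η₂ η₃ : Fin 4 → E) : fderiv ℝ (hg br B) a (tl E η₁) η₂ η₃ =
      hg br B a (hGam br B a η₁ η₂) η₃ + hg br B a η₂ (hGam br B a η₁ η₃) := by
  rw [fderiv_hg hL, hg_symm hL a η₂, hg_hGam hn, hg_hGam hn, gC_symm hL.symm (hor br a η₂)]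

theorem fderiv_hc (hL : IsMetricLie br B) (a : Fin 3 → E) (η₁ η₂ : Fin 4 → E) :
    fderiv ℝ (hc br) a (tl E η₁) η₂ =
      int0 (hZ br a η₁ η₂) - int0 (bilC (brT br) (gz (hor br a η₁)) (hor br a η₂)) := by
  have h1 := ((contDiff_hc hL).differentiable (by simp) a).hasFDerivAt
  have h2 := h1.clm_apply (hasFDerivAt_const η₂ a)
  have h3 := (int0 (E := E)).hasFDerivAt.comp a (differentiableAt_hor hL a η₂).hasFDerivAt
  have h4 := DFunLike.congr_fun (h2.unique h3) (tl E η₁)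
  have h5 : fderiv ℝ (hc br) a (tl E η₁) η₂ =
      int0 (fderiv ℝ (fun a => hor br a η₂) a (tl E η₁)) := by
    refine Eq.trans ?_ h4
    simp
  rw [h5, fderiv_hor hL, map_sub]

/-- The antisymmetric part of the covariant variation is an infinitesimal gauge transformation. -/
theorem hZ_sub (hL : IsMetricLie br B) (a : Fin 3 → E) (η₁ η₂ : Fin 4 → E) :
    ∃ ζ ζ' : C(unitInterval, E), (∃ ζ'', IsDeriv ζ' ζ'') ∧ IsDeriv ζ ζ' ∧ ζ 0 = 0 ∧
      ζ 1 = int0 (hZ br a η₂ η₁) - int0 (hZ br a η₁ η₂) ∧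
      hZ br a η₁ η₂ - hZ br a η₂ η₁ = fundC br (tz br a) ζ ζ' := by
  have h1 := isDeriv_lsol br (tz br a) (0, bilC (qL br) (hor br a η₂) (hor br a η₁) -
    bilC (qL br) (hor br a η₁) (hor br a η₂))
  have h2 : lsol br (tz br a) (0, bilC (qL br) (hor br a η₂) (hor br a η₁) -
    bilC (qL br) (hor br a η₁) (hor br a η₂)) = hZ br a η₁ η₂ - hZ br a η₂ η₁ := by
    rw [hZ_apply, hZ_apply, sub_neg_eq_add, neg_add_eq_sub, ← map_sub, Prod.mk_sub_mk, sub_zero]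
  rw [h2] at h1
  set x := hZ br a η₁ η₂ - hZ br a η₂ η₁ with hx
  have hx0 : x 0 = 0 := by
    rw [← h2, lsol_zero]
  have h3 := eq_dtz_add_fundC hL a h1 (fun t i hi => by
    rw [sub_add_cancel]
    change qL br _ _ i - qL br _ _ i = 0
    rw [← qN_of_ne br _ _ hi, ← qN_of_ne br _ _ hi, qN_symm hL.skew, sub_self])
    (isDeriv_gz x)
    ((h1.clm (ContinuousLinearMap.proj (R := ℝ) (φ := fun _ : Fin 4 => E) 0)).neg) (gz_zero x)
    (fun t => rfl)
  have h4 : (fun i : Fin 3 => x 0 i.succ) = 0 := by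
    rw [hx0]
    rfl
  rw [h4, map_zero, zero_add] at h3
  refine ⟨gz x, -comp0 x, ⟨_, (h1.clm
    (ContinuousLinearMap.proj (R := ℝ) (φ := fun _ : Fin 4 => E) 0)).neg⟩, isDeriv_gz x,
    gz_zero x, ?_, h3⟩
  rw [gz_one, hx, map_sub, neg_sub]

/-- Integration by parts. -/
theorem int0_brT (hL : IsMetricLie br B) (x y : C(unitInterval, Fin 4 → E)) :
    int0 (bilC (brT br) (gz x) y) - int0 (bilC (brT br) (gz y) x) =
      -br (int0 x) (int0 y) := by
  have : CompleteSpace E := FiniteDimensional.complete ℝ E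
  have h := isDeriv_bilC br (isDeriv_gz x) (isDeriv_gz y)
  have h1 := h.eq_add_prim 1
  rw [bilC_apply, bilC_apply, gz_zero, gz_zero, gz_one, gz_one, map_zero, zero_add] at h1
  rw [int0_apply, int0_apply, ← ContinuousMap.sub_apply, ← map_sub]
  have h2 : comp0 (bilC (brT br) (gz x) y) - comp0 (bilC (brT br) (gz y) x) =
      -(bilC br (-comp0 x) (gz y) + bilC br (gz x) (-comp0 y)) := by
    ext t
    simp [hL.skew (x t 0)]
    abel
  rw [h2, map_neg, ContinuousMap.neg_apply, ← h1]
  simp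

/-- The connection is torsion-free. -/
theorem torsion_hGam (hL : IsMetricLie br B) {a : Fin 3 → E} (hn : FrameNondeg br B a)
    (hA : ∀ p : E × (Fin 3 → E), ∃ κ, -hc br a κ = p.1 ∧ tl E κ = p.2) (η₁ η₂ : Fin 4 → E) :
    -hc br a (hGam br B a η₁ η₂ - hGam br B a η₂ η₁) = br (hc br a η₁) (hc br a η₂)
      - fderiv ℝ (hc br) a (tl E η₁) η₂ + fderiv ℝ (hc br) a (tl E η₂) η₁ ∧
    tl E (hGam br B a η₁ η₂ - hGam br B a η₂ η₁) = 0 := by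
  obtain ⟨ζ, ζ', ⟨ζ'', hζ'⟩, hζ, h0, h1, hZ⟩ := hZ_sub hL a η₁ η₂
  -- the horizontal vector with initial values `0` whose gauge transformation has the end value
  -- `ζ(1)`
  obtain ⟨κ, hκ1, hκ2⟩ := hA (ζ 1, 0)
  -- the horizontal vector of `κ` differs from `Z(η₁, η₂) - Z(η₂, η₁)` by an infinitesimal gauge
  -- transformation which vanishes at both ends, hence is orthogonal to the horizontal vectors
  have hκ : hGam br B a η₁ η₂ - hGam br B a η₂ η₁ = κ := by
    refine eq_of_hg hn fun θ => ?_
    rw [map_sub, _root_.sub_apply, hg_hGam hn, hg_hGam hn, ← _root_.sub_apply, ← map_sub, hZ,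
      hg_apply, ← sub_eq_zero, ← _root_.sub_apply, ← map_sub]
    have h2 := hor_eq hL a κ
    rw [hκ2, map_zero, zero_add] at h2
    have h3 : fundC br (tz br a) ζ ζ' - hor br a κ =
        fundC br (tz br a) (ζ - gz (hor br a κ)) (ζ' - -comp0 (hor br a κ)) := by
      conv_lhs => rw [h2]
      simp only [fundC, map_sub, _root_.sub_apply]
      abel
    rw [h3]
    refine gC_fundC_hor hL _ (hζ.sub (isDeriv_gz _)) (by simp [h0, gz_zero]) ?_ θ
    rw [ContinuousMap.sub_apply, gz_one]
    exact sub_eq_zero.2 hκ1.symm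
  rw [hκ]
  refine ⟨?_, hκ2⟩
  rw [hκ1, fderiv_hc hL, fderiv_hc hL, h1]
  have h2 := int0_brT hL (hor br a η₁) (hor br a η₂)
  have h3 : br (hc br a η₁) (hc br a η₂) = br (int0 (hor br a η₁)) (int0 (hor br a η₂)) := rfl
  rw [h3, ← neg_neg (br _ _), ← h2]
  abel_nf

end Connection

section HyperFrame

open Bundle

variable {F : Type*} [NormedAddCommGroup F] [NormedSpace ℝ F] [FiniteDimensional ℝ F]
  {V : Type*} [NormedAddCommGroup V] [NormedSpace ℝ V] [FiniteDimensional ℝ V]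
  {M : Type*} [TopologicalSpace M] [ChartedSpace F M] [IsManifold 𝓘(ℝ, F) ∞ M]

/-! ### Hypersymplectic structures from adapted frames -/

variable (F V M) in
/-- A frame of the tangent bundle of `M`, parametrised by `V`, which is given by one and the same
function `A` in all charts of `M`, together with a hypersymplectic structure which is constant
along the frame, except for the metric, and the connection form `Γ` of its Levi-Civita
connection. -/
structure HyperFrame where
  /-- The frame, as a function of the coordinates. -/
  A : F → V →L[ℝ] F
  /-- The metric in the frame, as a function of the coordinates. -/
  m : F → V →L[ℝ] V →L[ℝ] ℝ
  /-- The connection form in the frame. -/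
  Γ : M → V →L[ℝ] V →L[ℝ] V
  /-- The endomorphism `I` in the frame. -/
  I : V →L[ℝ] V
  /-- The endomorphism `S` in the frame. -/
  S : V →L[ℝ] V
  /-- The endomorphism `T` in the frame. -/
  T : V →L[ℝ] V
  inv : ∀ x : M, (A (chartAt F x x)).IsInvertible
  smooth_A : ∀ x : M, ContDiffAt ℝ ∞ A (chartAt F x x)
  smooth_m : ∀ x : M, ContDiffAt ℝ ∞ m (chartAt F x x)
  /-- The frame transforms as vector fields do under changes of charts. -/
  trans_A : ∀ x₀ x : M, x ∈ (chartAt F x₀).source → ∀ η,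
    fderiv ℝ (chartAt F x₀ ∘ (chartAt F x).symm) (chartAt F x x) (A (chartAt F x x) η) =
      A (chartAt F x₀ x) η
  /-- The components of the metric in the frame do not depend on the chart. -/
  trans_m : ∀ x₀ x : M, x ∈ (chartAt F x₀).source → m (chartAt F x₀ x) = m (chartAt F x x)
  m_symm : ∀ (x : M) η θ, m (chartAt F x x) η θ = m (chartAt F x x) θ η
  m_signature : ∀ x : M, ∃ P N : Submodule ℝ V, IsCompl P N ∧
    2 * Module.finrank ℝ P = Module.finrank ℝ V ∧ 2 * Module.finrank ℝ N = Module.finrank ℝ V ∧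
    (∀ v ∈ P, v ≠ 0 → 0 < m (chartAt F x x) v v) ∧ (∀ v ∈ N, v ≠ 0 → m (chartAt F x x) v v < 0)
  I_sq : ∀ v, I (I v) = -v
  S_sq : ∀ v, S (S v) = v
  T_sq : ∀ v, T (T v) = v
  I_S : ∀ v, I (S v) = T v
  S_I : ∀ v, S (I v) = -T v
  I_skew : ∀ (x : M) v w, m (chartAt F x x) (I v) w = -m (chartAt F x x) v (I w)
  S_skew : ∀ (x : M) v w, m (chartAt F x x) (S v) w = -m (chartAt F x x) v (S w)
  T_skew : ∀ (x : M) v w, m (chartAt F x x) (T v) w = -m (chartAt F x x) v (T w)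
  I_comm : ∀ x v w, Γ x v (I w) = I (Γ x v w)
  S_comm : ∀ x v w, Γ x v (S w) = S (Γ x v w)
  T_comm : ∀ x v w, Γ x v (T w) = T (Γ x v w)
  /-- The connection is metric. -/
  metric : ∀ (x : M) v w u, fderiv ℝ m (chartAt F x x) (A (chartAt F x x) v) w u =
    m (chartAt F x x) (Γ x v w) u + m (chartAt F x x) w (Γ x v u)
  /-- The connection is torsion-free: the left-hand side is the Lie bracket of two frame fields. -/
  torsion : ∀ (x : M) v w, fderiv ℝ A (chartAt F x x) (A (chartAt F x x) v) w -
    fderiv ℝ A (chartAt F x x) (A (chartAt F x x) w) v = A (chartAt F x x) (Γ x v w - Γ x w v)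

namespace HyperFrame

variable (h : HyperFrame F V M)

/-- The frame at a point, as an isomorphism onto the tangent space. -/
def fr (x : M) : V ≃L[ℝ] TangentSpace 𝓘(ℝ, F) x := (h.inv x).choose

theorem fr_apply (x : M) (η : V) : h.fr x η = h.A (chartAt F x x) η :=
  DFunLike.congr_fun (h.inv x).choose_spec η

/-- The coordinate changes of the tangent bundle are the derivatives of the changes of charts. -/
theorem tangentCoordChange_eq (x₀ x : M) : tangentCoordChange 𝓘(ℝ, F) x x₀ x =
    fderiv ℝ (chartAt F x₀ ∘ (chartAt F x).symm) (chartAt F x x) := by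
  rw [tangentCoordChange_def, modelWithCornersSelf_coe, range_id, fderivWithin_univ]
  rfl

/-- The trivialisation of the tangent bundle takes the frame to its expression in the chart. -/
theorem triv_fr {x₀ x : M} (hx : x ∈ (chartAt F x₀).source) (η : V) :
    (trivializationAt F (TangentSpace 𝓘(ℝ, F)) x₀).continuousLinearMapAt ℝ x (h.fr x η) =
      h.A (chartAt F x₀ x) η := by
  have h1 := TangentBundle.continuousLinearMapAt_trivializationAt_eq_core (I := 𝓘(ℝ, F)) hx
  refine (DFunLike.congr_fun h1 _).trans ?_
  have h2 := DFunLike.congr_fun (tangentCoordChange_eq (F := F) x₀ x) (h.fr x η)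
  refine h2.trans ?_
  rw [h.fr_apply]
  exact h.trans_A x₀ x hx η

theorem mem_baseSet {x₀ x : M} (hx : x ∈ (chartAt F x₀).source) :
    x ∈ (trivializationAt F (TangentSpace 𝓘(ℝ, F)) x₀).baseSet := hx

theorem isInvertible {x₀ x : M} (hx : x ∈ (chartAt F x₀).source) :
    (h.A (chartAt F x₀ x)).IsInvertible := by
  refine ⟨(h.fr x).trans ((trivializationAt F (TangentSpace 𝓘(ℝ, F)) x₀).continuousLinearEquivAt ℝ x
    (mem_baseSet hx)), ?_⟩
  refine ContinuousLinearMap.ext fun η => ?_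
  exact (congrFun (Trivialization.coe_continuousLinearEquivAt_eq _ (mem_baseSet hx)) _).trans (h.triv_fr hx η)

/-- The inverse of the trivialisation, in terms of the frame. -/
theorem symmL_apply {x₀ x : M} (hx : x ∈ (chartAt F x₀).source) (v : F) :
    (trivializationAt F (TangentSpace 𝓘(ℝ, F)) x₀).symmL ℝ x v =
      h.fr x ((h.A (chartAt F x₀ x)).inverse v) := by
  have h1 := h.triv_fr hx ((h.A (chartAt F x₀ x)).inverse v)
  rw [(h.isInvertible hx).self_apply_inverse] at h1
  conv_lhs => rw [← h1]
  exact Trivialization.symmL_continuousLinearMapAt _ (mem_baseSet hx) _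

theorem contDiffAt_inverse (x : M) :
    ContDiffAt ℝ ∞ (fun p => (h.A p).inverse) (chartAt F x x) := by
  obtain ⟨e, he⟩ := h.inv x
  have h1 := contDiffAt_map_inverse (n := ∞) e
  rw [he] at h1
  exact h1.comp _ (h.smooth_A x)

/-- A function which is smooth in the chart at the point is smooth. -/
theorem contMDiffAt_of_chart {W : Type*} [NormedAddCommGroup W] [NormedSpace ℝ W] {f : M → W}
    {g : F → W} {x : M} (hg : ContDiffAt ℝ ∞ g (chartAt F x x))
    (hf : ∀ᶠ y in nhds x, f y = g (chartAt F x y)) : ContMDiffAt 𝓘(ℝ, F) 𝓘(ℝ, W) ∞ f x := by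
  have h1 : ContMDiffAt 𝓘(ℝ, F) 𝓘(ℝ, F) ∞ (chartAt F x) x :=
    contMDiffAt_extChartAt (I := 𝓘(ℝ, F)) (n := ∞) (x := x)
  exact (hg.contMDiffAt.comp x h1).congr_of_eventuallyEq hf

/-! ### Endomorphisms -/

/-- The endomorphism field which is constant in the frame. -/
def endo (L : V →L[ℝ] V) (x : M) : TangentSpace 𝓘(ℝ, F) x →L[ℝ] TangentSpace 𝓘(ℝ, F) x :=
  (h.fr x : V →L[ℝ] TangentSpace 𝓘(ℝ, F) x) ∘L L ∘L ((h.fr x).symm : _ →L[ℝ] V)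

theorem endo_apply (L : V →L[ℝ] V) (x : M) (v : TangentSpace 𝓘(ℝ, F) x) :
    h.endo L x v = h.fr x (L ((h.fr x).symm v)) := rfl

theorem endo_smooth (L : V →L[ℝ] V) :
    ContMDiff 𝓘(ℝ, F) (𝓘(ℝ, F).prod 𝓘(ℝ, F →L[ℝ] F)) ∞ (fun x => TotalSpace.mk' (F →L[ℝ] F)
      (E := fun y : M => TangentSpace 𝓘(ℝ, F) y →L[ℝ] TangentSpace 𝓘(ℝ, F) y) x (h.endo L x)) := by
  intro x
  rw [contMDiffAt_hom_bundle]
  refine ⟨contMDiffAt_id, ?_⟩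
  -- in the trivialisation the endomorphism is `A L A⁻¹`
  refine contMDiffAt_of_chart (g := fun p => h.A p ∘L L ∘L (h.A p).inverse)
    ((h.smooth_A x).clm_comp (contDiffAt_const.clm_comp (h.contDiffAt_inverse x))) ?_
  filter_upwards [(chartAt F x).open_source.mem_nhds (mem_chart_source F x)] with y hy
  ext v
  change (trivializationAt F (TangentSpace 𝓘(ℝ, F)) x).continuousLinearMapAt ℝ y
    (h.endo L y ((trivializationAt F (TangentSpace 𝓘(ℝ, F)) x).symmL ℝ y v)) = _
  rw [h.symmL_apply hy, endo_apply, ContinuousLinearEquiv.symm_apply_apply, h.triv_fr hy]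
  rfl

/-! ### The metric -/

/-- The pullback of a bilinear form by a linear map. -/
def bilPull (b : V →L[ℝ] V →L[ℝ] ℝ) (i : F →L[ℝ] V) : F →L[ℝ] F →L[ℝ] ℝ :=
  ((ContinuousLinearMap.compL ℝ F V ℝ).flip i) ∘L b ∘L i

/-- The metric on the tangent spaces. -/
def met (x : M) : TangentSpace 𝓘(ℝ, F) x →L[ℝ] TangentSpace 𝓘(ℝ, F) x →L[ℝ] ℝ :=
  (bilPull (h.m (chartAt F x x)) (h.A (chartAt F x x)).inverse : F →L[ℝ] F →L[ℝ] ℝ)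

theorem inverse_apply (x : M) (v : TangentSpace 𝓘(ℝ, F) x) :
    (h.A (chartAt F x x)).inverse v = (h.fr x).symm v := by
  have h1 := h.fr_apply x ((h.fr x).symm v)
  rw [ContinuousLinearEquiv.apply_symm_apply] at h1
  have h2 := (h.inv x).inverse_apply_self ((h.fr x).symm v)
  exact (congrArg (h.A (chartAt F x x)).inverse h1).trans h2

theorem met_apply (x : M) (v w : TangentSpace 𝓘(ℝ, F) x) :
    h.met x v w = h.m (chartAt F x x) ((h.fr x).symm v) ((h.fr x).symm w) :=
  congrArg₂ (fun a b => h.m (chartAt F x x) a b) (h.inverse_apply x v) (h.inverse_apply x w)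

theorem met_smooth : ContMDiff 𝓘(ℝ, F) (𝓘(ℝ, F).prod 𝓘(ℝ, F →L[ℝ] F →L[ℝ] ℝ)) ∞
    (fun x => TotalSpace.mk' (F →L[ℝ] F →L[ℝ] ℝ)
      (E := fun y : M => TangentSpace 𝓘(ℝ, F) y →L[ℝ] TangentSpace 𝓘(ℝ, F) y →L[ℝ] ℝ) x
        (h.met x)) := by
  intro x
  rw [contMDiffAt_hom_bundle]
  refine ⟨contMDiffAt_id, ?_⟩
  refine contMDiffAt_of_chart
    (g := fun p => bilPull (h.m p) (h.A p).inverse) ?_ ?_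
  · have hi := h.contDiffAt_inverse x
    have hc : ContDiff ℝ ∞ fun i : F →L[ℝ] V => (ContinuousLinearMap.compL ℝ F V ℝ).flip i :=
      ContinuousLinearMap.contDiff _
    exact (hc.contDiffAt.comp _ hi).clm_comp ((h.smooth_m x).clm_comp hi)
  filter_upwards [(chartAt F x).open_source.mem_nhds (mem_chart_source F x)] with y hy
  ext v w
  refine (inCoordinates_apply_eq₂ (mem_baseSet hy) (mem_baseSet hy) (mem_univ y)).trans ?_
  have e1 := h.symmL_apply hy v
  have e2 := h.symmL_apply hy w
  refine (DFunLike.congr_fun (Bundle.Trivial.linearMapAt_trivialization ℝ M ℝ y) _).trans ?_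
  rw [Trivialization.symmL_apply _ (mem_baseSet hy)] at e1 e2
  rw [LinearMap.id_apply, e1, e2, met_apply, ContinuousLinearEquiv.symm_apply_apply,
    ContinuousLinearEquiv.symm_apply_apply, ← h.trans_m x y hy]
  rfl

theorem met_signature {k : ℕ} (hk : Module.finrank ℝ V = 4 * k) (x : M) :
    ∃ P N : Submodule ℝ (TangentSpace 𝓘(ℝ, F) x), IsCompl P N ∧
    Module.finrank ℝ P = 2 * k ∧ Module.finrank ℝ N = 2 * k ∧
    (∀ v ∈ P, v ≠ 0 → 0 < h.met x v v) ∧ (∀ v ∈ N, v ≠ 0 → h.met x v v < 0) := by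
  obtain ⟨P, N, h1, h2, h3, h4, h5⟩ := h.m_signature x
  let e := (h.fr x).toLinearEquiv
  refine ⟨P.map (e : V →ₗ[ℝ] TangentSpace 𝓘(ℝ, F) x), N.map (e : V →ₗ[ℝ] TangentSpace 𝓘(ℝ, F) x),
    ?_, ?_, ?_, ?_, ?_⟩
  · exact (OrderIso.isCompl_iff (Submodule.orderIsoMapComap e)).1 h1
  · rw [LinearEquiv.finrank_map_eq]
    omega
  · rw [LinearEquiv.finrank_map_eq]
    omega
  · rintro _ ⟨v, hv, rfl⟩ hne
    have hne' : v ≠ 0 := by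
      rintro rfl
      exact hne (map_zero _)
    have := h4 v hv hne'
    rw [met_apply]
    have e1 : (h.fr x).symm (e v) = v := (h.fr x).symm_apply_apply v
    exact (congrArg₂ (fun a b => h.m (chartAt F x x) a b) e1 e1).symm ▸ this
  · rintro _ ⟨v, hv, rfl⟩ hne
    have hne' : v ≠ 0 := by
      rintro rfl
      exact hne (map_zero _)
    have := h5 v hv hne'
    rw [met_apply]
    have e1 : (h.fr x).symm (e v) = v := (h.fr x).symm_apply_apply v
    exact (congrArg₂ (fun a b => h.m (chartAt F x x) a b) e1 e1).symm ▸ this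

end HyperFrame

end HyperFrame

section HyperFrameConnection

open Bundle

variable {F : Type*} [NormedAddCommGroup F] [NormedSpace ℝ F] [FiniteDimensional ℝ F]
  {V : Type*} [NormedAddCommGroup V] [NormedSpace ℝ V] [FiniteDimensional ℝ V]
  {M : Type*} [TopologicalSpace M] [ChartedSpace F M] [IsManifold 𝓘(ℝ, F) ∞ M]

theorem fderiv_clm_apply_eq {A : F → V →L[ℝ] F} {n : F → V} {p : F} (hA : DifferentiableAt ℝ A p)
    (hn : DifferentiableAt ℝ n p) (v : F) :
    fderiv ℝ (fun p => A p (n p)) p v = fderiv ℝ A p v (n p) + A p (fderiv ℝ n p v) := by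
  rw [(hA.hasFDerivAt.clm_apply hn.hasFDerivAt).fderiv]
  simp [add_comm]

theorem fderiv_bilinear_eq {m : F → V →L[ℝ] V →L[ℝ] ℝ} {y z : F → V} {p : F}
    (hm : DifferentiableAt ℝ m p) (hy : DifferentiableAt ℝ y p) (hz : DifferentiableAt ℝ z p)
    (v : F) : fderiv ℝ (fun p => m p (y p) (z p)) p v =
      fderiv ℝ m p v (y p) (z p) + m p (fderiv ℝ y p v) (z p) + m p (y p) (fderiv ℝ z p v) := by
  rw [((hm.hasFDerivAt.clm_apply hy.hasFDerivAt).clm_apply hz.hasFDerivAt).fderiv]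
  simp only [_root_.add_apply, ContinuousLinearMap.comp_apply, ContinuousLinearMap.flip_apply]
  ring

namespace HyperFrame

variable (h : HyperFrame F V M)

/-! ### Sections in the frame -/

/-- The components of a vector field in the frame. -/
def comps (σ : ∀ x : M, TangentSpace 𝓘(ℝ, F) x) (x : M) : V := (h.fr x).symm (σ x)

theorem fr_comps (σ : ∀ x : M, TangentSpace 𝓘(ℝ, F) x) (x : M) : h.fr x (h.comps σ x) = σ x :=
  (h.fr x).apply_symm_apply _

/-- The components in the frame, computed in the trivialisation at another point. -/
theorem comps_eq (σ : ∀ x : M, TangentSpace 𝓘(ℝ, F) x) {x₀ x : M}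
    (hx : x ∈ (chartAt F x₀).source) : h.comps σ x = (h.A (chartAt F x₀ x)).inverse
      (trivializationAt F (TangentSpace 𝓘(ℝ, F)) x₀ (TotalSpace.mk' F x (σ x))).2 := by
  have h1 := h.triv_fr hx (h.comps σ x)
  rw [fr_comps] at h1
  have h2 : (trivializationAt F (TangentSpace 𝓘(ℝ, F)) x₀).continuousLinearMapAt ℝ x (σ x) =
      (trivializationAt F (TangentSpace 𝓘(ℝ, F)) x₀ (TotalSpace.mk' F x (σ x))).2 :=
    congrFun (Trivialization.coe_linearMapAt_of_mem _ (mem_baseSet hx)) _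
  rw [← h2, h1, (h.isInvertible hx).inverse_apply_self]

theorem mdifferentiableAt_of_chart {W : Type*} [NormedAddCommGroup W] [NormedSpace ℝ W]
    {g : F → W} {x : M} (hg : ContDiffAt ℝ ∞ g (chartAt F x x)) :
    MDifferentiableAt 𝓘(ℝ, F) 𝓘(ℝ, W) (fun y => g (chartAt F x y)) x :=
  (contMDiffAt_of_chart hg (Filter.Eventually.of_forall fun _ => rfl)).mdifferentiableAt (by simp)

theorem mdiff_comps {σ : ∀ x : M, TangentSpace 𝓘(ℝ, F) x} {x : M}
    (hσ : MDifferentiableAt 𝓘(ℝ, F) (𝓘(ℝ, F).prod 𝓘(ℝ, F)) (fun y => TotalSpace.mk' F y (σ y)) x) :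
    MDifferentiableAt 𝓘(ℝ, F) 𝓘(ℝ, V) (h.comps σ) x := by
  have h1 := ((mdifferentiableAt_totalSpace _ _).1 hσ).2
  have h2 := (mdifferentiableAt_of_chart (h.contDiffAt_inverse x)).clm_apply h1
  refine h2.congr_of_eventuallyEq ?_
  filter_upwards [(chartAt F x).open_source.mem_nhds (mem_chart_source F x)] with y hy
  exact h.comps_eq σ hy

theorem comps_add (σ τ : ∀ x : M, TangentSpace 𝓘(ℝ, F) x) :
    h.comps (σ + τ) = h.comps σ + h.comps τ := funext fun x => (h.fr x).symm.map_add _ _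

theorem comps_smul (f : M → ℝ) (σ : ∀ x : M, TangentSpace 𝓘(ℝ, F) x) :
    h.comps (f • σ) = f • h.comps σ := funext fun x => (h.fr x).symm.map_smul _ _

theorem comps_endo (L : V →L[ℝ] V) (σ : ∀ x : M, TangentSpace 𝓘(ℝ, F) x) :
    h.comps (fun x => h.endo L x (σ x)) = fun x => L (h.comps σ x) :=
  funext fun x => (h.fr x).symm_apply_apply _

/-- The derivative in the chart of a function with values in a normed space. -/
theorem mvfderiv_eq {W : Type*} [NormedAddCommGroup W] [NormedSpace ℝ W] {f : M → W} {x : M}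
    (hf : MDifferentiableAt 𝓘(ℝ, F) 𝓘(ℝ, W) f x) (v : TangentSpace 𝓘(ℝ, F) x) :
    DifferentiableAt ℝ (f ∘ (chartAt F x).symm) (chartAt F x x) ∧
    mvfderiv 𝓘(ℝ, F) f x v = fderiv ℝ (f ∘ (chartAt F x).symm) (chartAt F x x) v := by
  have h1 : DifferentiableAt ℝ (f ∘ (chartAt F x).symm) (chartAt F x x) := by
    have h2 : DifferentiableWithinAt ℝ (f ∘ (chartAt F x).symm) (range 𝓘(ℝ, F)) (chartAt F x x) :=
      hf.differentiableWithinAt_writtenInExtChartAt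
    rwa [modelWithCornersSelf_coe, range_id, differentiableWithinAt_univ] at h2
  refine ⟨h1, ?_⟩
  have h3 : mfderiv 𝓘(ℝ, F) 𝓘(ℝ, W) f x = fderiv ℝ (f ∘ (chartAt F x).symm) (chartAt F x x) := by
    refine hf.mfderiv.trans ?_
    change fderivWithin ℝ (f ∘ (chartAt F x).symm) (range 𝓘(ℝ, F)) (chartAt F x x) = _
    rw [modelWithCornersSelf_coe, range_id, fderivWithin_univ]
  exact DFunLike.congr_fun h3 v

/-! ### The connection -/

/-- The covariant derivative with connection form `Γ`. -/
def covFun (σ : ∀ x : M, TangentSpace 𝓘(ℝ, F) x) (x : M) :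
    TangentSpace 𝓘(ℝ, F) x →L[ℝ] TangentSpace 𝓘(ℝ, F) x :=
  (h.fr x : V →L[ℝ] TangentSpace 𝓘(ℝ, F) x) ∘L
    (mvfderiv 𝓘(ℝ, F) (h.comps σ) x +
      (h.Γ x).flip (h.comps σ x) ∘L ((h.fr x).symm : TangentSpace 𝓘(ℝ, F) x →L[ℝ] V))

theorem covFun_apply (σ : ∀ x : M, TangentSpace 𝓘(ℝ, F) x) (x : M) (v : TangentSpace 𝓘(ℝ, F) x) :
    h.covFun σ x v = h.fr x (mvfderiv 𝓘(ℝ, F) (h.comps σ) x v +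
      h.Γ x ((h.fr x).symm v) (h.comps σ x)) := rfl

/-- The covariant derivative with connection form `Γ`. -/
def cov : CovariantDerivative 𝓘(ℝ, F) F (TangentSpace 𝓘(ℝ, F) : M → Type _) where
  toFun := h.covFun
  isCovariantDerivativeOnUniv :=
    { add := by
        intro σ τ x hσ hτ _
        ext v
        refine (h.covFun_apply _ x v).trans ?_
        change _ = h.covFun σ x v + h.covFun τ x v
        rw [covFun_apply, covFun_apply, ← map_add, comps_add,
          mvfderiv_add (h.mdiff_comps hσ) (h.mdiff_comps hτ)]
        congr 1
        simp only [_root_.add_apply, Pi.add_apply, map_add]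
        abel
      leibniz := by
        intro σ f x hσ hf _
        ext v
        refine (h.covFun_apply _ x v).trans ?_
        change _ = f x • h.covFun σ x v + mvfderiv 𝓘(ℝ, F) f x v • σ x
        rw [covFun_apply, ← h.fr_comps σ x, ← map_smul, ← map_smul, ← map_add, comps_smul,
          mvfderiv_smul hf (h.mdiff_comps hσ)]
        congr 1
        simp only [_root_.add_apply, Pi.smul_apply', map_smul, _root_.smul_apply,
          ContinuousLinearMap.smulRight_apply, smul_add]
        abel }

theorem cov_apply (σ : ∀ x : M, TangentSpace 𝓘(ℝ, F) x) (x : M) (v : TangentSpace 𝓘(ℝ, F) x) :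
    h.cov σ x v = h.fr x (mvfderiv 𝓘(ℝ, F) (h.comps σ) x v +
      h.Γ x ((h.fr x).symm v) (h.comps σ x)) := rfl

/-- An endomorphism which is constant in the frame and commutes with the connection form is
parallel. -/
theorem isParallel {L : V →L[ℝ] V} (hL : ∀ x v w, h.Γ x v (L w) = L (h.Γ x v w)) :
    IsParallel h.cov (h.endo L) := by
  intro Y x v hY
  have hd := h.mdiff_comps hY
  rw [cov_apply, cov_apply, endo_apply, ContinuousLinearEquiv.symm_apply_apply, comps_endo]
  congr 1
  rw [map_add, hL]
  congr 1
  have h1 : MDifferentiableAt 𝓘(ℝ, F) 𝓘(ℝ, V) (fun x => L (h.comps Y x)) x :=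
    L.differentiableAt.comp_mdifferentiableAt hd
  rw [(mvfderiv_eq h1 v).2, (mvfderiv_eq hd v).2]
  have h2 := (L.hasFDerivAt.comp _ (mvfderiv_eq hd v).1.hasFDerivAt).fderiv
  exact DFunLike.congr_fun h2 v

theorem mfderiv_chart_fr {x₀ x : M} (hx : x ∈ (chartAt F x₀).source) (η : V) :
    mfderiv 𝓘(ℝ, F) 𝓘(ℝ, F) (extChartAt 𝓘(ℝ, F) x₀) x (h.fr x η) = h.A (chartAt F x₀ x) η := by
  have : IsManifold 𝓘(ℝ, F) 1 M := IsManifold.of_le (n := ∞) (by simp)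
  have h1 := mfderiv_chartAt_eq_tangentCoordChange (I := 𝓘(ℝ, F)) hx
  refine (DFunLike.congr_fun h1 _).trans ?_
  refine (DFunLike.congr_fun (tangentCoordChange_eq (F := F) x₀ x) (h.fr x η)).trans ?_
  rw [h.fr_apply]
  exact h.trans_A x₀ x hx η

/-- The covariant derivative is metric and torsion-free, by the corresponding identities for the
frame and the product rule for the components of vector fields. -/
theorem isLeviCivita : IsLeviCivita 𝓘(ℝ, F) h.met h.cov where
  metric := by
    intro Y Z x v hY hZ
    have hy := h.mdiff_comps hY
    have hz := h.mdiff_comps hZ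
    -- near `x`, the function `g(Y, Z)` expressed by the components in the frame and the chart at
    -- `x`
    let b : M → ℝ := fun y => h.m (chartAt F x y) (h.comps Y y) (h.comps Z y)
    have e1 : (fun y => h.met y (Y y) (Z y)) =ᶠ[nhds x] b := by
      filter_upwards [(chartAt F x).open_source.mem_nhds (mem_chart_source F x)] with y hy
      rw [met_apply, ← h.trans_m x y hy]
      rfl
    have hb : MDifferentiableAt 𝓘(ℝ, F) 𝓘(ℝ, ℝ) b x :=
      ((mdifferentiableAt_of_chart (h.smooth_m x)).clm_apply hy).clm_apply hz
    have hb' := hb.congr_of_eventuallyEq e1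
    rw [(mvfderiv_eq hb' v).2]
    have hT : (chartAt F x).target ∈ nhds (chartAt F x x) :=
      (chartAt F x).open_target.mem_nhds ((chartAt F x).map_source (mem_chart_source F x))
    have hsx : (chartAt F x).symm (chartAt F x x) = x := (chartAt F x).left_inv (mem_chart_source F x)
    have e2 : (fun y => h.met y (Y y) (Z y)) ∘ (chartAt F x).symm =ᶠ[nhds (chartAt F x x)]
        fun p => h.m p (h.comps Y ((chartAt F x).symm p)) (h.comps Z ((chartAt F x).symm p)) := by
      have hc : Filter.Tendsto (chartAt F x).symm (nhds (chartAt F x x)) (nhds x) := by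
        have := (chartAt F x).continuousAt_symm ((chartAt F x).map_source (mem_chart_source F x))
        rwa [ContinuousAt, hsx] at this
      filter_upwards [hc.eventually e1, hT] with p hp hpt
      refine hp.trans ?_
      change h.m (chartAt F x ((chartAt F x).symm p)) _ _ = _
      rw [(chartAt F x).right_inv hpt]
    rw [e2.fderiv_eq]
    have d1 := (h.smooth_m x).differentiableAt (by simp)
    have d3 := fderiv_bilinear_eq d1 (mvfderiv_eq hy v).1 (mvfderiv_eq hz v).1 v
    refine Eq.trans d3 ?_
    have hv : (v : F) = h.A (chartAt F x x) ((h.fr x).symm v) := by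
      rw [← fr_apply, ContinuousLinearEquiv.apply_symm_apply]
    rw [met_apply, met_apply, cov_apply, cov_apply, ContinuousLinearEquiv.symm_apply_apply,
      ContinuousLinearEquiv.symm_apply_apply, (mvfderiv_eq hy v).2, (mvfderiv_eq hz v).2]
    have h3 := h.metric x ((h.fr x).symm v) (h.comps Y x) (h.comps Z x)
    rw [← hv] at h3
    simp only [Function.comp_apply, hsx]
    rw [h3]
    simp only [map_add, _root_.add_apply, comps]
    ring
  torsion_free := by
    intro X Y x hX hY
    have hx := h.mdiff_comps hX
    have hy := h.mdiff_comps hY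
    have hT : (chartAt F x).target ∈ nhds (chartAt F x x) :=
      (chartAt F x).open_target.mem_nhds ((chartAt F x).map_source (mem_chart_source F x))
    have hsx : (chartAt F x).symm (chartAt F x x) = x := (chartAt F x).left_inv (mem_chart_source F x)
    -- in the chart at `x` a vector field is the frame applied to its components
    have key : ∀ Z : ∀ x : M, TangentSpace 𝓘(ℝ, F) x,
        ∀ᶠ p in nhds (extChartAt 𝓘(ℝ, F) x x),
        mfderiv 𝓘(ℝ, F) 𝓘(ℝ, F) (extChartAt 𝓘(ℝ, F) x) ((extChartAt 𝓘(ℝ, F) x).symm p)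
          (Z ((extChartAt 𝓘(ℝ, F) x).symm p)) =
          (fun p => h.A p ((h.comps Z ∘ (chartAt F x).symm) p)) p := by
      intro Z
      filter_upwards [hT] with p hp
      have h1 := h.mfderiv_chart_fr ((chartAt F x).map_target hp)
        (h.comps Z ((chartAt F x).symm p))
      rw [fr_comps, (chartAt F x).right_inv hp] at h1
      exact h1
    rw [mlieBracket_eq_of_chart (key X) (key Y)]
    have dA := (h.smooth_A x).differentiableAt (by simp)
    have e1 := fderiv_clm_apply_eq dA (mvfderiv_eq hy (X x)).1
      (h.A (chartAt F x x) (h.comps X x))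
    have e2 := fderiv_clm_apply_eq dA (mvfderiv_eq hx (X x)).1
      (h.A (chartAt F x x) (h.comps Y x))
    have hXx : (X x : F) = h.A (chartAt F x x) (h.comps X x) := by
      rw [← fr_apply, fr_comps]
    have hYx : (Y x : F) = h.A (chartAt F x x) (h.comps Y x) := by
      rw [← fr_apply, fr_comps]
    simp only [Function.comp_apply, hsx] at e1 e2
    change _ = fderiv ℝ (fun p => h.A p (h.comps Y ((chartAt F x).symm p))) (chartAt F x x)
      (h.A (chartAt F x x) (h.comps X ((chartAt F x).symm (chartAt F x x)))) -
      fderiv ℝ (fun p => h.A p (h.comps X ((chartAt F x).symm p))) (chartAt F x x)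
      (h.A (chartAt F x x) (h.comps Y ((chartAt F x).symm (chartAt F x x))))
    rw [hsx]
    refine Eq.trans ?_ (congrArg₂ (fun a b : F => a - b) e1 e2).symm
    have t := h.torsion x (h.comps X x) (h.comps Y x)
    have e3 : (h.fr x).symm (X x) = h.comps X x := rfl
    have e4 : (h.fr x).symm (Y x) = h.comps Y x := rfl
    have e6 : mvfderiv 𝓘(ℝ, F) (h.comps Y) x (X x) =
        fderiv ℝ (h.comps Y ∘ (chartAt F x).symm) (chartAt F x x)
          (h.A (chartAt F x x) (h.comps X x)) := by
      rw [(mvfderiv_eq hy _).2, hXx]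
    have e7 : mvfderiv 𝓘(ℝ, F) (h.comps X) x (Y x) =
        fderiv ℝ (h.comps X ∘ (chartAt F x).symm) (chartAt F x x)
          (h.A (chartAt F x x) (h.comps Y x)) := by
      rw [(mvfderiv_eq hx _).2, hYx]
    rw [cov_apply, cov_apply, e3, e4, e6, e7]
    refine (congrArg₂ (fun a b : F => a - b) (h.fr_apply x _) (h.fr_apply x _)).trans ?_
    have e5 : fderiv ℝ h.A (chartAt F x x) (h.A (chartAt F x x) (h.comps X x)) (h.comps Y x) =
      h.A (chartAt F x x) (h.Γ x (h.comps X x) (h.comps Y x) - h.Γ x (h.comps Y x) (h.comps X x)) +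
      fderiv ℝ h.A (chartAt F x x) (h.A (chartAt F x x) (h.comps Y x)) (h.comps X x) :=
      sub_eq_iff_eq_add.1 t
    rw [e5]
    simp only [map_add, map_sub]
    change _ = _ - (_ + h.A (chartAt F x x) (fderiv ℝ (h.comps X ∘ (chartAt F x).symm) _ _))
    abel

/-- The hypersymplectic structure defined by an adapted frame. -/
def toStructure {k : ℕ} (hF : Module.finrank ℝ F = 4 * k) (hV : Module.finrank ℝ V = 4 * k) :
    HypersymplecticStructure 𝓘(ℝ, F) M k where
  dim_eq := hF
  g := h.met
  g_smooth := h.met_smooth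
  g_symm x v w := by rw [met_apply, met_apply, h.m_symm]
  g_signature := h.met_signature hV
  I := h.endo h.I
  S := h.endo h.S
  T := h.endo h.T
  I_smooth := h.endo_smooth h.I
  S_smooth := h.endo_smooth h.S
  T_smooth := h.endo_smooth h.T
  I_sq x v := by
    rw [endo_apply, endo_apply, ContinuousLinearEquiv.symm_apply_apply, h.I_sq, map_neg,
      ContinuousLinearEquiv.apply_symm_apply]
  S_sq x v := by
    rw [endo_apply, endo_apply, ContinuousLinearEquiv.symm_apply_apply, h.S_sq,
      ContinuousLinearEquiv.apply_symm_apply]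
  T_sq x v := by
    rw [endo_apply, endo_apply, ContinuousLinearEquiv.symm_apply_apply, h.T_sq,
      ContinuousLinearEquiv.apply_symm_apply]
  I_S x v := by
    rw [endo_apply, endo_apply, ContinuousLinearEquiv.symm_apply_apply, h.I_S, endo_apply]
  S_I x v := by
    rw [endo_apply, endo_apply, ContinuousLinearEquiv.symm_apply_apply, h.S_I, map_neg, endo_apply]
  I_skew x v w := by
    rw [met_apply, met_apply, endo_apply, endo_apply, ContinuousLinearEquiv.symm_apply_apply,
      ContinuousLinearEquiv.symm_apply_apply, h.I_skew]
  S_skew x v w := by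
    rw [met_apply, met_apply, endo_apply, endo_apply, ContinuousLinearEquiv.symm_apply_apply,
      ContinuousLinearEquiv.symm_apply_apply, h.S_skew]
  T_skew x v w := by
    rw [met_apply, met_apply, endo_apply, endo_apply, ContinuousLinearEquiv.symm_apply_apply,
      ContinuousLinearEquiv.symm_apply_apply, h.T_skew]
  parallel := ⟨h.cov, h.isLeviCivita, h.isParallel h.I_comm, h.isParallel h.S_comm,
    h.isParallel h.T_comm⟩

end HyperFrame

end HyperFrameConnection

section Gauge

universe w
variable {E : Type w} [NormedAddCommGroup E] [NormedSpace ℝ E] [FiniteDimensional ℝ E]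
  {G : Type*} [TopologicalSpace G] [ChartedSpace E G] [Group G] [LieGroup 𝓘(ℝ, E) ∞ G]

/-! ### Gauge transformations -/

/-- The pointwise adjoint action of a curve in the group. -/
def AdC (u : ℝ → G) (hu : ContinuousOn u (Icc (0 : ℝ) 1)) : C(unitInterval, E →L[ℝ] E) :=
  ⟨fun t => AdL E (u t), (continuous_AdL (E := E) (G := G)).comp
    (hu.comp_continuous continuous_subtype_val fun t => t.2)⟩

theorem AdC_apply (u : ℝ → G) (hu : ContinuousOn u (Icc (0 : ℝ) 1)) (t : unitInterval) :
    AdC (E := E) u hu t = AdL E (u t) := rfl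

/-- The function `Ad(u) X` for a curve `u` with logarithmic derivative `l`. -/
def adC1 (u : ℝ → G) (l : C(unitInterval, E)) (hu : ∀ t : unitInterval, HasLog u t (l t))
    (X : C1 E) : C1 E :=
  ⟨(applyCL (AdC u (continuousOn_of_hasLog hu)) (fn X),
    applyCL (AdC u (continuousOn_of_hasLog hu)) (der X) +
      brC (lieBracket E G) l (applyCL (AdC u (continuousOn_of_hasLog hu)) (fn X))), fun t => by
    have h := ((hu t).hasDerivWithinAt_AdL t.2).clm_apply (isDeriv_fn X t)
    have h2 : HasDerivWithinAt (fun s : ℝ => applyCL (AdC u (continuousOn_of_hasLog hu)) (fn X)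
        (projIcc 0 1 zero_le_one s)) _ (Icc (0 : ℝ) 1) t :=
      h.congr_of_eventuallyEq_of_mem (by
        filter_upwards [self_mem_nhdsWithin] with s hs
        simp [AdC_apply, projIcc_of_mem zero_le_one hs]) t.2
    convert h2 using 1
    simp [AdC_apply, projIcc_of_mem zero_le_one t.2]
    abel⟩

@[simp] theorem fn_adC1 (u : ℝ → G) (l : C(unitInterval, E))
    (hu : ∀ t : unitInterval, HasLog u t (l t)) (X : C1 E) (t : unitInterval) :
    fn (adC1 u l hu X) t = AdL E (u t) (fn X t) := rfl

@[simp] theorem der_adC1 (u : ℝ → G) (l : C(unitInterval, E))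
    (hu : ∀ t : unitInterval, HasLog u t (l t)) (X : C1 E) (t : unitInterval) :
    der (adC1 u l hu X) t = AdL E (u t) (der X t) + lieBracket E G (l t) (AdL E (u t) (fn X t)) :=
  rfl

/-- Solutions related on the component of index `0` and at the initial time by a curve `u` in the
group are related by `u` everywhere. -/
theorem eq_AdL_of_isSolution {B : LinearMap.BilinForm ℝ E} (hL : IsMetricLie (lieBracket E G) B)
    {T T' : Quad E}
    (hT : IsSolution (lieBracket E G) T) (hT' : IsSolution (lieBracket E G) T')
    {u : ℝ → G} {l : C(unitInterval, E)} (hu : ∀ t : unitInterval, HasLog u t (l t))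
    (h0 : ∀ t, fn (T' 0) t = AdL E (u t) (fn (T 0) t) - l t)
    (hi : ∀ i : Fin 3, fn (T' i.succ) 0 = AdL E (u 0) (fn (T i.succ) 0)) (i : Fin 3)
    (t : unitInterval) : fn (T' i.succ) t = AdL E (u t) (fn (T i.succ) t) := by
  -- the transform of `T` is a solution with the same data as `T'`
  let Y : Quad E := Fin.cons (T' 0) fun i : Fin 3 => adC1 u l hu (T i.succ)
  have hY : IsSolution (lieBracket E G) Y := by
    obtain ⟨h1, h2, h3⟩ := hT
    have key : ∀ (t : unitInterval) (i : Fin 3), der (Y i.succ) t +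
        lieBracket E G (fn (Y 0) t) (fn (Y i.succ) t) = AdL E (u t) (der (T i.succ) t +
          lieBracket E G (fn (T 0) t) (fn (T i.succ) t)) := fun t i => by
      simp only [Y, Fin.cons_succ, Fin.cons_zero, der_adC1, fn_adC1, h0, map_add, AdL_bracket,
        map_sub, _root_.sub_apply]
      abel
    refine ⟨?_, ?_, ?_⟩ <;> ext t
    · refine (key t 0).trans ?_
      have := DFunLike.congr_fun h1 t
      simp only [ContinuousMap.add_apply, ContinuousMap.neg_apply, brC_apply] at this
      refine (congrArg (AdL E (u t)) this).trans ?_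
      rw [map_neg, AdL_bracket]
      rfl
    · refine (key t 1).trans ?_
      have := DFunLike.congr_fun h2 t
      simp only [ContinuousMap.add_apply, brC_apply] at this
      refine (congrArg (AdL E (u t)) this).trans ?_
      rw [AdL_bracket]
      rfl
    · refine (key t 2).trans ?_
      have := DFunLike.congr_fun h3 t
      simp only [ContinuousMap.add_apply, brC_apply] at this
      refine (congrArg (AdL E (u t)) this).trans ?_
      rw [AdL_bracket]
      rfl
  have hr : restr (crdEquiv E Y) = restr (crdEquiv E T') := by
    refine Prod.ext rfl ?_
    funext i
    exact (hi i).symm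
  rw [isSolution_iff] at hY hT'
  rw [hr, ← hT'] at hY
  have hYT := (crdEquiv E).injective (nsMap_injective hL.skew hY)
  rw [← hYT]
  rfl

variable [CompactSpace G]

/-- Solutions are gauge equivalent exactly if they have the same holonomy and the same initial
values: if `v`, `v'` are the transports of `T₀`, `T₀'`, then the only candidate for the gauge
transformation is `u = v' v⁻¹`, which is `1` at the end exactly if the holonomies agree. -/
theorem gaugeRel_iff {B : LinearMap.BilinForm ℝ E} (hL : IsMetricLie (lieBracket E G) B)
    (T T' : solutions E G) : gaugeRel E G T T' ↔ hol G (fn (T.1 0)) = hol G (fn (T'.1 0)) ∧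
      ∀ i : Fin 3, fn (T.1 i.succ) 0 = fn (T'.1 i.succ) 0 := by
  constructor
  · rintro ⟨u, hu, h⟩
    have hlog : ∀ t : unitInterval, HasLog u t (rightLogDeriv E u t) := fun t =>
      hasLog_of_contMDiffOn hu.contMDiffOn t.2
    constructor
    · have h2 := hol_eq (G := G) (a := fn (T'.1 0))
        (v := fun s => u s * transport G (fn (T.1 0)) s) (by simp [hu.zero]) fun t => by
          have := (hlog t).mul t.2 (hasLog_transport G (fn (T.1 0)) t)
          rw [(h t).1, Ad_eq_AdL]
          convert! this using 1
          rw [map_neg]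
          abel
      rw [h2]
      simp [hu.one, hol]
    · intro i
      obtain ⟨-, h1, h2, h3⟩ := h 0
      simp only [Icc.coe_zero, hu.zero, Ad_eq_AdL, AdL_one] at h1 h2 h3
      fin_cases i
      · exact h1.symm
      · exact h2.symm
      · exact h3.symm
  · rintro ⟨hh, hi⟩
    set v := transport G (fn (T.1 0)) with hv
    set v' := transport G (fn (T'.1 0)) with hv'
    let u : ℝ → G := fun s => v' s * (v s)⁻¹
    have hu' : ∀ t : unitInterval, HasLog u t (-fn (T'.1 0) t + AdL E (u t) (fn (T.1 0) t)) :=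
      fun t => by
        have := (hasLog_transport G (fn (T'.1 0)) t).mul t.2
          ((hasLog_transport G (fn (T.1 0)) t).inv t.2)
        simp only [map_neg, neg_neg, ← hv, ← hv'] at this
        simpa only [u, AdL_mul] using! this
    have hc := continuousOn_of_hasLog hu'
    let l : C(unitInterval, E) := -fn (T'.1 0) + applyCL (AdC u hc) (fn (T.1 0))
    have hu : ∀ t : unitInterval, HasLog u t (l t) := hu'
    have hu0 : u 0 = 1 := by simp [u, hv, hv']
    have hu1 : u 1 = 1 := by
      change hol G (fn (T'.1 0)) * (hol G (fn (T.1 0)))⁻¹ = 1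
      rw [hh, mul_inv_cancel]
    have hY := eq_AdL_of_isSolution hL T.2 T'.2 hu (fun t => by
      change _ = _ - (-fn (T'.1 0) t + AdL E (u t) (fn (T.1 0) t))
      abel) (fun i => by rw [hu0, AdL_one]; exact (hi i).symm)
    refine ⟨u, ⟨contMDiffOn_of_hasLog (ξ := -(T'.1 0) + adC1 u l hu (T.1 0)) hu, hu0, hu1⟩,
      fun t => ?_⟩
    rw [Ad_eq_AdL, Ad_eq_AdL, Ad_eq_AdL, Ad_eq_AdL, (hu t).rightLogDeriv_eq t.2]
    refine ⟨?_, hY 0 t, hY 1 t, hY 2 t⟩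
    change _ = _ - (-fn (T'.1 0) t + AdL E (u t) (fn (T.1 0) t))
    abel

/-- The entries of index `1, 2, 3` of a quadruple at the time `0`. -/
def start (T : Quad E) : Fin 3 → E := fun i => fn (T i.succ) 0

/-- A solution is related by the transport of `T₀` to the solution in temporal gauge with the same
initial values. -/
theorem AdL_transport_inv {B : LinearMap.BilinForm ℝ E} (hL : IsMetricLie (lieBracket E G) B)
    {T : Quad E} (hT : IsSolution (lieBracket E G) T) (i : Fin 3) (t : unitInterval) :
    AdL E (transport G (fn (T 0)) t)⁻¹ (fn (T i.succ) t) =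
      tz (lieBracket E G) (start T) t i.succ := by
  have hu : ∀ t : unitInterval, HasLog (fun s => (transport G (fn (T 0)) s)⁻¹) t
      (applyCL (AdT G (fn (T 0))) (fn (T 0)) t) := fun t => by
    have := (hasLog_transport G (fn (T 0)) t).inv t.2
    rwa [map_neg, neg_neg] at this
  have h := eq_AdL_of_isSolution hL hT (isSolution_tq hL (start T)) hu (fun t => by
      rw [← ev_apply, ev_tq, tz_apply_zero hL]
      exact (sub_self _).symm) (fun i => by
      rw [← ev_apply, ev_tq]
      have := congrArg Prod.snd (restr_sol hL (0, start T))
      have h2 := congrFun this i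
      have h3 : tz (lieBracket E G) (start T) 0 i.succ = start T i := by
        rw [tz, val_zero]
        exact h2
      rw [h3]
      simp [AdL_one, start]) i t
  rw [← h, ← ev_apply, ev_tq]

end Gauge

section Solutions

universe w
variable {E : Type w} [NormedAddCommGroup E] [NormedSpace ℝ E] [FiniteDimensional ℝ E]
  {G : Type*} [TopologicalSpace G] [ChartedSpace E G] [Group G] [LieGroup 𝓘(ℝ, E) ∞ G]

/-! ### The manifold of solutions -/

theorem mem_contDiffGroupoid_self {V : Type*} [NormedAddCommGroup V] [NormedSpace ℝ V]
    {e : OpenPartialHomeomorph V V} (h1 : ContDiffOn ℝ ∞ e e.source)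
    (h2 : ContDiffOn ℝ ∞ e.symm e.target) : e ∈ contDiffGroupoid ∞ 𝓘(ℝ, V) := by
  refine mem_groupoid_of_pregroupoid.mpr ⟨?_, ?_⟩
  · simpa [contDiffPregroupoid] using! h1
  · simpa [contDiffPregroupoid] using! h2

variable (E G) in
/-- The Lie algebra has an inner product for which the adjoint operators are skew-symmetric. -/
class HasInvForm : Prop where
  exists_form : ∃ B : LinearMap.BilinForm ℝ E, IsMetricLie (lieBracket E G) B

variable [hI : HasInvForm E G]

variable (E G) in
/-- The set of solutions is the graph of the solution map, hence homeomorphic to the space of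
data. -/
def solHomeo : solutions E G ≃ₜ Data E where
  toFun T := restr (crdEquiv E T.1)
  invFun f := ⟨(crdEquiv E).symm (sol (lieBracket E G) f), by
    obtain ⟨B, hL⟩ := hI.exists_form
    change IsSolution _ _
    rw [isSolution_iff, ContinuousLinearEquiv.apply_symm_apply, restr_sol hL, nsMap_sol hL]⟩
  left_inv T := Subtype.ext (by
    obtain ⟨B, hL⟩ := hI.exists_form
    have h := (isSolution_iff T.1).1 T.2
    change (crdEquiv E).symm (sol (lieBracket E G) (restr (crdEquiv E T.1))) = T.1
    rw [sol_restr hL h, ContinuousLinearEquiv.symm_apply_apply])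
  right_inv f := by
    obtain ⟨B, hL⟩ := hI.exists_form
    change restr (crdEquiv E ((crdEquiv E).symm (sol (lieBracket E G) f))) = f
    rw [ContinuousLinearEquiv.apply_symm_apply, restr_sol hL]
  continuous_toFun := restr.continuous.comp ((crdEquiv E).continuous.comp continuous_subtype_val)
  continuous_invFun := by
    obtain ⟨B, hL⟩ := hI.exists_form
    exact ((crdEquiv E).symm.continuous.comp (contDiff_sol hL).continuous).subtype_mk _

theorem solHomeo_apply (T : solutions E G) : solHomeo E G T = restr (crdEquiv E T.1) := rfl

variable (E G) in
/-- The global chart of the manifold of solutions. -/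
def solChart : OpenPartialHomeomorph (solutions E G) (Data E) :=
  (solHomeo E G).toOpenPartialHomeomorph

/-- The solutions are modelled on the space of data by a single chart. -/
instance instChartedSpaceSolutions : ChartedSpace (Data E) (solutions E G) :=
  (solChart E G).singletonChartedSpace rfl

instance instIsManifoldSolutions : IsManifold 𝓘(ℝ, Data E) ∞ (solutions E G) :=
  { (solChart E G).singleton_hasGroupoid rfl (contDiffGroupoid ∞ 𝓘(ℝ, Data E)) with }

variable (E G) in
/-- The shear of the space of quadruples which flattens the graph of the solution map. -/
def shear : Quad E ≃ₜ Quad E where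
  toFun X := X - (crdEquiv E).symm (sol (lieBracket E G) (restr (crdEquiv E X))) +
    (crdEquiv E).symm (incl (restr (crdEquiv E X)))
  invFun X := X + (crdEquiv E).symm (sol (lieBracket E G) (restr (crdEquiv E X))) -
    (crdEquiv E).symm (incl (restr (crdEquiv E X)))
  left_inv X := by
    obtain ⟨B, hL⟩ := hI.exists_form
    simp only [map_add, map_sub, ContinuousLinearEquiv.apply_symm_apply, restr_sol hL, restr_incl]
    rw [sub_add_cancel]
    abel
  right_inv X := by
    obtain ⟨B, hL⟩ := hI.exists_form
    simp only [map_add, map_sub, ContinuousLinearEquiv.apply_symm_apply, restr_sol hL, restr_incl]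
    rw [add_sub_cancel_right]
    abel
  continuous_toFun := by
    obtain ⟨B, hL⟩ := hI.exists_form
    have h1 : Continuous fun X : Quad E => restr (crdEquiv E X) :=
      restr.continuous.comp (crdEquiv E).continuous
    exact (continuous_id.sub ((crdEquiv E).symm.continuous.comp
      ((contDiff_sol hL).continuous.comp h1))).add
      ((crdEquiv E).symm.continuous.comp (incl.continuous.comp h1))
  continuous_invFun := by
    obtain ⟨B, hL⟩ := hI.exists_form
    have h1 : Continuous fun X : Quad E => restr (crdEquiv E X) :=
      restr.continuous.comp (crdEquiv E).continuous
    exact (continuous_id.add ((crdEquiv E).symm.continuous.comp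
      ((contDiff_sol hL).continuous.comp h1))).sub
      ((crdEquiv E).symm.continuous.comp (incl.continuous.comp h1))

theorem contDiff_crdEquiv : ContDiff ℝ ∞ (crdEquiv E) := (crdEquiv E).contDiff

theorem contDiff_crdEquiv_symm : ContDiff ℝ ∞ (crdEquiv E).symm := (crdEquiv E).symm.contDiff

theorem contDiff_restr_crd : ContDiff ℝ ∞ (fun X : Quad E => restr (crdEquiv E X)) :=
  (restr (E := E)).contDiff.comp contDiff_crdEquiv

theorem contDiff_shear : ContDiff ℝ ∞ (shear E G) := by
  obtain ⟨B, hL⟩ := hI.exists_form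
  exact (contDiff_id.sub (contDiff_crdEquiv_symm.comp ((contDiff_sol hL).comp
    contDiff_restr_crd))).add (contDiff_crdEquiv_symm.comp ((incl (E := E)).contDiff.comp
      contDiff_restr_crd))

theorem contDiff_shear_symm : ContDiff ℝ ∞ (shear E G).symm := by
  obtain ⟨B, hL⟩ := hI.exists_form
  exact (contDiff_id.add (contDiff_crdEquiv_symm.comp ((contDiff_sol hL).comp
    contDiff_restr_crd))).sub (contDiff_crdEquiv_symm.comp ((incl (E := E)).contDiff.comp
      contDiff_restr_crd))

variable (E) in
/-- The splitting of the space of coordinates into the data and the rest. -/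
def splitCrd : Crd E ≃L[ℝ] Data E × (restr (E := E)).ker :=
  ContinuousLinearEquiv.equivOfRightInverse (restr (E := E)) (incl (E := E))
    (fun f => restr_incl f)

variable (E) in
/-- The splitting of the space of quadruples into the data and the rest. -/
def splitQuad : (Data E × (restr (E := E)).ker) ≃L[ℝ] Quad E :=
  (splitCrd E).symm.trans (crdEquiv E).symm

variable (E G) in
/-- In the chart `shear` of the space of quadruples, the inclusion of the solutions is the linear
inclusion of the space of data, which has the kernel of `restr` as a complement. -/
theorem isSmoothEmbedding_val : IsSmoothEmbedding 𝓘(ℝ, Data E) 𝓘(ℝ, Quad E) ∞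
    (Subtype.val : solutions E G → Quad E) := by
  refine ⟨⟨(restr (E := E)).ker, inferInstance, inferInstance, fun T => ?_⟩,
    Topology.IsEmbedding.subtypeVal⟩
  refine IsImmersionAtOfComplement.mk_of_charts (splitQuad E) (solChart E G)
    (shear E G).toOpenPartialHomeomorph (mem_univ _) (mem_univ _) ?_ ?_ (fun _ _ => mem_univ _) ?_
  · exact IsManifold.chart_mem_maximalAtlas (n := ∞) (I := 𝓘(ℝ, Data E)) T
  · exact StructureGroupoid.mem_maximalAtlas_of_mem_groupoid _
      (mem_contDiffGroupoid_self contDiff_shear.contDiffOn contDiff_shear_symm.contDiffOn)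
  · intro f _
    obtain ⟨B, hL⟩ := hI.exists_form
    change (crdEquiv E).symm (sol (lieBracket E G) f) -
      (crdEquiv E).symm (sol (lieBracket E G) (restr (crdEquiv E ((crdEquiv E).symm
        (sol (lieBracket E G) f))))) +
      (crdEquiv E).symm (incl (restr (crdEquiv E ((crdEquiv E).symm
        (sol (lieBracket E G) f))))) = (crdEquiv E).symm (incl f + 0)
    rw [ContinuousLinearEquiv.apply_symm_apply, restr_sol hL, sub_self, zero_add, add_zero]

/-- The differential of the inclusion of the manifold of solutions. -/
theorem mfderiv_val (T : solutions E G) (v : Data E) :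
    mfderiv 𝓘(ℝ, Data E) 𝓘(ℝ, Quad E) (Subtype.val : solutions E G → Quad E) T v =
      (crdEquiv E).symm (ivpInv (mat (qN (lieBracket E G)) (ev T.1)) (incl v)) := by
  obtain ⟨B, hL⟩ := hI.exists_form
  have hm : MDifferentiableAt 𝓘(ℝ, Data E) 𝓘(ℝ, Quad E)
      (Subtype.val : solutions E G → Quad E) T :=
    ((isSmoothEmbedding_val E G).contMDiff T).mdifferentiableAt (by simp)
  have h1 := (hasFDerivAt_sol hL (solHomeo E G T))
  rw [solHomeo_apply, sol_restr hL ((isSolution_iff T.1).1 T.2), val_crd] at h1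
  have h2 := ((crdEquiv E).symm : Crd E →L[ℝ] Quad E).hasFDerivAt.comp
    (restr (crdEquiv E T.1)) h1
  have h3 : mfderiv 𝓘(ℝ, Data E) 𝓘(ℝ, Quad E) (Subtype.val : solutions E G → Quad E) T =
      fderiv ℝ (fun f : Data E => (crdEquiv E).symm (sol (lieBracket E G) f))
        (restr (crdEquiv E T.1)) := by
    rw [hm.mfderiv, modelWithCornersSelf_coe, range_id, fderivWithin_univ]
    rfl
  rw [h3]
  exact DFunLike.congr_fun h2.fderiv v

end Solutions

/-! ### The holonomy of the solution with given data -/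

/-- A version of the inverse function theorem producing an element of the groupoid of smooth
local diffeomorphisms. -/
theorem exists_contDiffGroupoid {V : Type*} [NormedAddCommGroup V] [NormedSpace ℝ V]
    [CompleteSpace V] {f : V → V} {x : V} {O : Set V} (hO : IsOpen O) (hx : x ∈ O)
    (hf : ContDiffOn ℝ ∞ f O) (hd : HasFDerivAt f (ContinuousLinearMap.id ℝ V) x) :
    ∃ e : OpenPartialHomeomorph V V, x ∈ e.source ∧ e.source ⊆ O ∧ (∀ y, e y = f y) ∧
      e ∈ contDiffGroupoid ∞ 𝓘(ℝ, V) := by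
  have hfx : ContDiffAt ℝ ∞ f x := hf.contDiffAt (hO.mem_nhds hx)
  have hd' : HasFDerivAt f ((ContinuousLinearEquiv.refl ℝ V : V ≃L[ℝ] V) : V →L[ℝ] V) x := hd
  let e := hfx.toOpenPartialHomeomorph f hd' (by simp)
  have he : ∀ y, e y = f y := fun _ => rfl
  have hxe : x ∈ e.source := hfx.mem_toOpenPartialHomeomorph_source hd' (by simp)
  have hc : ContinuousOn (fderiv ℝ f) O := hf.continuousOn_fderiv_of_isOpen hO (by simp)
  -- restrict to the points where the derivative is invertible, so that the local inverse is smooth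
  -- on the whole target
  let O' : Set V := O ∩ fderiv ℝ f ⁻¹' range ((↑) : (V ≃L[ℝ] V) → V →L[ℝ] V)
  have hO' : IsOpen O' := hc.isOpen_inter_preimage hO (ContinuousLinearEquiv.isOpen)
  have hxO : x ∈ O' := ⟨hx, ⟨ContinuousLinearEquiv.refl ℝ V, hd'.fderiv.symm⟩⟩
  refine ⟨e.restrOpen O' hO', ⟨hxe, hxO⟩, fun y hy => hy.2.1, he,
    mem_contDiffGroupoid_self (fun y hy => ?_) (fun y hy => ?_)⟩
  · exact (hf.contDiffAt (hO.mem_nhds hy.2.1)).contDiffWithinAt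
  · have h1 := (e.restrOpen O' hO').map_target hy
    obtain ⟨A, hA⟩ := h1.2.2
    have h2 := hf.contDiffAt (hO.mem_nhds h1.2.1)
    refine ((e.restrOpen O' hO').contDiffAt_symm (f₀' := A) hy ?_ h2).contDiffWithinAt
    rw [hA]
    exact (h2.differentiableAt (by simp)).hasFDerivAt

section Split

variable {X Y K : Type*} [NormedAddCommGroup X] [NormedSpace ℝ X] [NormedAddCommGroup Y]
  [NormedSpace ℝ Y] [NormedAddCommGroup K] [NormedSpace ℝ K]

/-- Smoothness of the map which replaces the first component in a splitting by `h`. -/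
theorem contDiffAt_symm_split (s : X ≃L[ℝ] Y × K) {h : X → Y} {x : X} (hh : ContDiffAt ℝ ∞ h x) :
    ContDiffAt ℝ ∞ (fun v => s.symm (h v, (s v).2)) x :=
  s.symm.contDiff.contDiffAt.comp x (hh.prodMk (contDiff_snd.comp s.contDiff).contDiffAt)

/-- If the first component of a splitting is the derivative of `h`, then the map which replaces this
component by `h` has the derivative `1`. -/
theorem hasFDerivAt_symm_split (s : X ≃L[ℝ] Y × K) {h : X → Y} {L : X →L[ℝ] Y} {x : X}
    (hh : HasFDerivAt h L x) (hs : ∀ v, (s v).1 = L v) :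
    HasFDerivAt (fun v => s.symm (h v, (s v).2)) (ContinuousLinearMap.id ℝ X) x := by
  have h1 := (s.symm : Y × K →L[ℝ] X).hasFDerivAt.comp x
    (hh.prodMk (ContinuousLinearMap.snd ℝ Y K ∘L (s : X →L[ℝ] Y × K)).hasFDerivAt)
  refine h1.congr_fderiv (ContinuousLinearMap.ext fun v => ?_)
  change s.symm (L v, (s v).2) = v
  rw [← hs]
  exact s.symm_apply_apply v

end Split

section Holonomy

universe w
variable {E : Type w} [NormedAddCommGroup E] [NormedSpace ℝ E] [FiniteDimensional ℝ E]

/-- The function with the given initial value and derivative. -/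
def potE : E × C(unitInterval, E) →L[ℝ] C(unitInterval, E) :=
  constC E ∘L ContinuousLinearMap.fst ℝ _ _ + prim ∘L ContinuousLinearMap.snd ℝ _ _

theorem potE_apply (p : E × C(unitInterval, E)) (t : unitInterval) :
    potE p t = p.1 + prim p.2 t := rfl

@[simp] theorem potE_zero (p : E × C(unitInterval, E)) : potE p 0 = p.1 := by simp [potE_apply]

theorem isDeriv_potE (p : E × C(unitInterval, E)) : IsDeriv (potE p) p.2 := by
  have : CompleteSpace E := FiniteDimensional.complete ℝ E
  have := (isDeriv_const p.1).add (isDeriv_prim p.2)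
  rwa [zero_add] at this

theorem potE_eq {f f' : C(unitInterval, E)} (h : IsDeriv f f') : potE (f 0, f') = f := by
  have : CompleteSpace E := FiniteDimensional.complete ℝ E
  ext t
  exact (h.eq_add_prim t).symm

theorem potE_injective : Function.Injective (potE (E := E)) := fun p q h =>
  Prod.ext (by rw [← potE_zero p, ← potE_zero q, h])
    ((isDeriv_potE p).unique (h ▸ isDeriv_potE q))

variable (E) in
/-- The entry of index `0` of the solution with the given data. -/
def pot : Data E →L[ℝ] C(unitInterval, E) := potE ∘L ContinuousLinearMap.fst ℝ _ _

theorem pot_apply (f : Data E) : pot E f = potE f.1 := rfl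

theorem pot_restr (T : Quad E) : pot E (restr (crdEquiv E T)) = fn (T 0) :=
  potE_eq (isDeriv_fn (T 0))

/-- The differential of the holonomy and the initial values at the trivial data. -/
def dhol₀ : Data E →L[ℝ] E × (Fin 3 → E) :=
  (-(ContinuousMap.evalCLM ℝ (1 : unitInterval) ∘L prim ∘L pot E)).prod
    (ContinuousLinearMap.snd ℝ _ _)

variable (E) in
/-- The kernel of `dhol₀`. -/
def holKer : Submodule ℝ (Data E) := (dhol₀ (E := E)).ker

/-- A right inverse of `dhol₀`, given by the constant functions. -/
def dholInv : E × (Fin 3 → E) →L[ℝ] Data E :=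
  (ContinuousLinearMap.inl ℝ E C(unitInterval, E) ∘L (-ContinuousLinearMap.fst ℝ E (Fin 3 → E))).prod
    (ContinuousLinearMap.snd ℝ _ _)

theorem dhol₀_dholInv (p : E × (Fin 3 → E)) : dhol₀ (dholInv p) = p := by
  have : CompleteSpace E := FiniteDimensional.complete ℝ E
  refine Prod.ext ?_ rfl
  have h : ∀ t, pot E (dholInv p) t = -p.1 := fun t => by
    rw [pot_apply, potE_apply]
    simp [dholInv]
  change -(prim (pot E (dholInv p)) 1) = p.1
  rw [← integral_eq_prim_one]
  simp [h]

variable {G : Type*} [TopologicalSpace G] [ChartedSpace E G] [Group G] [LieGroup 𝓘(ℝ, E) ∞ G]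

local notation "φ" => phi E G
local notation "κ" => (OpenPartialHomeomorph.symm (phi E G))
local notation "e₀" => phi E G 1
local notation "U₁" => Icc (0 : ℝ) 1

/-- The operator `X ↦ Ad(u) X` on `C¹` functions, in the coordinates `(X(0), X')`. -/
def gaugeCrd (u : ℝ → G) (l : C(unitInterval, E)) (hu : ∀ t : unitInterval, HasLog u t (l t)) :
    E × C(unitInterval, E) →L[ℝ] E × C(unitInterval, E) :=
  (ContinuousLinearMap.fst ℝ _ _).prod
    (applyCL (AdC u (continuousOn_of_hasLog hu)) ∘L ContinuousLinearMap.snd ℝ _ _ +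
      brC (lieBracket E G) l ∘L applyCL (AdC u (continuousOn_of_hasLog hu)) ∘L potE)

/-- In the coordinates `(X(0), X')`, the operator `gaugeCrd` is the pointwise adjoint action. -/
theorem potE_gaugeCrd (u : ℝ → G) (l : C(unitInterval, E))
    (hu : ∀ t : unitInterval, HasLog u t (l t)) (h0 : u 0 = 1) (p : E × C(unitInterval, E)) :
    potE (gaugeCrd u l hu p) = applyCL (AdC u (continuousOn_of_hasLog hu)) (potE p) := by
  have h := isDeriv_fn (adC1 u l hu ⟨(potE p, p.2), isDeriv_potE p⟩)
  have h2 : gaugeCrd u l hu p = (fn (adC1 u l hu ⟨(potE p, p.2), isDeriv_potE p⟩) 0,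
      der (adC1 u l hu ⟨(potE p, p.2), isDeriv_potE p⟩)) := by
    refine Prod.ext ?_ rfl
    rw [fn_adC1]
    simp [h0, AdL_one, gaugeCrd, fn]
  exact (congrArg potE h2).trans (potE_eq h)

/-- The operator `X ↦ Ad(u) X` on `C¹` functions is invertible. -/
def gaugeEquiv (u : ℝ → G) (l : C(unitInterval, E)) (hu : ∀ t : unitInterval, HasLog u t (l t))
    (h0 : u 0 = 1) : (E × C(unitInterval, E)) ≃L[ℝ] E × C(unitInterval, E) :=
  have hu' : ∀ t : unitInterval, HasLog (fun s => (u s)⁻¹) t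
      ((-applyCL (AdInv u (continuousOn_of_hasLog hu)) l) t) := fun t => (hu t).inv t.2
  have h0' : (fun s => (u s)⁻¹) 0 = 1 := by simp [h0]
  ContinuousLinearEquiv.equivOfInverse (gaugeCrd u l hu) (gaugeCrd (fun s => (u s)⁻¹) _ hu')
    (fun p => potE_injective (by
      rw [potE_gaugeCrd _ _ _ h0', potE_gaugeCrd _ _ _ h0]
      ext t
      exact AdL_inv_apply _ _))
    (fun p => potE_injective (by
      rw [potE_gaugeCrd _ _ _ h0, potE_gaugeCrd _ _ _ h0']
      ext t
      exact AdL_apply_inv _ _))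

theorem potE_gaugeEquiv (u : ℝ → G) (l : C(unitInterval, E))
    (hu : ∀ t : unitInterval, HasLog u t (l t)) (h0 : u 0 = 1) (p : E × C(unitInterval, E)) :
    potE (gaugeEquiv u l hu h0 p) = applyCL (AdC u (continuousOn_of_hasLog hu)) (potE p) :=
  potE_gaugeCrd u l hu h0 p

variable [CompactSpace G]

/-- The holonomy is continuous, since it is smooth in the coordinates of `exists_hol_chart`. -/
theorem continuous_hol : Continuous (hol (E := E) G) := by
  have := isTopologicalGroup E G
  rw [continuous_iff_continuousAt]
  intro a
  obtain ⟨P, hP, hP0, -, hev⟩ := exists_hol_chart (G := G) a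
  have h1 : ContinuousAt (fun δ => hol G a * κ (P δ)) 0 :=
    continuousAt_const.mul (ContinuousAt.comp (g := κ)
      (by rw [hP0]; exact continuousAt_kap e0_mem) hP.continuousAt)
  have h2 : ContinuousAt (fun δ => hol G (a + δ)) 0 :=
    h1.congr (by filter_upwards [hev] with δ hδ using hδ.2.symm)
  have h3 : ContinuousAt (fun b => hol G (a + (b - a))) a :=
    ContinuousAt.comp (f := fun b => b - a) (g := fun δ => hol G (a + δ)) (by simpa using h2)
      (continuous_id.sub continuous_const).continuousAt
  simpa using h3

/-- The holonomy and the initial values, in the chart of `G` at `g₀`. -/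
def holCrd (g₀ : G) (f : Data E) : E × (Fin 3 → E) := (φ (g₀⁻¹ * hol G (pot E f)), f.2)

/-- The data with holonomy in the domain of the chart of `G` at `g₀`. -/
def holDom (E : Type w) [NormedAddCommGroup E] [NormedSpace ℝ E] [FiniteDimensional ℝ E]
    [ChartedSpace E G] [LieGroup 𝓘(ℝ, E) ∞ G] (g₀ : G) : Set (Data E) :=
  {f | g₀⁻¹ * hol G (pot E f) ∈ (phi E G).source}

theorem isOpen_holDom (g₀ : G) : IsOpen (holDom E g₀) := by
  have := isTopologicalGroup E G
  exact (phi E G).open_source.preimage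
    (continuous_const.mul (continuous_hol.comp (pot E).continuous))

/-- Near `f` the holonomy is the product of its value at `f` and of `κ(P(δ))` for a smooth `P`, and
the multiplication is smooth in the chart. -/
theorem contDiffAt_holCrd {g₀ : G} {f : Data E} (hf : f ∈ holDom E g₀) :
    ContDiffAt ℝ ∞ (holCrd g₀) f := by
  refine ContDiffAt.prodMk ?_ contDiffAt_snd
  obtain ⟨P, hP, hP0, -, hev⟩ := exists_hol_chart (G := G) (pot E f)
  have hκ : κ (φ (g₀⁻¹ * hol G (pot E f))) = g₀⁻¹ * hol G (pot E f) := (phi E G).left_inv hf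
  have h1 : ContDiffAt ℝ ∞ (fun y => lmul E G (φ (g₀⁻¹ * hol G (pot E f)), y)) e₀ :=
    ContDiffAt.comp (g := lmul E G) e₀ (contDiffAt_lmul ((phi E G).map_source hf) e0_mem
      (by
        change κ (φ (g₀⁻¹ * hol G (pot E f))) * κ e₀ ∈ (phi E G).source
        rw [hκ, kap_e0, mul_one]
        exact hf)) (contDiffAt_const.prodMk contDiffAt_id)
  have h0 : ContDiffAt ℝ ∞ (fun f' : Data E => pot E f' - pot E f) f :=
    ((pot E).contDiff.sub contDiff_const).contDiffAt
  have h2 : ContDiffAt ℝ ∞ (fun f' : Data E => P (pot E f' - pot E f)) f :=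
    ContDiffAt.comp (g := P) f (by simpa using hP) h0
  have h3 : ContDiffAt ℝ ∞ (fun f' : Data E => lmul E G (φ (g₀⁻¹ * hol G (pot E f)),
      P (pot E f' - pot E f))) f :=
    ContDiffAt.comp (f := fun f' : Data E => P (pot E f' - pot E f))
      (g := fun y => lmul E G (φ (g₀⁻¹ * hol G (pot E f)), y)) f
      (by simpa [hP0] using h1) h2
  refine h3.congr_of_eventuallyEq ?_
  have h4 : Filter.Tendsto (fun f' : Data E => pot E f' - pot E f) (nhds f) (nhds 0) := by
    simpa using h0.continuousAt.tendsto
  filter_upwards [h4.eventually hev] with f' hf'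
  have h5 := hf'.2
  rw [add_sub_cancel] at h5
  simp only [lmul, hκ, h5, mul_assoc]

/-- The differential of the holonomy and the initial values at the data `f`. -/
def dhol (G : Type*) [TopologicalSpace G] [ChartedSpace E G] [Group G] [LieGroup 𝓘(ℝ, E) ∞ G]
    [CompactSpace G] (f : Data E) : Data E →L[ℝ] E × (Fin 3 → E) :=
  (-(ContinuousMap.evalCLM ℝ (1 : unitInterval) ∘L prim ∘L applyCL (AdT G (pot E f)) ∘L
    pot E)).prod (ContinuousLinearMap.snd ℝ _ _)

/-- In the chart of `G` translated to the holonomy of `f`, the coordinates of the holonomy near `f`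
are the function `P` of `exists_hol_chart`. -/
theorem hasFDerivAt_holCrd (f : Data E) :
    HasFDerivAt (holCrd (hol G (pot E f))) (dhol G f) f := by
  refine HasFDerivAt.prodMk ?_ hasFDerivAt_snd
  obtain ⟨P, -, -, hP, hev⟩ := exists_hol_chart (G := G) (pot E f)
  have h0 : HasFDerivAt (fun f' : Data E => pot E f' - pot E f) (pot E) f :=
    (pot E).hasFDerivAt.sub_const _
  have h1 : HasFDerivAt P (-(ContinuousMap.evalCLM ℝ (1 : unitInterval) ∘L prim ∘L
      applyCL (AdT G (pot E f)))) (pot E f - pot E f) := by rwa [sub_self]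
  have h2 := HasFDerivAt.comp (f := fun f' : Data E => pot E f' - pot E f) f h1 h0
  refine h2.congr_of_eventuallyEq ?_
  have h4 : Filter.Tendsto (fun f' : Data E => pot E f' - pot E f) (nhds f) (nhds 0) := by
    simpa using h0.continuousAt.tendsto
  filter_upwards [h4.eventually hev] with f' hf'
  have h5 := hf'.2
  rw [add_sub_cancel] at h5
  simp only [h5, inv_mul_cancel_left, Function.comp]
  exact (phi E G).right_inv hf'.1

theorem hasLog_transport_inv (a : C(unitInterval, E)) (t : unitInterval) :
    HasLog (fun s => (transport G a s)⁻¹) t (applyCL (AdT G a) a t) := by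
  have h := (hasLog_transport G a t).inv t.2
  rwa [map_neg, neg_neg] at h

/-- The data splits into the values of the differential of the holonomy and the initial values,
and a complement which does not depend on the point: gauge transformations reduce this to the
trivial data. -/
theorem exists_holSplit (f : Data E) : ∃ s : Data E ≃L[ℝ] (E × (Fin 3 → E)) × holKer E,
    ∀ f', (s f').1 = dhol G f f' := by
  have h0 : (fun s => (transport G (pot E f) s)⁻¹) 0 = 1 := by simp
  refine ⟨((gaugeEquiv _ _ (hasLog_transport_inv (G := G) (pot E f)) h0).prodCongr
    (ContinuousLinearEquiv.refl ℝ (Fin 3 → E))).trans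
    (ContinuousLinearEquiv.equivOfRightInverse (dhol₀ (E := E)) (dholInv (E := E))
      (fun p => dhol₀_dholInv p)), fun f' => Prod.ext ?_ rfl⟩
  change -(prim (potE (gaugeEquiv _ _ (hasLog_transport_inv (G := G) (pot E f)) h0 f'.1)) 1) = _
  rw [potE_gaugeEquiv]
  rfl

/-- Around every point there is a chart of the space of data in which the holonomy and the initial
values are a linear projection. -/
theorem exists_straightening (f : Data E) : ∃ e : OpenPartialHomeomorph (Data E) (Data E),
    f ∈ e.source ∧ e.source ⊆ holDom E (hol G (pot E f)) ∧
      e ∈ contDiffGroupoid ∞ 𝓘(ℝ, Data E) ∧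
      ∃ s : Data E ≃L[ℝ] (E × (Fin 3 → E)) × holKer E,
        ∀ f', (s (e f')).1 = holCrd (hol G (pot E f)) f' := by
  have : CompleteSpace E := FiniteDimensional.complete ℝ E
  obtain ⟨s, hs⟩ := exists_holSplit (G := G) f
  let Ψ : Data E → Data E := fun f' => s.symm (holCrd (hol G (pot E f)) f', (s f').2)
  have hf : f ∈ holDom E (hol G (pot E f)) := by
    change (hol G (pot E f))⁻¹ * hol G (pot E f) ∈ (phi E G).source
    rw [inv_mul_cancel]
    exact one_mem_phi
  have h1 : ContDiffOn ℝ ∞ Ψ (holDom E (hol G (pot E f))) := fun f' hf' =>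
    (contDiffAt_symm_split (X := Data E) (Y := E × (Fin 3 → E)) (K := holKer E) s
      (contDiffAt_holCrd hf')).contDiffWithinAt
  have h2 : HasFDerivAt Ψ (ContinuousLinearMap.id ℝ (Data E)) f :=
    hasFDerivAt_symm_split (X := Data E) (Y := E × (Fin 3 → E)) (K := holKer E) s
      (hasFDerivAt_holCrd f) hs
  obtain ⟨e, he1, he2, he3, he4⟩ := exists_contDiffGroupoid (isOpen_holDom _) hf h1 h2
  refine ⟨e, he1, he2, he4, s, fun f' => ?_⟩
  rw [he3]
  change (s (s.symm _)).1 = _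
  rw [s.apply_symm_apply]

/-- The holonomy together with the initial values is an open map. -/
theorem isOpenMap_hol : IsOpenMap (fun f : Data E => (hol G (pot E f), f.2)) := by
  have hG := isTopologicalGroup E G
  have : CompleteSpace E := FiniteDimensional.complete ℝ E
  rw [isOpenMap_iff_nhds_le]
  intro f
  set g₀ := hol G (pot E f)
  have hf : f ∈ holDom E g₀ := by
    change g₀⁻¹ * hol G (pot E f) ∈ (phi E G).source
    rw [inv_mul_cancel]
    exact one_mem_phi
  have h1 := (contDiffAt_holCrd hf).hasStrictFDerivAt' (hasFDerivAt_holCrd f) (by simp)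
  have h2 : Filter.map (holCrd g₀) (nhds f) = nhds (holCrd g₀ f) := by
    refine h1.map_nhds_eq_of_surj (LinearMap.range_eq_top.2 fun p => ?_)
    obtain ⟨s, hs⟩ := exists_holSplit (G := G) f
    exact ⟨s.symm (p, 0), by
      refine (hs _).symm.trans ?_
      rw [ContinuousLinearEquiv.apply_symm_apply]⟩
  have h3 : holCrd g₀ f = (e₀, f.2) := by
    refine Prod.ext ?_ rfl
    change φ (g₀⁻¹ * g₀) = _
    rw [inv_mul_cancel]
  -- `R` inverts the chart of `G × 𝔤³` at the image point, and `holCrd` is open at `f` since its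
  -- derivative is onto
  let R : E × (Fin 3 → E) → G × (Fin 3 → E) := fun p => (g₀ * κ p.1, p.2)
  have h4 : Filter.map R (nhds (e₀, f.2)) = nhds (g₀, f.2) := by
    have h5 : Filter.map (fun y => g₀ * κ y) (nhds e₀) = nhds g₀ := by
      have h6 := (phi E G).symm.map_nhds_eq (x := e₀) e0_mem
      have h7 := (Homeomorph.mulLeft g₀).map_nhds_eq (κ e₀)
      rw [← h6, Filter.map_map, kap_e0] at h7
      simpa using! h7
    rw [nhds_prod_eq, nhds_prod_eq, ← h5]
    have h8 := Filter.prod_map_map_eq (f₁ := nhds e₀) (f₂ := nhds f.2)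
      (m₁ := fun y => g₀ * κ y) (m₂ := id)
    rw [Filter.map_id] at h8
    exact h8.symm
  have h6 : (fun f : Data E => (hol G (pot E f), f.2)) =ᶠ[nhds f] R ∘ holCrd g₀ := by
    filter_upwards [(isOpen_holDom g₀).mem_nhds hf] with f' hf'
    have h7 := (phi E G).left_inv hf'
    simp only [R, holCrd, Function.comp, h7, mul_inv_cancel_left]
  rw [Filter.map_congr h6, ← Filter.map_map, h2, h3, h4]

end Holonomy

section ModuliManifold

universe w
variable {E : Type w} [NormedAddCommGroup E] [NormedSpace ℝ E] [FiniteDimensional ℝ E]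
  {G : Type*} [TopologicalSpace G] [ChartedSpace E G] [Group G] [LieGroup 𝓘(ℝ, E) ∞ G]
  [CompactSpace G] [hI : HasInvForm E G]

local notation "φ" => phi E G
local notation "κ" => (OpenPartialHomeomorph.symm (phi E G))
local notation "e₀" => phi E G 1

/-! ### The moduli space as a manifold -/

/-- The gauge invariants of a solution: the holonomy of `T₀` and the initial values of
`T₁, T₂, T₃`. They identify the moduli space with an open subset of `G × 𝔤³`. -/
def invts : Moduli E G → G × (Fin 3 → E) :=
  Quot.lift (fun T => (hol G (fn (T.1 0)), start T.1)) fun T T' h => by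
    obtain ⟨B, hL⟩ := hI.exists_form
    obtain ⟨h1, h2⟩ := (gaugeRel_iff hL T T').1 h
    exact Prod.ext h1 (funext h2)

theorem invts_proj (T : solutions E G) :
    invts (proj E G T) = (hol G (fn (T.1 0)), start T.1) := rfl

theorem invts_proj_symm (f : Data E) :
    invts (proj E G ((solHomeo E G).symm f)) = (hol G (pot E f), f.2) := by
  have h : solHomeo E G ((solHomeo E G).symm f) = f := (solHomeo E G).apply_symm_apply f
  rw [invts_proj, ← pot_restr]
  change (hol G (pot E (solHomeo E G ((solHomeo E G).symm f))),
    (solHomeo E G ((solHomeo E G).symm f)).2) = _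
  rw [h]

theorem proj_surjective : Function.Surjective (proj E G) := Quot.mk_surjective

theorem continuous_proj : Continuous (proj E G) := continuous_quot_mk

/-- The invariants are injective by `gaugeRel_iff`, continuous by the definition of the quotient
topology, and open by `isOpenMap_hol`. -/
theorem isOpenEmbedding_invts : Topology.IsOpenEmbedding (invts (E := E) (G := G)) := by
  have hq : Topology.IsQuotientMap (fun f => proj E G ((solHomeo E G).symm f)) :=
    isQuotientMap_quot_mk.comp (solHomeo E G).symm.isQuotientMap
  have hc : invts (E := E) (G := G) ∘ (fun f => proj E G ((solHomeo E G).symm f)) =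
      fun f => (hol G (pot E f), f.2) := funext invts_proj_symm
  refine Topology.IsOpenEmbedding.of_continuous_injective_isOpenMap ?_ ?_ ?_
  · rw [hq.continuous_iff, hc]
    exact (continuous_hol.comp (pot E).continuous).prodMk continuous_snd
  · intro x y h
    obtain ⟨T, rfl⟩ := proj_surjective x
    obtain ⟨T', rfl⟩ := proj_surjective y
    obtain ⟨B, hL⟩ := hI.exists_form
    rw [invts_proj, invts_proj, Prod.mk.injEq] at h
    exact Quot.sound ((gaugeRel_iff hL T T').2 ⟨h.1, congrFun h.2⟩)
  · intro O hO
    have h1 := isOpenMap_hol (G := G) _ (hO.preimage hq.continuous)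
    rw [← hc, image_comp, image_preimage_eq _ hq.surjective] at h1
    exact h1

instance instNonemptyModuli : Nonempty (Moduli E G) := ⟨proj E G ((solHomeo E G).symm 0)⟩

instance instT2SpaceModuli [T2Space G] : T2Space (Moduli E G) :=
  T2Space.of_injective_continuous isOpenEmbedding_invts.injective isOpenEmbedding_invts.continuous

instance instSecondCountableModuli : SecondCountableTopology (Moduli E G) := by
  have : ProperSpace E := FiniteDimensional.proper ℝ E
  have : SecondCountableTopology G := ChartedSpace.secondCountable_of_sigmaCompact E G
  exact isOpenEmbedding_invts.isEmbedding.secondCountableTopology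

variable (E) in
/-- The model space of the moduli space. -/
abbrev Model : Type := EuclideanSpace ℝ (Fin (4 * Module.finrank ℝ E))

variable (E) in
/-- A linear identification of `𝔤 × 𝔤³` with the model space. -/
def crd4 : (E × (Fin 3 → E)) ≃L[ℝ] Model E :=
  ContinuousLinearEquiv.ofFinrankEq (by
    rw [Module.finrank_prod, Module.finrank_pi_fintype, finrank_euclideanSpace_fin]
    simp
    ring)

/-- The chart of `G × 𝔤³` at the points over `g₀`. -/
def chartGW (g₀ : G) : OpenPartialHomeomorph (G × (Fin 3 → E)) (Model E) :=
  have := isTopologicalGroup E G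
  (((Homeomorph.mulLeft g₀⁻¹).toOpenPartialHomeomorph ≫ₕ φ).prod
    (OpenPartialHomeomorph.refl (Fin 3 → E))) ≫ₕ (crd4 E).toHomeomorph.toOpenPartialHomeomorph

/-- The chart of the moduli space at `x`. -/
def modChart (x : Moduli E G) : OpenPartialHomeomorph (Moduli E G) (Model E) :=
  isOpenEmbedding_invts.toOpenPartialHomeomorph invts ≫ₕ chartGW (invts x).1

theorem modChart_apply (x y : Moduli E G) :
    modChart x y = crd4 E (φ ((invts x).1⁻¹ * (invts y).1), (invts y).2) := rfl

theorem mem_modChart_source {x y : Moduli E G} :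
    y ∈ (modChart x).source ↔ (invts x).1⁻¹ * (invts y).1 ∈ (phi E G).source := by
  simp [modChart, chartGW]

theorem mem_modChart_source_self (x : Moduli E G) : x ∈ (modChart x).source := by
  rw [mem_modChart_source, inv_mul_cancel]
  exact one_mem_phi

theorem modChart_self (x : Moduli E G) : modChart x x = crd4 E (e₀, (invts x).2) := by
  rw [modChart_apply, inv_mul_cancel]

theorem invts_modChart_symm {x : Moduli E G} {p : Model E} (hp : p ∈ (modChart x).target) :
    ((crd4 E).symm p).1 ∈ (phi E G).target ∧
    invts ((modChart x).symm p) = ((invts x).1 * κ ((crd4 E).symm p).1, ((crd4 E).symm p).2) := by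
  have h1 := (modChart x).map_target hp
  rw [mem_modChart_source] at h1
  have h2 := (modChart x).right_inv hp
  rw [modChart_apply] at h2
  have h3 : (crd4 E).symm p = (φ ((invts x).1⁻¹ * (invts ((modChart x).symm p)).1),
      (invts ((modChart x).symm p)).2) := by
    conv_lhs => rw [← h2]
    rw [ContinuousLinearEquiv.symm_apply_apply]
  rw [h3]
  refine ⟨(phi E G).map_source h1, Prod.ext ?_ rfl⟩
  simp [(phi E G).left_inv h1]

/-- The chart at a point translates its holonomy to the identity of `G`, so all charts are given by
the one chart of `G` at the identity. -/
instance instChartedSpaceModuli : ChartedSpace (Model E) (Moduli E G) where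
  atlas := range modChart
  chartAt := modChart
  mem_chart_source := mem_modChart_source_self
  chart_mem_atlas x := mem_range_self x

/-- The change of charts of the moduli space. -/
theorem modChart_comp_symm {x y : Moduli E G} {p : Model E} (hp : p ∈ (modChart x).target) :
    modChart y ((modChart x).symm p) = crd4 E (φ ((invts y).1⁻¹ * (invts x).1 *
      κ ((crd4 E).symm p).1), ((crd4 E).symm p).2) := by
  rw [modChart_apply, (invts_modChart_symm hp).2, mul_assoc]

theorem contDiffAt_leftMul_chart {h : G} {y : E} (hy : y ∈ (phi E G).target)
    (hm : h * κ y ∈ (phi E G).source) : ContDiffAt ℝ ∞ (fun z => φ (h * κ z)) y :=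
  contDiffAt_phi_comp (contMDiffAt_const.mul (contMDiffAt_kap hy)) hm

instance instIsManifoldModuli : IsManifold 𝓘(ℝ, Model E) ∞ (Moduli E G) := by
  refine isManifold_of_contDiffOn _ _ _ ?_
  rintro _ _ ⟨x, rfl⟩ ⟨y, rfl⟩
  intro p hp
  have hp1 : p ∈ (modChart x).target := hp.1.1
  have hp2 : (modChart x).symm p ∈ (modChart y).source := hp.1.2
  have h1 := invts_modChart_symm hp1
  rw [mem_modChart_source, h1.2, ← mul_assoc] at hp2
  have h2 : ContDiffAt ℝ ∞ (fun p : Model E => crd4 E (φ ((invts y).1⁻¹ * (invts x).1 *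
      κ ((crd4 E).symm p).1), ((crd4 E).symm p).2)) p := by
    have h3 : ContDiffAt ℝ ∞ (fun p : Model E => (crd4 E).symm p) p :=
      (crd4 E).symm.contDiff.contDiffAt
    have h4 := ContDiffAt.comp (f := fun p : Model E => ((crd4 E).symm p).1) p
      (contDiffAt_leftMul_chart h1.1 hp2) h3.fst
    exact (crd4 E).contDiff.contDiffAt.comp p (h4.prodMk h3.snd)
  refine ContDiffAt.contDiffWithinAt (h2.congr_of_eventuallyEq ?_)
  filter_upwards [(modChart x).open_target.mem_nhds hp1] with q hq
  exact modChart_comp_symm hq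

/-- The projection in the charts. -/
theorem modChart_proj_symm (T : solutions E G) (f : Data E) :
    modChart (proj E G T) (proj E G ((solHomeo E G).symm f)) =
      crd4 E (holCrd (hol G (pot E (solHomeo E G T))) f) := by
  rw [modChart_apply, invts_proj_symm, invts_proj, ← pot_restr]
  rfl

variable (E G) in
/-- In the charts of `exists_straightening` the projection is linear, with a complemented kernel. -/
theorem isSubmersion_proj : IsSubmersion 𝓘(ℝ, Data E) 𝓘(ℝ, Model E) ∞ (proj E G) := by
  refine ⟨holKer E, inferInstance, inferInstance, fun T => ?_⟩
  obtain ⟨e, he1, -, he3, s, hs⟩ := exists_straightening (G := G) (solHomeo E G T)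
  refine IsSubmersionAtOfComplement.mk_of_continuousAt continuous_proj.continuousAt
    (s.trans ((crd4 E).prodCongr (ContinuousLinearEquiv.refl ℝ (holKer E))))
    (solChart E G ≫ₕ e) (modChart (proj E G T)) ?_ (mem_modChart_source_self _) ?_
    (IsManifold.chart_mem_maximalAtlas (n := ∞) (I := 𝓘(ℝ, Model E)) (proj E G T)) ?_
  · rw [OpenPartialHomeomorph.trans_source]
    exact ⟨mem_univ _, he1⟩
  · have h1 := (mem_groupoid_of_pregroupoid.mp he3)
    rw [IsManifold.maximalAtlas, mem_maximalAtlas_iff]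
    intro e' he'
    have he'' : e' = solChart E G := he'
    subst he''
    have h2 : (solChart E G).symm ≫ₕ (solChart E G ≫ₕ e) ≈ e := by
      refine ⟨by ext y; simp [solChart], fun y _ => ?_⟩
      change e (solHomeo E G ((solHomeo E G).symm y)) = e y
      rw [(solHomeo E G).apply_symm_apply]
    have h3 : (solChart E G ≫ₕ e).symm ≫ₕ solChart E G ≈ e.symm := by
      refine ⟨by ext y; simp [solChart], fun y _ => ?_⟩
      change solHomeo E G ((solHomeo E G).symm (e.symm y)) = e.symm y
      rw [(solHomeo E G).apply_symm_apply]
    exact ⟨(contDiffGroupoid ∞ 𝓘(ℝ, Data E)).mem_of_eqOnSource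
      ((contDiffGroupoid ∞ 𝓘(ℝ, Data E)).symm he3) h3,
      (contDiffGroupoid ∞ 𝓘(ℝ, Data E)).mem_of_eqOnSource he3 h2⟩
  · intro y hy
    have hy' : y ∈ e.target := by simpa [solChart] using hy
    change modChart (proj E G T) (proj E G ((solHomeo E G).symm (e.symm y))) = crd4 E (s y).1
    rw [modChart_proj_symm, ← hs, e.right_inv hy']

/-- The differential of the projection. -/
theorem mfderiv_proj (T : solutions E G) (v : Data E) :
    mfderiv 𝓘(ℝ, Data E) 𝓘(ℝ, Model E) (proj E G) T v =
      crd4 E (dhol G (solHomeo E G T) v) := by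
  have hm : MDifferentiableAt 𝓘(ℝ, Data E) 𝓘(ℝ, Model E) (proj E G) T :=
    ((isSubmersion_proj E G).contMDiff T).mdifferentiableAt (by simp)
  have h2 := (crd4 E : _ →L[ℝ] Model E).hasFDerivAt.comp (solHomeo E G T)
    (hasFDerivAt_holCrd (G := G) (solHomeo E G T))
  have h3 : mfderiv 𝓘(ℝ, Data E) 𝓘(ℝ, Model E) (proj E G) T =
      fderiv ℝ (fun f : Data E => crd4 E (holCrd (hol G (pot E (solHomeo E G T))) f))
        (solHomeo E G T) := by
    rw [hm.mfderiv, modelWithCornersSelf_coe, range_id, fderivWithin_univ]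
    refine congrArg (fun F : Data E → Model E => fderiv ℝ F (solHomeo E G T)) ?_
    exact funext fun f => modChart_proj_symm T f
  rw [h3]
  exact DFunLike.congr_fun h2.fderiv v

end ModuliManifold

section Horizontal

universe w
variable {E : Type w} [NormedAddCommGroup E] [NormedSpace ℝ E] [FiniteDimensional ℝ E]
  {G : Type*} [TopologicalSpace G] [ChartedSpace E G] [Group G] [LieGroup 𝓘(ℝ, E) ∞ G]

/-! ### Horizontal solutions and gauge transformations -/

variable (E) in
/-- The adjoint action on quadruples. -/
def AdP (g : G) : (Fin 4 → E) →L[ℝ] (Fin 4 → E) :=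
  ContinuousLinearMap.pi fun i => AdL E g ∘L ContinuousLinearMap.proj i

@[simp] theorem AdP_apply (g : G) (x : Fin 4 → E) (i : Fin 4) : AdP E g x i = AdL E g (x i) := rfl

theorem AdP_qL (g : G) (a x : Fin 4 → E) :
    AdP E g (qL (lieBracket E G) a x) = qL (lieBracket E G) (AdP E g a) (AdP E g x) := by
  ext i
  fin_cases i <;> simp [qL_apply, AdL_bracket]

variable [CompactSpace G]

/-- The inverse of the transport takes a solution to temporal gauge; without the derivative of the
transport, the entry of index `0` is `Ad(v⁻¹) T₀`. -/
theorem AdP_transport_inv_ev {B : LinearMap.BilinForm ℝ E} (hL : IsMetricLie (lieBracket E G) B)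
    {T : Quad E} (hT : IsSolution (lieBracket E G) T) (t : unitInterval) :
    AdP E (transport G (fn (T 0)) t)⁻¹ (ev T t) = tz (lieBracket E G) (start T) t +
      inj0 E (AdL E (transport G (fn (T 0)) t)⁻¹ (fn (T 0) t)) := by
  ext i
  refine Fin.cases ?_ (fun i => ?_) i
  · rw [Pi.add_apply, tz_apply_zero hL, inj0_zero, zero_add]
    rfl
  · have h : ∀ x : E, inj0 E x i.succ = 0 := fun x => rfl
    rw [Pi.add_apply, h, add_zero]
    exact AdL_transport_inv hL hT i t

/-- Solutions of the linearised and gauge-fixed equations along a solution correspond to those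
along its transform in temporal gauge. -/
theorem AdP_transport_inv_horC {B : LinearMap.BilinForm ℝ E}
    (hL : IsMetricLie (lieBracket E G) B) {T : Quad E} (hT : IsSolution (lieBracket E G) T)
    (η : Fin 4 → E) (t : unitInterval) :
    AdP E (transport G (fn (T 0)) t)⁻¹ (horC (lieBracket E G) (ev T) η t) =
      hor (lieBracket E G) (start T) η t := by
  set br := lieBracket E G
  set u : ℝ → G := fun s => (transport G (fn (T 0)) s)⁻¹ with hu
  have hlog := hasLog_transport_inv (G := G) (fn (T 0))
  have hc : ContinuousOn u (Icc (0 : ℝ) 1) := continuousOn_of_hasLog hlog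
  set x := horC br (ev T) η
  let y : C(unitInterval, Fin 4 → E) := ⟨fun t i => applyCL (AdC u hc)
    ((ContinuousLinearMap.proj (R := ℝ) (φ := fun _ : Fin 4 => E) i).compLeftContinuous ℝ
      unitInterval x) t, continuous_pi fun i => ContinuousMap.continuous _⟩
  have hy : ∀ t, y t = AdP E (u t) (x t) := fun t => rfl
  have hd : IsDeriv y (-bilC (qL br) (tz br (start T)) y) := fun t => by
    refine hasDerivWithinAt_pi.2 fun i => ?_
    have h1 := isDeriv_horC br (ev T) η
    have h2 := h1.clm (ContinuousLinearMap.proj (R := ℝ) (φ := fun _ : Fin 4 => E) i)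
    have h3 := (adC1 u _ hlog ⟨(_, _), h2⟩).2 t
    refine h3.congr_deriv ?_
    change AdL E (u t) ((-bilC (qL br) (ev T) x) t i) + br (applyCL (AdT G (fn (T 0))) (fn (T 0)) t)
      (AdL E (u t) (x t i)) = -(qL br (tz br (start T) t) (y t) i)
    have h4 : AdL E (u t) ((-bilC (qL br) (ev T) x) t i) = -(AdP E (u t) (qL br (ev T t) (x t)) i) :=
      map_neg _ _
    rw [h4, AdP_qL, AdP_transport_inv_ev hL hT, map_add, _root_.add_apply, qL_inj0, ← hy]
    rw [Pi.add_apply, brT_apply]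
    change -(_ + br _ (y t i)) + br _ (y t i) = _
    rw [neg_add]
    exact neg_add_cancel_right _ _
  have h5 := eq_horC br (tz br (start T)) hd (neg_add_cancel _)
  have h6 : y 0 = η := by
    rw [hy, horC_zero]
    ext i
    simp [hu, AdL_one]
  rw [h6] at h5
  exact DFunLike.congr_fun h5 t

/-- The `L²` metric on horizontal solutions is invariant under the transformation to temporal
gauge. -/
theorem gC_horC_eq_hg {B : LinearMap.BilinForm ℝ E} (hL : IsMetricLie (lieBracket E G) B)
    (hA : ∀ (u : G) (x y : E), B (Ad E u x) (Ad E u y) = B x y) {T : Quad E}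
    (hT : IsSolution (lieBracket E G) T) (η θ : Fin 4 → E) :
    gC B (horC (lieBracket E G) (ev T) η) (horC (lieBracket E G) (ev T) θ) =
      hg (lieBracket E G) B (start T) η θ := by
  rw [hg_apply, gC_eq_integral, gC_eq_integral]
  congr 1
  funext t
  rw [← AdP_transport_inv_horC hL hT, ← AdP_transport_inv_horC hL hT]
  simp only [g4_apply, AdP_apply, ← Ad_eq_AdL, hA]

/-! ### The horizontal frame -/

/-- The horizontal frame: the differential of the holonomy and the initial values, on horizontal
solutions along the solution in temporal gauge. -/
def frm (br : E →L[ℝ] E →L[ℝ] E) (a : Fin 3 → E) : (Fin 4 → E) →L[ℝ] E × (Fin 3 → E) :=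
  (-hc br a).prod (tl E)

theorem frm_apply (br : E →L[ℝ] E →L[ℝ] E) (a : Fin 3 → E) (η : Fin 4 → E) :
    frm br a η = (-hc br a η, tl E η) := rfl

/-- A horizontal vector in the kernel of the frame is an infinitesimal gauge transformation
vanishing at both ends, hence orthogonal to all horizontal vectors. -/
theorem frm_injective {br : E →L[ℝ] E →L[ℝ] E} {B : LinearMap.BilinForm ℝ E}
    (hL : IsMetricLie br B) {a : Fin 3 → E} (hn : FrameNondeg br B a) :
    Function.Injective (frm br a) := by
  rw [injective_iff_map_eq_zero]
  intro η hη
  rw [frm_apply, Prod.mk_eq_zero, neg_eq_zero] at hη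
  refine hn η fun θ => ?_
  have h3 := hor_eq hL a η
  rw [hη.2, map_zero, zero_add] at h3
  rw [hg_apply, h3]
  refine gC_fundC_hor hL _ (isDeriv_gz _) (gz_zero _) ?_ θ
  rw [gz_one, neg_eq_zero]
  exact hη.1

theorem isInvertible_of_injective {br : E →L[ℝ] E →L[ℝ] E} {a : Fin 3 → E}
    (h : Function.Injective (frm br a)) : (frm br a).IsInvertible := by
  have h1 : Module.finrank ℝ (Fin 4 → E) = Module.finrank ℝ (E × (Fin 3 → E)) := by
    rw [Module.finrank_prod, Module.finrank_pi_fintype, Module.finrank_pi_fintype]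
    simp
    ring
  exact ⟨(LinearEquiv.ofInjectiveOfFinrankEq (frm br a : (Fin 4 → E) →ₗ[ℝ] _) h
    h1).toContinuousLinearEquiv, rfl⟩

/-- If `Δ ξ = 0` then the fundamental vector field of `ξ` is horizontal and its frame coordinates
vanish, since it is tangent to the gauge orbit. -/
theorem Delta_injective_of_frm {B : LinearMap.BilinForm ℝ E}
    (hL : IsMetricLie (lieBracket E G) B) {T : Quad E} (hT : IsSolution (lieBracket E G) T)
    (h : Function.Injective (frm (lieBracket E G) (start T))) (ξ : LieG00 E)
    (hξ : Delta (lieBracket E G) T ξ = 0) : ξ = 0 := by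
  have : CompleteSpace E := FiniteDimensional.complete ℝ E
  set br := lieBracket E G
  by_contra hne
  apply fundField_ne_zero br T hne
  have h1 := isDeriv_fundC_lie br T ξ
  have h2 := fundD_add hL hT ξ.1.1 ξ.1.2.1 ξ.1.2.2
  have h3 : bigDelta br T (ξ.1.1, ξ.1.2.1, ξ.1.2.2) = 0 := hξ
  rw [h3, map_zero, neg_zero] at h2
  have h4 := eq_horC br (ev T) h1 h2
  set x := fundC br (ev T) ξ.1.1 ξ.1.2.1
  have hlog := hasLog_transport_inv (G := G) (fn (T 0))
  let Y := adC1 _ _ hlog ⟨(ξ.1.1, ξ.1.2.1), ξ.2.1⟩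
  -- in temporal gauge the entry of index `0` is a derivative, so its integral vanishes
  have hY : comp0 (hor br (start T) (x 0)) = -der Y := by
    ext t
    rw [comp0_apply, ← AdP_transport_inv_horC hL hT, ← h4]
    change AdL E _ (br (ξ.1.1 t) (fn (T 0) t) - ξ.1.2.1 t) = -(AdL E _ (ξ.1.2.1 t) +
      br (AdL E _ (fn (T 0) t)) (AdL E _ (ξ.1.1 t)))
    rw [map_sub, AdL_bracket, hL.skew (AdL E _ (ξ.1.1 t))]
    abel
  have h5 : x 0 = 0 := by
    refine (injective_iff_map_eq_zero _).1 h _ ?_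
    rw [frm_apply, Prod.mk_eq_zero]
    constructor
    · change -(prim (comp0 (hor br (start T) (x 0))) 1) = 0
      rw [hY, map_neg, ContinuousMap.neg_apply, neg_neg]
      have h6 := (isDeriv_fn Y).eq_add_prim 1
      have h7 : fn Y 1 = 0 := by
        change AdL E _ (ξ.1.1 1) = 0
        rw [ξ.2.2.2.2, map_zero]
      have h8 : fn Y 0 = 0 := by
        change AdL E _ (ξ.1.1 0) = 0
        rw [ξ.2.2.2.1, map_zero]
      rw [h7, h8, zero_add] at h6
      exact h6.symm
    · funext i
      have h9 : x 0 i.succ = br (ξ.1.1 0) (fn (T i.succ) 0) := by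
        change br (ξ.1.1 0) (fn (T i.succ) 0) - 0 = _
        rw [sub_zero]
      rw [tl_apply, h9, ξ.2.2.2.1, map_zero]
      rfl
  rw [h5, map_zero] at h4
  exact Quad.ext_ev (by rw [ev_fundField]; simpa using! h4)

/-- Outside the degeneracy locus `Δ` is injective, and conversely. -/
theorem notMem_degeneracyLocus_iff_Delta {B : LinearMap.BilinForm ℝ E}
    (hL : IsMetricLie (lieBracket E G) B) {T : Quad E} (hT : T ∈ solutions E G) :
    T ∉ degeneracyLocus E G B ↔ ∀ ξ, Delta (lieBracket E G) T ξ = 0 → ξ = 0 := by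
  have h := degenerate_iff hL (T := T) hT
  constructor
  · intro h1 ξ hξ
    by_contra hne
    exact h1 ⟨hT, h.2 ⟨ξ, hξ, hne⟩⟩
  · rintro h1 ⟨-, h2⟩
    obtain ⟨ξ, hξ, hne⟩ := h.1 h2
    exact hne (h1 ξ hξ)

/-- Outside the degeneracy locus, the metric is non-degenerate in the horizontal frame. -/
theorem frameNondeg_of_notMem {B : LinearMap.BilinForm ℝ E}
    (hL : IsMetricLie (lieBracket E G) B)
    (hA : ∀ (u : G) (x y : E), B (Ad E u x) (Ad E u y) = B x y) {T : Quad E}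
    (hT : T ∈ solutions E G) (h : T ∉ degeneracyLocus E G B) :
    FrameNondeg (lieBracket E G) B (start T) := by
  rw [notMem_degeneracyLocus_iff_Delta hL hT] at h
  obtain ⟨e, he⟩ := (isInvertible_Delta_iff (lieBracket E G) T).2 h
  intro η hη
  refine horC_nondegenerate hL hT ?_ η fun θ => ?_
  · rw [← he]
    exact e.surjective
  · rw [gC_horC_eq_hg hL hA hT, hη]

end Horizontal

section Regular

universe w
variable {E : Type w} [NormedAddCommGroup E] [NormedSpace ℝ E] [FiniteDimensional ℝ E]
  {G : Type*} [TopologicalSpace G] [ChartedSpace E G] [Group G] [LieGroup 𝓘(ℝ, E) ∞ G]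

local notation "φ" => phi E G
local notation "κ" => (OpenPartialHomeomorph.symm (phi E G))
local notation "e₀" => phi E G 1

/-! ### The frame in the charts -/

variable (G) in
/-- The horizontal frame at the point of `G × 𝔤³` with coordinates `q`: the entries in `𝔤` are
translated from the identity. -/
def frmQ (q : E × (Fin 3 → E)) : (Fin 4 → E) →L[ℝ] E × (Fin 3 → E) :=
  ContinuousLinearMap.inl ℝ E (Fin 3 → E) ∘L ltr E G q.1 ∘L (-hc (lieBracket E G) q.2) +
    ContinuousLinearMap.inr ℝ E (Fin 3 → E) ∘L tl E

theorem frmQ_apply (q : E × (Fin 3 → E)) (η : Fin 4 → E) :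
    frmQ G q η = (ltr E G q.1 (-hc (lieBracket E G) q.2 η), tl E η) := by
  simp [frmQ]

theorem frmQ_e0 (a : Fin 3 → E) : frmQ G (e₀, a) = frm (lieBracket E G) a := by
  ext1 η
  rw [frmQ_apply, ltr_e0]
  rfl

theorem contDiffAt_frmQ {B : LinearMap.BilinForm ℝ E} (hL : IsMetricLie (lieBracket E G) B)
    {q : E × (Fin 3 → E)} (hq : q.1 ∈ (phi E G).target) : ContDiffAt ℝ ∞ (frmQ G) q := by
  have h1 : ContDiffAt ℝ ∞ (fun q : E × (Fin 3 → E) => ltr E G q.1) q :=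
    ContDiffAt.comp (f := fun q : E × (Fin 3 → E) => q.1) q (contDiffAt_ltr hq) contDiffAt_fst
  have h2 : ContDiff ℝ ∞ (fun q : E × (Fin 3 → E) => hc (lieBracket E G) q.2) :=
    (contDiff_hc hL).comp contDiff_snd
  exact (contDiffAt_const.clm_comp (h1.clm_comp h2.contDiffAt.neg)).add contDiffAt_const

/-- Invertibility is an open condition on the continuous function `frm`. -/
theorem isOpen_frm_isInvertible {B : LinearMap.BilinForm ℝ E}
    (hL : IsMetricLie (lieBracket E G) B) :
    IsOpen {a : Fin 3 → E | (frm (lieBracket E G) a).IsInvertible} := by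
  have : CompleteSpace E := FiniteDimensional.complete ℝ E
  have h1 : Continuous (fun a : Fin 3 → E => frmQ G (e₀, a)) := by
    rw [continuous_iff_continuousAt]
    intro a
    exact ContinuousAt.comp (g := frmQ G) (contDiffAt_frmQ hL e0_mem).continuousAt
      (continuous_const.prodMk continuous_id).continuousAt
  simp only [frmQ_e0] at h1
  exact (ContinuousLinearEquiv.isOpen (𝕜 := ℝ) (E := Fin 4 → E) (F := E × (Fin 3 → E))).preimage h1

/-- The Lie brackets of the fields of the horizontal frame are given by the antisymmetrised connection
form; this is the vanishing of the torsion. -/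
theorem fderiv_frmQ_sub {B : LinearMap.BilinForm ℝ E} (hL : IsMetricLie (lieBracket E G) B)
    {a : Fin 3 → E} (hn : FrameNondeg (lieBracket E G) B a)
    (hi : (frm (lieBracket E G) a).IsInvertible) (v w : Fin 4 → E) :
    fderiv ℝ (frmQ G) (e₀, a) (frmQ G (e₀, a) v) w -
      fderiv ℝ (frmQ G) (e₀, a) (frmQ G (e₀, a) w) v =
      frmQ G (e₀, a) (hGam (lieBracket E G) B a v w - hGam (lieBracket E G) B a w v) := by
  set br := lieBracket E G
  -- the derivative of the left translations, antisymmetrised, is the Lie bracket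
  have key : ∀ v w, fderiv ℝ (frmQ G) (e₀, a) (frmQ G (e₀, a) v) w =
      (fderiv ℝ (ltr E G) e₀ (-hc br a v) (-hc br a w) - fderiv ℝ (hc br) a (tl E v) w, 0) := by
    intro v w
    have h0 := ((contDiffAt_frmQ hL (q := (e₀, a)) e0_mem).differentiableAt (by simp)).hasFDerivAt
    have h1 := h0.clm_apply (hasFDerivAt_const w (e₀, a))
    have h2 : HasFDerivAt (ltr E G) _ e₀ :=
      ((contDiffAt_ltr (e0_mem (E := E) (G := G))).differentiableAt (by simp)).hasFDerivAt
    have h3 := HasFDerivAt.comp (f := fun q : E × (Fin 3 → E) => q.1) (e₀, a) h2 hasFDerivAt_fst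
    have h4 := ((contDiff_hc hL).differentiable (by simp) a).hasFDerivAt
    have h5 := HasFDerivAt.comp (f := fun q : E × (Fin 3 → E) => q.2) (e₀, a) h4 hasFDerivAt_snd
    have h6 := (h3.clm_apply (h5.neg.clm_apply (hasFDerivAt_const w (e₀, a)))).prodMk
      (hasFDerivAt_const (tl E w) (e₀, a))
    have h7 := h6.congr_of_eventuallyEq (f₁ := fun q => frmQ G q w)
      (Filter.Eventually.of_forall fun q => frmQ_apply q w)
    have h8 := DFunLike.congr_fun (h1.unique h7) (frmQ G (e₀, a) v)
    have h9 : frmQ G (e₀, a) v = (-hc br a v, tl E v) := by rw [frmQ_e0, frm_apply]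
    have h10 : fderiv ℝ (frmQ G) (e₀, a) (frmQ G (e₀, a) v) w =
        ((fderiv ℝ (frmQ G) (e₀, a)).flip w) (frmQ G (e₀, a) v) := rfl
    rw [h10]
    refine Eq.trans (by simp) (h8.trans ?_)
    rw [h9]
    refine Prod.ext ?_ ?_
    · simp [ltr_e0]
      abel
    · simp
  have hA : ∀ p : E × (Fin 3 → E), ∃ θ, -hc br a θ = p.1 ∧ tl E θ = p.2 := fun p => by
    obtain ⟨e, he⟩ := hi
    refine ⟨e.symm p, ?_⟩
    have h1 : frm br a (e.symm p) = p := by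
      rw [← he]
      exact e.apply_symm_apply p
    rw [frm_apply] at h1
    exact ⟨congrArg Prod.fst h1, congrArg Prod.snd h1⟩
  obtain ⟨h1, h2⟩ := torsion_hGam hL hn hA v w
  have h3 := lieBracket_eq (E := E) (G := G) (-hc br a v) (-hc br a w)
  have h4 : fderiv ℝ (ltr E G) e₀ (-hc br a v) (-hc br a w) -
      fderiv ℝ (ltr E G) e₀ (-hc br a w) (-hc br a v) = br (hc br a v) (hc br a w) := by
    rw [← h3]
    simp [br]
  rw [key, key, frmQ_e0, frm_apply, h1, h2, ← h4]
  refine Prod.ext ?_ ?_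
  · simp only [Prod.mk_sub_mk]
    abel
  · simp

end Regular

section Regular

universe w
variable {E : Type w} [NormedAddCommGroup E] [NormedSpace ℝ E] [FiniteDimensional ℝ E]
  {G : Type*} [TopologicalSpace G] [ChartedSpace E G] [Group G] [LieGroup 𝓘(ℝ, E) ∞ G]
  [CompactSpace G] [hI : HasInvForm E G]

local notation "φ" => phi E G
local notation "κ" => (OpenPartialHomeomorph.symm (phi E G))
local notation "e₀" => phi E G 1

/-! ### The hypersymplectic structure -/

variable (E G) in
/-- The open subset of the moduli space over which the horizontal frame is invertible. -/
def regular : Opens (Moduli E G) where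
  carrier := {x | (frm (lieBracket E G) (invts x).2).IsInvertible}
  is_open' := by
    obtain ⟨B, hL⟩ := hI.exists_form
    exact (isOpen_frm_isInvertible hL).preimage
      (continuous_snd.comp isOpenEmbedding_invts.continuous)

theorem mem_regular {x : Moduli E G} :
    x ∈ regular E G ↔ (frm (lieBracket E G) (invts x).2).IsInvertible := Iff.rfl

theorem proj_mem_regular_iff {B : LinearMap.BilinForm ℝ E}
    (hL : IsMetricLie (lieBracket E G) B)
    (hA : ∀ (u : G) (x y : E), B (Ad E u x) (Ad E u y) = B x y) (T : solutions E G) :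
    proj E G T ∈ regular E G ↔ T.1 ∉ degeneracyLocus E G B := by
  rw [mem_regular, invts_proj]
  constructor
  · rintro ⟨e, he⟩
    rw [notMem_degeneracyLocus_iff_Delta hL T.2]
    exact Delta_injective_of_frm hL T.2 (by rw [← he]; exact e.injective)
  · intro h
    exact isInvertible_of_injective (frm_injective hL (frameNondeg_of_notMem hL hA T.2 h))

/-- The frame is invertible exactly outside the degeneracy locus, so the regular part of the moduli
space is `𝓜⁰`. -/
theorem coe_regular {B : LinearMap.BilinForm ℝ E} (hL : IsMetricLie (lieBracket E G) B)
    (hA : ∀ (u : G) (x y : E), B (Ad E u x) (Ad E u y) = B x y) :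
    (regular E G : Set (Moduli E G)) = moduliZero E G B := by
  ext x
  constructor
  · intro hx
    obtain ⟨T, rfl⟩ := proj_surjective x
    exact ⟨T, (proj_mem_regular_iff hL hA T).1 hx, rfl⟩
  · rintro ⟨T, hT, rfl⟩
    exact (proj_mem_regular_iff hL hA T).2 hT

theorem frameNondeg_of_mem {B : LinearMap.BilinForm ℝ E} (hL : IsMetricLie (lieBracket E G) B)
    (hA : ∀ (u : G) (x y : E), B (Ad E u x) (Ad E u y) = B x y) {x : Moduli E G}
    (hx : x ∈ regular E G) : FrameNondeg (lieBracket E G) B (invts x).2 := by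
  obtain ⟨T, rfl⟩ := proj_surjective x
  exact frameNondeg_of_notMem hL hA T.2 ((proj_mem_regular_iff hL hA T).1 hx)

theorem chartAt_regular (x y : regular E G) : chartAt (Model E) x y = modChart x.1 y.1 := rfl

theorem crd4_symm_chartAt_self (x : regular E G) :
    (crd4 E).symm (chartAt (Model E) x x) = (e₀, (invts x.1).2) := by
  rw [chartAt_regular, modChart_self, ContinuousLinearEquiv.symm_apply_apply]

theorem crd4_symm_chartAt (x y : regular E G) : (crd4 E).symm (chartAt (Model E) x y) =
    (φ ((invts x.1).1⁻¹ * (invts y.1).1), (invts y.1).2) := by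
  rw [chartAt_regular, modChart_apply, ContinuousLinearEquiv.symm_apply_apply]

variable (G) in
/-- The horizontal frame in the charts of the moduli space. -/
def frmM (p : Model E) : (Fin 4 → E) →L[ℝ] Model E :=
  (crd4 E : E × (Fin 3 → E) →L[ℝ] Model E) ∘L frmQ G ((crd4 E).symm p)

theorem frmM_apply (p : Model E) (η : Fin 4 → E) :
    frmM G p η = crd4 E (frmQ G ((crd4 E).symm p) η) := rfl

theorem contDiffAt_frmM {B : LinearMap.BilinForm ℝ E} (hL : IsMetricLie (lieBracket E G) B)
    (x : regular E G) : ContDiffAt ℝ ∞ (frmM G) (chartAt (Model E) x x) := by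
  have h1 : ContDiffAt ℝ ∞ (frmQ G) ((crd4 E).symm (chartAt (Model E) x x)) := by
    rw [crd4_symm_chartAt_self]
    exact contDiffAt_frmQ hL e0_mem
  exact contDiffAt_const.clm_comp
    (h1.comp (chartAt (Model E) x x) (crd4 E).symm.contDiff.contDiffAt)

theorem fderiv_frmM {B : LinearMap.BilinForm ℝ E} (hL : IsMetricLie (lieBracket E G) B)
    (x : regular E G) (v : Model E) (w : Fin 4 → E) :
    fderiv ℝ (frmM G) (chartAt (Model E) x x) v w =
      crd4 E (fderiv ℝ (frmQ G) (e₀, (invts x.1).2) ((crd4 E).symm v) w) := by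
  have h1 : HasFDerivAt (frmQ G) (fderiv ℝ (frmQ G) (e₀, (invts x.1).2))
      ((crd4 E).symm (chartAt (Model E) x x)) := by
    rw [crd4_symm_chartAt_self]
    exact ((contDiffAt_frmQ hL e0_mem).differentiableAt (by simp)).hasFDerivAt
  have h2 := h1.comp (chartAt (Model E) x x)
    ((crd4 E).symm : Model E →L[ℝ] E × (Fin 3 → E)).hasFDerivAt
  have h3 := (hasFDerivAt_const (crd4 E : E × (Fin 3 → E) →L[ℝ] Model E)
    (chartAt (Model E) x x)).clm_comp h2
  have h4 := ((contDiffAt_frmM hL x).differentiableAt (by simp)).hasFDerivAt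
  have h5 := h4.unique h3
  rw [h5]
  simp

theorem frmM_isInvertible (x : regular E G) :
    (frmM G (chartAt (Model E) x x)).IsInvertible := by
  obtain ⟨e, he⟩ := mem_regular.1 x.2
  refine ⟨e.trans (crd4 E), ?_⟩
  rw [frmM, crd4_symm_chartAt_self, frmQ_e0, ← he]
  rfl

/-- The frame is left invariant, hence compatible with the changes of charts. -/
theorem fderiv_transition_frmM (x₀ x : regular E G) (hx : x ∈ (chartAt (Model E) x₀).source)
    (η : Fin 4 → E) :
    fderiv ℝ (chartAt (Model E) x₀ ∘ (chartAt (Model E) x).symm) (chartAt (Model E) x x)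
      (frmM G (chartAt (Model E) x x) η) = frmM G (chartAt (Model E) x₀ x) η := by
  set h := (invts x₀.1).1⁻¹ * (invts x.1).1 with hh
  have hm : h ∈ (phi E G).source := by
    have h1 : x.1 ∈ (modChart x₀.1).source := by
      have := hx
      rw [Opens.chartAt_eq, OpenPartialHomeomorph.subtypeRestr_source] at this
      exact this
    rwa [mem_modChart_source] at h1
  have hκ : κ (φ h) = h := (phi E G).left_inv hm
  have e1 : (chartAt (Model E) x₀ ∘ (chartAt (Model E) x).symm) =ᶠ[nhds (chartAt (Model E) x x)]
      fun p => crd4 E (φ (κ (φ h) * κ ((crd4 E).symm p).1), ((crd4 E).symm p).2) := by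
    filter_upwards [(chartAt (Model E) x).open_target.mem_nhds (mem_chart_target (Model E) x)]
      with p hp
    have h2 : ((chartAt (Model E) x).symm p).1 = (modChart x.1).symm p :=
      OpenPartialHomeomorph.subtypeRestr_symm_apply (e := modChart x.1) ⟨x⟩ hp
    have h3 : p ∈ (modChart x.1).target :=
      OpenPartialHomeomorph.subtypeRestr_target_subset (e := modChart x.1) ⟨x⟩ hp
    rw [Function.comp, chartAt_regular, h2, modChart_comp_symm h3, hκ]
  have h4 : HasFDerivAt (fun z => φ (κ (φ h) * κ z)) (ltr E G (φ h))
      (((crd4 E).symm (chartAt (Model E) x x)).1) := by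
    rw [crd4_symm_chartAt_self]
    exact hasFDerivAt_ltr ((phi E G).map_source hm)
  have h5 : HasFDerivAt (fun p => (crd4 E).symm p)
      ((crd4 E).symm : Model E →L[ℝ] E × (Fin 3 → E)) (chartAt (Model E) x x) :=
    ((crd4 E).symm : Model E →L[ℝ] E × (Fin 3 → E)).hasFDerivAt
  have h6 := HasFDerivAt.comp (f := fun p => ((crd4 E).symm p).1) _ h4 h5.fst
  have h7 := (crd4 E : E × (Fin 3 → E) →L[ℝ] Model E).hasFDerivAt.comp _ (h6.prodMk h5.snd)
  have h8 := (h7.congr_of_eventuallyEq e1).fderiv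
  rw [h8, frmM_apply, frmM_apply, crd4_symm_chartAt_self, crd4_symm_chartAt, frmQ_apply,
    frmQ_apply, ltr_e0]
  simp [← hh]

variable (G) in
/-- The metric of the moduli space in the horizontal frame, in the charts of the moduli space. -/
def metM (B : LinearMap.BilinForm ℝ E) (p : Model E) : (Fin 4 → E) →L[ℝ] (Fin 4 → E) →L[ℝ] ℝ :=
  hg (lieBracket E G) B ((crd4 E).symm p).2

theorem metM_chartAt (B : LinearMap.BilinForm ℝ E) (x y : regular E G) :
    metM G B (chartAt (Model E) x y) = hg (lieBracket E G) B (invts y.1).2 := by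
  rw [metM, crd4_symm_chartAt]

theorem contDiff_metM {B : LinearMap.BilinForm ℝ E} (hL : IsMetricLie (lieBracket E G) B) :
    ContDiff ℝ ∞ (metM G B) :=
  (contDiff_hg hL).comp (contDiff_snd.comp (crd4 E).symm.contDiff)

/-- The metric depends on the initial values only, so along a frame field it is differentiated in
the direction of the last three entries. -/
theorem fderiv_metM {B : LinearMap.BilinForm ℝ E} (hL : IsMetricLie (lieBracket E G) B)
    (x : regular E G) (v : Fin 4 → E) :
    fderiv ℝ (metM G B) (chartAt (Model E) x x) (frmM G (chartAt (Model E) x x) v) =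
      fderiv ℝ (hg (lieBracket E G) B) (invts x.1).2 (tl E v) := by
  have h1 : HasFDerivAt (hg (lieBracket E G) B) (fderiv ℝ (hg (lieBracket E G) B) (invts x.1).2)
      ((crd4 E).symm (chartAt (Model E) x x)).2 := by
    rw [crd4_symm_chartAt_self]
    exact ((contDiff_hg hL).differentiable (by simp) _).hasFDerivAt
  have h5 : HasFDerivAt (fun p => (crd4 E).symm p)
      ((crd4 E).symm : Model E →L[ℝ] E × (Fin 3 → E)) (chartAt (Model E) x x) :=
    ((crd4 E).symm : Model E →L[ℝ] E × (Fin 3 → E)).hasFDerivAt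
  have h6 := HasFDerivAt.comp (f := fun p : Model E => ((crd4 E).symm p).2)
    (g := hg (lieBracket E G) B) (chartAt (Model E) x x) h1 h5.snd
  have h7 : fderiv ℝ (metM G B) (chartAt (Model E) x x) = _ := h6.fderiv
  rw [h7]
  change fderiv ℝ (hg (lieBracket E G) B) (invts x.1).2
    (((crd4 E).symm (frmM G (chartAt (Model E) x x) v)).2) = _
  rw [frmM_apply, ContinuousLinearEquiv.symm_apply_apply, frmQ_apply]

/-- The signature is neutral, since `S` is an anti-isometric involution. -/
theorem exists_signature {B : LinearMap.BilinForm ℝ E} (hL : IsMetricLie (lieBracket E G) B)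
    {a : Fin 3 → E} (hn : FrameNondeg (lieBracket E G) B a) :
    ∃ P N : Submodule ℝ (Fin 4 → E), IsCompl P N ∧
      2 * Module.finrank ℝ P = Module.finrank ℝ (Fin 4 → E) ∧
      2 * Module.finrank ℝ N = Module.finrank ℝ (Fin 4 → E) ∧
      (∀ v ∈ P, v ≠ 0 → 0 < hg (lieBracket E G) B a v v) ∧
      (∀ v ∈ N, v ≠ 0 → hg (lieBracket E G) B a v v < 0) := by
  have hf : Module.finrank ℝ (Fin 4 → E) = 2 * (2 * Module.finrank ℝ E) := by
    rw [Module.finrank_pi_fintype]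
    simp
    ring
  let b : LinearMap.BilinForm ℝ (Fin 4 → E) := LinearMap.mk₂ ℝ
    (fun x y => hg (lieBracket E G) B a x y) (fun x y z => by simp) (fun c x y => by simp)
    (fun x y z => by simp) (fun c x y => by simp)
  obtain ⟨P, N, h1, h2, h3, h4, h5⟩ := exists_neutral_splitting b (fun x y => hg_symm hL a x y)
    hn (qS E : (Fin 4 → E) →ₗ[ℝ] (Fin 4 → E)) qS_qS (fun x => by
      change hg (lieBracket E G) B a (qS E x) (qS E x) = -hg (lieBracket E G) B a x x
      rw [hg_skew (qL_qS hL.skew) g4_qS, qS_qS]) hf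
  exact ⟨P, N, h1, by rw [h2, hf], by rw [h3, hf], h4, h5⟩

variable (G) in
/-- The hypersymplectic structure in the horizontal frame. -/
def hyperFrame (B : LinearMap.BilinForm ℝ E) (hL : IsMetricLie (lieBracket E G) B)
    (hA : ∀ (u : G) (x y : E), B (Ad E u x) (Ad E u y) = B x y) :
    HyperFrame (Model E) (Fin 4 → E) (regular E G) where
  A := frmM G
  m := metM G B
  Γ x := hGam (lieBracket E G) B (invts x.1).2
  I := qI E
  S := qS E
  T := qT E
  inv := frmM_isInvertible
  smooth_A := contDiffAt_frmM hL
  smooth_m x := (contDiff_metM hL).contDiffAt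
  trans_A := fderiv_transition_frmM
  trans_m x₀ x _ := by rw [metM_chartAt, metM_chartAt]
  m_symm x η θ := by rw [metM_chartAt, hg_symm hL]
  m_signature x := by
    rw [metM_chartAt]
    exact exists_signature hL (frameNondeg_of_mem hL hA x.2)
  I_sq := qI_qI
  S_sq := qS_qS
  T_sq := qT_qT
  I_S := qI_qS
  S_I := qS_qI
  I_skew x v w := by rw [metM_chartAt, hg_skew (qL_qI hL.skew) g4_qI]
  S_skew x v w := by rw [metM_chartAt, hg_skew (qL_qS hL.skew) g4_qS]
  T_skew x v w := by rw [metM_chartAt, hg_skew (qL_qT hL.skew) g4_qT]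
  I_comm x := hGam_comm (qL_qI hL.skew) g4_qI (frameNondeg_of_mem hL hA x.2)
  S_comm x := hGam_comm (qL_qS hL.skew) g4_qS (frameNondeg_of_mem hL hA x.2)
  T_comm x := hGam_comm (qL_qT hL.skew) g4_qT (frameNondeg_of_mem hL hA x.2)
  metric x v w u := by
    rw [fderiv_metM hL, metM_chartAt, fderiv_hg_eq hL (frameNondeg_of_mem hL hA x.2)]
  torsion x v w := by
    rw [fderiv_frmM hL, fderiv_frmM hL, frmM_apply, frmM_apply, frmM_apply,
      ContinuousLinearEquiv.symm_apply_apply, ContinuousLinearEquiv.symm_apply_apply,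
      crd4_symm_chartAt_self, ← map_sub, fderiv_frmQ_sub hL (frameNondeg_of_mem hL hA x.2) x.2]

end Regular

section HorizontalSpace

universe w
variable {E : Type w} [NormedAddCommGroup E] [NormedSpace ℝ E] [FiniteDimensional ℝ E]

/-! ### The horizontal space -/

/-- The equations of the horizontal space are `X' + q(T, X) = 0`. -/
theorem mem_horizontal_iff (br : E →L[ℝ] E →L[ℝ] E) (T X : Quad E) :
    X ∈ horizontal br T ↔ dv X + bilC (qL br) (ev T) (ev X) = 0 := by
  change linEq br T X = 0 ↔ _
  constructor
  · intro h
    ext t i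
    rw [← linEq_apply, h]
    rfl
  · intro h
    ext i t
    rw [linEq_apply, h]
    rfl

theorem ev_eq_horC {br : E →L[ℝ] E →L[ℝ] E} {T X : Quad E} (hX : X ∈ horizontal br T) :
    ev X = horC br (ev T) (ev X 0) :=
  eq_horC br (ev T) (isDeriv_ev X) ((mem_horizontal_iff br T X).1 hX)

theorem exists_horizontal (br : E →L[ℝ] E →L[ℝ] E) (T : Quad E) (η : Fin 4 → E) :
    ∃ X ∈ horizontal br T, ev X = horC br (ev T) η := by
  have h1 := isDeriv_horC br (ev T) η
  set X : Quad E := (crdEquiv E).symm (η, -bilC (qL br) (ev T) (horC br (ev T) η)) with hX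
  have h2 : ev X = horC br (ev T) η := by
    rw [hX, ev_crd_symm]
    ext1 t
    rw [val_apply, h1.eq_add_prim t, horC_zero]
  refine ⟨X, (mem_horizontal_iff br T X).2 ?_, h2⟩
  rw [h2, hX, dv_crd_symm, neg_add_cancel]

/-- Elements of the horizontal space are determined by their initial values, which are arbitrary. -/
def horizontalEquiv (br : E →L[ℝ] E →L[ℝ] E) (T : Quad E) :
    horizontal br T ≃ₗ[ℝ] (Fin 4 → E) :=
  LinearEquiv.ofBijective
    { toFun := fun X => ev X.1 0
      map_add' := fun X Y => by simp
      map_smul' := fun c X => by simp }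
    ⟨fun X Y h => Subtype.ext (Quad.ext_ev (by
        have h' : ev X.1 0 = ev Y.1 0 := h
        rw [ev_eq_horC X.2, ev_eq_horC Y.2, h'])),
      fun η => by
        obtain ⟨X, hX, h⟩ := exists_horizontal br T η
        exact ⟨⟨X, hX⟩, by change ev X 0 = η; rw [h, horC_zero]⟩⟩

/-- The horizontal space is invariant under endomorphisms commuting with the linearised
equations. -/
theorem mem_horizontal_of_commute {br : E →L[ℝ] E →L[ℝ] E} {L : (Fin 4 → E) →L[ℝ] (Fin 4 → E)}
    (hL : ∀ a x, qL br a (L x) = L (qL br a x)) {T X Y : Quad E} (he : ev Y = pw L (ev X))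
    (hd : dv Y = pw L (dv X)) (hX : X ∈ horizontal br T) : Y ∈ horizontal br T := by
  rw [mem_horizontal_iff] at hX ⊢
  have h : bilC (qL br) (ev T) (pw L (ev X)) = pw L (bilC (qL br) (ev T) (ev X)) := by
    ext1 t
    simp only [bilC_apply, pw_apply, hL]
  rw [he, hd, h, ← map_add, hX, map_zero]

theorem ev_opI (X : Quad E) : ev (opI X) = pw (qI E) (ev X) := by
  ext t i
  fin_cases i <;> rfl

theorem dv_opI (X : Quad E) : dv (opI X) = pw (qI E) (dv X) := by
  ext t i
  fin_cases i <;> rfl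

theorem ev_opS (X : Quad E) : ev (opS X) = pw (qS E) (ev X) := by
  ext t i
  fin_cases i <;> rfl

theorem dv_opS (X : Quad E) : dv (opS X) = pw (qS E) (dv X) := by
  ext t i
  fin_cases i <;> rfl

theorem ev_opT (X : Quad E) : ev (opT X) = pw (qT E) (ev X) := by
  ext t i
  fin_cases i <;> rfl

theorem dv_opT (X : Quad E) : dv (opT X) = pw (qT E) (dv X) := by
  ext t i
  fin_cases i <;> rfl

/-- Horizontal vectors satisfy the linearised Nahm--Schmid equations. -/
theorem ivp_of_mem_horizontal {br : E →L[ℝ] E →L[ℝ] E} {T X : Quad E}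
    (hX : X ∈ horizontal br T) :
    ivp (mat (qN br) (ev T)) (crdEquiv E X) = incl (restr (crdEquiv E X)) := by
  rw [mem_horizontal_iff] at hX
  have h : ∀ t i, i ≠ 0 → (ivp (mat (qN br) (ev T)) (crdEquiv E X)).2 t i = 0 := by
    intro t i hi
    rw [ivp_apply, val_crd, applyCL_mat]
    change dv X t i + qN br (ev T t) (ev X t) i = 0
    rw [qN_of_ne _ _ _ hi]
    exact congrFun (DFunLike.congr_fun hX t) i
  have h1 := (eq_incl_restr_iff _).2 fun i t => h t i.succ (Fin.succ_ne_zero i)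
  have h2 : restr (ivp (mat (qN br) (ev T)) (crdEquiv E X)) = restr (crdEquiv E X) := by
    rw [ivp_apply, val_crd, applyCL_mat, restr_apply, restr_apply]
    refine Prod.ext (Prod.ext rfl ?_) rfl
    ext t
    change dv X t 0 + qN br (ev T t) (ev X t) 0 = dv X t 0
    rw [qN_zero, add_zero]
  rw [h1, h2]

variable {G : Type*} [TopologicalSpace G] [ChartedSpace E G] [Group G] [LieGroup 𝓘(ℝ, E) ∞ G]
  [CompactSpace G] [hI : HasInvForm E G]

/-- Horizontal vectors are tangent to the manifold of solutions. -/
theorem mfderiv_val_of_mem_horizontal {T : solutions E G} {X : Quad E}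
    (hX : X ∈ horizontal (lieBracket E G) T.1) :
    mfderiv 𝓘(ℝ, Data E) 𝓘(ℝ, Quad E) (Subtype.val : solutions E G → Quad E) T
      (restr (crdEquiv E X) : Data E) = X := by
  refine (mfderiv_val T _).trans ?_
  rw [← ivp_of_mem_horizontal hX, ivpInv_ivp, ContinuousLinearEquiv.symm_apply_apply]

/-- The differential of the projection on horizontal vectors is the horizontal frame. -/
theorem mfderiv_proj_of_mem_horizontal {B : LinearMap.BilinForm ℝ E}
    (hL : IsMetricLie (lieBracket E G) B) {T : solutions E G} {X : Quad E}
    (hX : X ∈ horizontal (lieBracket E G) T.1) :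
    mfderiv 𝓘(ℝ, Data E) 𝓘(ℝ, Model E) (proj E G) T (restr (crdEquiv E X) : Data E) =
      crd4 E (frm (lieBracket E G) (start T.1) (ev X 0)) := by
  refine (mfderiv_proj T _).trans ?_
  rw [frm_apply, solHomeo_apply]
  refine congrArg (crd4 E) (Prod.ext ?_ rfl)
  change -(prim (applyCL (AdT G (pot E (restr (crdEquiv E T.1)))) (pot E (restr (crdEquiv E X)))) 1)
    = -(prim (comp0 (hor (lieBracket E G) (start T.1) (ev X 0))) 1)
  rw [pot_restr, pot_restr]
  congr 3
  ext t
  rw [comp0_apply, ← AdP_transport_inv_horC hL T.2, ← ev_eq_horC hX]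
  rfl

/-- The charts of an open subset are restrictions of charts, so the differential of the inclusion is
the identity of the model space. -/
theorem mfderiv_subtypeVal {F : Type*} [NormedAddCommGroup F] [NormedSpace ℝ F]
    {M : Type*} [TopologicalSpace M] [ChartedSpace F M] [IsManifold 𝓘(ℝ, F) ∞ M] (U : Opens M)
    (x : U) (v : F) :
    mfderiv 𝓘(ℝ, F) 𝓘(ℝ, F) (Subtype.val : U → M) x v = v := by
  have hm : MDifferentiableAt 𝓘(ℝ, F) 𝓘(ℝ, F) (Subtype.val : U → M) x :=
    (contMDiff_subtype_val (n := ∞) x).mdifferentiableAt (by simp)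
  have h1 : fderiv ℝ (chartAt F x.1 ∘ (Subtype.val : U → M) ∘ (chartAt F x).symm)
      (chartAt F x x) = ContinuousLinearMap.id ℝ F := by
    refine (Filter.EventuallyEq.fderiv_eq (f := id) ?_).trans fderiv_id
    filter_upwards [(chartAt F x).open_target.mem_nhds (mem_chart_target F x)] with p hp
    exact (chartAt F x).right_inv hp
  have h3 : mfderiv 𝓘(ℝ, F) 𝓘(ℝ, F) (Subtype.val : U → M) x = fderiv ℝ
      (chartAt F x.1 ∘ (Subtype.val : U → M) ∘ (chartAt F x).symm) (chartAt F x x) := by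
    refine hm.mfderiv.trans ?_
    change fderivWithin ℝ (chartAt F x.1 ∘ (Subtype.val : U → M) ∘ (chartAt F x).symm)
      (range 𝓘(ℝ, F)) (chartAt F x x) = _
    rw [modelWithCornersSelf_coe, range_id, fderivWithin_univ]
  exact DFunLike.congr_fun (h3.trans h1) v

theorem hyperFrame_fr {B : LinearMap.BilinForm ℝ E} (hL : IsMetricLie (lieBracket E G) B)
    (hA : ∀ (u : G) (x y : E), B (Ad E u x) (Ad E u y) = B x y) (x : regular E G)
    (η : Fin 4 → E) :
    (hyperFrame G B hL hA).fr x η = crd4 E (frm (lieBracket E G) (invts x.1).2 η) := by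
  refine (HyperFrame.fr_apply _ x η).trans ?_
  change frmM G (chartAt (Model E) x x) η = _
  rw [frmM_apply, crd4_symm_chartAt_self, frmQ_e0]

theorem hyperFrame_met {B : LinearMap.BilinForm ℝ E} (hL : IsMetricLie (lieBracket E G) B)
    (hA : ∀ (u : G) (x y : E), B (Ad E u x) (Ad E u y) = B x y) (x : regular E G)
    (η θ : Fin 4 → E) :
    (hyperFrame G B hL hA).met x ((hyperFrame G B hL hA).fr x η) ((hyperFrame G B hL hA).fr x θ) =
      hg (lieBracket E G) B (invts x.1).2 η θ := by
  rw [HyperFrame.met_apply, ContinuousLinearEquiv.symm_apply_apply,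
    ContinuousLinearEquiv.symm_apply_apply]
  change metM G B (chartAt (Model E) x x) η θ = _
  rw [metM_chartAt]

/-- The isomorphism of the horizontal space with the tangent space of the moduli space. -/
def horizontalTangent {B : LinearMap.BilinForm ℝ E} (hL : IsMetricLie (lieBracket E G) B)
    (hA : ∀ (u : G) (x y : E), B (Ad E u x) (Ad E u y) = B x y) (T : Quad E) (x : regular E G) :
    horizontal (lieBracket E G) T ≃ₗ[ℝ] TangentSpace 𝓘(ℝ, Model E) x :=
  (horizontalEquiv (lieBracket E G) T).trans ((hyperFrame G B hL hA).fr x).toLinearEquiv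

theorem horizontalTangent_apply {B : LinearMap.BilinForm ℝ E}
    (hL : IsMetricLie (lieBracket E G) B)
    (hA : ∀ (u : G) (x y : E), B (Ad E u x) (Ad E u y) = B x y) (T : Quad E) (x : regular E G)
    (X : horizontal (lieBracket E G) T) :
    horizontalTangent hL hA T x X = (hyperFrame G B hL hA).fr x (ev X.1 0) := rfl

/-- An endomorphism in the horizontal frame corresponds to the pointwise endomorphism of horizontal
vectors. -/
theorem endo_horizontalTangent {B : LinearMap.BilinForm ℝ E}
    (hL : IsMetricLie (lieBracket E G) B)
    (hA : ∀ (u : G) (x y : E), B (Ad E u x) (Ad E u y) = B x y) (T : Quad E) (x : regular E G)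
    {L : (Fin 4 → E) →L[ℝ] (Fin 4 → E)} (X Y : horizontal (lieBracket E G) T)
    (he : ev Y.1 = pw L (ev X.1)) :
    (hyperFrame G B hL hA).endo L x (horizontalTangent hL hA T x X) =
      horizontalTangent hL hA T x Y := by
  rw [HyperFrame.endo_apply, horizontalTangent_apply, horizontalTangent_apply,
    ContinuousLinearEquiv.symm_apply_apply, he]
  rfl

end HorizontalSpace

end

end NahmSchmid

theorem mainTheorem2 {E : Type u} [NormedAddCommGroup E] [NormedSpace ℝ E]
    [FiniteDimensional ℝ E]
    {G : Type v} [TopologicalSpace G] [ChartedSpace E G] [Group G] [LieGroup 𝓘(ℝ, E) ∞ G]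
    [CompactSpace G] [T2Space G]
    (B : LinearMap.BilinForm ℝ E)
    (hB_symm : ∀ x y, B x y = B y x)
    (hB_pos : ∀ x, x ≠ 0 → 0 < B x x)
    (hB_Ad : ∀ (u : G) (x y : E), B (Ad E u x) (Ad E u y) = B x y) :
    (∀ T ∈ solutions E G,
      (Delta (lieBracket E G) T).IsFredholm ∧
      Module.finrank ℝ (Delta (lieBracket E G) T).ker =
        Module.finrank ℝ (C(unitInterval, E) ⧸ (Delta (lieBracket E G) T).range) ∧
      (T ∉ degeneracyLocus E G B ↔ (Delta (lieBracket E G) T).IsInvertible)) ∧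
    ∃ (F : Type u) (_ : NormedAddCommGroup F) (_ : NormedSpace ℝ F) (_ : CompleteSpace F)
      (_ : ChartedSpace F (solutions E G)) (_ : IsManifold 𝓘(ℝ, F) ∞ (solutions E G))
      (_ : ChartedSpace (EuclideanSpace ℝ (Fin (4 * Module.finrank ℝ E))) (Moduli E G))
      (_ : IsManifold (𝓡 (4 * Module.finrank ℝ E)) ∞ (Moduli E G)),
      T2Space (Moduli E G) ∧ SecondCountableTopology (Moduli E G) ∧
      IsSmoothEmbedding 𝓘(ℝ, F) 𝓘(ℝ, Quad E) ∞ (Subtype.val : solutions E G → Quad E) ∧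
      IsSubmersion 𝓘(ℝ, F) (𝓡 (4 * Module.finrank ℝ E)) ∞ (proj E G) ∧
      ∃ M₀ : Opens (Moduli E G), (M₀ : Set (Moduli E G)) = moduliZero E G B ∧
      ∃ h : HypersymplecticStructure (𝓡 (4 * Module.finrank ℝ E)) M₀ (Module.finrank ℝ E),
      ∀ T : solutions E G, T.1 ∉ degeneracyLocus E G B → ∃ hT : proj E G T ∈ M₀,
      ∃ Θ : horizontal (lieBracket E G) T.1 ≃ₗ[ℝ]
          TangentSpace (𝓡 (4 * Module.finrank ℝ E)) (⟨proj E G T, hT⟩ : M₀),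
        (∀ X : horizontal (lieBracket E G) T.1, ∃ v : TangentSpace 𝓘(ℝ, F) T,
          mfderiv 𝓘(ℝ, F) 𝓘(ℝ, Quad E) (Subtype.val : solutions E G → Quad E) T v
            = X.1 ∧
          mfderiv (𝓡 (4 * Module.finrank ℝ E)) (𝓡 (4 * Module.finrank ℝ E))
              (Subtype.val : M₀ → Moduli E G) ⟨proj E G T, hT⟩ (Θ X)
            = mfderiv 𝓘(ℝ, F) (𝓡 (4 * Module.finrank ℝ E)) (proj E G) T v) ∧
        (∀ X Y, h.g ⟨proj E G T, hT⟩ (Θ X) (Θ Y) = metricL2 B X Y) ∧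
        (∀ X, ∃ hX, h.I ⟨proj E G T, hT⟩ (Θ X) = Θ ⟨opI X, hX⟩) ∧
        (∀ X, ∃ hX, h.S ⟨proj E G T, hT⟩ (Θ X) = Θ ⟨opS X, hX⟩) ∧
        (∀ X, ∃ hX, h.T ⟨proj E G T, hT⟩ (Θ X) = Θ ⟨opT X, hX⟩) := by

  have hL : IsMetricLie (lieBracket E G) B := isMetricLie_lieBracket hB_symm hB_pos hB_Ad
  have : HasInvForm E G := ⟨B, hL⟩
  have hc : CompleteSpace E := FiniteDimensional.complete ℝ E
  refine ⟨fun T hT => ⟨isFredholm_Delta _ T, index_Delta _ T, ?_⟩, ?_⟩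
  · rw [notMem_degeneracyLocus_iff_Delta hL hT, isInvertible_Delta_iff]
  have hF : Module.finrank ℝ (Model E) = 4 * Module.finrank ℝ E := finrank_euclideanSpace_fin
  have hV : Module.finrank ℝ (Fin 4 → E) = 4 * Module.finrank ℝ E := by
    rw [Module.finrank_pi_fintype]
    simp
  refine ⟨Data E, inferInstance, inferInstance, inferInstance, inferInstance, inferInstance,
    instChartedSpaceModuli, instIsManifoldModuli, inferInstance, inferInstance,
    isSmoothEmbedding_val E G, isSubmersion_proj E G, regular E G, coe_regular hL hB_Ad,
    (hyperFrame G B hL hB_Ad).toStructure hF hV, fun T hT => ?_⟩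
  have hreg : proj E G T ∈ regular E G := (proj_mem_regular_iff hL hB_Ad T).2 hT
  refine ⟨hreg, horizontalTangent hL hB_Ad T.1 ⟨proj E G T, hreg⟩, fun X => ?_, fun X Y => ?_,
    fun X => ?_, fun X => ?_, fun X => ?_⟩
  · refine ⟨(restr (crdEquiv E X.1) : Data E), mfderiv_val_of_mem_horizontal X.2, ?_⟩
    refine (mfderiv_subtypeVal (regular E G) ⟨proj E G T, hreg⟩ _).trans ?_
    refine (hyperFrame_fr hL hB_Ad ⟨proj E G T, hreg⟩ (ev X.1 0)).trans ?_
    refine Eq.trans ?_ (mfderiv_proj_of_mem_horizontal hL X.2).symm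
    rw [invts_proj]
  · refine (hyperFrame_met hL hB_Ad ⟨proj E G T, hreg⟩ (ev X.1 0) (ev Y.1 0)).trans ?_
    rw [invts_proj, metricL2_eq, ev_eq_horC X.2, ev_eq_horC Y.2, gC_horC_eq_hg hL hB_Ad T.2,
      horC_zero, horC_zero]
  · exact ⟨mem_horizontal_of_commute (qL_qI hL.skew) (ev_opI _) (dv_opI _) X.2,
      endo_horizontalTangent hL hB_Ad T.1 _ X _ (ev_opI _)⟩
  · exact ⟨mem_horizontal_of_commute (qL_qS hL.skew) (ev_opS _) (dv_opS _) X.2,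
      endo_horizontalTangent hL hB_Ad T.1 _ X _ (ev_opS _)⟩
  · exact ⟨mem_horizontal_of_commute (qL_qT hL.skew) (ev_opT _) (dv_opT _) X.2,
      endo_horizontalTangent hL hB_Ad T.1 _ X _ (ev_opT _)⟩
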